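/- Let $K$ be an algebraically closed field of characteristic $0$ and let $(I,E)$ be a finite graph without loops (multiple edges allowed). Let $H$ be its set of oriented edges, with source and target maps $s,t:H\to I$ and reversal $a\mapsto\bar a$. Fix an orientation $\Omega$, i.e. $H=\Omega\sqcup\overline\Omega$, and put $\varepsilon(a)=1$ if $a\in\Omega$ and $\varepsilon(a)=-1$ otherwise. Let $\Lambda$ be the completed preprojective algebra: the completion, with respect to its augmentation ideal, of the quotient of the path algebra of $(I,H,s,t)$ by the relations $\sum_{s(a)=i}\varepsilon(a)\,\bar a a=0$ ($i\in I$). Let $\Lambda\text{-mod}$ be the category of finite dimensional left $\Lambda$-modules; for such a module $M$ write $M_i=e_iM$ and $M_a:M_{s(a)}\to M_{t(a)}$ for the action of $a\in H$. Let $\Pi$ be the completed preprojective algebra of the Kronecker quiver, with arrows $\alpha,\beta:0\to1$, reversed arrows $\bar\alpha,\bar\beta:1\to0$, and augmentation ideal $J$. Let $S,R$ be in $\Lambda\text{-mod}$ with $$\mathrm{End}_\Lambda(S)=\mathrm{End}_\Lambda(R)=K,\quad \mathrm{Hom}_\Lambda(S,R)=\mathrm{Hom}_\Lambda(R,S)=0,\quad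 \mathrm{Ext}^1_\Lambda(S,S)=\mathrm{Ext}^1_\Lambda(R,R)=0,\quad \dim\mathrm{Ext}^1_\Lambda(S,R)=2.$$ For $M,N$ in $\Lambda\text{-mod}$, $g\in\bigoplus_{a\in H}\mathrm{Hom}_K(M_{s(a)},N_{t(a)})$ and $h\in\bigoplus_{a\in H}\mathrm{Hom}_K(N_{s(a)},M_{t(a)})$, put $$d^1_{M,N}(g)=\Bigl(\sum_{s(a)=i}\varepsilon(a)(N_{\bar a}g_a+g_{\bar a}M_a)\Bigr)_{i\in I},\qquad \tau_1(g,h)=\sum_{i\in I}\mathrm{Tr}\Bigl(\sum_{s(a)=i}\varepsilon(a)\,g_{\bar a}h_a\Bigr).$$ (1) There are $\xi,\eta\in\bigoplus_a\mathrm{Hom}_K(S_{s(a)},R_{t(a)})$ and $\hat\xi,\hat\eta\in\bigoplus_a\mathrm{Hom}_K(R_{s(a)},S_{t(a)})$ such that $$d^1_{S,R}(\xi)=d^1_{S,R}(\eta)=0,\quad d^1_{R,S}(\hat\xi)=d^1_{R,S}(\hat\eta)=0,\quad \tau_1(\xi,\hat\xi)=\tau_1(\eta,\hat\eta)=1,\quad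 \tau_1(\xi,\hat\eta)=\tau_1(\eta,\hat\xi)=0.$$ (2) For every such choice there is a universal lifting, i.e. there are matrices $X_a=\begin{pmatrix}S^{(\infty)}_a&Q^{(\infty)}_a\\P^{(\infty)}_a&R^{(\infty)}_a\end{pmatrix}$, $a\in H$, with entries $$S^{(\infty)}_a\in\mathrm{Hom}_K(S_{s(a)},S_{t(a)})\otimes e_0\Pi e_0,\qquad Q^{(\infty)}_a\in\mathrm{Hom}_K(R_{s(a)},S_{t(a)})\otimes e_0\Pi e_1,$$ $$P^{(\infty)}_a\in\mathrm{Hom}_K(S_{s(a)},R_{t(a)})\otimes e_1\Pi e_0,\qquad R^{(\infty)}_a\in\mathrm{Hom}_K(R_{s(a)},R_{t(a)})\otimes e_1\Pi e_1,$$ such that $$X_a\equiv\begin{pmatrix}S_a\otimes e_0&\hat\xi_a\otimes\bar\alpha+\hat\eta_a\otimes\bar\beta\\ \xi_a\otimes\alpha+\eta_a\otimes\beta&R_a\otimes e_1\end{pmatrix}\bmod\begin{pmatrix}J^2&J^3\\J^3&J^2\end{pmatrix}\quad(a\in H),\qquad \sum_{s(a)=i}\varepsilon(a)X_{\bar a}X_a=0\quad(i\in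 I).$$ (3) For every universal lifting $(X_a)$ there is a functor $\mathscr H:\Pi\text{-mod}\to\Lambda\text{-mod}$ that sends $V$ to the $I$-graded vector space with components $(S_i\otimes_KV_0)\oplus(R_i\otimes_KV_1)$, where $V_p=e_pV$, on which $a\in H$ acts by the matrix $X_a$ evaluated on $V$, and that sends $f:V\to W$ to the map given by $\mathrm{id}_S\otimes f|_{V_0}$ and $\mathrm{id}_R\otimes f|_{V_1}$. This functor is exact and induces an equivalence of categories between $\Pi\text{-mod}$ and $\langle S,R\rangle$, the smallest full subcategory of $\Lambda\text{-mod}$ that contains $S$ and $R$ and is closed under isomorphisms, kernels, cokernels and extensions (i.e. the smallest extension-closed abelian subcategory containing $S$ and $R$). -/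

import Mathlib

open CategoryTheory TensorProduct
open scoped ModuleCat

universe u

namespace HallFunctors

noncomputable section

/-- A finite graph without loops (multiple edges allowed) with vertex set `I`, presented by its set
`H` of oriented edges (source, target, reversal `a ↦ bar a`), together with an orientation `Ω`:
exactly one of `a`, `bar a` belongs to `Ω`. -/
structure OrientedGraph (I H : Type) where
  s : H → I
  t : H → I
  bar : H → H
  bar_bar : ∀ a, bar (bar a) = a
  s_bar : ∀ a, s (bar a) = t a
  no_loop : ∀ a, s a ≠ t a
  Ω : Set H
  bar_mem : ∀ a, bar a ∈ Ω ↔ a ∉ Ω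

section Completion

variable (K : Type*) (A : Type*) [Field K] [Ring A] [Algebra K A] (J : Ideal A) [J.IsTwoSided]

/-- The completion of an algebra `A` with respect to a two-sided ideal `J`: the inverse limit of
the quotients `A ⧸ J ^ n`, as an algebra of compatible sequences. -/
def completion : Subalgebra K (∀ n : ℕ, A ⧸ J ^ n) where
  carrier := {x | ∀ (m n : ℕ) (h : m ≤ n),
    Ideal.Quotient.factor (Ideal.pow_le_pow_right h) (x n) = x m}
  mul_mem' {x y} hx hy := by
    intro m n h
    rw [Pi.mul_apply, map_mul, hx m n h, hy m n h, Pi.mul_apply]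
  add_mem' {x y} hx hy := by
    intro m n h
    rw [Pi.add_apply, map_add, hx m n h, hy m n h, Pi.add_apply]
  algebraMap_mem' c := by
    intro m n h
    rfl

/-- The canonical map of an algebra to its completion. -/
def toCompletion : A →ₐ[K] completion K A J :=
  AlgHom.codRestrict (AlgHom.pi fun n => Ideal.Quotient.mkₐ K (J ^ n)) (completion K A J)
    (by intro x m n h; rfl)

/-- The projection of the completion onto `A ⧸ J ^ n`. -/
def evalCompletion (n : ℕ) : completion K A J →ₐ[K] A ⧸ J ^ n :=
  (Pi.evalAlgHom K (fun n : ℕ => A ⧸ J ^ n) n).comp (completion K A J).val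

end Completion

section Algebras

variable (K : Type u) [Field K] {I H : Type} [Fintype I] [Fintype H] (Q : OrientedGraph I H)

open Classical in
/-- The sign `ε(a)`: `1` if `a ∈ Ω` and `-1` otherwise. -/
def OrientedGraph.ε (a : H) : K := if a ∈ Q.Ω then 1 else -1

open Classical in
/-- The oriented edges that start at the vertex `i`. -/
def OrientedGraph.out (i : I) : Finset H := Finset.univ.filter fun a => Q.s a = i

open Classical in
/-- Relations on the generators `e_i` (`i ∈ I`) and `a ∈ H`. The first four families present the
path algebra of the double quiver (a path is written from right to left, as acting on left
modules); the last one consists of the preprojective relations `∑_{s(a) = i} ε(a) (bar a) a = 0`. -/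
inductive PreRel : FreeAlgebra K (I ⊕ H) → FreeAlgebra K (I ⊕ H) → Prop
  | idem (i j : I) : PreRel
      (FreeAlgebra.ι K (Sum.inl i) * FreeAlgebra.ι K (Sum.inl j))
      (if i = j then FreeAlgebra.ι K (Sum.inl i) else 0)
  | one : PreRel (∑ i : I, FreeAlgebra.ι K (Sum.inl i)) 1
  | target (a : H) : PreRel
      (FreeAlgebra.ι K (Sum.inl (Q.t a)) * FreeAlgebra.ι K (Sum.inr a))
      (FreeAlgebra.ι K (Sum.inr a))
  | source (a : H) : PreRel
      (FreeAlgebra.ι K (Sum.inr a) * FreeAlgebra.ι K (Sum.inl (Q.s a)))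
      (FreeAlgebra.ι K (Sum.inr a))
  | preproj (i : I) : PreRel
      (∑ a ∈ Q.out i,
        Q.ε K a • (FreeAlgebra.ι K (Sum.inr (Q.bar a)) * FreeAlgebra.ι K (Sum.inr a)))
      0

/-- The (non-completed) preprojective algebra. -/
def Pre : Type u := RingQuot (PreRel K Q)

instance : Ring (Pre K Q) := inferInstanceAs (Ring (RingQuot (PreRel K Q)))

instance : Algebra K (Pre K Q) := inferInstanceAs (Algebra K (RingQuot (PreRel K Q)))

/-- The quotient map from the free algebra to the preprojective algebra. -/
def mkPre : FreeAlgebra K (I ⊕ H) →ₐ[K] Pre K Q := RingQuot.mkAlgHom K (PreRel K Q)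

open Classical in
/-- The augmentation of the preprojective algebra onto `𝐒 = ⨁ K e_i`: it is the identity on the
`e_i` and kills the arrows. -/
def aug : Pre K Q →ₐ[K] (I → K) :=
  RingQuot.liftAlgHom K
    ⟨FreeAlgebra.lift K (Sum.elim (fun i => Pi.single i 1) (fun _ => 0)), by
      intro x y h
      induction h with
      | idem i j =>
        by_cases hij : i = j
        · subst hij
          simp [← Pi.single_mul]
        · rw [if_neg hij]
          ext k
          by_cases hk : k = i
          · subst hk
            simp [hij]
          · simp [Pi.single_apply, hk]
      | one =>
        simp only [map_sum, FreeAlgebra.lift_ι_apply, Sum.elim_inl, map_one]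
        ext k
        simp [Pi.single_apply]
      | target a => simp
      | source a => simp
      | preproj i => simp⟩

/-- The augmentation ideal of the preprojective algebra. -/
def augIdeal : Ideal (Pre K Q) := RingHom.ker (aug K Q)

instance : (augIdeal K Q).IsTwoSided :=
  inferInstanceAs (RingHom.ker (aug K Q)).IsTwoSided

/-- The completed preprojective algebra: the completion of the preprojective algebra with respect
to its augmentation ideal. -/
def Lam : Type u := completion K (Pre K Q) (augIdeal K Q)

instance : Ring (Lam K Q) := inferInstanceAs (Ring (completion K (Pre K Q) (augIdeal K Q)))

instance : Algebra K (Lam K Q) :=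
  inferInstanceAs (Algebra K (completion K (Pre K Q) (augIdeal K Q)))

/-- The canonical map from the preprojective algebra to its completion. -/
def toLam : Pre K Q →ₐ[K] Lam K Q := toCompletion K (Pre K Q) (augIdeal K Q)

/-- The projection of the completed preprojective algebra onto the quotient of the preprojective
algebra by the `n`-th power of its augmentation ideal. -/
def projLam (n : ℕ) : Lam K Q →ₐ[K] Pre K Q ⧸ (augIdeal K Q) ^ n :=
  evalCompletion K (Pre K Q) (augIdeal K Q) n

/-- The idempotent `e_i` in the completed preprojective algebra. -/
def vtx (i : I) : Lam K Q :=
  toLam K Q (mkPre K Q (FreeAlgebra.ι K (Sum.inl i)))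

/-- The arrow `a` in the completed preprojective algebra. -/
def arr (a : H) : Lam K Q :=
  toLam K Q (mkPre K Q (FreeAlgebra.ι K (Sum.inr a)))

/-- The augmentation ideal of the completed preprojective algebra: the kernel of its projection
onto the quotient of the preprojective algebra by the augmentation ideal. -/
def radIdeal : Ideal (Lam K Q) := RingHom.ker (projLam K Q 1)

/-- The subspace `e_q A e_p` of a completed preprojective algebra `A`. -/
def corner (q p : I) : Submodule K (Lam K Q) where
  carrier := {x | vtx K Q q * x = x ∧ x * vtx K Q p = x}
  add_mem' {x y} hx hy := ⟨by rw [mul_add, hx.1, hy.1], by rw [add_mul, hx.2, hy.2]⟩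
  zero_mem' := ⟨mul_zero _, zero_mul _⟩
  smul_mem' c x hx := ⟨by rw [mul_smul_comm, hx.1], by rw [smul_mul_assoc, hx.2]⟩

/-- The finite dimensional modules over the completed preprojective algebra. -/
def isFD : ObjectProperty (ModuleCat.{u} (Lam K Q)) := fun M => Module.Finite K M

/-- The category of finite dimensional left modules over the completed preprojective algebra. -/
abbrev FDMod : Type (u + 1) := (isFD K Q).FullSubcategory

end Algebras

/-- The Kronecker quiver. The vertices are `0` and `1`; the arrows `α`, `β` from `0` to `1` are
`(0, false)`, `(1, false)`, and the reversed arrows are `(0, true)`, `(1, true)`. -/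
def kronecker : OrientedGraph (Fin 2) (Fin 2 × Bool) where
  s a := if a.2 then 1 else 0
  t a := if a.2 then 0 else 1
  bar a := (a.1, !a.2)
  bar_bar a := by simp
  s_bar a := by rcases a with ⟨k, _ | _⟩ <;> rfl
  no_loop a := by rcases a with ⟨k, _ | _⟩ <;> simp
  Ω := {a | a.2 = false}
  bar_mem a := by rcases a with ⟨k, _ | _⟩ <;> simp

/-- The completed preprojective algebra `Π` of type `Ã₁`. -/
abbrev PiAlg (K : Type u) [Field K] : Type u := Lam K kronecker

section Modules

variable {K : Type u} [Field K] {I H : Type} [Fintype I] [Fintype H] {Q : OrientedGraph I H}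

/-- The action of an element of the algebra on a module, as a `K`-linear map. -/
def lact (M : ModuleCat.{u} (Lam K Q)) (x : Lam K Q) : M →ₗ[K] M := Algebra.lsmul K K M x

/-- The component `M_i = e_i M`. -/
def compo (M : ModuleCat.{u} (Lam K Q)) (i : I) : Submodule K M :=
  LinearMap.range (lact M (vtx K Q i))

/-- The space `Hom_K(M_i, N_j)`, realized inside `Hom_K(M, N)` as the space of the maps that
vanish on the components `M_k` with `k ≠ i` and take their values in `N_j`. -/
def homComp (M N : ModuleCat.{u} (Lam K Q)) (i j : I) : Submodule K (M →ₗ[K] N) where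
  carrier := {f | lact N (vtx K Q j) ∘ₗ f = f ∧ f ∘ₗ lact M (vtx K Q i) = f}
  add_mem' {f g} hf hg :=
    ⟨by rw [LinearMap.comp_add, hf.1, hg.1], by rw [LinearMap.add_comp, hf.2, hg.2]⟩
  zero_mem' := ⟨LinearMap.comp_zero _, LinearMap.zero_comp _⟩
  smul_mem' c f hf :=
    ⟨by rw [LinearMap.comp_smul, hf.1], by rw [LinearMap.smul_comp, hf.2]⟩

/-- `S` and `R` are orthogonal rigid bricks with `dim Ext¹(S, R) = 2`. -/
structure IsHallPair (S R : ModuleCat.{u} (Lam K Q)) : Prop where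
  end_S : Function.Bijective fun c : K => c • 𝟙 S
  end_R : Function.Bijective fun c : K => c • 𝟙 R
  rigid_S : Subsingleton (Abelian.Ext S S 1)
  rigid_R : Subsingleton (Abelian.Ext R R 1)
  hom_SR : Subsingleton (S ⟶ R)
  hom_RS : Subsingleton (R ⟶ S)
  ext_SR : Module.finrank K (Abelian.Ext S R 1) = 2

/-- The `i`-th component of `d¹_{M,N}(g)`, that is
`∑_{s(a) = i} ε(a) (N_{bar a} g_a + g_{bar a} M_a)`. -/
def dOne (M N : ModuleCat.{u} (Lam K Q)) (g : H → (M →ₗ[K] N)) (i : I) : M →ₗ[K] N :=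
  ∑ a ∈ Q.out i, Q.ε K a •
    (lact N (arr K Q (Q.bar a)) ∘ₗ g a + g (Q.bar a) ∘ₗ lact M (arr K Q a))

/-- The bilinear form
`τ₁(g, h) = ∑_i Tr (∑_{s(a) = i} ε(a) g_{bar a} h_a)`. -/
def tauOne (M N : ModuleCat.{u} (Lam K Q)) (g : H → (M →ₗ[K] N)) (h : H → (N →ₗ[K] M)) : K :=
  ∑ i : I, LinearMap.trace K N (∑ a ∈ Q.out i, Q.ε K a • (g (Q.bar a) ∘ₗ h a))

/-- The choice, made on cocycles, of a basis `(ξ, η)` of `Ext¹(S, R)` and of the basis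
`(ξ', η')` of `Ext¹(R, S)` that is dual to it for the pairing `τ₁`. -/
structure DualCocycles (S R : ModuleCat.{u} (Lam K Q)) where
  ξ : H → (S →ₗ[K] R)
  η : H → (S →ₗ[K] R)
  ξ' : H → (R →ₗ[K] S)
  η' : H → (R →ₗ[K] S)
  ξ_mem : ∀ a, ξ a ∈ homComp S R (Q.s a) (Q.t a)
  η_mem : ∀ a, η a ∈ homComp S R (Q.s a) (Q.t a)
  ξ'_mem : ∀ a, ξ' a ∈ homComp R S (Q.s a) (Q.t a)
  η'_mem : ∀ a, η' a ∈ homComp R S (Q.s a) (Q.t a)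
  d_ξ : ∀ i, dOne S R ξ i = 0
  d_η : ∀ i, dOne S R η i = 0
  d_ξ' : ∀ i, dOne R S ξ' i = 0
  d_η' : ∀ i, dOne R S η' i = 0
  τ_ξξ' : tauOne S R ξ ξ' = 1
  τ_ηη' : tauOne S R η η' = 1
  τ_ξη' : tauOne S R ξ η' = 0
  τ_ηξ' : tauOne S R η ξ' = 0

/-- The smallest (strictly full) abelian subcategory of the category of finite dimensional
modules that is closed under extensions and contains `S` and `R`. -/
def hallSubcategory (S R : ModuleCat.{u} (Lam K Q)) : ObjectProperty (ModuleCat.{u} (Lam K Q)) :=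
  fun M => ∀ P : ObjectProperty (ModuleCat.{u} (Lam K Q)),
    P ≤ isFD K Q → P.IsClosedUnderIsomorphisms → P.IsClosedUnderKernels →
    P.IsClosedUnderCokernels → P.IsClosedUnderExtensions → P S → P R → P M

/-- The space `Hom_K(M_{s(a)}, N_{t(a)}) ⊗ e_q Π e_p`, inside `Hom_K(M, N) ⊗ Π`. -/
def liftSpace (M N : ModuleCat.{u} (Lam K Q)) (a : H) (q p : Fin 2) :
    Submodule K ((M →ₗ[K] N) ⊗[K] PiAlg K) :=
  Submodule.map₂ (TensorProduct.mk K (M →ₗ[K] N) (PiAlg K))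
    (homComp M N (Q.s a) (Q.t a)) (corner K kronecker q p)

/-- The space `Hom_K(M, N) ⊗ J^k`, inside `Hom_K(M, N) ⊗ Π`, where `J` is the augmentation ideal
of `Π`. -/
def liftFil (M N : ModuleCat.{u} (Lam K Q)) (k : ℕ) :
    Submodule K ((M →ₗ[K] N) ⊗[K] PiAlg K) :=
  Submodule.map₂ (TensorProduct.mk K (M →ₗ[K] N) (PiAlg K)) ⊤
    ((radIdeal K kronecker ^ k).restrictScalars K)

/-- The composition product
`Hom_K(N, P) ⊗ Π × Hom_K(M, N) ⊗ Π → Hom_K(M, P) ⊗ Π`, `(f ⊗ x, g ⊗ y) ↦ (f ∘ g) ⊗ x y`. -/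
def mulPi (M N P : ModuleCat.{u} (Lam K Q)) :
    (N →ₗ[K] P) ⊗[K] PiAlg K →ₗ[K] (M →ₗ[K] N) ⊗[K] PiAlg K →ₗ[K] (M →ₗ[K] P) ⊗[K] PiAlg K :=
  TensorProduct.map₂ (LinearMap.llcomp K M N P) (LinearMap.mul K (PiAlg K))

/-- A universal lifting: for each `a ∈ H`, a matrix
`(S_a Q_a; P_a R_a)` with coefficients in `Π`, which is congruent to
`(S_a ⊗ e₀, ξ'_a ⊗ α' + η'_a ⊗ β'; ξ_a ⊗ α + η_a ⊗ β, R_a ⊗ e₁)` modulo `(J² J³; J³ J²)`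
(here `α'`, `β'` are the reversed arrows), subject to the preprojective relations. -/
structure UniversalLifting {S R : ModuleCat.{u} (Lam K Q)} (D : DualCocycles S R) where
  matS : H → (S →ₗ[K] S) ⊗[K] PiAlg K
  matR : H → (R →ₗ[K] R) ⊗[K] PiAlg K
  matP : H → (S →ₗ[K] R) ⊗[K] PiAlg K
  matQ : H → (R →ₗ[K] S) ⊗[K] PiAlg K
  matS_mem : ∀ a, matS a ∈ liftSpace S S a 0 0
  matR_mem : ∀ a, matR a ∈ liftSpace R R a 1 1
  matP_mem : ∀ a, matP a ∈ liftSpace S R a 1 0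
  matQ_mem : ∀ a, matQ a ∈ liftSpace R S a 0 1
  matS_congr : ∀ a, matS a - lact S (arr K Q a) ⊗ₜ vtx K kronecker 0 ∈ liftFil S S 2
  matR_congr : ∀ a, matR a - lact R (arr K Q a) ⊗ₜ vtx K kronecker 1 ∈ liftFil R R 2
  matP_congr : ∀ a, matP a -
    (D.ξ a ⊗ₜ arr K kronecker (0, false) + D.η a ⊗ₜ arr K kronecker (1, false)) ∈ liftFil S R 3
  matQ_congr : ∀ a, matQ a -
    (D.ξ' a ⊗ₜ arr K kronecker (0, true) + D.η' a ⊗ₜ arr K kronecker (1, true)) ∈ liftFil R S 3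
  rel_SS : ∀ i, ∑ a ∈ Q.out i, Q.ε K a •
    (mulPi S S S (matS (Q.bar a)) (matS a) + mulPi S R S (matQ (Q.bar a)) (matP a)) = 0
  rel_SQ : ∀ i, ∑ a ∈ Q.out i, Q.ε K a •
    (mulPi R S S (matS (Q.bar a)) (matQ a) + mulPi R R S (matQ (Q.bar a)) (matR a)) = 0
  rel_PS : ∀ i, ∑ a ∈ Q.out i, Q.ε K a •
    (mulPi S S R (matP (Q.bar a)) (matS a) + mulPi S R R (matR (Q.bar a)) (matP a)) = 0
  rel_PQ : ∀ i, ∑ a ∈ Q.out i, Q.ε K a •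
    (mulPi R S R (matP (Q.bar a)) (matQ a) + mulPi R R R (matR (Q.bar a)) (matR a)) = 0

/-- The map `V_p → V_q`, `v ↦ e_q x v`, defined by an element `x` of `Π` acting on a
`Π`-module `V`. -/
def actComp (V : ModuleCat.{u} (PiAlg K)) (q p : Fin 2) :
    PiAlg K →ₗ[K] (compo V p →ₗ[K] compo V q) where
  toFun x :=
    LinearMap.codRestrict (compo V q) (lact V (vtx K kronecker q * x) ∘ₗ (compo V p).subtype)
      (fun v => ⟨lact V x v, by simp [lact]⟩)
  map_add' x y := by
    ext v
    simp [lact, mul_add]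
  map_smul' c x := by
    ext v
    simp [lact]

/-- Evaluation of `Hom_K(M, N) ⊗ Π` on a `Π`-module `V`: it sends `f ⊗ x` to the tensor product
of `f` with the map `V_p → V_q` defined by `x`. -/
def evalPi (M N : ModuleCat.{u} (Lam K Q)) (V : ModuleCat.{u} (PiAlg K)) (q p : Fin 2) :
    (M →ₗ[K] N) ⊗[K] PiAlg K →ₗ[K] (M ⊗[K] compo V p →ₗ[K] N ⊗[K] compo V q) :=
  TensorProduct.lift
    ((TensorProduct.mapBilinear (RingHom.id K) M (compo V p) N (compo V q)).compl₂
      (actComp V q p))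

/-- The map `V_p → W_p` induced by a morphism of modules `V → W`. -/
def compMap {V W : ModuleCat.{u} (Lam K Q)} (f : V ⟶ W) (p : I) : compo V p →ₗ[K] compo W p :=
  LinearMap.restrict (p := compo V p) (q := compo W p) (f.hom.restrictScalars K) (by
    rintro _ ⟨v, rfl⟩
    exact ⟨f.hom v, by simp [lact]⟩)

/-- The vector space `(S ⊗ V₀) ⊕ (R ⊗ V₁)`, which is the direct sum over `i ∈ I` of the
spaces `M_i = (S_i ⊗ V₀) ⊕ (R_i ⊗ V₁)`. -/
abbrev hallSpace (S R : ModuleCat.{u} (Lam K Q)) (V : ModuleCat.{u} (PiAlg K)) : Type u :=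
  (S ⊗[K] compo V 0) × (R ⊗[K] compo V 1)

/-- The projection of `⨁ M_i` onto `M_i`. -/
def hallVtx (S R : ModuleCat.{u} (Lam K Q)) (V : ModuleCat.{u} (PiAlg K)) (i : I) :
    hallSpace S R V →ₗ[K] hallSpace S R V :=
  ((lact S (vtx K Q i)).rTensor (compo V 0)).prodMap ((lact R (vtx K Q i)).rTensor (compo V 1))

/-- The map `M_{s(a)} → M_{t(a)}` (extended by zero) obtained by evaluating the matrix
`(S_a Q_a; P_a R_a)` of the universal lifting on `V`. -/
def hallArr {S R : ModuleCat.{u} (Lam K Q)} {D : DualCocycles S R} (L : UniversalLifting D)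
    (V : ModuleCat.{u} (PiAlg K)) (a : H) : hallSpace S R V →ₗ[K] hallSpace S R V :=
  LinearMap.prod
    (LinearMap.coprod (evalPi S S V 0 0 (L.matS a)) (evalPi R S V 0 1 (L.matQ a)))
    (LinearMap.coprod (evalPi S R V 1 0 (L.matP a)) (evalPi R R V 1 1 (L.matR a)))

/-- The map `(S ⊗ V₀) ⊕ (R ⊗ V₁) → (S ⊗ W₀) ⊕ (R ⊗ W₁)` induced by a morphism `V → W`. -/
def hallMap (S R : ModuleCat.{u} (Lam K Q)) {V W : ModuleCat.{u} (PiAlg K)} (f : V ⟶ W) :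
    hallSpace S R V →ₗ[K] hallSpace S R W :=
  ((compMap f 0).lTensor S).prodMap ((compMap f 1).lTensor R)

/-- `F` is the functor defined by the universal lifting `L`: up to the identification `φ` of the
underlying vector spaces, `F V` is the space `⨁ M_i` graded by `I` on which the arrows
`a ∈ H` act by the evaluation on `V` of the matrices of `L`, and `F` acts on morphisms in the
obvious way. As the `e_i` and the `a ∈ H` generate a dense subalgebra, this determines `F` up to
isomorphism. -/
def IsHallFunctor {S R : ModuleCat.{u} (Lam K Q)} {D : DualCocycles S R} (L : UniversalLifting D)
    (F : FDMod K kronecker ⥤ FDMod K Q) : Prop :=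
  ∃ φ : ∀ V : FDMod K kronecker, (F.obj V).obj ≃ₗ[K] hallSpace S R V.obj,
    (∀ (V : FDMod K kronecker) (i : I) (m : (F.obj V).obj),
      φ V (vtx K Q i • m) = hallVtx S R V.obj i (φ V m)) ∧
    (∀ (V : FDMod K kronecker) (a : H) (m : (F.obj V).obj),
      φ V (arr K Q a • m) = hallArr L V.obj a (φ V m)) ∧
    (∀ (V W : FDMod K kronecker) (f : V ⟶ W) (m : (F.obj V).obj),
      φ W ((F.map f).hom.hom m) = hallMap S R f.hom (φ V m))

end Modules

section Exactness

variable {K : Type u} [Field K] {I H I' H' : Type} [Fintype I] [Fintype H] [Fintype I'] [Fintype H']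
  {Q : OrientedGraph I H} {Q' : OrientedGraph I' H'}

/-- The functor `F` takes short exact sequences to short exact sequences. -/
def IsExactFunctor (F : FDMod K Q' ⥤ FDMod K Q) : Prop :=
  F.Additive ∧ ∀ (X Y Z : FDMod K Q') (f : X ⟶ Y) (g : Y ⟶ Z),
    Function.Injective f.hom.hom → Function.Exact f.hom.hom g.hom.hom →
    Function.Surjective g.hom.hom →
      Function.Injective (F.map f).hom.hom ∧
      Function.Exact (F.map f).hom.hom (F.map g).hom.hom ∧
      Function.Surjective (F.map g).hom.hom

end Exactness

end

end HallFunctors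

/-! For finite dimensional modules `M`, `N`, the complex of graded maps with differentials `d⁰ : C⁰
→ C¹` and `d¹ : C¹ → C⁰` has `Hom(M, N)` as kernel and `Ext¹(M, N)` as its middle cohomology; the
second fact goes through derivations that vanish on the idempotents (`Der0`). The trace pairings
make `d⁰` for `(M, N)` and `d¹` for `(N, M)` adjoint up to sign (`Rep.tau_dZero`). Hence `Ext¹(S,
R)` and `Ext¹(R, S)` are dual, which gives (1), the cokernel of `d¹` is dual to `Hom(N, M)`, and
dimensions obey the Euler form formula `Rep.finrank_Z1_add`.

For (2), the elements `x = α - β̄` and `y = β + ᾱ` of `Π` commute and exchange the two vertices. So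
it suffices to find power series in two commuting variables with coefficients in `End(S × R)`, block
diagonal in even degrees and off-diagonal in odd degrees, that satisfy the preprojective relation.
They are built degree by degree. The obstruction lives in the dual of `End(S ⊕ R) = K × K`, so it
consists of the traces on `S` and on `R`. Their sum vanishes by the symmetry `a ↔ ā`. The remaining
trace in degree `N + 2` is removed by adding multiples of the two cocycles `R → S` in degree `N +
1`: by duality this moves the trace by an arbitrary combination of `x` and `y`, that is, by any
homogeneous polynomial of positive degree (`IsApprox.exists_succ`).

For (3), the radical filtration of `V` shows that the evaluated matrices give a nilpotent
representation, hence a module over the completed algebra. The central statement is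
`exists_eq_hallLin`: if the boundary of a graded map `u` between the images of `V` and `W` is minus
the evaluation of a derivation `d`, then `u` is induced by a graded map `φ : V → W` and `d` is minus
the inner derivation of `φ`. It is proved by comparing leading terms along the radical filtrations,
where the equation only involves `Hom` and `Ext¹` between `S` and `R`. For `d = 0` this is fullness;
for general `d` it is injectivity on `Ext¹`. Since `S` and `R` have the same Euler form as the
simple `Π`-modules, a dimension count turns injectivity into surjectivity on `Ext¹`
(`map_hallDL_sup_B1`).

Exactness and fullness then make the essential image closed under kernels and cokernels,
surjectivity on `Ext¹` makes it closed under extensions, and it contains `S` and `R` as images of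
the simples. Conversely, every `V` is an iterated extension of simples, so its image lies in `⟨S,
R⟩`. -/

namespace HallFunctors

noncomputable section

/-! ### The preprojective algebra and the powers of its augmentation ideal. -/

section PreprojectiveAlgebra

variable (K : Type u) [Field K] {I H : Type} [Fintype I] [Fintype H] (Q : OrientedGraph I H)

/-- The idempotent `e_i` of the preprojective algebra. -/
def preV (i : I) : Pre K Q := mkPre K Q (FreeAlgebra.ι K (Sum.inl i))

/-- The arrow `a` of the preprojective algebra. -/
def preA (a : H) : Pre K Q := mkPre K Q (FreeAlgebra.ι K (Sum.inr a))

lemma mkPre_surjective : Function.Surjective (mkPre K Q) :=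
  RingQuot.mkAlgHom_surjective K (PreRel K Q)

lemma mkPre_rel {x y : FreeAlgebra K (I ⊕ H)} (h : PreRel K Q x y) : mkPre K Q x = mkPre K Q y :=
  RingQuot.mkAlgHom_rel K h

open Classical in
lemma preV_mul (i j : I) : preV K Q i * preV K Q j = if i = j then preV K Q i else 0 := by
  have := mkPre_rel K Q (PreRel.idem i j)
  rw [map_mul] at this
  rw [preV, preV, this]
  split_ifs <;> simp

lemma preV_sum : ∑ i, preV K Q i = 1 := by
  have := mkPre_rel K Q (PreRel.one)
  simpa [preV] using this

lemma preV_preA (a : H) : preV K Q (Q.t a) * preA K Q a = preA K Q a := by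
  have := mkPre_rel K Q (PreRel.target a)
  rwa [map_mul] at this

lemma preA_preV (a : H) : preA K Q a * preV K Q (Q.s a) = preA K Q a := by
  have := mkPre_rel K Q (PreRel.source a)
  rwa [map_mul] at this

lemma preA_rel (i : I) : ∑ a ∈ Q.out i, Q.ε K a • (preA K Q (Q.bar a) * preA K Q a) = 0 := by
  have := mkPre_rel K Q (PreRel.preproj i)
  simpa [preA] using this

open Classical in
lemma aug_preV (i : I) : aug K Q (preV K Q i) = Pi.single i 1 := by
  unfold aug preV mkPre
  erw [RingQuot.liftAlgHom_mkAlgHom_apply]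
  simp

lemma aug_preA (a : H) : aug K Q (preA K Q a) = 0 := by
  unfold aug preA mkPre
  erw [RingQuot.liftAlgHom_mkAlgHom_apply]
  simp

variable {K Q} in
/-- Induction on elements of the preprojective algebra. -/
lemma Pre.induction {p : Pre K Q → Prop} (halg : ∀ c, p (algebraMap K _ c))
    (hV : ∀ i, p (preV K Q i)) (hA : ∀ a, p (preA K Q a)) (hadd : ∀ x y, p x → p y → p (x + y))
    (hmul : ∀ x y, p x → p y → p (x * y)) (x : Pre K Q) : p x := by
  obtain ⟨x, rfl⟩ := mkPre_surjective K Q x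
  induction x using FreeAlgebra.induction with
  | grade0 c => simpa using halg c
  | grade1 v => rcases v with i | a; exacts [hV i, hA a]
  | add x y hx hy => rw [map_add]; exact hadd _ _ hx hy
  | mul x y hx hy => rw [map_mul]; exact hmul _ _ hx hy

/-- Every path is trivial or factors through its first arrow on the right, so the elements of this
shape form a left ideal, and that left ideal contains `1 = ∑ e_i`. -/
lemma Pre.exists_eq_sum (x : Pre K Q) :
    ∃ (c : I → K) (y : H → Pre K Q), x = ∑ i, c i • preV K Q i + ∑ a, y a * preA K Q a := by
  classical
  suffices h : ∀ (x : Pre K Q) (c : I → K) (y : H → Pre K Q), ∃ (c' : I → K) (y' : H → Pre K Q),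
      x * (∑ i, c i • preV K Q i + ∑ a, y a * preA K Q a) =
        ∑ i, c' i • preV K Q i + ∑ a, y' a * preA K Q a by
    obtain ⟨c, y, h⟩ := h x 1 0
    refine ⟨c, y, ?_⟩
    rw [← h]
    simp [preV_sum]
  intro x
  induction x using Pre.induction with
  | halg r =>
    intro c y
    refine ⟨fun i => r * c i, fun a => r • y a, ?_⟩
    simp [Algebra.algebraMap_eq_smul_one, mul_smul, ← Finset.smul_sum, smul_add]
  | hV i =>
    intro c y
    refine ⟨Pi.single i (c i), fun a => preV K Q i * y a, ?_⟩
    simp [mul_add, Finset.mul_sum, preV_mul, mul_assoc, Pi.single_apply, ite_smul]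
  | hA b =>
    intro c y
    -- Since `b e_i = 0` unless `i = s(b)`, the vertex part contributes `c (Q.s b)` times the arrow
    -- `b`, which joins the coefficient of that arrow.
    refine ⟨0, fun a => (Pi.single b (c (Q.s b)) : H → K) a • 1 + preA K Q b * y a, ?_⟩
    have : ∀ i, preA K Q b * preV K Q i = if i = Q.s b then preA K Q b else 0 := by
      intro i
      rw [← preA_preV, mul_assoc, preV_mul]
      split_ifs with h1 h2 h2
      · rw [preA_preV]
      · exact absurd h1.symm h2
      · exact absurd h2.symm h1
      · simp
    simp [mul_add, Finset.mul_sum, this, add_mul, Finset.sum_add_distrib, mul_assoc,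
      Pi.single_apply, ite_smul]
  | hadd x x' hx hx' =>
    intro c y
    obtain ⟨c1, y1, h1⟩ := hx c y
    obtain ⟨c2, y2, h2⟩ := hx' c y
    refine ⟨c1 + c2, y1 + y2, ?_⟩
    rw [add_mul, h1, h2]
    simp only [Pi.add_apply, add_smul, add_mul, Finset.sum_add_distrib]
    abel
  | hmul x x' hx hx' =>
    intro c y
    obtain ⟨c1, y1, h1⟩ := hx' c y
    obtain ⟨c2, y2, h2⟩ := hx c1 y1
    exact ⟨c2, y2, by rw [mul_assoc, h1, h2]⟩

lemma preA_mem_augIdeal (a : H) : preA K Q a ∈ augIdeal K Q := aug_preA K Q a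

variable {K Q} in
lemma exists_of_mem_augIdeal {x : Pre K Q} (hx : x ∈ augIdeal K Q) :
    ∃ y : H → Pre K Q, x = ∑ a, y a * preA K Q a := by
  classical
  obtain ⟨c, y, rfl⟩ := Pre.exists_eq_sum K Q x
  have h : aug K Q (∑ i, c i • preV K Q i + ∑ a, y a * preA K Q a) = 0 := hx
  have hc : ∀ i, c i = 0 := by
    intro i
    have := congrFun h i
    simpa [aug_preV, aug_preA, Pi.single_apply] using this
  exact ⟨y, by simp [hc]⟩

variable {K Q} in
lemma exists_of_mem_augIdeal_pow_succ {m : ℕ} {x : Pre K Q} (hx : x ∈ augIdeal K Q ^ (m + 1)) :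
    ∃ y : H → Pre K Q, (∀ a, y a ∈ augIdeal K Q ^ m) ∧ x = ∑ a, y a * preA K Q a := by
  rw [Submodule.pow_succ] at hx
  refine Submodule.mul_induction_on hx ?_ ?_
  · intro z hz w hw
    obtain ⟨y, rfl⟩ := exists_of_mem_augIdeal hw
    refine ⟨fun a => z * y a, fun a => (Ideal.IsTwoSided.mul_mem_of_left _ hz), ?_⟩
    simp [Finset.mul_sum, mul_assoc]
  · rintro x x' ⟨y, hy, rfl⟩ ⟨y', hy', rfl⟩
    exact ⟨y + y', fun a => add_mem (hy a) (hy' a), by simp [add_mul, Finset.sum_add_distrib]⟩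

end PreprojectiveAlgebra

/-! ### The completion: its topology is the radical topology, and finite dimensional modules are
nilpotent. -/

section Completed

variable {K : Type u} [Field K] {I H : Type} [Fintype I] [Fintype H] {Q : OrientedGraph I H}

lemma projLam_toLam (n : ℕ) (x : Pre K Q) :
    projLam K Q n (toLam K Q x) = Ideal.Quotient.mk _ x := rfl

@[ext]
lemma Lam.ext {x y : Lam K Q} (h : ∀ n, projLam K Q n x = projLam K Q n y) : x = y :=
  Subtype.ext (funext h)

/-- An element of the completed preprojective algebra from a compatible sequence. -/
def Lam.mk (z : ℕ → Pre K Q) (hz : ∀ n, z (n + 1) - z n ∈ augIdeal K Q ^ n) : Lam K Q :=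
  ⟨fun n => Ideal.Quotient.mk _ (z n), by
    intro m n h
    induction n, h using Nat.le_induction with
    | base => rfl
    | succ n h ih =>
      rw [← ih, Ideal.Quotient.factor_mk, Ideal.Quotient.factor_mk, Ideal.Quotient.eq]
      exact Ideal.pow_le_pow_right h (hz n)⟩

lemma projLam_mk (z : ℕ → Pre K Q) (hz) (n : ℕ) :
    projLam K Q n (Lam.mk z hz) = Ideal.Quotient.mk _ (z n) := rfl

lemma Lam.exists_rep (x : Lam K Q) : ∃ (z : ℕ → Pre K Q)
    (hz : ∀ n, z (n + 1) - z n ∈ augIdeal K Q ^ n), x = Lam.mk z hz := by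
  choose z hz using fun n => Ideal.Quotient.mk_surjective (projLam K Q n x)
  have h : ∀ n, z (n + 1) - z n ∈ augIdeal K Q ^ n := by
    intro n
    rw [← Ideal.Quotient.eq, hz n]
    have := x.2 n (n + 1) n.le_succ
    change _ = projLam K Q n x at this
    rw [← this]
    change _ = Ideal.Quotient.factor _ (projLam K Q (n + 1) x)
    rw [← hz (n + 1)]
    rfl
  exact ⟨z, h, by ext n; rw [projLam_mk, hz n]⟩

/-- The kernel of the projection of the completed algebra onto the quotient by `J ^ n`. -/
def kerLam (K : Type u) [Field K] (Q : OrientedGraph I H) (n : ℕ) : Ideal (Lam K Q) :=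
  RingHom.ker (projLam K Q n)

instance (n : ℕ) : (kerLam K Q n).IsTwoSided :=
  inferInstanceAs (RingHom.ker (projLam K Q n)).IsTwoSided

instance : (radIdeal K Q).IsTwoSided :=
  inferInstanceAs (RingHom.ker (projLam K Q 1)).IsTwoSided

lemma mem_kerLam {n : ℕ} {x : Lam K Q} : x ∈ kerLam K Q n ↔ projLam K Q n x = 0 := Iff.rfl

lemma toLam_mem_kerLam {n : ℕ} {x : Pre K Q} : toLam K Q x ∈ kerLam K Q n ↔ x ∈ augIdeal K Q ^ n := by
  rw [mem_kerLam, projLam_toLam, Ideal.Quotient.eq_zero_iff_mem]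

lemma exists_sub_toLam_mem (x : Lam K Q) (n : ℕ) : ∃ z, x - toLam K Q z ∈ kerLam K Q n := by
  obtain ⟨z, hz⟩ := Ideal.Quotient.mk_surjective (projLam K Q n x)
  exact ⟨z, by rw [mem_kerLam, map_sub, projLam_toLam, hz, sub_self]⟩

/-- Each increment of an approximating sequence is written with arrows on the right, and the
coefficients of each arrow are summed. The sums converge, and the finiteness of `H` yields finitely
many coefficients in the completion. -/
lemma exists_of_mem_kerLam_succ {n : ℕ} {x : Lam K Q} (hx : x ∈ kerLam K Q (n + 1)) :
    ∃ y : H → Lam K Q, (∀ a, y a ∈ kerLam K Q n) ∧ x = ∑ a, y a * arr K Q a := by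
  obtain ⟨z, hz, rfl⟩ := x.exists_rep
  have hz0 : ∀ m ≤ n, z (m + 1) ∈ augIdeal K Q ^ (m + 1) := by
    intro m hm
    have h1 : z (n + 1) ∈ augIdeal K Q ^ (n + 1) := by
      rwa [mem_kerLam, projLam_mk, Ideal.Quotient.eq_zero_iff_mem] at hx
    have h2 : ∀ k, m ≤ k → z (k + 1) - z (m + 1) ∈ augIdeal K Q ^ (m + 1) := by
      intro k hk
      induction k, hk using Nat.le_induction with
      | base => simp
      | succ k hk ih =>
        rw [← sub_add_sub_cancel _ (z (k + 1)) _]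
        exact add_mem (Ideal.pow_le_pow_right (by omega) (hz (k + 1))) ih
    have := sub_mem (Ideal.pow_le_pow_right (by omega) h1) (h2 n hm)
    simpa using this
  -- A second approximating sequence of the same element. The shift by one puts the increment at `m`
  -- in `J ^ (m + 1)`, so that its coefficients lie in `J ^ m`; the initial zeros are allowed
  -- because `z (n + 1)` lies in `J ^ (n + 1)`, and they put the coefficients in `kerLam K Q n`.
  set w : ℕ → Pre K Q := fun m => if m ≤ n then 0 else z (m + 1) with hw
  have hwd : ∀ m, ∃ y : H → Pre K Q, (∀ a, y a ∈ augIdeal K Q ^ m) ∧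
      (m < n → ∀ a, y a = 0) ∧ w (m + 1) - w m = ∑ a, y a * preA K Q a := by
    intro m
    rcases lt_or_ge m n with hm | hm
    · refine ⟨0, fun a => zero_mem _, fun _ _ => rfl, ?_⟩
      simp [hw, hm.le, Nat.succ_le_of_lt hm]
    · have : w (m + 1) - w m ∈ augIdeal K Q ^ (m + 1) := by
        rcases hm.eq_or_lt with rfl | hm
        · have h1 := add_mem (hz (n + 1)) (hz0 n le_rfl)
          simpa [hw] using h1
        · simpa [hw, not_le.2 hm, not_le.2 (Nat.lt_succ_of_lt hm)] using hz (m + 1)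
      obtain ⟨y, hy, h⟩ := exists_of_mem_augIdeal_pow_succ this
      exact ⟨y, hy, fun h => absurd hm (not_le.2 h), h⟩
  choose y hy hy0 hyw using hwd
  refine ⟨fun a => Lam.mk (Q := Q) (fun k => ∑ m ∈ Finset.range k, y m a)
    (fun k => by simpa [Finset.sum_range_succ] using hy k a), ?_, ?_⟩
  · intro a
    rw [mem_kerLam, projLam_mk, Finset.sum_eq_zero, map_zero]
    intro m hm
    exact hy0 m (Finset.mem_range.1 hm) a
  · ext k
    simp only [map_sum, map_mul, projLam_mk]
    change Ideal.Quotient.mk (augIdeal K Q ^ k) (z k) = ∑ a, (∑ m ∈ Finset.range k, Ideal.Quotient.mk (augIdeal K Q ^ k) (y m a)) *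
      Ideal.Quotient.mk (augIdeal K Q ^ k) (preA K Q a)
    have h1 : ∀ k, w k = ∑ m ∈ Finset.range k, ∑ a, y m a * preA K Q a := by
      intro k
      induction k with
      | zero => simp [hw]
      | succ k ih => rw [Finset.sum_range_succ, ← ih, ← hyw, add_sub_cancel]
    have h2 : z k - w k ∈ augIdeal K Q ^ k := by
      by_cases hk : k ≤ n
      · simp only [hw, hk, if_true, sub_zero]
        rcases k with _ | k
        · rw [Submodule.pow_zero, Ideal.one_eq_top]; trivial
        · exact hz0 k (by omega)
      · simp only [hw, hk, if_false]
        rw [← neg_mem_iff, neg_sub]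
        exact hz k
    rw [Ideal.Quotient.eq.2 h2, h1, Finset.sum_comm]
    simp only [map_sum, map_mul, Finset.sum_mul]

lemma arr_mem_kerLam_one (a : H) : arr K Q a ∈ kerLam K Q 1 := by
  have := toLam_mem_kerLam (K := K) (Q := Q) (n := 1) (x := preA K Q a)
  rw [Submodule.pow_one] at this
  exact this.2 (preA_mem_augIdeal K Q a)

lemma arr_mem_radIdeal (a : H) : arr K Q a ∈ radIdeal K Q := arr_mem_kerLam_one a

lemma kerLam_le_radIdeal_pow (n : ℕ) : kerLam K Q n ≤ radIdeal K Q ^ n := by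
  induction n with
  | zero => rw [Submodule.pow_zero, Ideal.one_eq_top]; exact le_top
  | succ n ih =>
    intro x hx
    obtain ⟨y, hy, rfl⟩ := exists_of_mem_kerLam_succ hx
    refine sum_mem fun a _ => ?_
    rw [Submodule.pow_succ]
    exact Ideal.mul_mem_mul (ih (hy a)) (arr_mem_radIdeal a)

lemma exists_of_mem_radIdeal {x : Lam K Q} (hx : x ∈ radIdeal K Q) :
    ∃ y : H → Lam K Q, x = ∑ a, y a * arr K Q a := by
  obtain ⟨y, -, h⟩ := exists_of_mem_kerLam_succ (n := 0) hx
  exact ⟨y, h⟩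

lemma exists_sub_vtx_mem (x : Lam K Q) :
    ∃ c : I → K, x - ∑ i, c i • vtx K Q i ∈ radIdeal K Q := by
  obtain ⟨z, hz⟩ := exists_sub_toLam_mem x 1
  obtain ⟨c, y, rfl⟩ := Pre.exists_eq_sum K Q z
  refine ⟨c, ?_⟩
  have h2 : toLam K Q (∑ a, y a * preA K Q a) ∈ kerLam K Q 1 := by
    rw [map_sum]
    refine sum_mem fun a _ => ?_
    rw [map_mul]
    exact Ideal.mul_mem_left _ _ (arr_mem_kerLam_one a)
  have := add_mem hz h2
  rw [map_add, sub_add_eq_sub_sub, sub_add_cancel] at this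
  simp only [map_sum, map_smul] at this
  exact this

open Classical in
lemma vtx_mul (i j : I) : vtx K Q i * vtx K Q j = if i = j then vtx K Q i else 0 := by
  have := congrArg (toLam K Q) (preV_mul K Q i j)
  rw [map_mul] at this
  refine this.trans ?_
  split_ifs <;> simp [vtx, preV]

lemma vtx_sum : ∑ i, vtx K Q i = 1 := by
  have := congrArg (toLam K Q) (preV_sum K Q)
  rwa [map_sum, map_one] at this

lemma vtx_arr (a : H) : vtx K Q (Q.t a) * arr K Q a = arr K Q a := by
  have := congrArg (toLam K Q) (preV_preA K Q a)
  rwa [map_mul] at this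

lemma arr_vtx (a : H) : arr K Q a * vtx K Q (Q.s a) = arr K Q a := by
  have := congrArg (toLam K Q) (preA_preV K Q a)
  rwa [map_mul] at this

lemma arr_rel (i : I) : ∑ a ∈ Q.out i, Q.ε K a • (arr K Q (Q.bar a) * arr K Q a) = 0 := by
  have := congrArg (toLam K Q) (preA_rel K Q i)
  simp only [map_sum, map_smul, map_mul, map_zero] at this
  exact this

lemma mul_mem_kerLam_add {m n : ℕ} {x y : Lam K Q} (hx : x ∈ kerLam K Q m)
    (hy : y ∈ kerLam K Q n) : x * y ∈ kerLam K Q (m + n) := by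
  obtain ⟨z, hz⟩ := exists_sub_toLam_mem x (m + n)
  obtain ⟨w, hw⟩ := exists_sub_toLam_mem y (m + n)
  have hle : ∀ {k l : ℕ}, k ≤ l → kerLam K Q l ≤ kerLam K Q k := by
    intro k l h u hu
    rw [mem_kerLam] at hu ⊢
    have := u.2 k l h
    change Ideal.Quotient.factor _ (projLam K Q l u) = projLam K Q k u at this
    rw [← this, hu, map_zero]
  have hz' : z ∈ augIdeal K Q ^ m := by
    rw [← toLam_mem_kerLam]
    simpa using sub_mem hx (hle (Nat.le_add_right m n) hz)
  have hw' : w ∈ augIdeal K Q ^ n := by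
    rw [← toLam_mem_kerLam]
    simpa using sub_mem hy (hle (Nat.le_add_left n m) hw)
  have h1 : toLam K Q z * toLam K Q w ∈ kerLam K Q (m + n) := by
    rw [← map_mul, toLam_mem_kerLam, Ideal.IsTwoSided.pow_add]
    exact Ideal.mul_mem_mul hz' hw'
  have : x * y = (x - toLam K Q z) * y + toLam K Q z * (y - toLam K Q w)
    + toLam K Q z * toLam K Q w := by noncomm_ring
  rw [this]
  exact add_mem (add_mem (Ideal.mul_mem_right _ _ hz) (Ideal.mul_mem_left _ _ hw)) h1

/-- Algebraic powers of the radical are therefore closed, so the completed algebra carries its own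
adic topology. The inclusion that needs an argument is `kerLam_le_radIdeal_pow`, which rests on
`exists_of_mem_kerLam_succ`. -/
lemma radIdeal_pow_eq (n : ℕ) : radIdeal K Q ^ n = kerLam K Q n := by
  refine le_antisymm ?_ (kerLam_le_radIdeal_pow n)
  induction n with
  | zero =>
    intro x _
    rw [mem_kerLam]
    have : Subsingleton (Pre K Q ⧸ augIdeal K Q ^ 0) := by
      rw [Submodule.pow_zero, Ideal.one_eq_top]
      exact Ideal.Quotient.subsingleton_iff.2 rfl
    exact Subsingleton.elim _ _
  | succ n ih =>
    rw [Submodule.pow_succ, Ideal.mul_le]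
    exact fun x hx y hy => mul_mem_kerLam_add (ih hx) hy

/-- For `x` in the radical the geometric series converges to a left inverse of `1 - x`. A maximal
left ideal that misses `x` would contain some `1 - c x`, hence `1`. -/
lemma radIdeal_le_jacobson : radIdeal K Q ≤ Ring.jacobson (Lam K Q) := by
  have hunit : ∀ x ∈ radIdeal K Q, ∃ y, y * (1 - x) = 1 := by
    intro x hx
    choose z hz using fun n => exists_sub_toLam_mem (∑ k ∈ Finset.range n, x ^ k) n
    have hxk : ∀ k, x ^ k ∈ kerLam K Q k := fun k => by
      rw [← radIdeal_pow_eq]; exact Ideal.pow_mem_pow hx k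
    have hle : ∀ n, kerLam K Q (n + 1) ≤ kerLam K Q n := fun n => by
      rw [← radIdeal_pow_eq, ← radIdeal_pow_eq]; exact Ideal.pow_le_pow_right n.le_succ
    have hz' : ∀ n, z (n + 1) - z n ∈ augIdeal K Q ^ n := by
      intro n
      rw [← toLam_mem_kerLam, map_sub]
      have h1 := add_mem (sub_mem (hz n) (hle n (hz (n + 1)))) (hxk n)
      rw [Finset.sum_range_succ] at h1
      convert h1 using 1
      abel
    refine ⟨Lam.mk z hz', ?_⟩
    · ext n
      have h1 : projLam K Q n (Lam.mk z hz') = projLam K Q n (∑ k ∈ Finset.range n, x ^ k) := by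
        rw [projLam_mk, ← projLam_toLam, eq_comm, ← sub_eq_zero, ← map_sub]
        exact hz n
      rw [map_mul, h1, ← map_mul, geom_sum_mul_neg, map_sub,
        mem_kerLam.1 (hxk n), sub_zero]
  intro x hx
  rw [Ring.jacobson_eq_sInf_isMaximal, Ideal.mem_sInf]
  intro M hM
  by_contra hxM
  have : M ⊔ Ideal.span {x} = ⊤ := hM.1.2 _ (by
    rw [left_lt_sup]
    intro h
    exact hxM (h (Ideal.mem_span_singleton_self x)))
  obtain ⟨m, hm, w, hw, h1⟩ := Submodule.mem_sup.1 ((Ideal.eq_top_iff_one _).1 this)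
  obtain ⟨c, rfl⟩ := Submodule.mem_span_singleton.1 hw
  obtain ⟨y, hy⟩ := hunit (c * x) (Ideal.mul_mem_left _ _ hx)
  have h2 : 1 - c * x = m := by rw [← h1]; simp
  rw [h2] at hy
  exact hM.ne_top ((Ideal.eq_top_iff_one _).2 (hy ▸ Ideal.mul_mem_left _ _ hm))

/-- Finite dimensional modules over the completed algebra are annihilated by a power of the
radical. -/
lemma exists_radIdeal_pow_smul_eq_zero (M : ModuleCat.{u} (Lam K Q)) (hM : Module.Finite K M) :
    ∃ n, ∀ x ∈ radIdeal K Q ^ n, ∀ m : M, x • m = 0 := by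
  have hfin : ∀ N : Submodule (Lam K Q) M, N.FG := by
    intro N
    have : IsNoetherian (Lam K Q) M := isNoetherian_of_tower K inferInstance
    exact IsNoetherian.noetherian N
  by_contra! hcon
  have hne : ∀ n, (radIdeal K Q ^ n) • (⊤ : Submodule (Lam K Q) M) ≠ ⊥ := by
    intro n h
    obtain ⟨x, hx, m, hxm⟩ := hcon n
    have : x • m ∈ (radIdeal K Q ^ n) • (⊤ : Submodule (Lam K Q) M) :=
      Submodule.smul_mem_smul hx trivial
    rw [h] at this
    exact hxm this
  -- By Nakayama's lemma the chain `J ^ n M` drops strictly as long as it is nonzero, which an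
  -- Artinian module forbids.
  have hanti : StrictAnti fun n => (radIdeal K Q ^ n) • (⊤ : Submodule (Lam K Q) M) := by
    refine strictAnti_nat_of_succ_lt fun n => ?_
    change (radIdeal K Q ^ (n + 1)) • ⊤ < (radIdeal K Q ^ n) • (⊤ : Submodule (Lam K Q) M)
    rw [Ideal.IsTwoSided.pow_succ, Submodule.mul_smul]
    exact (Submodule.smul_mono_left radIdeal_le_jacobson).trans_lt
      (Submodule.FG.jacobson_smul_lt (hne n) (hfin _))
  have : IsArtinian (Lam K Q) M := isArtinian_of_tower K inferInstance
  obtain ⟨n, hn⟩ := IsArtinian.monotone_stabilizes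
    ⟨fun n => OrderDual.toDual ((radIdeal K Q ^ n) • (⊤ : Submodule (Lam K Q) M)), hanti.antitone⟩
  have h1 := hanti (Nat.lt_succ_self n)
  have h2 := hn (n + 1) n.le_succ
  exact h1.ne h2.symm

end Completed

/-! ### Nilpotent representations versus modules over the completed algebra. -/

section Representations

variable {K : Type u} [Field K] {I H : Type} [Fintype I] [Fintype H]

/-- A representation of the preprojective algebra on a vector space `M`: the actions of the
idempotents and of the arrows. -/
structure Rep (K : Type u) [Field K] {I H : Type} [Fintype I] [Fintype H] (Q : OrientedGraph I H)
    (M : Type u) [AddCommGroup M] [Module K M] where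
  E : I → M →ₗ[K] M
  A : H → M →ₗ[K] M
  E_idem : ∀ i, E i ∘ₗ E i = E i
  E_ortho : ∀ i j, i ≠ j → E i ∘ₗ E j = 0
  E_sum : ∑ i, E i = LinearMap.id
  E_A : ∀ a, E (Q.t a) ∘ₗ A a = A a
  A_E : ∀ a, A a ∘ₗ E (Q.s a) = A a
  rel : ∀ i, ∑ a ∈ Q.out i, Q.ε K a • (A (Q.bar a) ∘ₗ A a) = 0

variable {Q : OrientedGraph I H}
variable {M N : Type u} [AddCommGroup M] [Module K M] [AddCommGroup N] [Module K N]

namespace Rep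

/-- The algebra homomorphism defined by a representation. -/
def lift (ρ : Rep K Q M) : Pre K Q →ₐ[K] Module.End K M :=
  RingQuot.liftAlgHom K
    ⟨FreeAlgebra.lift K (Sum.elim ρ.E ρ.A), by
      intro x y h
      induction h with
      | idem i j =>
        split_ifs with hij
        · subst hij
          simpa [Module.End.mul_eq_comp] using ρ.E_idem i
        · simpa [Module.End.mul_eq_comp] using ρ.E_ortho i j hij
      | one => simpa [Module.End.one_eq_id] using ρ.E_sum
      | target a => simpa [Module.End.mul_eq_comp] using ρ.E_A a
      | source a => simpa [Module.End.mul_eq_comp] using ρ.A_E a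
      | preproj i => simpa [Module.End.mul_eq_comp] using ρ.rel i⟩

lemma lift_preV (ρ : Rep K Q M) (i : I) : ρ.lift (preV K Q i) = ρ.E i := by
  unfold lift preV mkPre
  erw [RingQuot.liftAlgHom_mkAlgHom_apply]
  simp

lemma lift_preA (ρ : Rep K Q M) (a : H) : ρ.lift (preA K Q a) = ρ.A a := by
  unfold lift preA mkPre
  erw [RingQuot.liftAlgHom_mkAlgHom_apply]
  simp

/-- Nilpotent representations. -/
def IsNilp (ρ : Rep K Q M) : Prop := ∃ n, ∀ z ∈ augIdeal K Q ^ n, ρ.lift z = 0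

/-- Intertwining operators. -/
def Intertwines (ρ : Rep K Q M) (σ : Rep K Q N) (f : M →ₗ[K] N) : Prop :=
  (∀ i m, f (ρ.E i m) = σ.E i (f m)) ∧ ∀ a m, f (ρ.A a m) = σ.A a (f m)

lemma Intertwines.map_lift {ρ : Rep K Q M} {σ : Rep K Q N} {f : M →ₗ[K] N}
    (h : ρ.Intertwines σ f) (z : Pre K Q) (m : M) : f (ρ.lift z m) = σ.lift z (f m) := by
  induction z using Pre.induction generalizing m with
  | halg c => simp
  | hV i => rw [lift_preV, lift_preV, h.1]
  | hA a => rw [lift_preA, lift_preA, h.2]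
  | hadd x y hx hy => simp [hx, hy]
  | hmul x y hx hy => simp [hx, hy]

end Rep

/-- The representation underlying a module. -/
def repOf (M : ModuleCat.{u} (Lam K Q)) : Rep K Q M where
  E i := lact M (vtx K Q i)
  A a := lact M (arr K Q a)
  E_idem i := by
    classical
    ext m
    have := vtx_mul (K := K) (Q := Q) i i
    simp [lact, smul_smul, this]
  E_ortho i j h := by
    classical
    ext m
    have := vtx_mul (K := K) (Q := Q) i j
    simp [lact, smul_smul, this, h]
  E_sum := by
    ext m
    simp only [lact, LinearMap.sum_apply, Algebra.lsmul_coe, LinearMap.id_apply]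
    rw [← Finset.sum_smul, vtx_sum, one_smul]
  E_A a := by
    ext m
    simp [lact, smul_smul, vtx_arr]
  A_E a := by
    ext m
    simp [lact, smul_smul, arr_vtx]
  rel i := by
    ext m
    have := congrArg (fun x => x • m) (arr_rel (K := K) (Q := Q) i)
    simpa [lact, Finset.sum_smul, LinearMap.sum_apply, smul_smul] using this

lemma repOf_E (M : ModuleCat.{u} (Lam K Q)) (i : I) (m : M) :
    (repOf M).E i m = vtx K Q i • m := rfl

lemma repOf_A (M : ModuleCat.{u} (Lam K Q)) (a : H) (m : M) :
    (repOf M).A a m = arr K Q a • m := rfl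

lemma repOf_lift (M : ModuleCat.{u} (Lam K Q)) (z : Pre K Q) (m : M) :
    (repOf M).lift z m = toLam K Q z • m := by
  induction z using Pre.induction generalizing m with
  | halg c => simp
  | hV i => rw [Rep.lift_preV]; rfl
  | hA a => rw [Rep.lift_preA]; rfl
  | hadd x y hx hy => simp [hx, hy, add_smul]
  | hmul x y hx hy => simp [hx, hy, mul_smul]

lemma repOf_isNilp (M : ModuleCat.{u} (Lam K Q)) (hM : Module.Finite K M) :
    (repOf M).IsNilp := by
  obtain ⟨n, hn⟩ := exists_radIdeal_pow_smul_eq_zero M hM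
  refine ⟨n, fun z hz => ?_⟩
  ext m
  rw [repOf_lift, hn _ (by rw [radIdeal_pow_eq, toLam_mem_kerLam]; exact hz)]
  rfl

/-- Intertwining operators between finite dimensional modules are linear over the completed
algebra. -/
lemma Rep.Intertwines.map_smul {M N : ModuleCat.{u} (Lam K Q)} (hM : Module.Finite K M)
    (hN : Module.Finite K N) {f : M →ₗ[K] N} (h : (repOf M).Intertwines (repOf N) f)
    (x : Lam K Q) (m : M) : f (x • m) = x • f m := by
  obtain ⟨n, hn⟩ := exists_radIdeal_pow_smul_eq_zero M hM
  obtain ⟨k, hk⟩ := exists_radIdeal_pow_smul_eq_zero N hN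
  -- At precision `n + k` the error acts by zero on both modules, so `x` may be replaced by an
  -- element of the uncompleted algebra.
  obtain ⟨z, hz⟩ := exists_sub_toLam_mem x (n + k)
  rw [← radIdeal_pow_eq] at hz
  have h1 : x • m = toLam K Q z • m := by
    rw [← sub_eq_zero, ← sub_smul]
    exact hn _ (Ideal.pow_le_pow_right (Nat.le_add_right n k) hz) m
  have h2 : x • f m = toLam K Q z • f m := by
    rw [← sub_eq_zero, ← sub_smul]
    exact hk _ (Ideal.pow_le_pow_right (Nat.le_add_left k n) hz) (f m)
  rw [h1, h2, ← repOf_lift, ← repOf_lift, h.map_lift]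

/-- The morphism of finite dimensional modules defined by an intertwining operator. -/
def Rep.Intertwines.hom {M N : ModuleCat.{u} (Lam K Q)} (hM : Module.Finite K M)
    (hN : Module.Finite K N) {f : M →ₗ[K] N} (h : (repOf M).Intertwines (repOf N) f) : M ⟶ N :=
  ModuleCat.ofHom
    { toFun := f
      map_add' := f.map_add
      map_smul' := fun x m => h.map_smul hM hN x m }

lemma Rep.Intertwines.hom_apply {M N : ModuleCat.{u} (Lam K Q)} (hM : Module.Finite K M)
    (hN : Module.Finite K N) {f : M →ₗ[K] N} (h : (repOf M).Intertwines (repOf N) f) (m : M) :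
    (h.hom hM hN).hom m = f m := rfl

/-- The action of the completed algebra defined by a nilpotent representation. -/
def Rep.liftLam (ρ : Rep K Q M) {n : ℕ} (hn : ∀ z ∈ augIdeal K Q ^ n, ρ.lift z = 0) :
    Lam K Q →+* Module.End K M :=
  (Ideal.Quotient.lift (augIdeal K Q ^ n) ρ.lift.toRingHom hn).comp (projLam K Q n).toRingHom

lemma Rep.liftLam_toLam (ρ : Rep K Q M) {n : ℕ} (hn : ∀ z ∈ augIdeal K Q ^ n, ρ.lift z = 0)
    (z : Pre K Q) : ρ.liftLam hn (toLam K Q z) = ρ.lift z := rfl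

/-- A copy of the space of a representation that does not carry its structure of a vector space. -/
def Rep.Carrier (_ : Rep K Q M) : Type u := M

instance (ρ : Rep K Q M) : AddCommGroup ρ.Carrier := inferInstanceAs (AddCommGroup M)

/-- The module structure defined by a nilpotent representation. -/
abbrev Rep.carrierModule (ρ : Rep K Q M) {n : ℕ} (hn : ∀ z ∈ augIdeal K Q ^ n, ρ.lift z = 0) :
    Module (Lam K Q) ρ.Carrier :=
  letI : Module (Module.End K M) ρ.Carrier := inferInstanceAs (Module (Module.End K M) M)
  Module.compHom ρ.Carrier (ρ.liftLam hn)

/-- The module over the completed algebra defined by a nilpotent representation. -/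
def Rep.toModule (ρ : Rep K Q M) {n : ℕ} (hn : ∀ z ∈ augIdeal K Q ^ n, ρ.lift z = 0) :
    ModuleCat.{u} (Lam K Q) :=
  letI := ρ.carrierModule hn
  ModuleCat.of (Lam K Q) ρ.Carrier

/-- A nilpotent representation comes from a module over the completed algebra. -/
lemma Rep.IsNilp.exists_module {ρ : Rep K Q M} (hρ : ρ.IsNilp) :
    ∃ (X : ModuleCat.{u} (Lam K Q)) (e : X ≃ₗ[K] M),
      (∀ i x, e (vtx K Q i • x) = ρ.E i (e x)) ∧ ∀ a x, e (arr K Q a • x) = ρ.A a (e x) := by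
  obtain ⟨n, hn⟩ := hρ
  let e : ρ.toModule hn ≃+ M := AddEquiv.refl M
  have key : ∀ (x : Lam K Q) (m : ρ.toModule hn), e (x • m) = ρ.liftLam hn x (e m) := fun _ _ => rfl
  -- The scalars of a module over the completed algebra act through that algebra; this action has to
  -- be compared with the original vector space structure.
  have he : ∀ (c : K) (x : ρ.toModule hn), e (c • x) = c • e x := by
    intro c x
    have : algebraMap K (Lam K Q) c = toLam K Q (algebraMap K _ c) := ((toLam K Q).commutes c).symm
    change e (algebraMap K (Lam K Q) c • x) = _
    rw [this, key, ρ.liftLam_toLam hn, AlgHom.commutes]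
    rfl
  refine ⟨ρ.toModule hn, e.toLinearEquiv he, fun i x => ?_, fun a x => ?_⟩
  · exact congrArg (fun f => f (e x)) (ρ.lift_preV i)
  · exact congrArg (fun f => f (e x)) (ρ.lift_preA a)

end Representations

/-! ### Adjoint maps for perfect pairings and nondegeneracy of the trace. -/

section LinearAlgebra

variable {K : Type*} [Field K]

/-- The ranges of adjoint maps have the same dimension. -/
lemma finrank_range_eq_of_adjoint {U V U' V' : Type*} [AddCommGroup U] [Module K U]
    [AddCommGroup V] [Module K V] [AddCommGroup U'] [Module K U'] [AddCommGroup V'] [Module K V']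
    [FiniteDimensional K U] [FiniteDimensional K U']
    (p : V →ₗ[K] U →ₗ[K] K) (p' : V' →ₗ[K] U' →ₗ[K] K) [p.IsPerfPair] [p'.IsPerfPair]
    (d : U →ₗ[K] U') (d' : V' →ₗ[K] V) (h : ∀ u v', p (d' v') u = p' v' (d u)) :
    Module.finrank K (LinearMap.range d') = Module.finrank K (LinearMap.range d) := by
  have h1 : p.toPerfPair.toLinearMap ∘ₗ d' = d.dualMap ∘ₗ p'.toPerfPair.toLinearMap := by
    ext v' u
    simpa using h u v'
  have h2 := LinearMap.finrank_range_dualMap_eq_finrank_range d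
  rw [← h2, ← LinearMap.range_comp_of_range_eq_top d.dualMap
    (LinearEquiv.range p'.toPerfPair), ← h1, LinearMap.range_comp]
  exact (LinearEquiv.finrank_map_eq p.toPerfPair _).symm

/-- The range of a map is the orthogonal of the kernel of its adjoint. -/
lemma exists_eq_of_adjoint {U V U' V' : Type*} [AddCommGroup U] [Module K U]
    [AddCommGroup V] [Module K V] [AddCommGroup U'] [Module K U'] [AddCommGroup V'] [Module K V']
    [FiniteDimensional K U] [FiniteDimensional K U']
    (p : V →ₗ[K] U →ₗ[K] K) (p' : V' →ₗ[K] U' →ₗ[K] K) [p.IsPerfPair] [p'.IsPerfPair]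
    (d : U →ₗ[K] U') (d' : V' →ₗ[K] V) (h : ∀ u v', p (d' v') u = p' v' (d u))
    (v : V) (hv : ∀ u, d u = 0 → p v u = 0) : ∃ v', d' v' = v := by
  have h1 : p v ∈ LinearMap.range d.dualMap := by
    rw [LinearMap.range_dualMap_eq_dualAnnihilator_ker, Submodule.mem_dualAnnihilator]
    exact fun u hu => hv u hu
  obtain ⟨ℓ, hℓ⟩ := h1
  refine ⟨p'.toPerfPair.symm ℓ, p.toPerfPair.injective ?_⟩
  ext u
  rw [LinearMap.toPerfPair_apply, LinearMap.toPerfPair_apply, h,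
    LinearMap.apply_symm_toPerfPair_self, ← hℓ]
  rfl

lemma linearMap_sum_comp {ι M N L : Type*} [AddCommGroup M] [Module K M] [AddCommGroup N]
    [Module K N] [AddCommGroup L] [Module K L] (s : Finset ι) (f : ι → N →ₗ[K] L)
    (g : M →ₗ[K] N) : (∑ i ∈ s, f i) ∘ₗ g = ∑ i ∈ s, f i ∘ₗ g := by
  ext m
  simp [LinearMap.sum_apply]

lemma linearMap_comp_sum {ι M N L : Type*} [AddCommGroup M] [Module K M] [AddCommGroup N]
    [Module K N] [AddCommGroup L] [Module K L] (s : Finset ι) (f : ι → M →ₗ[K] N)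
    (g : N →ₗ[K] L) : g ∘ₗ (∑ i ∈ s, f i) = ∑ i ∈ s, g ∘ₗ f i := by
  ext m
  simp [LinearMap.sum_apply]

/-- A rank one map `k = φ(·) m` suffices: the trace of `f ∘ k` is `φ (f m)`. -/
lemma exists_trace_comp_ne_zero {M N : Type*} [AddCommGroup M] [Module K M] [AddCommGroup N]
    [Module K N] [FiniteDimensional K N] {f : M →ₗ[K] N} (hf : f ≠ 0) :
    ∃ k : N →ₗ[K] M, LinearMap.trace K N (f ∘ₗ k) ≠ 0 := by
  obtain ⟨m, hm⟩ : ∃ m, f m ≠ 0 := by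
    by_contra! h
    exact hf (LinearMap.ext h)
  obtain ⟨φ, hφ⟩ := Module.Projective.exists_dual_ne_zero K hm
  refine ⟨φ.smulRight m, ?_⟩
  have : f ∘ₗ φ.smulRight m = φ.smulRight (f m) := by ext; simp
  rw [this, LinearMap.trace_smulRight]
  exact hφ

end LinearAlgebra

/-! ### The self-dual complex of graded maps between two representations. -/

section Complex

variable {K : Type u} [Field K] {I H : Type} [Fintype I] [Fintype H] {Q : OrientedGraph I H}
variable {M N L : Type u} [AddCommGroup M] [Module K M] [AddCommGroup N] [Module K N]
  [AddCommGroup L] [Module K L]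

namespace OrientedGraph

lemma t_bar (Q : OrientedGraph I H) (a : H) : Q.t (Q.bar a) = Q.s a := by
  rw [← Q.s_bar, Q.bar_bar]

lemma ε_bar (Q : OrientedGraph I H) (a : H) : Q.ε K (Q.bar a) = - Q.ε K a := by
  classical
  have := Q.bar_mem a
  by_cases h : a ∈ Q.Ω <;> simp_all [OrientedGraph.ε]

lemma ε_mul_self (Q : OrientedGraph I H) (a : H) : Q.ε K a * Q.ε K a = 1 := by
  unfold OrientedGraph.ε
  split_ifs <;> simp

/-- Reversal of edges, as a permutation. -/
def barEquiv (Q : OrientedGraph I H) : H ≃ H := ⟨Q.bar, Q.bar, Q.bar_bar, Q.bar_bar⟩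

lemma sum_bar (Q : OrientedGraph I H) {A : Type*} [AddCommMonoid A] (f : H → A) :
    ∑ a, f (Q.bar a) = ∑ a, f a := Q.barEquiv.sum_comp f

lemma sum_out (Q : OrientedGraph I H) {A : Type*} [AddCommMonoid A] (f : H → A) :
    ∑ i, ∑ a ∈ Q.out i, f a = ∑ a, f a := by
  classical
  unfold OrientedGraph.out
  exact Finset.sum_fiberwise _ _ _

lemma mem_out (Q : OrientedGraph I H) {a : H} {i : I} : a ∈ Q.out i ↔ Q.s a = i := by
  classical
  simp [OrientedGraph.out]

end OrientedGraph

namespace Rep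

variable (ρ : Rep K Q M) (σ : Rep K Q N)

lemma E_idem_apply (i : I) (m : M) : ρ.E i (ρ.E i m) = ρ.E i m :=
  congrArg (fun f => f m) (ρ.E_idem i)

lemma E_ortho_apply {i j : I} (h : i ≠ j) (m : M) : ρ.E i (ρ.E j m) = 0 :=
  congrArg (fun f => f m) (ρ.E_ortho i j h)

lemma E_sum_apply (m : M) : ∑ i, ρ.E i m = m := by
  have := congrArg (fun f => f m) ρ.E_sum
  simpa [LinearMap.sum_apply] using this

lemma E_A_apply (a : H) (m : M) : ρ.E (Q.t a) (ρ.A a m) = ρ.A a m :=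
  congrArg (fun f => f m) (ρ.E_A a)

lemma A_E_apply (a : H) (m : M) : ρ.A a (ρ.E (Q.s a) m) = ρ.A a m :=
  congrArg (fun f => f m) (ρ.A_E a)

/-- The maps `M → N` that vanish outside of `M_i` and have values in `N_j`. -/
def homG (i j : I) : Submodule K (M →ₗ[K] N) where
  carrier := {f | σ.E j ∘ₗ f = f ∧ f ∘ₗ ρ.E i = f}
  add_mem' {f g} hf hg :=
    ⟨by rw [LinearMap.comp_add, hf.1, hg.1], by rw [LinearMap.add_comp, hf.2, hg.2]⟩
  zero_mem' := ⟨LinearMap.comp_zero _, LinearMap.zero_comp _⟩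
  smul_mem' c f hf :=
    ⟨by rw [LinearMap.comp_smul, hf.1], by rw [LinearMap.smul_comp, hf.2]⟩

/-- The graded maps. -/
def C0 : Submodule K (M →ₗ[K] N) where
  carrier := {f | ∀ i, σ.E i ∘ₗ f = f ∘ₗ ρ.E i}
  add_mem' {f g} hf hg i := by rw [LinearMap.comp_add, hf i, hg i, LinearMap.add_comp]
  zero_mem' i := by simp
  smul_mem' c f hf i := by rw [LinearMap.comp_smul, hf i, LinearMap.smul_comp]

/-- The families of graded maps indexed by the arrows. -/
def C1 : Submodule K (H → M →ₗ[K] N) :=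
  Submodule.pi Set.univ fun a => ρ.homG σ (Q.s a) (Q.t a)

variable {ρ σ} in
lemma mem_C1 {g : H → M →ₗ[K] N} : g ∈ ρ.C1 σ ↔ ∀ a, g a ∈ ρ.homG σ (Q.s a) (Q.t a) := by
  simp [C1, Submodule.mem_pi]

lemma homG.E_apply {ρ : Rep K Q M} {σ : Rep K Q N} {i j : I} {f : M →ₗ[K] N}
    (hf : f ∈ ρ.homG σ i j) (m : M) : σ.E j (f m) = f m := congrArg (fun f => f m) hf.1

lemma homG.apply_E {ρ : Rep K Q M} {σ : Rep K Q N} {i j : I} {f : M →ₗ[K] N}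
    (hf : f ∈ ρ.homG σ i j) (m : M) : f (ρ.E i m) = f m := congrArg (fun f => f m) hf.2

lemma homG.E_apply_ne {ρ : Rep K Q M} {σ : Rep K Q N} {i j k : I} {f : M →ₗ[K] N}
    (hf : f ∈ ρ.homG σ i j) (h : k ≠ j) (m : M) : σ.E k (f m) = 0 := by
  rw [← homG.E_apply hf, σ.E_ortho_apply h]

lemma homG.apply_E_ne {ρ : Rep K Q M} {σ : Rep K Q N} {i j k : I} {f : M →ₗ[K] N}
    (hf : f ∈ ρ.homG σ i j) (h : i ≠ k) (m : M) : f (ρ.E k m) = 0 := by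
  rw [← homG.apply_E hf, ρ.E_ortho_apply h, map_zero]

lemma homG_comp {ρ : Rep K Q M} {σ : Rep K Q N} {τ : Rep K Q L} {i j k : I} {f : M →ₗ[K] N}
    {g : N →ₗ[K] L} (hg : g ∈ σ.homG τ j k) (hf : f ∈ ρ.homG σ i j) :
    g ∘ₗ f ∈ ρ.homG τ i k :=
  ⟨by rw [← LinearMap.comp_assoc, hg.1], by rw [LinearMap.comp_assoc, hf.2]⟩

lemma A_mem (a : H) : ρ.A a ∈ ρ.homG ρ (Q.s a) (Q.t a) := ⟨ρ.E_A a, ρ.A_E a⟩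

lemma C0.comm {ρ : Rep K Q M} {σ : Rep K Q N} {f : M →ₗ[K] N} (hf : f ∈ ρ.C0 σ) (i : I) (m : M) :
    σ.E i (f m) = f (ρ.E i m) := congrArg (fun f => f m) (hf i)

lemma C0_comp_homG {ρ : Rep K Q M} {σ : Rep K Q N} {τ : Rep K Q L} {i j : I} {f : M →ₗ[K] N}
    {g : N →ₗ[K] L} (hg : g ∈ σ.C0 τ) (hf : f ∈ ρ.homG σ i j) :
    g ∘ₗ f ∈ ρ.homG τ i j :=
  ⟨by rw [← LinearMap.comp_assoc, hg, LinearMap.comp_assoc, hf.1],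
    by rw [LinearMap.comp_assoc, hf.2]⟩

lemma homG_comp_C0 {ρ : Rep K Q M} {σ : Rep K Q N} {τ : Rep K Q L} {i j : I} {f : M →ₗ[K] N}
    {g : N →ₗ[K] L} (hg : g ∈ σ.homG τ i j) (hf : f ∈ ρ.C0 σ) :
    g ∘ₗ f ∈ ρ.homG τ i j :=
  ⟨by rw [← LinearMap.comp_assoc, hg.1],
    by rw [LinearMap.comp_assoc, ← hf, ← LinearMap.comp_assoc, hg.2]⟩

lemma homG_self_le_C0 (i : I) : ρ.homG σ i i ≤ ρ.C0 σ := by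
  intro f hf j
  ext m
  simp only [LinearMap.comp_apply]
  by_cases h : j = i
  · subst h
    rw [homG.E_apply hf, homG.apply_E hf]
  · rw [homG.E_apply_ne hf h, homG.apply_E_ne hf (Ne.symm h)]

/-- The differential `d⁰` of the complex attached to two representations. -/
def dZero : (M →ₗ[K] N) →ₗ[K] (H → M →ₗ[K] N) :=
  LinearMap.pi fun a => LinearMap.llcomp K M N N (σ.A a) - LinearMap.lcomp K N (ρ.A a)

lemma dZero_apply (f : M →ₗ[K] N) (a : H) : ρ.dZero σ f a = σ.A a ∘ₗ f - f ∘ₗ ρ.A a := rfl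

/-- The differential `d¹`, with its components at the vertices added up. -/
def dTot : (H → M →ₗ[K] N) →ₗ[K] (M →ₗ[K] N) :=
  ∑ a, Q.ε K a • (LinearMap.llcomp K M N N (σ.A (Q.bar a)) ∘ₗ LinearMap.proj a +
    LinearMap.lcomp K N (ρ.A a) ∘ₗ LinearMap.proj (Q.bar a))

lemma dTot_apply (g : H → M →ₗ[K] N) : ρ.dTot σ g =
    ∑ a, Q.ε K a • (σ.A (Q.bar a) ∘ₗ g a + g (Q.bar a) ∘ₗ ρ.A a) := by
  ext m
  simp [dTot, LinearMap.sum_apply]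

/-- The component of `d¹` at a vertex. -/
def dVtx (g : H → M →ₗ[K] N) (i : I) : M →ₗ[K] N :=
  ∑ a ∈ Q.out i, Q.ε K a • (σ.A (Q.bar a) ∘ₗ g a + g (Q.bar a) ∘ₗ ρ.A a)

lemma sum_dVtx (g : H → M →ₗ[K] N) : ∑ i, ρ.dVtx σ g i = ρ.dTot σ g := by
  rw [dTot_apply]
  exact Q.sum_out _

/-- A family of maps graded by closed walks at `i`, added up over `i`, is graded, and vanishes only
if its components do. -/
lemma sum_mem_C0 {f : I → M →ₗ[K] N} (hf : ∀ i, f i ∈ ρ.homG σ i i) : ∑ i, f i ∈ ρ.C0 σ :=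
  sum_mem fun i _ => ρ.homG_self_le_C0 σ i (hf i)

/-- The component at `i` can be read off from the sum over all vertices. This is why `dTot`, a
single map, carries the same information as the family `dVtx`. -/
lemma sum_comp_E {f : I → M →ₗ[K] N} (hf : ∀ i, f i ∈ ρ.homG σ i i) (i : I) :
    (∑ j, f j) ∘ₗ ρ.E i = f i := by
  classical
  ext m
  rw [LinearMap.comp_apply, LinearMap.sum_apply, Finset.sum_eq_single i]
  · rw [homG.apply_E (hf i)]
  · intro j _ hj
    rw [homG.apply_E_ne (hf j) hj]
  · simp

lemma walk_mem {g : H → M →ₗ[K] N} {g' : H → N →ₗ[K] L} {τ : Rep K Q L} (hg : g ∈ ρ.C1 σ)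
    (hg' : g' ∈ σ.C1 τ) (a : H) : g' (Q.bar a) ∘ₗ g a ∈ ρ.homG τ (Q.s a) (Q.s a) := by
  rw [mem_C1] at hg hg'
  have := hg' (Q.bar a)
  rw [Q.s_bar, Q.t_bar] at this
  exact homG_comp this (hg a)

lemma A_mem_C1 : ρ.A ∈ ρ.C1 ρ := mem_C1.2 ρ.A_mem

lemma dVtx_mem {g : H → M →ₗ[K] N} (hg : g ∈ ρ.C1 σ) (i : I) : ρ.dVtx σ g i ∈ ρ.homG σ i i := by
  refine sum_mem fun a ha => Submodule.smul_mem _ _ ?_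
  rw [Q.mem_out] at ha
  subst ha
  exact add_mem (walk_mem _ _ hg σ.A_mem_C1 a) (walk_mem _ _ ρ.A_mem_C1 hg a)

lemma dTot_mem {g : H → M →ₗ[K] N} (hg : g ∈ ρ.C1 σ) : ρ.dTot σ g ∈ ρ.C0 σ := by
  rw [← sum_dVtx]
  exact ρ.sum_mem_C0 σ (ρ.dVtx_mem σ hg)

lemma dTot_eq_zero_iff {g : H → M →ₗ[K] N} (hg : g ∈ ρ.C1 σ) :
    ρ.dTot σ g = 0 ↔ ∀ i, ρ.dVtx σ g i = 0 := by
  rw [← sum_dVtx]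
  constructor
  · intro h i
    rw [← ρ.sum_comp_E σ (ρ.dVtx_mem σ hg) i, h, LinearMap.zero_comp]
  · intro h
    simp [h]

lemma dZero_mem {f : M →ₗ[K] N} (hf : f ∈ ρ.C0 σ) : ρ.dZero σ f ∈ ρ.C1 σ := by
  rw [mem_C1]
  intro a
  exact sub_mem (homG_comp_C0 (σ.A_mem a) hf) (C0_comp_homG hf (ρ.A_mem a))

lemma intertwines_iff {f : M →ₗ[K] N} :
    ρ.Intertwines σ f ↔ f ∈ ρ.C0 σ ∧ ρ.dZero σ f = 0 := by
  constructor
  · intro h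
    refine ⟨fun i => ?_, ?_⟩
    · ext m
      exact (h.1 i m).symm
    · ext a m
      simp [dZero_apply, h.2 a m]
  · rintro ⟨h1, h2⟩
    refine ⟨fun i m => (C0.comm h1 i m).symm, fun a m => ?_⟩
    have := congrArg (fun g => g a m) h2
    exact (sub_eq_zero.1 this).symm

/-- The relation of the preprojective algebra, summed over the vertices. -/
lemma rel_tot : ∑ a, Q.ε K a • (ρ.A (Q.bar a) ∘ₗ ρ.A a) = 0 := by
  rw [← Q.sum_out]
  exact Finset.sum_eq_zero fun i _ => ρ.rel i

/-- For each arrow the two mixed terms `σ_ā f ρ_a` cancel, and what remains are the preprojective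
relations of `σ` and `ρ`. -/
lemma dTot_dZero (f : M →ₗ[K] N) : ρ.dTot σ (ρ.dZero σ f) = 0 := by
  have h : ∀ a, σ.A (Q.bar a) ∘ₗ ρ.dZero σ f a + ρ.dZero σ f (Q.bar a) ∘ₗ ρ.A a =
      (σ.A (Q.bar a) ∘ₗ σ.A a) ∘ₗ f - f ∘ₗ (ρ.A (Q.bar a) ∘ₗ ρ.A a) := by
    intro a
    ext m
    simp [dZero_apply]
  simp only [dTot_apply, h, smul_sub, Finset.sum_sub_distrib]
  have h1 := congrArg (fun k => k ∘ₗ f) σ.rel_tot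
  have h2 := congrArg (fun k => f ∘ₗ k) ρ.rel_tot
  simp only [linearMap_sum_comp, linearMap_comp_sum, LinearMap.smul_comp, LinearMap.comp_smul,
    LinearMap.zero_comp, LinearMap.comp_zero] at h1 h2
  rw [h1, h2, sub_zero]

/-- The form `τ₁`. -/
def tau (K : Type u) [Field K] (Q : OrientedGraph I H) (M N : Type u) [AddCommGroup M] [Module K M]
    [AddCommGroup N] [Module K N] : (H → M →ₗ[K] N) →ₗ[K] (H → N →ₗ[K] M) →ₗ[K] K :=
  ∑ a, Q.ε K a • ((LinearMap.llcomp K N M N).compr₂ (LinearMap.trace K N)).compl₁₂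
    (LinearMap.proj (Q.bar a)) (LinearMap.proj a)

lemma tau_apply (g : H → M →ₗ[K] N) (h : H → N →ₗ[K] M) :
    tau K Q M N g h = ∑ a, Q.ε K a * LinearMap.trace K N (g (Q.bar a) ∘ₗ h a) := by
  simp only [tau, LinearMap.sum_apply, LinearMap.smul_apply, smul_eq_mul]
  rfl

variable [FiniteDimensional K M] [FiniteDimensional K N]

/-- Reversing the arrows changes the sign `ε`, and the trace is cyclic. -/
lemma tau_swap (g : H → M →ₗ[K] N) (h : H → N →ₗ[K] M) :
    tau K Q N M h g = - tau K Q M N g h := by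
  rw [tau_apply, tau_apply, ← Q.sum_bar, ← Finset.sum_neg_distrib]
  refine Finset.sum_congr rfl fun a _ => ?_
  rw [Q.bar_bar, Q.ε_bar, LinearMap.trace_comp_comm', neg_mul]

/-- The self-duality of the complex: `d⁰` and `d¹` are adjoint up to sign. The duality of `Ext¹`,
the description of the obstructions to solving `d¹ g = c` and the Euler form formula all come from
this identity. -/
lemma tau_dZero (f : M →ₗ[K] N) (h : H → N →ₗ[K] M) :
    tau K Q M N (ρ.dZero σ f) h = - LinearMap.trace K N (f ∘ₗ σ.dTot ρ h) := by
  have h1 : LinearMap.trace K N (f ∘ₗ σ.dTot ρ h) =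
      ∑ a, Q.ε K a * LinearMap.trace K N (f ∘ₗ ρ.A (Q.bar a) ∘ₗ h a) +
      ∑ a, Q.ε K a * LinearMap.trace K N (f ∘ₗ h (Q.bar a) ∘ₗ σ.A a) := by
    simp only [dTot_apply, linearMap_comp_sum, LinearMap.comp_smul, LinearMap.comp_add, map_sum,
      map_smul, map_add, smul_eq_mul, mul_add, Finset.sum_add_distrib]
  have h2 : ∑ a, Q.ε K a * LinearMap.trace K N (f ∘ₗ h (Q.bar a) ∘ₗ σ.A a) =
      - ∑ a, Q.ε K a * LinearMap.trace K N (σ.A (Q.bar a) ∘ₗ f ∘ₗ h a) := by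
    rw [← Q.sum_bar, ← Finset.sum_neg_distrib]
    refine Finset.sum_congr rfl fun a _ => ?_
    rw [Q.bar_bar, Q.ε_bar, ← LinearMap.comp_assoc, LinearMap.trace_comp_comm', neg_mul]
  rw [h1, h2, tau_apply]
  simp only [dZero_apply, LinearMap.sub_comp, map_sub, mul_sub, Finset.sum_sub_distrib,
    LinearMap.comp_assoc]
  ring

/-- The projection onto the graded maps. -/
def gr (f : M →ₗ[K] N) : M →ₗ[K] N := ∑ i, σ.E i ∘ₗ f ∘ₗ ρ.E i

omit [FiniteDimensional K M] [FiniteDimensional K N] in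
lemma gr_mem (f : M →ₗ[K] N) : ρ.gr σ f ∈ ρ.C0 σ := by
  refine ρ.sum_mem_C0 σ fun i => ⟨?_, ?_⟩
  · rw [← LinearMap.comp_assoc, σ.E_idem]
  · rw [LinearMap.comp_assoc, LinearMap.comp_assoc, ρ.E_idem]

/-- The projection onto the graded families indexed by the arrows. -/
def gr1 (g : H → M →ₗ[K] N) : H → M →ₗ[K] N := fun a => σ.E (Q.t a) ∘ₗ g a ∘ₗ ρ.E (Q.s a)

omit [FiniteDimensional K M] [FiniteDimensional K N] in
lemma gr1_mem (g : H → M →ₗ[K] N) : ρ.gr1 σ g ∈ ρ.C1 σ := by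
  rw [mem_C1]
  refine fun a => ⟨?_, ?_⟩
  · rw [gr1, ← LinearMap.comp_assoc, σ.E_idem]
  · rw [gr1, LinearMap.comp_assoc, LinearMap.comp_assoc, ρ.E_idem]

/-- Against a graded map the trace only sees the graded part of the other factor. A test map found
by `exists_trace_comp_ne_zero` can thus be made graded, so the pairing stays nondegenerate on graded
maps. -/
lemma trace_comp_gr {f : M →ₗ[K] N} (hf : f ∈ ρ.C0 σ) (k : N →ₗ[K] M) :
    LinearMap.trace K N (f ∘ₗ σ.gr ρ k) = LinearMap.trace K N (f ∘ₗ k) := by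
  have h : ∀ i, LinearMap.trace K N (f ∘ₗ ρ.E i ∘ₗ k ∘ₗ σ.E i) =
      LinearMap.trace K N (f ∘ₗ ρ.E i ∘ₗ k) := by
    intro i
    rw [← LinearMap.comp_assoc, ← hf i, ← LinearMap.comp_assoc, LinearMap.trace_comp_comm',
      ← LinearMap.comp_assoc, ← LinearMap.comp_assoc, σ.E_idem, hf i, LinearMap.comp_assoc]
  simp only [gr, linearMap_comp_sum, map_sum, h]
  rw [← map_sum, ← linearMap_comp_sum, ← linearMap_sum_comp, ρ.E_sum, LinearMap.id_comp]

lemma tau_gr1 {g : H → M →ₗ[K] N} (hg : g ∈ ρ.C1 σ) (h : H → N →ₗ[K] M) :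
    tau K Q M N g (σ.gr1 ρ h) = tau K Q M N g h := by
  rw [tau_apply, tau_apply]
  refine Finset.sum_congr rfl fun a _ => ?_
  have h1 := mem_C1.1 hg (Q.bar a)
  rw [Q.s_bar, Q.t_bar] at h1
  rw [gr1, ← LinearMap.comp_assoc, h1.2, ← LinearMap.comp_assoc, LinearMap.trace_comp_comm',
    ← LinearMap.comp_assoc, h1.1]

/-- The trace pairing on graded maps. -/
def pair0 : ρ.C0 σ →ₗ[K] σ.C0 ρ →ₗ[K] K :=
  ((LinearMap.llcomp K N M N).compr₂ (LinearMap.trace K N)).compl₁₂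
    (ρ.C0 σ).subtype (σ.C0 ρ).subtype

omit [FiniteDimensional K M] [FiniteDimensional K N] in
lemma pair0_apply (f : ρ.C0 σ) (k : σ.C0 ρ) :
    ρ.pair0 σ f k = LinearMap.trace K N (f.1 ∘ₗ k.1) := rfl

/-- The pairing `τ₁` on graded families. -/
def pair1 : ρ.C1 σ →ₗ[K] σ.C1 ρ →ₗ[K] K :=
  (tau K Q M N).compl₁₂ (ρ.C1 σ).subtype (σ.C1 ρ).subtype

lemma pair0_injective : Function.Injective (ρ.pair0 σ) := by
  rw [← LinearMap.ker_eq_bot, LinearMap.ker_eq_bot']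
  rintro ⟨f, hf⟩ h
  by_contra hne
  obtain ⟨k, hk⟩ := exists_trace_comp_ne_zero (f := f) (by simpa using hne)
  apply hk
  rw [← ρ.trace_comp_gr σ hf]
  exact congrArg (fun ℓ => ℓ ⟨σ.gr ρ k, σ.gr_mem ρ k⟩) h

lemma pair1_injective : Function.Injective (ρ.pair1 σ) := by
  classical
  rw [← LinearMap.ker_eq_bot, LinearMap.ker_eq_bot']
  rintro ⟨g, hg⟩ h
  by_contra hne
  obtain ⟨a, ha⟩ : ∃ a, g a ≠ 0 := by
    by_contra! h0
    exact hne (Subtype.ext (funext h0))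
  obtain ⟨k, hk⟩ := exists_trace_comp_ne_zero ha
  -- A test family supported on the single arrow `bar a` isolates the component `g a`.
  have h1 : tau K Q M N g (Pi.single (Q.bar a) k) = 0 := by
    rw [← ρ.tau_gr1 σ hg]
    exact congrArg (fun ℓ => ℓ ⟨_, σ.gr1_mem ρ (Pi.single (Q.bar a) k)⟩) h
  rw [tau_apply, Finset.sum_eq_single (Q.bar a)] at h1
  · rw [Q.bar_bar, Pi.single_eq_same] at h1
    rcases mul_eq_zero.1 h1 with h2 | h2
    · have := Q.ε_mul_self (K := K) (Q.bar a)
      rw [h2] at this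
      simp at this
    · exact hk h2
  · intro b _ hb
    rw [Pi.single_eq_of_ne hb]
    simp
  · simp

instance : (ρ.pair0 σ).IsPerfPair := by
  refine LinearMap.IsPerfPair.of_injective (ρ.pair0_injective σ) ?_
  have : (ρ.pair0 σ).flip = σ.pair0 ρ := by
    ext f k
    exact LinearMap.trace_comp_comm' _ _
  rw [this]
  exact σ.pair0_injective ρ

instance : (ρ.pair1 σ).IsPerfPair := by
  refine LinearMap.IsPerfPair.of_injective (ρ.pair1_injective σ) ?_
  have : (ρ.pair1 σ).flip = - σ.pair1 ρ := by
    ext f k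
    exact (neg_eq_iff_eq_neg.2 (tau_swap (Q := Q) k.1 f.1)).symm.trans rfl
  rw [this]
  exact neg_injective.comp (σ.pair1_injective ρ)

/-- `d⁰` on graded maps. -/
def dZeroG : ρ.C0 σ →ₗ[K] ρ.C1 σ :=
  ((ρ.dZero σ).comp (ρ.C0 σ).subtype).codRestrict _ fun f => ρ.dZero_mem σ f.2

/-- `d¹` on graded families. -/
def dTotG : ρ.C1 σ →ₗ[K] ρ.C0 σ :=
  ((ρ.dTot σ).comp (ρ.C1 σ).subtype).codRestrict _ fun g => ρ.dTot_mem σ g.2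

lemma pair_adjoint (f : ρ.C0 σ) (h : σ.C1 ρ) :
    σ.pair0 ρ (σ.dTotG ρ h) f = σ.pair1 ρ h (ρ.dZeroG σ f) := by
  have := ρ.tau_dZero σ f.1 h.1
  rw [← neg_eq_iff_eq_neg, ← tau_swap, LinearMap.trace_comp_comm'] at this
  exact this.symm

/-- The image of `d¹` is the orthogonal of the space of intertwining operators. -/
lemma exists_dTot_eq {c : N →ₗ[K] M} (hc : c ∈ σ.C0 ρ)
    (h : ∀ f : M →ₗ[K] N, ρ.Intertwines σ f → LinearMap.trace K M (c ∘ₗ f) = 0) :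
    ∃ g ∈ σ.C1 ρ, σ.dTot ρ g = c := by
  obtain ⟨g, hg⟩ := exists_eq_of_adjoint (σ.pair0 ρ) (σ.pair1 ρ) (ρ.dZeroG σ) (σ.dTotG ρ)
    (ρ.pair_adjoint σ) ⟨c, hc⟩ (fun f hf => h f.1
      ((ρ.intertwines_iff σ).2 ⟨f.2, congrArg Subtype.val hf⟩))
  exact ⟨g.1, g.2, congrArg Subtype.val hg⟩

/-- The cocycles. -/
def Z1 : Submodule K (H → M →ₗ[K] N) := ρ.C1 σ ⊓ LinearMap.ker (ρ.dTot σ)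

/-- The coboundaries. -/
def B1 : Submodule K (H → M →ₗ[K] N) := (ρ.C0 σ).map (ρ.dZero σ)

/-- The space of intertwining operators. -/
def homs : Submodule K (M →ₗ[K] N) := ρ.C0 σ ⊓ LinearMap.ker (ρ.dZero σ)

omit [FiniteDimensional K M] [FiniteDimensional K N] in
lemma B1_le_Z1 : ρ.B1 σ ≤ ρ.Z1 σ := by
  rintro _ ⟨f, hf, rfl⟩
  exact ⟨ρ.dZero_mem σ hf, ρ.dTot_dZero σ f⟩

omit [FiniteDimensional K M] [FiniteDimensional K N] in
variable {ρ σ} in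
lemma mem_homs {f : M →ₗ[K] N} : f ∈ ρ.homs σ ↔ ρ.Intertwines σ f := (ρ.intertwines_iff σ).symm

/-- A functional on cochains that vanishes on coboundaries is given by a cocycle. -/
lemma exists_Z1_eq_tau (ℓ : (H → M →ₗ[K] N) →ₗ[K] K) (hℓ : ∀ g ∈ ρ.B1 σ, ℓ g = 0) :
    ∃ h ∈ σ.Z1 ρ, ∀ g ∈ ρ.C1 σ, ℓ g = tau K Q M N g h := by
  obtain ⟨h, hh⟩ := (LinearMap.IsPerfPair.bijective_right (ρ.pair1 σ)).2 (ℓ ∘ₗ (ρ.C1 σ).subtype)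
  have h1 : ∀ g ∈ ρ.C1 σ, ℓ g = tau K Q M N g h.1 := fun g hg =>
    (congrArg (fun k => k ⟨g, hg⟩) hh).symm
  refine ⟨h.1, ⟨h.2, ?_⟩, h1⟩
  -- By adjointness, vanishing on coboundaries means that `d¹ h` has trace zero against every graded
  -- map, so `h` is a cocycle.
  have h2 : (⟨σ.dTot ρ h.1, σ.dTot_mem ρ h.2⟩ : σ.C0 ρ) = 0 := by
    apply (σ.pair0_injective ρ)
    ext f
    rw [pair0_apply, LinearMap.trace_comp_comm', map_zero, LinearMap.zero_apply]
    have := ρ.tau_dZero σ f.1 h.1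
    rw [← h1 _ (ρ.dZero_mem σ f.2), hℓ _ ⟨f.1, f.2, rfl⟩] at this
    exact (neg_eq_zero.1 this.symm)
  exact congrArg Subtype.val h2

lemma finrank_B1 : Module.finrank K (ρ.B1 σ) + Module.finrank K (ρ.homs σ) =
    Module.finrank K (ρ.C0 σ) := by
  have h := LinearMap.finrank_range_add_finrank_ker (ρ.dZeroG σ)
  rw [← h]
  congr 1
  · refine LinearEquiv.finrank_eq ?_ 
    have : (ρ.B1 σ) = (LinearMap.range (ρ.dZeroG σ)).map (ρ.C1 σ).subtype := by
      rw [← LinearMap.range_comp, dZeroG, LinearMap.subtype_comp_codRestrict, LinearMap.range_comp,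
        Submodule.range_subtype]
      rfl
    rw [this]
    exact (Submodule.equivMapOfInjective _ (ρ.C1 σ).injective_subtype _).symm
  · refine LinearEquiv.finrank_eq ?_
    have : (ρ.homs σ) = (LinearMap.ker (ρ.dZeroG σ)).map (ρ.C0 σ).subtype := by
      rw [dZeroG, LinearMap.ker_codRestrict, LinearMap.ker_comp, Submodule.map_comap_subtype]
      rfl
    rw [this]
    exact (Submodule.equivMapOfInjective _ (ρ.C0 σ).injective_subtype _).symm

/-- The rank of `d¹` on `C¹(M, N)` is the rank of its adjoint, `d⁰` on `C⁰(N, M)`, which is the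
dimension of the coboundaries in the opposite direction. -/
lemma finrank_Z1 : Module.finrank K (ρ.Z1 σ) + Module.finrank K (σ.B1 ρ) =
    Module.finrank K (ρ.C1 σ) := by
  have h := LinearMap.finrank_range_add_finrank_ker (ρ.dTotG σ)
  rw [← h, finrank_range_eq_of_adjoint (ρ.pair0 σ) (ρ.pair1 σ) (σ.dZeroG ρ) (ρ.dTotG σ)
    (σ.pair_adjoint ρ), add_comm]
  congr 1
  · refine LinearEquiv.finrank_eq ?_ 
    have : (σ.B1 ρ) = (LinearMap.range (σ.dZeroG ρ)).map (σ.C1 ρ).subtype := by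
      rw [← LinearMap.range_comp, dZeroG, LinearMap.subtype_comp_codRestrict, LinearMap.range_comp,
        Submodule.range_subtype]
      rfl
    rw [this]
    exact (Submodule.equivMapOfInjective _ (σ.C1 ρ).injective_subtype _).symm
  · refine LinearEquiv.finrank_eq ?_
    have : (ρ.Z1 σ) = (LinearMap.ker (ρ.dTotG σ)).map (ρ.C1 σ).subtype := by
      rw [dTotG, LinearMap.ker_codRestrict, LinearMap.ker_comp, Submodule.map_comap_subtype]
      rfl
    rw [this]
    exact (Submodule.equivMapOfInjective _ (ρ.C1 σ).injective_subtype _).symm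

lemma finrank_C0_comm : Module.finrank K (ρ.C0 σ) = Module.finrank K (σ.C0 ρ) :=
  Module.finrank_of_isPerfPair (ρ.pair0 σ)

lemma finrank_C1_comm : Module.finrank K (ρ.C1 σ) = Module.finrank K (σ.C1 ρ) :=
  Module.finrank_of_isPerfPair (ρ.pair1 σ)

end Rep

end Complex

/-! ### Cocycles, derivations and extensions realized on a product. -/

section Derivations

variable {K : Type u} [Field K] {I H : Type} [Fintype I] [Fintype H] {Q : OrientedGraph I H}

/-- The representation on `N × M` defined by a cocycle. -/
def Rep.extend {M N : Type u} [AddCommGroup M] [Module K M] [AddCommGroup N] [Module K N]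
    (ρ : Rep K Q M) (σ : Rep K Q N) (g : H → M →ₗ[K] N) (hg : g ∈ ρ.Z1 σ) : Rep K Q (N × M) where
  E i := (σ.E i).prodMap (ρ.E i)
  A a := (σ.A a).prodMap (ρ.A a) + LinearMap.inl K N M ∘ₗ g a ∘ₗ LinearMap.snd K N M
  E_idem i := by rw [LinearMap.prodMap_comp, ρ.E_idem, σ.E_idem]
  E_ortho i j h := by rw [LinearMap.prodMap_comp, ρ.E_ortho i j h, σ.E_ortho i j h]; rfl
  E_sum := by
    refine LinearMap.ext fun x => Prod.ext ?_ ?_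
    · simp [LinearMap.sum_apply, Prod.fst_sum, σ.E_sum_apply]
    · simp [LinearMap.sum_apply, Prod.snd_sum, ρ.E_sum_apply]
  E_A a := by
    have := homG.E_apply (Rep.mem_C1.1 hg.1 a)
    refine LinearMap.ext fun x => Prod.ext ?_ ?_
    · simp [σ.E_A_apply, this]
    · simp [ρ.E_A_apply]
  A_E a := by
    have := homG.apply_E (Rep.mem_C1.1 hg.1 a)
    refine LinearMap.ext fun x => Prod.ext ?_ ?_
    · simp [σ.A_E_apply, this]
    · simp [ρ.A_E_apply]
  rel i := by
    have h1 := (ρ.dTot_eq_zero_iff σ hg.1).1 hg.2 i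
    refine LinearMap.ext fun x => Prod.ext ?_ ?_
    · have h2 := congrArg (fun f => f x.1) (σ.rel i)
      have h3 := congrArg (fun f => f x.2) h1
      simp only [LinearMap.sum_apply, LinearMap.smul_apply, LinearMap.comp_apply, dVtx,
        LinearMap.add_apply, LinearMap.zero_apply] at h2 h3
      simp [LinearMap.sum_apply, Prod.fst_sum, smul_add, Finset.sum_add_distrib, h2] at h3 ⊢
      rw [← h3]
    · have h2 := congrArg (fun f => f x.2) (ρ.rel i)
      simpa [LinearMap.sum_apply, Prod.snd_sum] using h2

variable (M N : ModuleCat.{u} (Lam K Q))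

/-- The derivations of the completed algebra with values in `Hom(M, N)` that vanish on the
idempotents. -/
def Der0 : Submodule K (Lam K Q →ₗ[K] M →ₗ[K] N) where
  carrier := {δ | (∀ x y m, δ (x * y) m = x • δ y m + δ x (y • m)) ∧ ∀ i, δ (vtx K Q i) = 0}
  add_mem' {δ δ'} h h' := by
    refine ⟨fun x y m => ?_, fun i => ?_⟩
    · simp only [LinearMap.add_apply, h.1, h'.1, smul_add]
      abel
    · rw [LinearMap.add_apply, h.2, h'.2, add_zero]
  zero_mem' := ⟨fun x y m => by simp, fun i => rfl⟩
  smul_mem' c δ h := by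
    refine ⟨fun x y m => ?_, fun i => ?_⟩
    · simp only [LinearMap.smul_apply, h.1, smul_add]
      rw [smul_comm c x]
    · rw [LinearMap.smul_apply, h.2, smul_zero]

variable {M N}

lemma Der0.map_one {δ : Lam K Q →ₗ[K] M →ₗ[K] N} (hδ : δ ∈ Der0 M N) : δ 1 = 0 := by
  rw [← vtx_sum, map_sum]
  exact Finset.sum_eq_zero fun i _ => hδ.2 i

/-- The cocycle given by the values of a derivation on the arrows. -/
def Der0.ev (M N : ModuleCat.{u} (Lam K Q)) :
    (Lam K Q →ₗ[K] M →ₗ[K] N) →ₗ[K] (H → M →ₗ[K] N) :=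
  LinearMap.pi fun a => LinearMap.applyₗ (arr K Q a)

lemma Der0.ev_apply (δ : Lam K Q →ₗ[K] M →ₗ[K] N) (a : H) : Der0.ev M N δ a = δ (arr K Q a) := rfl

lemma Der0.ev_mem {δ : Lam K Q →ₗ[K] M →ₗ[K] N} (hδ : δ ∈ Der0 M N) :
    Der0.ev M N δ ∈ (repOf M).Z1 (repOf N) := by
  have h1 : Der0.ev M N δ ∈ (repOf M).C1 (repOf N) := by
    rw [Rep.mem_C1]
    refine fun a => ⟨?_, ?_⟩
    · ext m
      have := hδ.1 (vtx K Q (Q.t a)) (arr K Q a) m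
      rw [vtx_arr, hδ.2, LinearMap.zero_apply, add_zero] at this
      exact this.symm
    · ext m
      have := hδ.1 (arr K Q a) (vtx K Q (Q.s a)) m
      rw [arr_vtx, hδ.2, LinearMap.zero_apply, smul_zero, zero_add] at this
      exact this.symm
  refine ⟨h1, ?_⟩
  change (repOf M).dTot (repOf N) (Der0.ev M N δ) = 0
  rw [Rep.dTot_eq_zero_iff _ _ h1]
  intro i
  ext m
  have h2 := congrArg (fun x => δ x m) (arr_rel (K := K) (Q := Q) i)
  simp only [map_sum, map_smul, map_zero, LinearMap.sum_apply, LinearMap.smul_apply,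
    LinearMap.zero_apply, hδ.1] at h2
  simp only [Rep.dVtx, LinearMap.sum_apply, LinearMap.smul_apply, LinearMap.add_apply,
    LinearMap.comp_apply]
  exact h2

/-- No continuity is assumed. The Leibniz rule makes a derivation vanish on a deep power of the
radical, because both modules are nilpotent, and modulo that power the arrows and the idempotents
generate the algebra. -/
lemma Der0.eq_zero_of_ev (hM : Module.Finite K M) (hN : Module.Finite K N)
    {δ : Lam K Q →ₗ[K] M →ₗ[K] N} (hδ : δ ∈ Der0 M N) (h : Der0.ev M N δ = 0) : δ = 0 := by
  have h1 : ∀ z : Pre K Q, δ (toLam K Q z) = 0 := by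
    intro z
    induction z using Pre.induction with
    | halg c => rw [AlgHom.commutes, Algebra.algebraMap_eq_smul_one, map_smul, Der0.map_one hδ,
        smul_zero]
    | hV i => exact hδ.2 i
    | hA a => exact congrArg (fun g => g a) h
    | hadd x y hx hy => rw [map_add, map_add, hx, hy, add_zero]
    | hmul x y hx hy =>
      ext m
      rw [map_mul, hδ.1, hx, hy]
      simp
  obtain ⟨n, hn⟩ := exists_radIdeal_pow_smul_eq_zero M hM
  obtain ⟨k, hk⟩ := exists_radIdeal_pow_smul_eq_zero N hN
  have h2 : ∀ x ∈ radIdeal K Q ^ (k + n), δ x = 0 := by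
    intro x hx
    rw [Ideal.IsTwoSided.pow_add] at hx
    refine Submodule.mul_induction_on hx (fun x hx y hy => ?_) (fun x y hx hy => ?_)
    · ext m
      rw [hδ.1, hk x hx, hn y hy]
      simp
    · rw [map_add, hx, hy, add_zero]
  ext x m
  obtain ⟨z, hz⟩ := exists_sub_toLam_mem x (k + n)
  rw [← radIdeal_pow_eq] at hz
  have := h2 _ hz
  rw [map_sub, h1, sub_zero] at this
  rw [this]
  rfl

/-- Extensions of `M` by `N`, realized on `N × M`, are given by derivations. -/
lemma Der0.exists_of_Z1 (hM : Module.Finite K M) (hN : Module.Finite K N)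
    {g : H → M →ₗ[K] N} (hg : g ∈ (repOf M).Z1 (repOf N)) :
    ∃ δ ∈ Der0 M N, Der0.ev M N δ = g ∧ ∃ (X : ModuleCat.{u} (Lam K Q)) (e : X ≃ₗ[K] N × M),
      ∀ (x : Lam K Q) (p : N × M), e (x • e.symm p) = (x • p.1 + δ x p.2, x • p.2) := by
  set ρ := (repOf M).extend (repOf N) g hg with hρ
  have hinl : (repOf N).Intertwines ρ (LinearMap.inl K N M) := by
    refine ⟨fun i n => ?_, fun a n => ?_⟩ <;> refine Prod.ext ?_ ?_ <;> simp [hρ, Rep.extend]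
  have hsnd : ρ.Intertwines (repOf M) (LinearMap.snd K N M) := by
    refine ⟨fun i n => ?_, fun a n => ?_⟩ <;> simp [hρ, Rep.extend]
  have hnil : ρ.IsNilp := by
    obtain ⟨n, hn⟩ := repOf_isNilp M hM
    obtain ⟨k, hk⟩ := repOf_isNilp N hN
    -- In a product from `J ^ k · J ^ n` the right factor kills the quotient `M`, hence maps into
    -- the submodule `N`, which the left factor kills.
    refine ⟨k + n, fun z hz => ?_⟩
    rw [Ideal.IsTwoSided.pow_add] at hz
    refine Submodule.mul_induction_on hz (fun x hx y hy => ?_) (fun x y hx hy => ?_)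
    · refine LinearMap.ext fun p => ?_
      have h1 : (ρ.lift y p).2 = 0 := by
        have := hsnd.map_lift y p
        rw [hn y hy] at this
        exact this
      have h2 : ρ.lift y p = LinearMap.inl K N M (ρ.lift y p).1 := Prod.ext rfl h1
      rw [map_mul, Module.End.mul_apply, h2, ← hinl.map_lift, hk x hx]
      simp
    · rw [map_add, hx, hy, add_zero]
  obtain ⟨X, e, he1, he2⟩ := hnil.exists_module
  have hX : Module.Finite K X := Module.Finite.equiv e.symm
  have hinl' : (repOf N).Intertwines (repOf X) (e.symm.toLinearMap ∘ₗ LinearMap.inl K N M) := by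
    refine ⟨fun i n => e.injective ?_, fun a n => e.injective ?_⟩
    · rw [repOf_E X, he1]
      simpa using hinl.1 i n
    · rw [repOf_A X, he2]
      simpa using hinl.2 a n
  have hsnd' : (repOf X).Intertwines (repOf M) (LinearMap.snd K N M ∘ₗ e.toLinearMap) := by
    refine ⟨fun i n => ?_, fun a n => ?_⟩
    · rw [repOf_E, LinearMap.comp_apply, LinearEquiv.coe_coe, he1]
      exact hsnd.1 i (e n)
    · rw [repOf_A, LinearMap.comp_apply, LinearEquiv.coe_coe, he2]
      exact hsnd.2 a (e n)
  have hl : ∀ (x : Lam K Q) (n : N), e (x • e.symm (n, 0)) = (x • n, 0) := by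
    intro x n
    have := hinl'.map_smul hN hX x n
    simp only [LinearMap.comp_apply, LinearEquiv.coe_coe, LinearMap.inl_apply] at this
    rw [← this, LinearEquiv.apply_symm_apply]
  have hr : ∀ (x : Lam K Q) (p : N × M), (e (x • e.symm p)).2 = x • p.2 := by
    intro x p
    have := hsnd'.map_smul hX hM x (e.symm p)
    simpa using this
  -- The action on `N × M` is block triangular, and the derivation is its off-diagonal entry.
  let δ : Lam K Q →ₗ[K] M →ₗ[K] N := LinearMap.mk₂ K (fun x m => (e (x • e.symm (0, m))).1)
    (fun x y m => by simp [add_smul]) (fun c x m => by simp)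
    (fun x m m' => by
      have : ((0, m + m') : N × M) = (0, m) + (0, m') := by simp
      rw [this, map_add, smul_add, map_add]
      rfl)
    (fun c x m => by
      have : ((0, c • m) : N × M) = c • (0, m) := by simp
      rw [this, e.symm.map_smul, smul_comm x c, e.map_smul]
      rfl)
  have hδ : ∀ x m, δ x m = (e (x • e.symm (0, m))).1 := fun _ _ => rfl
  have hform : ∀ (x : Lam K Q) (p : N × M), e (x • e.symm p) = (x • p.1 + δ x p.2, x • p.2) := by
    intro x p
    have hp : p = (p.1, 0) + (0, p.2) := by simp
    refine Prod.ext ?_ (hr x p)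
    conv_lhs => rw [hp, map_add, smul_add, map_add, Prod.fst_add, hl]
    rfl
  refine ⟨δ, ⟨fun x y m => ?_, fun i => ?_⟩, ?_, X, e, hform⟩
  · have h1 : y • e.symm (0, m) = e.symm (δ y m, y • m) := by
      rw [LinearEquiv.eq_symm_apply, hform]
      simp
    rw [hδ, mul_smul, h1, hform]
  · ext m
    rw [hδ, he1]
    simp [hρ, Rep.extend]
  · ext a m
    rw [Der0.ev_apply, hδ, he2]
    simp [hρ, Rep.extend]

/-- The extension is built from the cocycle of `δ`; the derivation it produces equals `δ` because a
derivation is determined by its values on the arrows. -/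
lemma Der0.exists_module (hM : Module.Finite K M) (hN : Module.Finite K N)
    {δ : Lam K Q →ₗ[K] M →ₗ[K] N} (hδ : δ ∈ Der0 M N) :
    ∃ (X : ModuleCat.{u} (Lam K Q)) (e : X ≃ₗ[K] N × M),
      ∀ (x : Lam K Q) (p : N × M), e (x • e.symm p) = (x • p.1 + δ x p.2, x • p.2) := by
  obtain ⟨δ', hδ', hev, X, e, he⟩ := Der0.exists_of_Z1 hM hN (Der0.ev_mem hδ)
  have : δ' = δ := by
    rw [← sub_eq_zero]
    exact Der0.eq_zero_of_ev hM hN (sub_mem hδ' hδ) (by rw [map_sub, hev, sub_self])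
  exact ⟨X, e, this ▸ he⟩

lemma Der0.map_ev (hM : Module.Finite K M) (hN : Module.Finite K N) :
    (Der0 M N).map (Der0.ev M N) = (repOf M).Z1 (repOf N) := by
  refine le_antisymm ?_ fun g hg => ?_
  · rintro _ ⟨δ, hδ, rfl⟩
    exact Der0.ev_mem hδ
  · obtain ⟨δ, hδ, h, -⟩ := Der0.exists_of_Z1 hM hN hg
    exact ⟨δ, hδ, h⟩

/-- The inner derivation defined by a linear map. -/
def inner (f : M →ₗ[K] N) : Lam K Q →ₗ[K] M →ₗ[K] N :=
  LinearMap.mk₂ K (fun x m => x • f m - f (x • m))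
    (fun x y m => by simp only [add_smul, map_add]; abel)
    (fun c x m => by simp [smul_sub])
    (fun x m m' => by simp only [smul_add, map_add]; abel)
    (fun c x m => by rw [smul_comm x c m, map_smul, map_smul, smul_comm x c, smul_sub])

lemma inner_apply (f : M →ₗ[K] N) (x : Lam K Q) (m : M) : inner f x m = x • f m - f (x • m) := rfl

lemma inner_mem {f : M →ₗ[K] N} (hf : f ∈ (repOf M).C0 (repOf N)) : inner f ∈ Der0 M N := by
  refine ⟨fun x y m => ?_, fun i => ?_⟩
  · simp only [inner_apply, mul_smul, smul_sub]
    abel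
  · ext m
    exact sub_eq_zero.2 (Rep.C0.comm hf i m)

lemma ev_inner (f : M →ₗ[K] N) : Der0.ev M N (inner f) = (repOf M).dZero (repOf N) f := by
  ext a m
  rfl

end Derivations

/-! ### Comparison of `Abelian.Ext` with derivations modulo inner derivations. -/

section ExtGroups

variable {K : Type u} [Field K] {I H : Type} [Fintype I] [Fintype H] {Q : OrientedGraph I H}
variable {S R : ModuleCat.{u} (Lam K Q)}

/-- The projective cover `Λ ⊗ S → S`. -/
def freeCover (S : ModuleCat.{u} (Lam K Q)) : Lam K Q ⊗[K] S →ₗ[Lam K Q] S :=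
  TensorProduct.AlgebraTensorModule.lift
    { toFun := fun x => lact S x
      map_add' := fun x y => by ext m; simp [lact, add_smul]
      map_smul' := fun x y => by ext m; simp [lact, mul_smul] }

lemma freeCover_tmul (x : Lam K Q) (s : S) : freeCover S (x ⊗ₜ s) = x • s := rfl

lemma freeCover_surjective : Function.Surjective (freeCover S) := fun s =>
  ⟨1 ⊗ₜ s, by rw [freeCover_tmul, one_smul]⟩

/-- The linear map on `Λ ⊗ S` defined by a derivation. -/
def Der0.total (δ : Lam K Q →ₗ[K] S →ₗ[K] R) : Lam K Q ⊗[K] S →ₗ[K] R := TensorProduct.lift δ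

/-- The defect of linearity of `Der0.total δ` factors through `freeCover`, so it disappears on the
kernel of the cover. -/
lemma Der0.total_smul {δ : Lam K Q →ₗ[K] S →ₗ[K] R} (hδ : δ ∈ Der0 S R) (x : Lam K Q)
    (t : Lam K Q ⊗[K] S) : Der0.total δ (x • t) = x • Der0.total δ t + δ x (freeCover S t) := by
  induction t with
  | zero => simp
  | tmul y s => exact hδ.1 x y s
  | add t t' h h' =>
    rw [smul_add, map_add, h, h', map_add, map_add, map_add, smul_add]
    abel

/-- The homomorphism defined by a derivation on the kernel of the projective cover. -/
def Der0.onKer {δ : Lam K Q →ₗ[K] S →ₗ[K] R} (hδ : δ ∈ Der0 S R) :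
    LinearMap.ker (freeCover S) →ₗ[Lam K Q] R where
  toFun t := Der0.total δ t.1
  map_add' t t' := map_add _ _ _
  map_smul' x t := by
    have ht : freeCover S t.1 = 0 := t.2
    rw [Submodule.coe_smul, Der0.total_smul hδ, ht, map_zero, add_zero]
    rfl

/-- The short exact sequence given by the projective cover. -/
abbrev coverSeq (S : ModuleCat.{u} (Lam K Q)) : ShortComplex (ModuleCat.{u} (Lam K Q)) :=
  (freeCover S).shortComplexKer

lemma coverSeq_shortExact (S : ModuleCat.{u} (Lam K Q)) : (coverSeq S).ShortExact :=
  LinearMap.shortExact_shortComplexKer freeCover_surjective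

instance : Projective (coverSeq S).X₂ :=
  (IsProjective.iff_projective (R := Lam K Q) (Lam K Q ⊗[K] S)).1 inferInstance

/-- The class in `Ext¹(S, R)` of a derivation. -/
def Der0.toExt (S R : ModuleCat.{u} (Lam K Q)) : Der0 S R →ₗ[K] Abelian.Ext S R 1 where
  toFun δ := (coverSeq_shortExact S).extClass.comp
    (Abelian.Ext.mk₀ (ModuleCat.ofHom (Der0.onKer δ.2))) (add_zero 1)
  map_add' δ δ' := by
    rw [← Abelian.Ext.comp_add, ← Abelian.Ext.mk₀_add]
    congr 2
    ext t
    exact congrArg (fun f => f t.1)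
      ((TensorProduct.lift.equiv (.id K) (Lam K Q) S R).map_add δ.1 δ'.1)
  map_smul' c δ := by
    rw [RingHom.id_apply, ← Abelian.Ext.comp_smul, ← Abelian.Ext.mk₀_smul]
    congr 2
    ext t
    exact congrArg (fun f => f t.1)
      ((TensorProduct.lift.equiv (.id K) (Lam K Q) S R).map_smul c δ.1)

/-- The `K`-linear projection of `Λ ⊗ S` onto the kernel of the projective cover. -/
def toKer (S : ModuleCat.{u} (Lam K Q)) : Lam K Q ⊗[K] S →ₗ[K] LinearMap.ker (freeCover S) where
  toFun t := ⟨t - 1 ⊗ₜ freeCover S t, by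
    rw [LinearMap.mem_ker, map_sub, freeCover_tmul, one_smul, sub_self]⟩
  map_add' t t' := by
    ext
    simp only [map_add, tmul_add, Submodule.coe_add]
    abel
  map_smul' c t := by
    ext
    have : freeCover S (c • t) = c • freeCover S t := (freeCover S).map_smul_of_tower c t
    simp [this, smul_sub]

lemma toKer_coe (t : LinearMap.ker (freeCover S)) : toKer S t.1 = t := by
  ext
  have ht : freeCover S t.1 = 0 := t.2
  change t.1 - 1 ⊗ₜ freeCover S t.1 = t.1
  rw [ht, tmul_zero, sub_zero]

/-- The homomorphism `Λ ⊗ S → R` that extends a linear map `S → R`. -/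
def freeLift (f : S →ₗ[K] R) : Lam K Q ⊗[K] S →ₗ[Lam K Q] R :=
  TensorProduct.AlgebraTensorModule.lift
    { toFun := fun x => lact R x ∘ₗ f
      map_add' := fun x y => by ext m; simp [lact, add_smul]
      map_smul' := fun x y => by ext m; simp [lact, mul_smul] }

lemma total_inner (f : S →ₗ[K] R) (t : Lam K Q ⊗[K] S) :
    Der0.total (inner f) t = freeLift f t - f (freeCover S t) := by
  induction t with
  | zero => simp
  | tmul y s => rfl
  | add t t' h h' =>
    rw [map_add, h, h', map_add, map_add, map_add]
    abel

/-- The middle term of `coverSeq` is projective, so a class comes from a homomorphism `φ` on the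
kernel of the cover. Composing `φ` with the projection `toKer` gives a derivation, which is then
corrected by an inner derivation so that it vanishes on the idempotents; this does not change the
class. -/
lemma Der0.toExt_surjective (S R : ModuleCat.{u} (Lam K Q)) :
    Function.Surjective (Der0.toExt S R) := by
  classical
  intro c
  obtain ⟨c, rfl⟩ := Abelian.Ext.contravariant_sequence_exact₃ (coverSeq_shortExact S) R c
    (Abelian.Ext.eq_zero_of_projective (P := (coverSeq S).X₂) _) (add_zero 1)
  obtain ⟨φ, rfl⟩ := (Abelian.Ext.mk₀_bijective _ _).2 c
  let φ' : LinearMap.ker (freeCover S) →ₗ[Lam K Q] R := φ.hom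
  let δ₀ : Lam K Q →ₗ[K] S →ₗ[K] R :=
    TensorProduct.curry ((φ'.restrictScalars K) ∘ₗ toKer S)
  have hδ₀ : ∀ x s, δ₀ x s = φ' (toKer S (x ⊗ₜ s)) := fun _ _ => rfl
  have htot : ∀ t, Der0.total δ₀ t = φ' (toKer S t) := by
    intro t
    induction t with
    | zero => simp
    | tmul y s => rfl
    | add t t' h h' => rw [map_add, h, h', map_add, map_add]
  have hder : ∀ x y s, δ₀ (x * y) s = x • δ₀ y s + δ₀ x (y • s) := by
    intro x y s
    rw [hδ₀, hδ₀, hδ₀, ← map_smul, ← map_add]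
    congr 1
    ext
    simp [toKer, freeCover_tmul, mul_smul, smul_sub, TensorProduct.smul_tmul']
  -- Averaging over the idempotents: the inner derivation of `u` cancels the values of `δ₀` on all
  -- the `e_i`, as `heu` and `hue` show.
  let u : S →ₗ[K] R := ∑ j, δ₀ (vtx K Q j) ∘ₗ lact S (vtx K Q j)
  have hu : ∀ s, u s = ∑ j, δ₀ (vtx K Q j) (vtx K Q j • s) := by
    intro s
    simp [u, LinearMap.sum_apply, lact]
  have hue : ∀ i s, u (vtx K Q i • s) = δ₀ (vtx K Q i) (vtx K Q i • s) := by
    intro i s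
    rw [hu, Finset.sum_eq_single i]
    · rw [smul_smul, vtx_mul, if_pos rfl]
    · intro j _ hj
      rw [smul_smul, vtx_mul, if_neg hj, zero_smul, map_zero]
    · simp
  have heu : ∀ i s, vtx K Q i • u s = δ₀ (vtx K Q i) (vtx K Q i • s) - δ₀ (vtx K Q i) s := by
    intro i s
    have h1 : ∀ j, vtx K Q i • δ₀ (vtx K Q j) (vtx K Q j • s) =
        (if i = j then δ₀ (vtx K Q i) (vtx K Q j • s) else 0) - δ₀ (vtx K Q i) (vtx K Q j • s) := by
      intro j
      have := hder (vtx K Q i) (vtx K Q j) (vtx K Q j • s)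
      rw [smul_smul, vtx_mul, vtx_mul, if_pos rfl] at this
      rw [eq_sub_iff_add_eq, ← this]
      split_ifs with h
      · rw [h]
      · simp
    rw [hu, Finset.smul_sum, Finset.sum_congr rfl fun j _ => h1 j, Finset.sum_sub_distrib,
      Finset.sum_ite_eq, if_pos (Finset.mem_univ _), ← map_sum, ← Finset.sum_smul, vtx_sum,
      one_smul]
  have hmem : δ₀ + inner u ∈ Der0 S R := by
    refine ⟨fun x y s => ?_, fun i => ?_⟩
    · simp only [LinearMap.add_apply, hder, inner_apply, mul_smul, smul_add, smul_sub]
      abel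
    · ext s
      rw [LinearMap.add_apply, LinearMap.add_apply, inner_apply, heu, hue]
      simp
  refine ⟨⟨_, hmem⟩, ?_⟩
  -- The correction extends to the free module through `freeLift u`, so it contributes zero to the
  -- class.
  have h1 : ModuleCat.ofHom (Der0.onKer hmem) =
      φ + (coverSeq S).f ≫ ModuleCat.ofHom (freeLift u) := by
    ext t
    have ht : freeCover S t.1 = 0 := t.2
    have h2 := htot t.1
    rw [toKer_coe] at h2
    have h3 := total_inner u t.1
    rw [ht, map_zero, sub_zero] at h3
    have h4 := congrArg (fun f => f t.1)
      ((TensorProduct.lift.equiv (.id K) (Lam K Q) S R).map_add δ₀ (inner u))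
    refine h4.trans ?_
    exact congrArg₂ (· + ·) h2 h3
  change (coverSeq_shortExact S).extClass.comp
    (Abelian.Ext.mk₀ (ModuleCat.ofHom (Der0.onKer hmem))) (add_zero 1) = _
  rw [h1, Abelian.Ext.mk₀_add, Abelian.Ext.comp_add, ← Abelian.Ext.mk₀_comp_mk₀,
    ShortComplex.ShortExact.extClass_comp_assoc, add_zero]

/-- A zero class means that the homomorphism on the kernel extends to some `ψ` on `Λ ⊗ S`; then `f =
ψ (1 ⊗ ·)` makes the derivation inner, and `f` is graded because the derivation vanishes on the
idempotents. -/
lemma Der0.toExt_eq_zero (δ : Der0 S R) (h : Der0.toExt S R δ = 0) :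
    ∃ f ∈ (repOf S).C0 (repOf R), δ.1 = inner f := by
  obtain ⟨c, hc⟩ := Abelian.Ext.contravariant_sequence_exact₁ (coverSeq_shortExact S) R _
    (add_zero 1) h
  obtain ⟨ψ, rfl⟩ := (Abelian.Ext.mk₀_bijective _ _).2 c
  rw [Abelian.Ext.mk₀_comp_mk₀] at hc
  have h1 := (Abelian.Ext.mk₀_bijective _ _).1 hc
  let ψ' : Lam K Q ⊗[K] S →ₗ[Lam K Q] R := ψ.hom
  let f : S →ₗ[K] R := (ψ'.restrictScalars K) ∘ₗ TensorProduct.mk K (Lam K Q) S 1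
  have hf : ∀ s, f s = ψ' (1 ⊗ₜ s) := fun _ => rfl
  have h2 : δ.1 = inner f := by
    ext x s
    have h3 := congrArg (fun g => g.hom (toKer S (x ⊗ₜ s))) h1
    change ψ' (x ⊗ₜ s - 1 ⊗ₜ (x • s)) = Der0.total δ.1 (x ⊗ₜ s - 1 ⊗ₜ (x • s)) at h3
    rw [map_sub, map_sub] at h3
    change _ = δ.1 x s - δ.1 1 (x • s) at h3
    rw [Der0.map_one δ.2, LinearMap.zero_apply, sub_zero] at h3
    rw [← h3, inner_apply, hf, hf, ← map_smul, TensorProduct.smul_tmul', smul_eq_mul, mul_one]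
  refine ⟨f, fun i => ?_, h2⟩
  ext s
  have h3 := congrArg (fun g => g s) (δ.2.2 i)
  rw [h2] at h3
  exact sub_eq_zero.1 h3

lemma Der0.toExt_inner {f : S →ₗ[K] R} (hf : f ∈ (repOf S).C0 (repOf R)) :
    Der0.toExt S R ⟨inner f, inner_mem hf⟩ = 0 := by
  have h1 : ModuleCat.ofHom (Der0.onKer (inner_mem hf)) =
      (coverSeq S).f ≫ ModuleCat.ofHom (freeLift f) := by
    ext t
    have ht : freeCover S t.1 = 0 := t.2
    have h3 := total_inner f t.1
    rw [ht, map_zero, sub_zero] at h3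
    exact h3
  change (coverSeq_shortExact S).extClass.comp
    (Abelian.Ext.mk₀ (ModuleCat.ofHom (Der0.onKer (inner_mem hf)))) (add_zero 1) = _
  rw [h1, ← Abelian.Ext.mk₀_comp_mk₀, ShortComplex.ShortExact.extClass_comp_assoc]

/-- If `Ext¹` vanishes, cocycles are coboundaries. -/
lemma Z1_eq_B1_of_subsingleton (hS : Module.Finite K S) (hR : Module.Finite K R)
    (h : Subsingleton (Abelian.Ext S R 1)) :
    (repOf S).Z1 (repOf R) = (repOf S).B1 (repOf R) := by
  refine le_antisymm (fun g hg => ?_) (Rep.B1_le_Z1 _ _)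
  rw [← Der0.map_ev hS hR] at hg
  obtain ⟨δ, hδ, rfl⟩ := hg
  obtain ⟨f, hf, h1⟩ := Der0.toExt_eq_zero ⟨δ, hδ⟩ (Subsingleton.elim _ _)
  change δ = inner f at h1
  rw [h1, ev_inner]
  exact ⟨f, hf, rfl⟩

/-- The dimension of `Ext¹` is the dimension of the space of cocycles modulo coboundaries. -/
lemma finrank_Z1_eq (hS : Module.Finite K S) (hR : Module.Finite K R) :
    Module.finrank K ((repOf S).Z1 (repOf R)) =
      Module.finrank K (Abelian.Ext S R 1) + Module.finrank K ((repOf S).B1 (repOf R)) := by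
  have hinj : Function.Injective ((Der0.ev S R).domRestrict (Der0 S R)) := by
    rw [injective_iff_map_eq_zero]
    exact fun δ hδ => Subtype.ext (Der0.eq_zero_of_ev hS hR δ.2 hδ)
  have hfin : Module.Finite K (Der0 S R) := Module.Finite.of_injective _ hinj
  have h1 : Module.finrank K ((repOf S).Z1 (repOf R)) = Module.finrank K (Der0 S R) := by
    rw [← Der0.map_ev hS hR, ← LinearMap.range_domRestrict]
    exact LinearMap.finrank_range_of_inj hinj
  have h2 := LinearMap.finrank_range_add_finrank_ker (K := K) (V := Der0 S R)
    (V₂ := Abelian.Ext S R 1) (Der0.toExt S R)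
  rw [LinearMap.range_eq_top.2 (Der0.toExt_surjective S R), finrank_top] at h2
  rw [h1, ← h2]
  congr 1
  have h3 : (LinearMap.ker (Der0.toExt S R)).map ((Der0.ev S R).domRestrict (Der0 S R)) =
      (repOf S).B1 (repOf R) := by
    ext g
    constructor
    · rintro ⟨δ, hδ, rfl⟩
      obtain ⟨f, hf, h4⟩ := Der0.toExt_eq_zero δ hδ
      rw [LinearMap.domRestrict_apply, h4, ev_inner]
      exact ⟨f, hf, rfl⟩
    · rintro ⟨f, hf, rfl⟩
      exact ⟨⟨inner f, inner_mem hf⟩, Der0.toExt_inner hf, ev_inner f⟩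
  rw [← h3]
  exact (LinearEquiv.finrank_eq (Submodule.equivMapOfInjective _ hinj _))

end ExtGroups

/-! ### Dual bases of `Ext¹(S, R)` and `Ext¹(R, S)`. -/

section DualCocyclesExistence

/-- A relative dual basis for a two-dimensional subquotient. -/
lemma exists_dual_pair {K X : Type*} [Field K] [AddCommGroup X] [Module K X]
    [FiniteDimensional K X] {B Z : Submodule K X} (hBZ : B ≤ Z)
    (h : Module.finrank K Z = 2 + Module.finrank K B) :
    ∃ v ∈ Z, ∃ w ∈ Z, ∃ ℓ ℓ' : X →ₗ[K] K, (∀ b ∈ B, ℓ b = 0) ∧ (∀ b ∈ B, ℓ' b = 0) ∧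
      ℓ v = 1 ∧ ℓ w = 0 ∧ ℓ' v = 0 ∧ ℓ' w = 1 := by
  have h1 := LinearMap.finrank_range_add_finrank_ker (B.mkQ.domRestrict Z)
  have h2 : Module.finrank K (LinearMap.ker (B.mkQ.domRestrict Z)) = Module.finrank K B := by
    rw [LinearMap.ker_domRestrict, Submodule.ker_mkQ]
    exact (Submodule.comapSubtypeEquivOfLe hBZ).finrank_eq
  have h3 : Module.finrank K (LinearMap.range (B.mkQ.domRestrict Z)) = 2 := by omega
  let b := Module.finBasisOfFinrankEq K _ h3
  obtain ⟨v, hv⟩ := (b 0).2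
  obtain ⟨w, hw⟩ := (b 1).2
  obtain ⟨ℓ, hℓ⟩ := LinearMap.exists_extend (b.coord 0)
  obtain ⟨ℓ', hℓ'⟩ := LinearMap.exists_extend (b.coord 1)
  have hB : ∀ (k : X ⧸ B →ₗ[K] K), ∀ x ∈ B, (k ∘ₗ B.mkQ) x = 0 := by
    intro k x hx
    rw [LinearMap.comp_apply, Submodule.mkQ_apply, (Submodule.Quotient.mk_eq_zero B).2 hx, map_zero]
  have key : ∀ (k : X ⧸ B →ₗ[K] K) (i j : Fin 2),
      k ∘ₗ (LinearMap.range (B.mkQ.domRestrict Z)).subtype = b.coord i →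
      k (b j) = if j = i then 1 else 0 := by
    intro k i j hk
    have := congrArg (fun f => f (b j)) hk
    simpa [Finsupp.single_apply] using this
  refine ⟨v.1, v.2, w.1, w.2, ℓ ∘ₗ B.mkQ, ℓ' ∘ₗ B.mkQ, hB ℓ, hB ℓ', ?_, ?_, ?_, ?_⟩
  · have := key ℓ 0 0 hℓ; rw [← hv] at this; simpa using this
  · have := key ℓ 0 1 hℓ; rw [← hw] at this; simpa using this
  · have := key ℓ' 1 0 hℓ'; rw [← hv] at this; simpa using this
  · have := key ℓ' 1 1 hℓ'; rw [← hw] at this; simpa using this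

variable {K : Type u} [Field K] {I H : Type} [Fintype I] [Fintype H] {Q : OrientedGraph I H}
variable {S R : ModuleCat.{u} (Lam K Q)}

lemma tauOne_eq (g : H → S →ₗ[K] R) (h : H → R →ₗ[K] S) :
    tauOne S R g h = Rep.tau K Q S R g h := by
  rw [Rep.tau_apply, tauOne, ← Q.sum_out]
  simp only [map_sum, map_smul, smul_eq_mul]

lemma mem_Z1_iff {g : H → S →ₗ[K] R} : g ∈ (repOf S).Z1 (repOf R) ↔
    (∀ a, g a ∈ homComp S R (Q.s a) (Q.t a)) ∧ ∀ i, dOne S R g i = 0 := by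
  constructor
  · intro h
    exact ⟨Rep.mem_C1.1 h.1, (Rep.dTot_eq_zero_iff _ _ h.1).1 h.2⟩
  · intro h
    have h1 : g ∈ (repOf S).C1 (repOf R) := Rep.mem_C1.2 h.1
    exact ⟨h1, (Rep.dTot_eq_zero_iff _ _ h1).2 h.2⟩

/-- A basis of `Ext¹(S, R)` has dual functionals on cochains that vanish on coboundaries, and
`Rep.exists_Z1_eq_tau` represents these by cocycles in the opposite direction. -/
lemma exists_dualCocycles (hS : Module.Finite K S) (hR : Module.Finite K R)
    (h : Module.finrank K (Abelian.Ext S R 1) = 2) : Nonempty (DualCocycles S R) := by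
  have h1 := finrank_Z1_eq hS hR
  rw [h] at h1
  obtain ⟨ξ, hξ, η, hη, ℓ, ℓ', hℓ, hℓ', h2, h3, h4, h5⟩ :=
    exists_dual_pair (Rep.B1_le_Z1 _ _) h1
  obtain ⟨ξ', hξ', h6⟩ := Rep.exists_Z1_eq_tau _ _ ℓ hℓ
  obtain ⟨η', hη', h7⟩ := Rep.exists_Z1_eq_tau _ _ ℓ' hℓ'
  refine ⟨⟨ξ, η, ξ', η', (mem_Z1_iff.1 hξ).1, (mem_Z1_iff.1 hη).1, (mem_Z1_iff.1 hξ').1,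
    (mem_Z1_iff.1 hη').1, (mem_Z1_iff.1 hξ).2, (mem_Z1_iff.1 hη).2, (mem_Z1_iff.1 hξ').2,
    (mem_Z1_iff.1 hη').2, ?_, ?_, ?_, ?_⟩⟩
  · rw [tauOne_eq, ← h6 _ hξ.1, h2]
  · rw [tauOne_eq, ← h7 _ hη.1, h5]
  · rw [tauOne_eq, ← h7 _ hξ.1, h4]
  · rw [tauOne_eq, ← h6 _ hη.1, h3]

end DualCocyclesExistence

/-! ### Parity on `End(S × R)` and the obstructions to solving `d¹ g = c`. -/

section Deformation

variable {K : Type u} [Field K] {I H : Type} [Fintype I] [Fintype H] {Q : OrientedGraph I H}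
variable {S R : Type u} [AddCommGroup S] [Module K S] [AddCommGroup R] [Module K R]

/-- The direct sum of two representations. -/
def Rep.prod (σ : Rep K Q S) (τ : Rep K Q R) : Rep K Q (S × R) where
  E i := (σ.E i).prodMap (τ.E i)
  A a := (σ.A a).prodMap (τ.A a)
  E_idem i := by rw [LinearMap.prodMap_comp, σ.E_idem, τ.E_idem]
  E_ortho i j h := by rw [LinearMap.prodMap_comp, σ.E_ortho i j h, τ.E_ortho i j h]; rfl
  E_sum := by
    refine LinearMap.ext fun x => Prod.ext ?_ ?_
    · simp [LinearMap.sum_apply, Prod.fst_sum, σ.E_sum_apply]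
    · simp [LinearMap.sum_apply, Prod.snd_sum, τ.E_sum_apply]
  E_A a := by rw [LinearMap.prodMap_comp, σ.E_A, τ.E_A]
  A_E a := by rw [LinearMap.prodMap_comp, σ.A_E, τ.A_E]
  rel i := by
    refine LinearMap.ext fun x => Prod.ext ?_ ?_
    · simpa [LinearMap.sum_apply, Prod.fst_sum] using congrArg (fun f => f x.1) (σ.rel i)
    · simpa [LinearMap.sum_apply, Prod.snd_sum] using congrArg (fun f => f x.2) (τ.rel i)

variable (K S R) in
/-- The projections onto the two summands of `S × R`, indexed by the parity. -/
def proj (p : ZMod 2) : Module.End K (S × R) :=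
  if p = 0 then LinearMap.inl K S R ∘ₗ LinearMap.fst K S R
  else LinearMap.inr K S R ∘ₗ LinearMap.snd K S R

lemma zmod_two_cases (p : ZMod 2) : p = 0 ∨ p = 1 := by
  revert p; decide

lemma proj_zero : proj K S R 0 = LinearMap.inl K S R ∘ₗ LinearMap.fst K S R := rfl

lemma proj_one : proj K S R 1 = LinearMap.inr K S R ∘ₗ LinearMap.snd K S R := rfl

lemma proj_mul_self (p : ZMod 2) : proj K S R p * proj K S R p = proj K S R p := by
  rcases zmod_two_cases p with rfl | rfl <;> rfl

lemma proj_mul_ne {p q : ZMod 2} (h : p ≠ q) : proj K S R p * proj K S R q = 0 := by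
  rcases zmod_two_cases p with rfl | rfl <;> rcases zmod_two_cases q with rfl | rfl
  · exact absurd rfl h
  · ext <;> simp [proj]
  · ext <;> simp [proj]
  · exact absurd rfl h

lemma sum_zmod_two {A : Type*} [AddCommMonoid A] (f : ZMod 2 → A) : ∑ p, f p = f 0 + f 1 :=
  Fin.sum_univ_two f

lemma sum_proj : ∑ p, proj K S R p = 1 := by
  rw [sum_zmod_two]
  ext <;> simp [proj]

/-- Endomorphisms of `S × R` of a given parity: the even ones are block diagonal, the odd ones
have vanishing diagonal blocks. -/
def Par (n : ZMod 2) : Submodule K (Module.End K (S × R)) where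
  carrier := {f | ∀ p, f * proj K S R p = proj K S R (p + n) * f}
  add_mem' hf hg p := by rw [add_mul, hf, hg, mul_add]
  zero_mem' p := by simp
  smul_mem' c f hf p := by rw [smul_mul_assoc, hf, mul_smul_comm]

lemma Par.mul {m n : ZMod 2} {f g : Module.End K (S × R)} (hf : f ∈ Par m) (hg : g ∈ Par n) :
    f * g ∈ Par (m + n) := by
  intro p
  rw [mul_assoc, hg p, ← mul_assoc, hf, mul_assoc]
  congr 2
  abel

/-- The part of an endomorphism of a given parity. -/
def parProj (n : ZMod 2) (f : Module.End K (S × R)) : Module.End K (S × R) :=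
  ∑ p, proj K S R (p + n) * f * proj K S R p

lemma parProj_mem (n : ZMod 2) (f : Module.End K (S × R)) : parProj n f ∈ Par n := by
  intro q
  rw [parProj, Finset.sum_mul, Finset.mul_sum, Finset.sum_eq_single q, Finset.sum_eq_single q]
  · rw [mul_assoc, proj_mul_self, ← mul_assoc, ← mul_assoc, proj_mul_self]
  · intro p _ hp
    rw [← mul_assoc, ← mul_assoc, proj_mul_ne (by simpa using hp.symm), zero_mul, zero_mul]
  · simp
  · intro p _ hp
    rw [mul_assoc, proj_mul_ne hp, mul_zero]
  · simp

lemma parProj_eq {n : ZMod 2} {f : Module.End K (S × R)} (hf : f ∈ Par n) : parProj n f = f := by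
  have h : ∀ p, proj K S R (p + n) * f * proj K S R p = f * proj K S R p := by
    intro p
    rw [← hf p, mul_assoc, proj_mul_self]
  rw [parProj, Finset.sum_congr rfl fun p _ => h p, ← Finset.mul_sum, sum_proj, mul_one]

variable (σ : Rep K Q S) (τ : Rep K Q R)

lemma prod_A_mem (a : H) : (σ.prod τ).A a ∈ Par 0 := by
  intro p
  rw [add_zero]
  rcases zmod_two_cases p with rfl | rfl <;> ext <;> simp [proj, Rep.prod]

lemma proj_mem_C0 (p : ZMod 2) : proj K S R p ∈ (σ.prod τ).C0 (σ.prod τ) := by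
  intro i
  rcases zmod_two_cases p with rfl | rfl <;> ext <;> simp [proj, Rep.prod]

/-- The arrows act on `S × R` by block diagonal maps, so `d¹` commutes with the projection to a
given parity and a solution may be replaced by its part of the right parity. -/
lemma dTot_parProj (n : ZMod 2) (g : H → Module.End K (S × R)) :
    (σ.prod τ).dTot (σ.prod τ) (fun a => parProj n (g a)) =
      parProj n ((σ.prod τ).dTot (σ.prod τ) g) := by
  have h1 : ∀ a f, (σ.prod τ).A a * parProj n f = parProj n ((σ.prod τ).A a * f) := by
    intro a f
    have h := prod_A_mem σ τ a
    rw [parProj, parProj, Finset.mul_sum]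
    refine Finset.sum_congr rfl fun p _ => ?_
    have := h (p + n)
    rw [add_zero] at this
    rw [← mul_assoc, ← mul_assoc, this, mul_assoc (proj K S R (p + n))]
  have h2 : ∀ a f, parProj n f * (σ.prod τ).A a = parProj n (f * (σ.prod τ).A a) := by
    intro a f
    have h := prod_A_mem σ τ a
    rw [parProj, parProj, Finset.sum_mul]
    refine Finset.sum_congr rfl fun p _ => ?_
    have := h p
    rw [add_zero] at this
    rw [mul_assoc, ← this]
    simp only [mul_assoc]
  have h3 : ∀ (f g : Module.End K (S × R)), parProj n (f + g) = parProj n f + parProj n g := by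
    intro f g
    simp [parProj, mul_add, add_mul, Finset.sum_add_distrib]
  have h4 : ∀ (c : K) (f : Module.End K (S × R)), parProj n (c • f) = c • parProj n f := by
    intro c f
    simp [parProj, Finset.smul_sum]
  have h5 : parProj n (0 : Module.End K (S × R)) = 0 := by simp [parProj]
  have h6 : ∀ (f : H → Module.End K (S × R)), parProj n (∑ a, f a) = ∑ a, parProj n (f a) := by
    intro f
    exact map_sum (⟨⟨parProj n, h5⟩, h3⟩ : Module.End K (S × R) →+ Module.End K (S × R)) f _
  rw [Rep.dTot_apply, Rep.dTot_apply]
  refine Eq.trans ?_ (h6 _).symm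
  refine Finset.sum_congr rfl fun a _ => ?_
  refine Eq.trans ?_ (h4 _ _).symm
  congr 1
  refine Eq.trans ?_ (h3 _ _).symm
  exact congrArg₂ (· + ·) (h1 _ _) (h2 _ _)

/-- The only endomorphisms are scalars, and there are no maps between the two representations. -/
structure Rep.IsBrickPair (σ : Rep K Q S) (τ : Rep K Q R) : Prop where
  end_left : ∀ f, σ.Intertwines σ f → ∃ c : K, f = c • LinearMap.id
  end_right : ∀ f, τ.Intertwines τ f → ∃ c : K, f = c • LinearMap.id
  hom_left : ∀ f, σ.Intertwines τ f → f = 0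
  hom_right : ∀ f, τ.Intertwines σ f → f = 0

variable {σ τ}

lemma Rep.IsBrickPair.end_prod (h : σ.IsBrickPair τ) {f : Module.End K (S × R)}
    (hf : (σ.prod τ).Intertwines (σ.prod τ) f) :
    ∃ c d : K, f = c • proj K S R 0 + d • proj K S R 1 := by
  have h1 : ∀ i m, f ((σ.E i m.1), (τ.E i m.2)) = (σ.E i (f m).1, τ.E i (f m).2) := fun i m => hf.1 i m
  have h2 : ∀ i m, f ((σ.A i m.1), (τ.A i m.2)) = (σ.A i (f m).1, τ.A i (f m).2) := fun i m => hf.2 i m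
  obtain ⟨c, hc⟩ := h.end_left (LinearMap.fst K S R ∘ₗ f ∘ₗ LinearMap.inl K S R)
    ⟨fun i s => by simpa using congrArg Prod.fst (h1 i (s, 0)),
      fun i s => by simpa using congrArg Prod.fst (h2 i (s, 0))⟩
  obtain ⟨d, hd⟩ := h.end_right (LinearMap.snd K S R ∘ₗ f ∘ₗ LinearMap.inr K S R)
    ⟨fun i s => by simpa using congrArg Prod.snd (h1 i (0, s)),
      fun i s => by simpa using congrArg Prod.snd (h2 i (0, s))⟩
  have h3 := h.hom_left (LinearMap.snd K S R ∘ₗ f ∘ₗ LinearMap.inl K S R)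
    ⟨fun i s => by simpa using congrArg Prod.snd (h1 i (s, 0)),
      fun i s => by simpa using congrArg Prod.snd (h2 i (s, 0))⟩
  have h4 := h.hom_right (LinearMap.fst K S R ∘ₗ f ∘ₗ LinearMap.inr K S R)
    ⟨fun i s => by simpa using congrArg Prod.fst (h1 i (0, s)),
      fun i s => by simpa using congrArg Prod.fst (h2 i (0, s))⟩
  refine ⟨c, d, ?_⟩
  refine LinearMap.prod_ext (LinearMap.ext fun s => Prod.ext ?_ ?_)
    (LinearMap.ext fun s => Prod.ext ?_ ?_)
  · simpa [proj] using congrArg (fun k => k s) hc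
  · simpa [proj] using congrArg (fun k => k s) h3
  · simpa [proj] using congrArg (fun k => k s) h4
  · simpa [proj] using congrArg (fun k => k s) hd

variable [FiniteDimensional K S] [FiniteDimensional K R]

lemma trace_proj_mul_of_odd {c : Module.End K (S × R)} (hc : c ∈ Par 1) (p : ZMod 2) :
    LinearMap.trace K _ (proj K S R p * c) = 0 := by
  rw [← proj_mul_self, mul_assoc, LinearMap.trace_mul_comm]
  have := hc (p + 1)
  rw [add_assoc, show (1 : ZMod 2) + 1 = 0 from rfl, add_zero] at this
  rw [← this, mul_assoc, proj_mul_ne (by simp), mul_zero, map_zero]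

/-- The obstructions to solving `d¹ g = c` are the traces on the two summands. -/
lemma Rep.IsBrickPair.exists_dTot_eq (h : σ.IsBrickPair τ) {n : ZMod 2}
    {c : Module.End K (S × R)} (hc : c ∈ (σ.prod τ).C0 (σ.prod τ)) (hn : c ∈ Par n)
    (htr : ∀ p, LinearMap.trace K _ (proj K S R p * c) = 0) :
    ∃ g ∈ (σ.prod τ).C1 (σ.prod τ), (∀ a, g a ∈ Par n) ∧ (σ.prod τ).dTot (σ.prod τ) g = c := by
  -- The image of `d¹` is the orthogonal of the endomorphisms of `S × R`, and these are combinations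
  -- of the two projections.
  obtain ⟨g, hg, hgc⟩ := (σ.prod τ).exists_dTot_eq (σ.prod τ) hc (by
    intro f hf
    obtain ⟨x, y, rfl⟩ := h.end_prod hf
    change LinearMap.trace K _ (c * _) = 0
    rw [mul_add, mul_smul_comm, mul_smul_comm, map_add, map_smul, map_smul,
      LinearMap.trace_mul_comm, htr, LinearMap.trace_mul_comm, htr]
    simp)
  refine ⟨fun a => parProj n (g a), ?_, fun a => parProj_mem n _, ?_⟩
  · rw [Rep.mem_C1] at hg ⊢
    intro a
    refine sum_mem fun p _ => ?_
    rw [mul_assoc]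
    exact C0_comp_homG (proj_mem_C0 σ τ _) (homG_comp_C0 (hg a) (proj_mem_C0 σ τ _))
  · rw [dTot_parProj, hgc, parProj_eq hn]

end Deformation

/-! ### Lowest order terms of products of power series. -/

section PowerSeriesOrder

open MvPowerSeries

variable {A : Type*} [Ring A] {F G : MvPowerSeries (Fin 2) A} {m : Fin 2 →₀ ℕ} {k l : ℕ}

lemma coeff_mul_eq_zero (hF : ∀ m, m.degree < k → coeff m F = 0)
    (hG : ∀ m, m.degree < l → coeff m G = 0) (hm : m.degree < k + l) : coeff m (F * G) = 0 := by
  classical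
  rw [coeff_mul]
  refine Finset.sum_eq_zero fun pq h => ?_
  rw [Finset.HasAntidiagonal.mem_antidiagonal] at h
  rw [← h, map_add] at hm
  by_cases h1 : pq.1.degree < k
  · rw [hF _ h1, zero_mul]
  · rw [hG pq.2 (by omega), mul_zero]

lemma coeff_mul_of_order_left (hF : ∀ m, m.degree < k → coeff m F = 0) (hm : m.degree ≤ k) :
    coeff m (F * G) = coeff m F * coeff 0 G := by
  classical
  rw [coeff_mul, Finset.sum_eq_single (m, 0)]
  · intro pq h hne
    rw [Finset.HasAntidiagonal.mem_antidiagonal] at h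
    rw [hF, zero_mul]
    have h1 : pq.2 ≠ 0 := by
      intro h0
      rw [h0, add_zero] at h
      exact hne (Prod.ext h h0)
    have h2 : pq.2.degree ≠ 0 := by rwa [Ne, Finsupp.degree_eq_zero_iff]
    rw [← h, map_add] at hm
    omega
  · simp

lemma coeff_mul_of_order_right (hF : ∀ m, m.degree < k → coeff m F = 0) (hm : m.degree ≤ k) :
    coeff m (G * F) = coeff 0 G * coeff m F := by
  classical
  rw [coeff_mul, Finset.sum_eq_single (0, m)]
  · intro pq h hne
    rw [Finset.HasAntidiagonal.mem_antidiagonal] at h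
    rw [hF, mul_zero]
    have h1 : pq.1 ≠ 0 := by
      intro h0
      rw [h0, zero_add] at h
      exact hne (Prod.ext h0 h)
    have h2 : pq.1.degree ≠ 0 := by rwa [Ne, Finsupp.degree_eq_zero_iff]
    rw [← h, map_add] at hm
    omega
  · simp

lemma degree_eq_one {q : Fin 2 →₀ ℕ} (h : q.degree = 1) :
    q = Finsupp.single 0 1 ∨ q = Finsupp.single 1 1 := by
  rw [Finsupp.degree_eq_sum, Fin.sum_univ_two] at h
  rcases Nat.eq_zero_or_pos (q 0) with h0 | h0
  · right
    ext i
    fin_cases i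
    · simpa using h0
    · simp; omega
  · left
    ext i
    fin_cases i
    · simp; omega
    · simp; omega

/-- When `F` starts in degree `k` and `G` has no constant term, the coefficients of `F * G` in
degree `k + 1` only see the linear part of `G`. -/
lemma coeff_mul_linear (hF : ∀ m, m.degree < k → coeff m F = 0) (h0 : coeff 0 G = 0)
    (hm : m.degree = k + 1) :
    coeff m (F * G) = coeff m (F * monomial (Finsupp.single 0 1) (coeff (Finsupp.single 0 1) G)) +
      coeff m (F * monomial (Finsupp.single 1 1) (coeff (Finsupp.single 1 1) G)) := by
  classical
  rw [coeff_mul, coeff_mul, coeff_mul, ← Finset.sum_add_distrib]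
  refine Finset.sum_congr rfl fun pq h => ?_
  rw [Finset.HasAntidiagonal.mem_antidiagonal] at h
  rw [← h, map_add] at hm
  by_cases h1 : pq.1.degree < k
  · simp [hF _ h1]
  have h01 : (Finsupp.single 0 1 : Fin 2 →₀ ℕ) ≠ Finsupp.single 1 1 := by
    intro h
    simpa using congrArg (fun f => f 0) h
  rcases Nat.eq_zero_or_pos pq.2.degree with h2 | h2
  · rw [Finsupp.degree_eq_zero_iff] at h2
    rw [h2, h0, coeff_monomial, coeff_monomial, if_neg, if_neg] <;> simp [eq_comm]
  · rcases degree_eq_one (q := pq.2) (by omega) with h2 | h2 <;>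
      rw [h2, coeff_monomial, coeff_monomial]
    · rw [if_pos rfl, if_neg h01]; simp
    · rw [if_pos rfl, if_neg h01.symm]; simp

end PowerSeriesOrder

/-! ### The preprojective relation as a quadratic form on families of series. -/

section RelationSeries

open MvPowerSeries

variable {K : Type u} [Field K] {I H : Type} [Fintype I] [Fintype H] (Q : OrientedGraph I H)
variable {A : Type*} [Ring A] [Algebra K A]

lemma coeff_smul' (c : K) (F : MvPowerSeries (Fin 2) A) (m : Fin 2 →₀ ℕ) :
    coeff m (c • F) = c • coeff m F := rfl

variable (K) in
/-- The polarization of the preprojective relation. -/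
def relB (X Y : H → MvPowerSeries (Fin 2) A) : MvPowerSeries (Fin 2) A :=
  ∑ a, Q.ε K a • (X (Q.bar a) * Y a)

lemma coeff_relB (X Y : H → MvPowerSeries (Fin 2) A) (m : Fin 2 →₀ ℕ) :
    coeff m (relB K Q X Y) = ∑ a, Q.ε K a • coeff m (X (Q.bar a) * Y a) := by
  rw [relB, map_sum]
  rfl

lemma relB_add_add (X Y : H → MvPowerSeries (Fin 2) A) :
    relB K Q (X + Y) (X + Y) =
      relB K Q X X + (relB K Q X Y + relB K Q Y X) + relB K Q Y Y := by
  simp only [relB, Pi.add_apply, ← Finset.sum_add_distrib]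
  refine Finset.sum_congr rfl fun a _ => ?_
  rw [mul_add, add_mul, add_mul, smul_add, smul_add, smul_add]
  abel

lemma coeff_relB_eq_of_agree {X Y : H → MvPowerSeries (Fin 2) A} {N : ℕ}
    (h : ∀ a m, m.degree ≤ N → coeff m (X a) = coeff m (Y a)) {m : Fin 2 →₀ ℕ}
    (hm : m.degree ≤ N) : coeff m (relB K Q X X) = coeff m (relB K Q Y Y) := by
  classical
  rw [coeff_relB, coeff_relB]
  refine Finset.sum_congr rfl fun a _ => ?_
  rw [coeff_mul, coeff_mul]
  congr 1
  refine Finset.sum_congr rfl fun pq hpq => ?_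
  rw [Finset.HasAntidiagonal.mem_antidiagonal] at hpq
  rw [← hpq, map_add] at hm
  rw [h _ pq.1 (by omega), h _ pq.2 (by omega)]

end RelationSeries

/-! ### Approximate solutions and their trace obstructions. -/

section DeformationStep

lemma sum_antidiagonal_swap' {A : Type*} [AddCommMonoid A] (m : Fin 2 →₀ ℕ)
    (f : (Fin 2 →₀ ℕ) × (Fin 2 →₀ ℕ) → A) :
    ∑ p ∈ Finset.HasAntidiagonal.antidiagonal m, f p.swap =
      ∑ p ∈ Finset.HasAntidiagonal.antidiagonal m, f p := by
  refine Finset.sum_equiv (Equiv.prodComm _ _) (fun p => ?_) fun _ _ => rfl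
  simp [Finset.HasAntidiagonal.mem_antidiagonal, add_comm]

open MvPowerSeries

variable {K : Type u} [Field K] {I H : Type} [Fintype I] [Fintype H] {Q : OrientedGraph I H}
variable {S R : Type u} [AddCommGroup S] [Module K S] [AddCommGroup R] [Module K R]

/-- The endomorphism of `S × R` with given off-diagonal blocks. -/
def offDiag (f : S →ₗ[K] R) (g : R →ₗ[K] S) : Module.End K (S × R) :=
  LinearMap.inr K S R ∘ₗ f ∘ₗ LinearMap.fst K S R + LinearMap.inl K S R ∘ₗ g ∘ₗ LinearMap.snd K S R

@[simp] lemma offDiag_apply (f : S →ₗ[K] R) (g : R →ₗ[K] S) (x : S × R) :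
    offDiag f g x = (g x.2, f x.1) := by
  simp [offDiag]

lemma offDiag_mem_Par (f : S →ₗ[K] R) (g : R →ₗ[K] S) : offDiag f g ∈ Par 1 := by
  intro p
  rcases zmod_two_cases p with rfl | rfl
  · rw [zero_add, proj_zero, proj_one]
    ext <;> simp
  · rw [show (1 : ZMod 2) + 1 = 0 from rfl, proj_zero, proj_one]
    ext <;> simp

lemma offDiag_mem_homG {σ : Rep K Q S} {τ : Rep K Q R} {i j : I} {f : S →ₗ[K] R} {g : R →ₗ[K] S}
    (hf : f ∈ σ.homG τ i j) (hg : g ∈ τ.homG σ i j) :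
    offDiag f g ∈ (σ.prod τ).homG (σ.prod τ) i j := by
  constructor
  · refine LinearMap.ext fun x => ?_
    exact Prod.ext (by simpa [Rep.prod] using Rep.homG.E_apply hg x.2)
      (by simpa [Rep.prod] using Rep.homG.E_apply hf x.1)
  · refine LinearMap.ext fun x => ?_
    exact Prod.ext (by simpa [Rep.prod] using Rep.homG.apply_E hg x.2)
      (by simpa [Rep.prod] using Rep.homG.apply_E hf x.1)

lemma dTot_offDiag (σ : Rep K Q S) (τ : Rep K Q R) (f : H → S →ₗ[K] R) (g : H → R →ₗ[K] S) :
    (σ.prod τ).dTot (σ.prod τ) (fun a => offDiag (f a) (g a)) =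
      offDiag (σ.dTot τ f) (τ.dTot σ g) := by
  rw [Rep.dTot_apply, Rep.dTot_apply, Rep.dTot_apply]
  refine LinearMap.ext fun x => Prod.ext ?_ ?_
  · simp [LinearMap.sum_apply, Prod.fst_sum, Rep.prod]
  · simp [LinearMap.sum_apply, Prod.snd_sum, Rep.prod]

lemma trace_proj_offDiag_mul [FiniteDimensional K S] [FiniteDimensional K R]
    (f f' : S →ₗ[K] R) (g g' : R →ₗ[K] S) :
    LinearMap.trace K _ (proj K S R 0 * (offDiag f g * offDiag f' g')) =
      LinearMap.trace K _ (g ∘ₗ f') := by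
  have : proj K S R 0 * (offDiag f g * offDiag f' g') =
      LinearMap.inl K S R ∘ₗ ((g ∘ₗ f') ∘ₗ LinearMap.fst K S R) := by
    refine LinearMap.ext fun x => Prod.ext ?_ ?_ <;> simp [proj]
  rw [this, LinearMap.trace_comp_comm', LinearMap.comp_assoc]
  rfl

variable [FiniteDimensional K S] [FiniteDimensional K R]

variable (K S R) in
/-- The trace of the upper left block. -/
def trUp : Module.End K (S × R) →ₗ[K] K :=
  LinearMap.trace K _ ∘ₗ LinearMap.mulLeft K (proj K S R 0)

/-- The upper left block of a product of two off-diagonal maps is `g ∘ f'`; summed with signs, the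
obstruction created by off-diagonal terms is therefore a value of `τ₁`. -/
lemma sum_trUp_offDiag (f f' : H → S →ₗ[K] R) (g g' : H → R →ₗ[K] S) :
    ∑ a, Q.ε K a • trUp K S R (offDiag (f (Q.bar a)) (g (Q.bar a)) * offDiag (f' a) (g' a)) =
      Rep.tau K Q R S g f' := by
  rw [Rep.tau_apply]
  refine Finset.sum_congr rfl fun a _ => ?_
  rw [smul_eq_mul]
  congr 1
  exact trace_proj_offDiag_mul _ _ _ _

/-- The coefficientwise multiple of an endomorphism by a power series. -/
def scal (U : MvPowerSeries (Fin 2) K) (f : Module.End K (S × R)) :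
    MvPowerSeries (Fin 2) (Module.End K (S × R)) := fun m => coeff m U • f

omit [FiniteDimensional K S] [FiniteDimensional K R] in
lemma coeff_scal (U : MvPowerSeries (Fin 2) K) (f : Module.End K (S × R)) (m : Fin 2 →₀ ℕ) :
    coeff m (scal U f) = coeff m U • f := rfl

/-- The coefficientwise application of a linear map to a power series. -/
def mapCoeff {A B : Type*} [AddCommGroup A] [Module K A] [AddCommGroup B] [Module K B]
    (φ : A →ₗ[K] B) (F : MvPowerSeries (Fin 2) A) : MvPowerSeries (Fin 2) B := fun m => φ (F m)

omit [FiniteDimensional K S] [FiniteDimensional K R] in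
lemma coeff_mapCoeff (φ : Module.End K (S × R) →ₗ[K] K)
    (F : MvPowerSeries (Fin 2) (Module.End K (S × R))) (m : Fin 2 →₀ ℕ) :
    coeff m (mapCoeff φ F) = φ (coeff m F) := rfl

omit [FiniteDimensional K S] [FiniteDimensional K R] in
lemma coeff_mul_scal (φ : Module.End K (S × R) →ₗ[K] K) (U : MvPowerSeries (Fin 2) K)
    (f : Module.End K (S × R)) (F : MvPowerSeries (Fin 2) (Module.End K (S × R)))
    (m : Fin 2 →₀ ℕ) : φ (coeff m (F * scal U f)) =
      coeff m (U * mapCoeff (φ ∘ₗ LinearMap.mulRight K f) F) := by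
  classical
  rw [coeff_mul, coeff_mul, map_sum, ← sum_antidiagonal_swap']
  refine Finset.sum_congr rfl fun pq _ => ?_
  rw [coeff_scal]
  simp only [Prod.fst_swap, Prod.snd_swap, mul_smul_comm, map_smul]
  rfl

omit [FiniteDimensional K S] [FiniteDimensional K R] in
lemma coeff_scal_mul (φ : Module.End K (S × R) →ₗ[K] K) (U : MvPowerSeries (Fin 2) K)
    (f : Module.End K (S × R)) (F : MvPowerSeries (Fin 2) (Module.End K (S × R)))
    (m : Fin 2 →₀ ℕ) : φ (coeff m (scal U f * F)) =
      coeff m (U * mapCoeff (φ ∘ₗ LinearMap.mulLeft K f) F) := by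
  classical
  rw [coeff_mul, coeff_mul, map_sum]
  refine Finset.sum_congr rfl fun pq _ => ?_
  rw [coeff_scal]
  simp only [smul_mul_assoc, map_smul]
  rfl

/-- A family of series that solves the relation up to a given order, and such that the obstruction
to solving it in the next degree vanishes. -/
structure IsApprox (σ : Rep K Q S) (τ : Rep K Q R) (N : ℕ)
    (X : H → MvPowerSeries (Fin 2) (Module.End K (S × R))) : Prop where
  graded : ∀ a m, coeff m (X a) ∈ (σ.prod τ).homG (σ.prod τ) (Q.s a) (Q.t a)
  par : ∀ a m, coeff m (X a) ∈ Par (m.degree : ZMod 2)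
  zero : ∀ a, coeff 0 (X a) = (σ.prod τ).A a
  rel : ∀ m, m.degree ≤ N → coeff m (relB K Q X X) = 0
  tr : ∀ m, m.degree = N + 1 → trUp K S R (coeff m (relB K Q X X)) = 0

variable {σ : Rep K Q S} {τ : Rep K Q R}

omit [FiniteDimensional K S] [FiniteDimensional K R] in
lemma coeff_relB_mem_C0 {X : H → MvPowerSeries (Fin 2) (Module.End K (S × R))}
    (h : ∀ a m, coeff m (X a) ∈ (σ.prod τ).homG (σ.prod τ) (Q.s a) (Q.t a)) (m : Fin 2 →₀ ℕ) :
    coeff m (relB K Q X X) ∈ (σ.prod τ).C0 (σ.prod τ) := by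
  classical
  rw [coeff_relB]
  refine sum_mem fun a _ => Submodule.smul_mem _ _ ?_
  rw [coeff_mul]
  refine sum_mem fun pq _ => Rep.homG_self_le_C0 _ _ (Q.s a) ?_
  exact Rep.walk_mem _ _ (g := fun a => coeff pq.2 (X a)) (g' := fun a => coeff pq.1 (X a))
    (Rep.mem_C1.2 fun a => h a _) (Rep.mem_C1.2 fun a => h a _) a

omit [FiniteDimensional K S] [FiniteDimensional K R] in
lemma coeff_relB_mem_Par {X : H → MvPowerSeries (Fin 2) (Module.End K (S × R))}
    (h : ∀ a m, coeff m (X a) ∈ Par (m.degree : ZMod 2)) (m : Fin 2 →₀ ℕ) :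
    coeff m (relB K Q X X) ∈ Par (m.degree : ZMod 2) := by
  classical
  rw [coeff_relB]
  refine sum_mem fun a _ => Submodule.smul_mem _ _ ?_
  rw [coeff_mul]
  refine sum_mem fun pq hpq => ?_
  rw [Finset.HasAntidiagonal.mem_antidiagonal] at hpq
  rw [← hpq, map_add, Nat.cast_add]
  exact Par.mul (h _ _) (h _ _)

/-- Exchanging `a` with `bar a` and the two factors under the trace changes the sign, so the total
trace equals its own negative. Of the two trace obstructions only the one on `S` remains. -/
lemma trace_coeff_relB [CharZero K] (X : H → MvPowerSeries (Fin 2) (Module.End K (S × R)))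
    (m : Fin 2 →₀ ℕ) : LinearMap.trace K _ (coeff m (relB K Q X X)) = 0 := by
  classical
  have h : LinearMap.trace K _ (coeff m (relB K Q X X)) =
      - LinearMap.trace K _ (coeff m (relB K Q X X)) := by
    conv_lhs => rw [coeff_relB, ← Q.sum_bar]
    rw [coeff_relB, map_sum, map_sum, ← Finset.sum_neg_distrib]
    refine Finset.sum_congr rfl fun a _ => ?_
    rw [map_smul, map_smul, Q.ε_bar, Q.bar_bar, neg_smul, coeff_mul, coeff_mul, map_sum, map_sum,
      ← sum_antidiagonal_swap']
    congr 2
    exact Finset.sum_congr rfl fun pq _ => LinearMap.trace_mul_comm _ _ _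
  exact self_eq_neg.1 h

/-- The polarized relation between a family of series and a homogeneous one. -/
lemma coeff_relB_add {X δ : H → MvPowerSeries (Fin 2) (Module.End K (S × R))} {n : ℕ}
    (hn : 1 ≤ n) (h0 : ∀ a, coeff 0 (X a) = (σ.prod τ).A a)
    (hδ : ∀ a m, m.degree < n → coeff m (δ a) = 0) {m : Fin 2 →₀ ℕ} (hm : m.degree ≤ n) :
    coeff m (relB K Q (X + δ) (X + δ)) = coeff m (relB K Q X X) +
      (σ.prod τ).dTot (σ.prod τ) (fun a => coeff m (δ a)) := by
  rw [relB_add_add, map_add, map_add, map_add, Rep.dTot_apply]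
  have h1 : coeff m (relB K Q δ δ) = 0 := by
    rw [coeff_relB]
    refine Finset.sum_eq_zero fun a _ => ?_
    rw [coeff_mul_eq_zero (hδ _) (hδ _) (by omega), smul_zero]
  rw [h1, add_zero, coeff_relB Q X δ, coeff_relB Q δ X, ← Finset.sum_add_distrib]
  refine congrArg (coeff m (relB K Q X X) + ·) (Finset.sum_congr rfl fun a _ => ?_)
  rw [coeff_mul_of_order_left (hδ _) hm, coeff_mul_of_order_right (hδ _) hm, h0, h0, smul_add]
  rfl

end DeformationStep

/-! ### Extending a solution by one degree. -/

section DeformationExists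

open MvPowerSeries

variable {K : Type u} [Field K] {I H : Type} [Fintype I] [Fintype H] {Q : OrientedGraph I H}
variable {S R : Type u} [AddCommGroup S] [Module K S] [AddCommGroup R] [Module K R]

variable [FiniteDimensional K S] [FiniteDimensional K R]

variable {σ : Rep K Q S} {τ : Rep K Q R}

lemma coeff_mul_monomial_one (U : MvPowerSeries (Fin 2) K) (m n : Fin 2 →₀ ℕ) (c : K)
    [Decidable (n ≤ m)] :
    coeff m (U * monomial n c) = if n ≤ m then coeff (m - n) U * c else 0 := by
  rw [coeff_mul_monomial]
  congr

/-- A homogeneous polynomial without constant term is a combination of the variables. -/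
lemma exists_eq_mul_X_add (T : MvPowerSeries (Fin 2) K) (n : ℕ) :
    ∃ U V : MvPowerSeries (Fin 2) K, (∀ m, m.degree ≠ n → coeff m U = 0 ∧ coeff m V = 0) ∧
      ((∀ m, m.degree = n + 1 → coeff m T = 0) → U = 0 ∧ V = 0) ∧
      ∀ m, m.degree = n + 1 → coeff m (U * monomial (Finsupp.single 0 1) 1) +
        coeff m (V * monomial (Finsupp.single 1 1) 1) = coeff m T := by
  classical
  let U : MvPowerSeries (Fin 2) K := fun p =>
    if p.degree = n then coeff (p + Finsupp.single 0 1) T else 0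
  -- A monomial divisible by the first variable is already produced by `U`; `V` is left with the
  -- pure powers of the second variable.
  let V : MvPowerSeries (Fin 2) K := fun p =>
    if p.degree = n ∧ p 0 = 0 then coeff (p + Finsupp.single 1 1) T else 0
  have hU : ∀ p, coeff p U = if p.degree = n then coeff (p + Finsupp.single 0 1) T else 0 :=
    fun p => rfl
  have hV : ∀ p, coeff p V =
      if p.degree = n ∧ p 0 = 0 then coeff (p + Finsupp.single 1 1) T else 0 := fun p => rfl
  refine ⟨U, V, fun m hm => ?_, fun h => ⟨?_, ?_⟩, fun m hm => ?_⟩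
  · rw [hU, hV, if_neg hm, if_neg fun h => hm h.1]
    exact ⟨rfl, rfl⟩
  · ext p
    rw [hU]
    split_ifs with hp
    · rw [h _ (by rw [map_add, hp, Finsupp.degree_single]), coeff_zero]
    · rw [coeff_zero]
  · ext p
    rw [hV]
    split_ifs with hp
    · rw [h _ (by rw [map_add, hp.1, Finsupp.degree_single]), coeff_zero]
    · rw [coeff_zero]
  · rw [coeff_mul_monomial_one, coeff_mul_monomial_one, mul_one, mul_one]
    have hdeg : m 0 + m 1 = n + 1 := by
      rw [← hm, Finsupp.degree_eq_sum, Fin.sum_univ_two]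
    have h1 : ∀ i : Fin 2, Finsupp.single i 1 ≤ m → m - Finsupp.single i 1 + Finsupp.single i 1 = m ∧
        (m - Finsupp.single i 1).degree = n := by
      intro i hi
      have h2 := tsub_add_cancel_of_le hi
      refine ⟨h2, ?_⟩
      have h3 := congrArg Finsupp.degree h2
      rw [map_add, Finsupp.degree_single, hm] at h3
      omega
    have h4 : ∀ i : Fin 2, Finsupp.single i 1 ≤ m ↔ m i ≠ 0 := by
      intro i
      rw [Finsupp.single_le_iff]
      omega
    by_cases h0 : m 0 = 0
    · have h5 : Finsupp.single 1 1 ≤ m := by rw [h4]; omega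
      rw [if_neg (by rw [h4]; simpa using h0), if_pos h5, hV, if_pos, (h1 1 h5).1, zero_add]
      refine ⟨(h1 1 h5).2, ?_⟩
      simp [h0]
    · have h5 : Finsupp.single 0 1 ≤ m := by rw [h4]; omega
      rw [if_pos h5, hU, if_pos (h1 0 h5).2, (h1 0 h5).1]
      split_ifs with h6
      · rw [hV, if_neg, add_zero]
        simp [h0]
      · rw [add_zero]

lemma degree_two_cases {m : Fin 2 →₀ ℕ} (h : m.degree ≤ 1) :
    m = 0 ∨ m = Finsupp.single 0 1 ∨ m = Finsupp.single 1 1 := by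
  rcases Nat.eq_zero_or_pos m.degree with h0 | h0
  · exact .inl ((Finsupp.degree_eq_zero_iff _).1 h0)
  · exact .inr (degree_eq_one (by omega))

/-- The effect on the obstruction of changing the lower left cocycles. -/
lemma trUp_relB_scal {X : H → MvPowerSeries (Fin 2) (Module.End K (S × R))}
    (h0 : ∀ a, coeff 0 (X a) = (σ.prod τ).A a) {f : Fin 2 → H → S →ₗ[K] R}
    {g : Fin 2 → H → R →ₗ[K] S}
    (h1 : ∀ i a, coeff (Finsupp.single i 1) (X a) = offDiag (f i a) (g i a))
    {k : H → R →ₗ[K] S} (hk : k ∈ τ.Z1 σ) {U : MvPowerSeries (Fin 2) K} {n : ℕ}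
    (hU : ∀ m, m.degree ≠ n → coeff m U = 0) {m : Fin 2 →₀ ℕ} (hm : m.degree = n + 1) :
    trUp K S R (coeff m (relB K Q X (fun a => scal U (offDiag 0 (k a))) +
      relB K Q (fun a => scal U (offDiag 0 (k a))) X)) =
      coeff m (U * monomial (Finsupp.single 0 1) (Rep.tau K Q R S k (f 0))) +
      coeff m (U * monomial (Finsupp.single 1 1) (Rep.tau K Q R S k (f 1))) := by
  -- The scalar series `U` factors out of the trace, leaving a scalar series `G` that does not
  -- depend on `U`.
  let G : MvPowerSeries (Fin 2) K := ∑ a, Q.ε K a •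
    (mapCoeff (trUp K S R ∘ₗ LinearMap.mulRight K (offDiag 0 (k a))) (X (Q.bar a)) +
      mapCoeff (trUp K S R ∘ₗ LinearMap.mulLeft K (offDiag 0 (k (Q.bar a)))) (X a))
  have hG : ∀ p, coeff p G = ∑ a, Q.ε K a • trUp K S R
      (coeff p (X (Q.bar a)) * offDiag 0 (k a) + offDiag 0 (k (Q.bar a)) * coeff p (X a)) := by
    intro p
    rw [map_sum]
    refine Finset.sum_congr rfl fun a _ => ?_
    rw [coeff_smul', map_add, map_add]
    rfl
  have hUG : trUp K S R (coeff m (relB K Q X (fun a => scal U (offDiag 0 (k a))) +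
      relB K Q (fun a => scal U (offDiag 0 (k a))) X)) = coeff m (U * G) := by
    rw [map_add, coeff_relB, coeff_relB, ← Finset.sum_add_distrib, map_sum, Finset.mul_sum, map_sum]
    refine Finset.sum_congr rfl fun a _ => ?_
    rw [← smul_add, map_smul, map_add, coeff_mul_scal, coeff_scal_mul, mul_smul_comm, coeff_smul',
      mul_add, map_add]
  -- The constant term is the trace of `d¹` of the cocycle `k`, while the linear terms below are its
  -- pairings with the cocycles `f i`.
  have hG0 : coeff 0 G = 0 := by
    have h2 : (σ.prod τ).dTot (σ.prod τ) (fun a => offDiag 0 (k a)) = 0 := by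
      rw [dTot_offDiag (f := fun _ => 0), hk.2]
      have : σ.dTot τ (fun _ => 0) = 0 := map_zero _
      rw [this]
      simp [offDiag]
    rw [hG]
    rw [Rep.dTot_apply] at h2
    have h3 := congrArg (trUp K S R) h2
    rw [map_zero] at h3
    rw [← h3]
    refine (Finset.sum_congr rfl fun a _ => ?_).trans (map_sum (trUp K S R) _ _).symm
    rw [h0, h0]
    exact (map_smul _ _ _).symm
  have hG1 : ∀ i : Fin 2, coeff (Finsupp.single i 1) G = Rep.tau K Q R S k (f i) := by
    intro i
    rw [hG]
    have h2 : Rep.tau K Q R S (g i) 0 = 0 := map_zero _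
    rw [← zero_add (Rep.tau K Q R S k (f i)), ← h2, ← sum_trUp_offDiag (f := f i) (g' := k),
      ← sum_trUp_offDiag (f := 0) (g' := g i), ← Finset.sum_add_distrib]
    refine Finset.sum_congr rfl fun a _ => ?_
    rw [h1, h1, map_add, smul_add]
    rfl
  rw [hUG, coeff_mul_linear (fun m hm => hU m hm.ne) hG0 hm, hG1, hG1]

/-- Solving the relation in one more degree. -/
lemma IsApprox.exists_succ [CharZero K] (h : σ.IsBrickPair τ) {N : ℕ} (hN : 1 ≤ N)
    {X : H → MvPowerSeries (Fin 2) (Module.End K (S × R))} (hX : IsApprox σ τ N X)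
    {f : Fin 2 → H → S →ₗ[K] R} {g : Fin 2 → H → R →ₗ[K] S}
    (h1 : ∀ i a, coeff (Finsupp.single i 1) (X a) = offDiag (f i a) (g i a))
    {k : Fin 2 → H → R →ₗ[K] S} (hk : ∀ i, k i ∈ τ.Z1 σ)
    (hkf : ∀ i j, Rep.tau K Q R S (k i) (f j) = if i = j then -1 else 0) :
    ∃ Y, IsApprox σ τ (N + 1) Y ∧ ∀ a m, m.degree ≤ N → coeff m (Y a) = coeff m (X a) := by
  classical
  -- A first correction `d` solves the relation in degree `N + 1`; it is zero in every other degree.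
  have hsol : ∀ m : Fin 2 →₀ ℕ, ∃ d ∈ (σ.prod τ).C1 (σ.prod τ),
      (∀ a, d a ∈ Par (m.degree : ZMod 2)) ∧ (m.degree ≠ N + 1 → d = 0) ∧
      (m.degree = N + 1 → (σ.prod τ).dTot (σ.prod τ) d = - coeff m (relB K Q X X)) := by
    intro m
    by_cases hm : m.degree = N + 1
    · obtain ⟨d, hd, hd1, hd2⟩ := h.exists_dTot_eq (n := (m.degree : ZMod 2))
        (c := - coeff m (relB K Q X X)) (neg_mem (coeff_relB_mem_C0 hX.graded m))
        (neg_mem (coeff_relB_mem_Par hX.par m)) (by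
          -- One trace vanishes by the approximation hypothesis, the other because the total trace
          -- does.
          have h2 : LinearMap.trace K _ (proj K S R 0 * coeff m (relB K Q X X)) = 0 := hX.tr m hm
          have h3 := trace_coeff_relB (Q := Q) X m
          rw [← one_mul (coeff m (relB K Q X X)), ← sum_proj (K := K) (S := S) (R := R),
            sum_zmod_two, add_mul, map_add, h2, zero_add] at h3
          intro p
          refine (congrArg (LinearMap.trace K _)
            (mul_neg (proj K S R p) (coeff m (relB K Q X X)))).trans ?_
          rw [map_neg, neg_eq_zero]
          rcases zmod_two_cases p with rfl | rfl
          · exact h2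
          · exact h3)
      exact ⟨d, hd, hd1, fun h => absurd hm h, fun _ => hd2⟩
    · exact ⟨0, zero_mem _, fun a => zero_mem _, fun _ => rfl, fun h => absurd h hm⟩
  choose d hdC hdP hd0 hd using hsol
  let δ : H → MvPowerSeries (Fin 2) (Module.End K (S × R)) := fun a m => d m a
  have hδ : ∀ a m, coeff m (δ a) = d m a := fun a m => rfl
  have hδ0 : ∀ a m, m.degree ≠ N + 1 → coeff m (δ a) = 0 := fun a m hm => by
    rw [hδ, hd0 m hm]; rfl
  let Z := X + δ
  have hZa : ∀ a, Z a = X a + δ a := fun _ => rfl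
  have hZ : ∀ a m, m.degree ≤ N → coeff m (Z a) = coeff m (X a) := by
    intro a m hm
    rw [hZa, map_add, hδ0 _ _ (by omega), add_zero]
  have hZg : ∀ a m, coeff m (Z a) ∈ (σ.prod τ).homG (σ.prod τ) (Q.s a) (Q.t a) := by
    intro a m
    rw [hZa, map_add]
    exact add_mem (hX.graded a m) (Rep.mem_C1.1 (hdC m) a)
  have hZp : ∀ a m, coeff m (Z a) ∈ Par (m.degree : ZMod 2) := by
    intro a m
    rw [hZa, map_add]
    exact add_mem (hX.par a m) (hdP m a)
  have hZ0 : ∀ a, coeff 0 (Z a) = (σ.prod τ).A a := fun a => by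
    rw [hZ _ _ (by simp), hX.zero]
  have hZ1 : ∀ i a, coeff (Finsupp.single i 1) (Z a) = offDiag (f i a) (g i a) := fun i a => by
    rw [hZ _ _ (by rwa [Finsupp.degree_single]), h1]
  have hZr : ∀ m, m.degree ≤ N + 1 → coeff m (relB K Q Z Z) = 0 := by
    intro m hm
    rw [coeff_relB_add (by omega) hX.zero (fun a m hm => hδ0 a m hm.ne) hm]
    by_cases hm' : m.degree = N + 1
    · have := hd m hm'
      exact (congrArg (coeff m (relB K Q X X) + ·) this).trans (add_neg_cancel _)
    · rw [hX.rel m (by omega), zero_add]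
      have : (fun a => coeff m (δ a)) = 0 := by
        funext a
        exact hδ0 a m hm'
      rw [this, map_zero]
  -- The trace obstruction left over in degree `N + 2` is written as a combination of the two
  -- variables; its coefficients, of degree `N + 1`, will multiply the cocycles `k 0` and `k 1`.
  obtain ⟨U, V, hUV, hUV0, hUVT⟩ :=
    exists_eq_mul_X_add (mapCoeff (trUp K S R) (relB K Q Z Z)) (N + 1)
  let W : Fin 2 → MvPowerSeries (Fin 2) K := ![U, V]
  have hW : ∀ i m, m.degree ≠ N + 1 → coeff m (W i) = 0 := by
    intro i m hm
    fin_cases i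
    · exact (hUV m hm).1
    · exact (hUV m hm).2
  -- The second correction is off-diagonal, so it is only allowed when `N + 1` is odd. Otherwise
  -- degree `N + 2` is odd, the obstruction is the trace of an odd map, and no correction is needed.
  have hWpar : ((N + 1 : ℕ) : ZMod 2) ≠ 1 → ∀ i, W i = 0 := by
    intro hpar
    have := hUV0 (fun m hm => by
      refine trace_proj_mul_of_odd ?_ 0
      have h2 := coeff_relB_mem_Par (Q := Q) hZp m
      rw [hm] at h2
      rcases zmod_two_cases ((N + 1 : ℕ) : ZMod 2) with h3 | h3
      · rw [Nat.cast_add (N + 1) 1, h3, zero_add, Nat.cast_one] at h2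
        exact h2
      · exact absurd h3 hpar)
    intro i
    fin_cases i
    · exact this.1
    · exact this.2
  let e : Fin 2 → H → MvPowerSeries (Fin 2) (Module.End K (S × R)) :=
    fun i a => scal (W i) (offDiag 0 (k i a))
  have he : ∀ i a m, coeff m (e i a) = coeff m (W i) • offDiag 0 (k i a) := fun i a m => rfl
  let D := e 0 + e 1
  have hDa : ∀ a, D a = e 0 a + e 1 a := fun _ => rfl
  have hD : ∀ a m, coeff m (D a) =
      coeff m (W 0) • offDiag 0 (k 0 a) + coeff m (W 1) • offDiag 0 (k 1 a) := fun a m => by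
    rw [hDa, map_add, he, he]
  have hD0 : ∀ a m, m.degree ≠ N + 1 → coeff m (D a) = 0 := by
    intro a m hm
    rw [hD, hW _ _ hm, hW _ _ hm, zero_smul, zero_smul, add_zero]
  have hDg : ∀ a m, coeff m (D a) ∈ (σ.prod τ).homG (σ.prod τ) (Q.s a) (Q.t a) := by
    intro a m
    rw [hD]
    exact add_mem
      (Submodule.smul_mem _ _ (offDiag_mem_homG (zero_mem _) (Rep.mem_C1.1 (hk 0).1 a)))
      (Submodule.smul_mem _ _ (offDiag_mem_homG (zero_mem _) (Rep.mem_C1.1 (hk 1).1 a)))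
  have hDp : ∀ a m, coeff m (D a) ∈ Par (m.degree : ZMod 2) := by
    intro a m
    by_cases hm : m.degree = N + 1
    · by_cases hpar : ((N + 1 : ℕ) : ZMod 2) = 1
      · rw [hD, hm, hpar]
        exact add_mem (Submodule.smul_mem _ _ (offDiag_mem_Par _ _))
          (Submodule.smul_mem _ _ (offDiag_mem_Par _ _))
      · rw [hD, hWpar hpar, hWpar hpar, coeff_zero, zero_smul, zero_smul, add_zero]
        exact zero_mem _
    · rw [hD0 a m hm]
      exact zero_mem _
  -- The second correction consists of cocycles, so it leaves the relation in degree `N + 1` intact.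
  have hdD : ∀ m, (σ.prod τ).dTot (σ.prod τ) (fun a => coeff m (D a)) = 0 := by
    intro m
    have h2 : ∀ i, (σ.prod τ).dTot (σ.prod τ) (fun a => offDiag 0 (k i a)) = 0 := by
      intro i
      rw [dTot_offDiag (f := fun _ => 0), (hk i).2]
      have : σ.dTot τ (fun _ => 0) = 0 := map_zero _
      rw [this]
      simp [offDiag]
    have h3 : (fun a => coeff m (D a)) = coeff m (W 0) • (fun a => offDiag 0 (k 0 a)) +
        coeff m (W 1) • (fun a => offDiag 0 (k 1 a)) := funext fun a => hD a m
    rw [h3, map_add, map_smul, map_smul, h2, h2, smul_zero, smul_zero, add_zero]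
  refine ⟨Z + D, ⟨fun a m => ?_, fun a m => ?_, fun a => ?_, fun m hm => ?_, fun m hm => ?_⟩,
    fun a m hm => ?_⟩
  · rw [Pi.add_apply, map_add]
    exact add_mem (hZg a m) (hDg a m)
  · rw [Pi.add_apply, map_add]
    exact add_mem (hZp a m) (hDp a m)
  · rw [Pi.add_apply, map_add, hZ0, hD0 _ _ (by simp), add_zero]
  · rw [coeff_relB_add (by omega) hZ0 (fun a m hm => hD0 a m hm.ne) hm, hdD, hZr m hm, add_zero]
  -- In degree `N + 2` only the terms linear in `D` change the trace. By the duality `hkf`, with its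
  -- value `-1`, they subtract exactly the obstruction.
  · have hDD : coeff m (relB K Q D D) = 0 := by
      rw [coeff_relB]
      refine Finset.sum_eq_zero fun a _ => ?_
      rw [coeff_mul_eq_zero (fun m hm => hD0 _ m hm.ne) (fun m hm => hD0 _ m hm.ne) (by omega),
        smul_zero]
    have hZD : relB K Q Z D + relB K Q D Z =
        (relB K Q Z (e 0) + relB K Q (e 0) Z) + (relB K Q Z (e 1) + relB K Q (e 1) Z) := by
      simp only [relB, ← Finset.sum_add_distrib]
      refine Finset.sum_congr rfl fun a _ => ?_
      simp only [hDa, mul_add, add_mul, smul_add]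
      abel
    have h3 : trUp K S R (coeff m (relB K Q Z (e 0) + relB K Q (e 0) Z)) = _ :=
      trUp_relB_scal hZ0 hZ1 (hk 0) (hW 0) hm
    have h4 : trUp K S R (coeff m (relB K Q Z (e 1) + relB K Q (e 1) Z)) = _ :=
      trUp_relB_scal hZ0 hZ1 (hk 1) (hW 1) hm
    rw [relB_add_add, map_add, map_add, map_add, hDD, hZD, map_zero, add_zero, map_add, map_add,
      map_add, h3, h4,
      hkf, hkf, hkf, hkf]
    have h2 := hUVT m hm
    rw [coeff_mapCoeff] at h2
    rw [← h2]
    simp [W, map_neg]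
    ring
  · rw [Pi.add_apply, map_add, hD0 _ _ (by omega), add_zero, hZ a m hm]

end DeformationExists

/-! ### The initial solution of order one and the limit of the approximations. -/

section DeformationLimit

open MvPowerSeries

variable {K : Type u} [Field K] {I H : Type} [Fintype I] [Fintype H] {Q : OrientedGraph I H}
variable {S R : Type u} [AddCommGroup S] [Module K S] [AddCommGroup R] [Module K R]
variable [FiniteDimensional K S] [FiniteDimensional K R]
variable {σ : Rep K Q S} {τ : Rep K Q R}

/-- The first approximation is a solution up to order one. -/
lemma exists_isApprox_one {f : Fin 2 → H → S →ₗ[K] R} {g : Fin 2 → H → R →ₗ[K] S}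
    (hf : ∀ i, f i ∈ σ.Z1 τ) (hg : ∀ i, g i ∈ τ.Z1 σ)
    (hgf : ∀ i j, Rep.tau K Q R S (g i) (f j) + Rep.tau K Q R S (g j) (f i) = 0)
    (hgf0 : ∀ i, Rep.tau K Q R S (g i) (f i) = 0) :
    ∃ X, IsApprox σ τ 1 X ∧
      ∀ i a, coeff (Finsupp.single i 1) (X a) = offDiag (f i a) (g i a) := by
  classical
  let A := (σ.prod τ).A
  let c : Fin 2 → H → Module.End K (S × R) := fun i a => offDiag (f i a) (g i a)
  let e : Fin 2 → (Fin 2 →₀ ℕ) := fun i => Finsupp.single i 1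
  have he : ∀ i, (e i).degree = 1 := fun i => Finsupp.degree_single _ _
  have he0 : ∀ i, e i ≠ 0 := fun i h => by
    have := he i
    rw [h] at this
    simp at this
  have hinj : ∀ i j, e i = e j → i = j := fun i j h =>
    Finsupp.single_left_injective one_ne_zero h
  let X : H → MvPowerSeries (Fin 2) (Module.End K (S × R)) :=
    fun a => monomial 0 (A a) + ∑ i, monomial (e i) (c i a)
  have hX : ∀ a m, coeff m (X a) = (if m = 0 then A a else 0) + ∑ i, if m = e i then c i a else 0 := by
    intro a m
    rw [map_add, map_sum, coeff_monomial]
    simp only [coeff_monomial]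
  have hX0 : ∀ a, coeff 0 (X a) = A a := by
    intro a
    rw [hX, if_pos rfl, Finset.sum_eq_zero fun i _ => if_neg (he0 i).symm, add_zero]
  have hX1 : ∀ i a, coeff (e i) (X a) = c i a := by
    intro i a
    rw [hX, if_neg (he0 i), zero_add, Finset.sum_eq_single i, if_pos rfl]
    · intro j _ hj
      exact if_neg fun h => hj (hinj _ _ h).symm
    · simp
  have hX2 : ∀ m, m ≠ 0 → (∀ i, m ≠ e i) → ∀ a, coeff m (X a) = 0 := by
    intro m h0 h a
    rw [hX, if_neg h0, zero_add]
    exact Finset.sum_eq_zero fun i _ => if_neg (h i)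
  refine ⟨X, ⟨fun a m => ?_, fun a m => ?_, hX0, fun m hm => ?_, fun m hm => ?_⟩, hX1⟩
  · by_cases h0 : m = 0
    · rw [h0, hX0]
      exact Rep.A_mem _ a
    by_cases h1 : ∃ i, m = e i
    · obtain ⟨i, rfl⟩ := h1
      rw [hX1]
      exact offDiag_mem_homG (Rep.mem_C1.1 (hf i).1 a) (Rep.mem_C1.1 (hg i).1 a)
    · push Not at h1
      rw [hX2 m h0 h1]
      exact zero_mem _
  · by_cases h0 : m = 0
    · rw [h0, hX0, map_zero, Nat.cast_zero]
      exact prod_A_mem σ τ a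
    by_cases h1 : ∃ i, m = e i
    · obtain ⟨i, rfl⟩ := h1
      rw [hX1, he, Nat.cast_one]
      exact offDiag_mem_Par _ _
    · push Not at h1
      rw [hX2 m h0 h1]
      exact zero_mem _
  · rw [coeff_relB]
    by_cases h0 : m = 0
    · subst h0
      rw [← (σ.prod τ).rel_tot]
      refine Finset.sum_congr rfl fun a _ => ?_
      rw [coeff_mul]
      simp [hX0]
      rfl
    · have h1 : ∃ i, m = e i := by
        rcases degree_two_cases hm with h | h | h
        · exact absurd h h0
        · exact ⟨0, h⟩
        · exact ⟨1, h⟩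
      obtain ⟨i, rfl⟩ := h1
      -- In degree one the relation says that the linear coefficients are cocycles.
      have h2 : (σ.prod τ).dTot (σ.prod τ) (c i) = 0 := by
        rw [dTot_offDiag, (hf i).2, (hg i).2]
        simp [offDiag]
      rw [Rep.dTot_apply] at h2
      refine Eq.trans (Finset.sum_congr rfl fun a _ => ?_) h2
      have h3 : Finset.HasAntidiagonal.antidiagonal (e i) = {(0, e i), (e i, 0)} := by
        ext ⟨p, q⟩
        rw [Finset.HasAntidiagonal.mem_antidiagonal]
        simp only [Finset.mem_insert, Finset.mem_singleton, Prod.mk.injEq]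
        constructor
        · intro h
          have h4 := congrArg Finsupp.degree h
          rw [map_add, he] at h4
          rcases Nat.eq_zero_or_pos p.degree with h5 | h5
          · rw [Finsupp.degree_eq_zero_iff] at h5
            left
            exact ⟨h5, by rwa [h5, zero_add] at h⟩
          · have h6 : q.degree = 0 := by omega
            rw [Finsupp.degree_eq_zero_iff] at h6
            right
            exact ⟨by rwa [h6, add_zero] at h, h6⟩
        · rintro (⟨rfl, rfl⟩ | ⟨rfl, rfl⟩) <;> simp
      rw [coeff_mul, h3, Finset.sum_pair (fun h => he0 i (congrArg Prod.fst h).symm)]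
      rw [hX0, hX0, hX1, hX1]
      rfl
  · have h1 : ∀ a, coeff m (X (Q.bar a) * X a) =
        ∑ i, ∑ j, if m = e i + e j then c i (Q.bar a) * c j a else 0 := by
      intro a
      have h2 : ∀ n b, n.degree < 2 → coeff m (monomial n b) = (0 : Module.End K (S × R)) := by
        intro n b hn
        rw [coeff_monomial, if_neg]
        rintro rfl
        omega
      simp only [X, mul_add, add_mul, Finset.sum_mul, Finset.mul_sum, monomial_mul_monomial, map_add,
        map_sum, Finset.sum_add_distrib]
      have h4 : ∀ b : Fin 2 → Module.End K (S × R), ∑ i, coeff m (monomial (0 + e i) (b i)) = 0 :=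
        fun b => Finset.sum_eq_zero fun i _ => h2 _ _ (by simp [he])
      have h5 : ∀ b : Fin 2 → Module.End K (S × R), ∑ i, coeff m (monomial (e i + 0) (b i)) = 0 :=
        fun b => Finset.sum_eq_zero fun i _ => h2 _ _ (by simp [he])
      rw [h2 _ _ (by simp), h4, h5, zero_add, zero_add, zero_add, Finset.sum_comm]
      simp only [coeff_monomial]
    -- The obstruction in degree two is a quadratic form in the variables whose coefficients are
    -- values of `τ₁`; `hgf` and `hgf0` say that its symmetrization vanishes.
    have h3 : trUp K S R (coeff m (relB K Q X X)) =
        ∑ i, ∑ j, if m = e i + e j then Rep.tau K Q R S (g i) (f j) else 0 := by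
      rw [coeff_relB, map_sum]
      simp only [h1, map_smul, map_sum, Finset.smul_sum]
      rw [Finset.sum_comm]
      refine Finset.sum_congr rfl fun i _ => ?_
      rw [Finset.sum_comm]
      refine Finset.sum_congr rfl fun j _ => ?_
      split_ifs
      · exact sum_trUp_offDiag _ _ _ _
      · simp
    rw [h3, Fin.sum_univ_two, Fin.sum_univ_two, Fin.sum_univ_two, hgf0, hgf0, add_comm (e 1) (e 0)]
    split_ifs <;> simp [hgf]

/-- The passage to the limit of successive approximations. -/
lemma exists_relB_eq_zero [CharZero K] (h : σ.IsBrickPair τ)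
    {f : Fin 2 → H → S →ₗ[K] R} {g : Fin 2 → H → R →ₗ[K] S}
    (hf : ∀ i, f i ∈ σ.Z1 τ) (hg : ∀ i, g i ∈ τ.Z1 σ)
    (hgf : ∀ i j, Rep.tau K Q R S (g i) (f j) + Rep.tau K Q R S (g j) (f i) = 0)
    (hgf0 : ∀ i, Rep.tau K Q R S (g i) (f i) = 0)
    {k : Fin 2 → H → R →ₗ[K] S} (hk : ∀ i, k i ∈ τ.Z1 σ)
    (hkf : ∀ i j, Rep.tau K Q R S (k i) (f j) = if i = j then -1 else 0) :
    ∃ X : H → MvPowerSeries (Fin 2) (Module.End K (S × R)),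
      (∀ a m, coeff m (X a) ∈ (σ.prod τ).homG (σ.prod τ) (Q.s a) (Q.t a)) ∧
      (∀ a m, coeff m (X a) ∈ Par (m.degree : ZMod 2)) ∧
      (∀ a, coeff 0 (X a) = (σ.prod τ).A a) ∧
      (∀ i a, coeff (Finsupp.single i 1) (X a) = offDiag (f i a) (g i a)) ∧
      relB K Q X X = 0 := by
  obtain ⟨X₁, hX₁, hX₁'⟩ := exists_isApprox_one hf hg hgf hgf0
  -- The index is shifted by one, since the construction starts with a solution of order one.
  let P : ℕ → (H → MvPowerSeries (Fin 2) (Module.End K (S × R))) → Prop := fun N X =>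
    IsApprox σ τ (N + 1) X ∧ ∀ i a, coeff (Finsupp.single i 1) (X a) = offDiag (f i a) (g i a)
  have hstep : ∀ N (X : {X // P N X}), ∃ Y : {Y // P (N + 1) Y},
      ∀ a m, m.degree ≤ N + 1 → coeff m (Y.1 a) = coeff m (X.1 a) := by
    rintro N ⟨X, hX, hX'⟩
    obtain ⟨Y, hY, hYX⟩ := hX.exists_succ h (by omega) hX' hk hkf
    exact ⟨⟨Y, hY, fun i a => by rw [hYX _ _ (by rw [Finsupp.degree_single]; omega), hX']⟩, hYX⟩
  choose F hF using hstep
  let Y : ∀ N, {Y // P N Y} := fun N => Nat.rec ⟨X₁, hX₁, hX₁'⟩ (fun N X => F N X) N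
  have hY : ∀ N d a m, m.degree ≤ N + 1 → coeff m ((Y (N + d)).1 a) = coeff m ((Y N).1 a) := by
    intro N d a m hm
    induction d with
    | zero => rfl
    | succ d ih =>
      rw [← ih]
      exact hF (N + d) (Y (N + d)) a m (by omega)
  -- The coefficient at `m` is read from the approximation with index `m.degree`, after which it no
  -- longer changes.
  let X : H → MvPowerSeries (Fin 2) (Module.End K (S × R)) :=
    fun a m => coeff m ((Y m.degree).1 a)
  have hX : ∀ N a m, m.degree ≤ N → coeff m (X a) = coeff m ((Y N).1 a) := by
    intro N a m hm
    obtain ⟨d, rfl⟩ := Nat.exists_eq_add_of_le hm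
    exact (hY _ d a m (by omega)).symm
  refine ⟨X, fun a m => ?_, fun a m => ?_, fun a => ?_, fun i a => ?_, ?_⟩
  · rw [hX _ a m le_rfl]
    exact (Y _).2.1.graded a m
  · rw [hX _ a m le_rfl]
    exact (Y _).2.1.par a m
  · rw [hX _ a 0 le_rfl]
    exact (Y _).2.1.zero a
  · rw [hX _ a _ le_rfl]
    exact (Y _).2.2 i a
  · ext1 m
    rw [coeff_relB_eq_of_agree Q (fun a p hp => hX m.degree a p hp) le_rfl,
      (Y _).2.1.rel m (by omega), coeff_zero]

end DeformationLimit

/-! ### Power series in two commuting elements of the Kronecker preprojective algebra. -/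

section KroneckerSeries

variable (K : Type u) [Field K]

/-- The first of two commuting generators of the preprojective algebra of the Kronecker quiver. -/
def kronX : Pre K kronecker := preA K kronecker (0, false) - preA K kronecker (1, true)

/-- The second of two commuting generators of the preprojective algebra of the Kronecker quiver. -/
def kronY : Pre K kronecker := preA K kronecker (1, false) + preA K kronecker (0, true)

lemma preV_mul_preA (i : Fin 2) (a : Fin 2 × Bool) : preV K kronecker i * preA K kronecker a =
    if i = kronecker.t a then preA K kronecker a else 0 := by
  rw [← preV_preA, ← mul_assoc, preV_mul]
  split_ifs with h
  · rw [h]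
  · rw [zero_mul]

lemma preA_mul_preV (i : Fin 2) (a : Fin 2 × Bool) : preA K kronecker a * preV K kronecker i =
    if i = kronecker.s a then preA K kronecker a else 0 := by
  rw [← preA_preV, mul_assoc, preV_mul]
  by_cases h : i = kronecker.s a
  · rw [if_pos h, if_pos h.symm]
  · rw [if_neg h, if_neg (Ne.symm h), mul_zero]

lemma preA_mul_preA_eq_zero {a b : Fin 2 × Bool} (h : kronecker.s a ≠ kronecker.t b) :
    preA K kronecker a * preA K kronecker b = 0 := by
  rw [← preV_preA K kronecker b, ← mul_assoc, preA_mul_preV, if_neg h.symm, zero_mul]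

lemma kron_ε (k : Fin 2) (b : Bool) : kronecker.ε K (k, b) = if b then -1 else 1 := by
  cases b <;> simp [OrientedGraph.ε, kronecker]

lemma kron_rel_zero : preA K kronecker (0, true) * preA K kronecker (0, false) +
    preA K kronecker (1, true) * preA K kronecker (1, false) = 0 := by
  classical
  have h := preA_rel K kronecker 0
  have h1 : kronecker.out 0 = {(0, false), (1, false)} := by
    ext ⟨k, b⟩
    rw [kronecker.mem_out]
    fin_cases k <;> cases b <;> simp [kronecker]
  rw [h1, Finset.sum_pair (by simp), kron_ε, kron_ε] at h
  simp only [Bool.false_eq_true, if_false, one_smul] at h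
  exact h

lemma kron_rel_one : preA K kronecker (0, false) * preA K kronecker (0, true) +
    preA K kronecker (1, false) * preA K kronecker (1, true) = 0 := by
  classical
  have h := preA_rel K kronecker 1
  have h1 : kronecker.out 1 = {(0, true), (1, true)} := by
    ext ⟨k, b⟩
    rw [kronecker.mem_out]
    fin_cases k <;> cases b <;> simp [kronecker]
  rw [h1, Finset.sum_pair (by simp)] at h
  have h2 : -(preA K kronecker (0, false) * preA K kronecker (0, true)) +
    -(preA K kronecker (1, false) * preA K kronecker (1, true)) = 0 := by
    rw [kron_ε, kron_ε] at h
    simp only [if_true, neg_one_smul] at h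
    exact h
  rw [← neg_add, neg_eq_zero] at h2
  exact h2

/-- With `x = α - β̄` and `y = β + ᾱ` one has `xy = αᾱ - β̄β` and `yx = ᾱα - ββ̄`, and the relations
at the two vertices identify these expressions. -/
lemma kron_commute : Commute (kronX K) (kronY K) := by
  have h0 := kron_rel_zero K
  have h1 := kron_rel_one K
  have h2 := preA_mul_preA_eq_zero K (a := (0, false)) (b := (1, false)) (by simp [kronecker])
  have h3 := preA_mul_preA_eq_zero K (a := (1, true)) (b := (0, true)) (by simp [kronecker])
  have h4 := preA_mul_preA_eq_zero K (a := (1, false)) (b := (0, false)) (by simp [kronecker])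
  have h5 := preA_mul_preA_eq_zero K (a := (0, true)) (b := (1, true)) (by simp [kronecker])
  unfold Commute SemiconjBy kronX kronY
  rw [sub_mul, mul_add, mul_add, add_mul, mul_sub, mul_sub, h2, h3, h4, h5,
    eq_neg_of_add_eq_zero_left h0, eq_neg_of_add_eq_zero_left h1]
  abel

lemma kronX_mul_preV (p : Fin 2) :
    kronX K * preV K kronecker p = preV K kronecker p.rev * kronX K := by
  unfold kronX
  rw [sub_mul, mul_sub]
  simp only [preA_mul_preV, preV_mul_preA]
  fin_cases p <;> simp [kronecker]

lemma kronY_mul_preV (p : Fin 2) :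
    kronY K * preV K kronecker p = preV K kronecker p.rev * kronY K := by
  unfold kronY
  rw [add_mul, mul_add]
  simp only [preA_mul_preV, preV_mul_preA]
  fin_cases p <;> simp [kronecker]

lemma pow_mul_preV {x : Pre K kronecker}
    (hx : ∀ p : Fin 2, x * preV K kronecker p = preV K kronecker p.rev * x) (n : ℕ) (p : Fin 2) :
    x ^ n * preV K kronecker p = preV K kronecker (Fin.rev^[n] p) * x ^ n := by
  induction n generalizing p with
  | zero => simp
  | succ n ih =>
    rw [pow_succ, mul_assoc, hx, ← mul_assoc, ih, Function.iterate_succ_apply, mul_assoc]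

/-- The monomials in the commuting generators. -/
def kronMon (m : Fin 2 →₀ ℕ) : Pre K kronecker := kronX K ^ m 0 * kronY K ^ m 1

lemma kronMon_add (p q : Fin 2 →₀ ℕ) : kronMon K (p + q) = kronMon K p * kronMon K q := by
  unfold kronMon
  rw [Finsupp.add_apply, Finsupp.add_apply, pow_add, pow_add, mul_assoc, mul_assoc, ← mul_assoc _ _ (kronY K ^ q 1),
    ← mul_assoc (kronY K ^ p 1), ((kron_commute K).pow_pow (q 0) (p 1)).eq]

lemma kronMon_zero : kronMon K 0 = 1 := by
  simp [kronMon]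

lemma kronMon_single_zero : kronMon K (Finsupp.single 0 1) = kronX K := by
  simp [kronMon]

lemma kronMon_single_one : kronMon K (Finsupp.single 1 1) = kronY K := by
  simp [kronMon]

lemma kronMon_mem (m : Fin 2 →₀ ℕ) : kronMon K m ∈ augIdeal K kronecker ^ m.degree := by
  rw [Finsupp.degree_eq_sum, Fin.sum_univ_two, Ideal.IsTwoSided.pow_add]
  exact Ideal.mul_mem_mul
    (Ideal.pow_mem_pow (sub_mem (preA_mem_augIdeal _ _ _) (preA_mem_augIdeal _ _ _)) _)
    (Ideal.pow_mem_pow (add_mem (preA_mem_augIdeal _ _ _) (preA_mem_augIdeal _ _ _)) _)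

/-- Each of the two generators exchanges the vertices. Monomials of even degree thus connect a
vertex with itself and those of odd degree connect different vertices, which matches the parity
imposed on coefficients in `End(S × R)`. -/
lemma kronMon_mul_preV {m : Fin 2 →₀ ℕ} {q p : Fin 2} (h : Even m.degree ↔ q = p) :
    kronMon K m * preV K kronecker p = preV K kronecker q * kronMon K m := by
  unfold kronMon
  rw [mul_assoc, pow_mul_preV K (kronY_mul_preV K), ← mul_assoc, pow_mul_preV K (kronX_mul_preV K),
    mul_assoc, ← Function.iterate_add_apply]
  congr 2
  rw [Finsupp.degree_eq_sum, Fin.sum_univ_two] at h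
  have hinv : Function.Involutive (Fin.rev : Fin 2 → Fin 2) := Fin.rev_involutive
  by_cases hm : Even (m 0 + m 1)
  · rw [hinv.iterate_even hm, h.1 hm]
    rfl
  · rw [hinv.iterate_odd (Nat.not_even_iff_odd.1 hm)]
    have hqp : ∀ q p : Fin 2, q ≠ p → p.rev = q := by decide
    exact hqp q p (mt h.2 hm)

/-- The monomials of degree less than `n`. -/
def lowMon (n : ℕ) : Finset (Fin 2 →₀ ℕ) := (Finsupp.finite_of_degree_lt n).toFinset

lemma mem_lowMon {n : ℕ} {m : Fin 2 →₀ ℕ} : m ∈ lowMon n ↔ m.degree < n := by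
  simp [lowMon]

/-- The value of a truncated power series at the commuting generators. -/
def kronTrunc (c : (Fin 2 →₀ ℕ) → K) (n : ℕ) : Pre K kronecker :=
  ∑ m ∈ lowMon n, c m • kronMon K m

lemma kronTrunc_succ_sub (c : (Fin 2 →₀ ℕ) → K) (n : ℕ) :
    kronTrunc K c (n + 1) - kronTrunc K c n ∈ augIdeal K kronecker ^ n := by
  classical
  have hsub : lowMon n ⊆ lowMon (n + 1) := fun m hm => by
    rw [mem_lowMon] at hm ⊢
    omega
  rw [kronTrunc, kronTrunc, ← Finset.sum_sdiff hsub, add_sub_cancel_right]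
  refine sum_mem fun m hm => ?_
  rw [Finset.mem_sdiff, mem_lowMon, mem_lowMon] at hm
  rw [show n = m.degree by omega, Algebra.smul_def]
  exact Ideal.mul_mem_left _ _ (kronMon_mem K m)

/-- Evaluation of power series at the commuting generators. -/
def kronEval : ((Fin 2 →₀ ℕ) → K) →ₗ[K] PiAlg K where
  toFun c := Lam.mk (kronTrunc K c) (kronTrunc_succ_sub K c)
  map_add' c d := by
    refine Lam.ext fun n => ?_
    rw [map_add, projLam_mk, projLam_mk, projLam_mk, ← map_add]
    simp only [kronTrunc, Pi.add_apply, add_smul, Finset.sum_add_distrib]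
  map_smul' k c := by
    refine Lam.ext fun n => ?_
    rw [RingHom.id_apply, map_smul, projLam_mk, projLam_mk]
    refine Eq.trans ?_ (map_smul (Ideal.Quotient.mkₐ K (augIdeal K kronecker ^ n)) k _)
    simp only [kronTrunc, Pi.smul_apply, smul_assoc, Finset.smul_sum]
    rfl

variable {K}

lemma projLam_kronEval (c : (Fin 2 →₀ ℕ) → K) (n : ℕ) :
    projLam K kronecker n (kronEval K c) = Ideal.Quotient.mk _ (kronTrunc K c n) := rfl

lemma kronEval_mem {c : (Fin 2 →₀ ℕ) → K} {n : ℕ} (h : ∀ m, m.degree < n → c m = 0) :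
    kronEval K c ∈ radIdeal K kronecker ^ n := by
  rw [radIdeal_pow_eq, mem_kerLam, projLam_kronEval, kronTrunc, Finset.sum_eq_zero, map_zero]
  intro m hm
  rw [h m (mem_lowMon.1 hm), zero_smul]

lemma kronEval_single (m : Fin 2 →₀ ℕ) :
    kronEval K (Pi.single m 1) = toLam K kronecker (kronMon K m) := by
  classical
  refine Lam.ext fun n => ?_
  rw [projLam_kronEval, projLam_toLam, kronTrunc]
  by_cases hm : m ∈ lowMon n
  · rw [Finset.sum_eq_single m]
    · simp
    · intro p _ hp
      rw [Pi.single_eq_of_ne hp, zero_smul]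
    · exact fun h => absurd hm h
  · rw [Finset.sum_eq_zero, map_zero, eq_comm, Ideal.Quotient.eq_zero_iff_mem]
    · rw [mem_lowMon, not_lt] at hm
      exact Ideal.pow_le_pow_right hm (kronMon_mem K m)
    · intro p hp
      rw [Pi.single_eq_of_ne (by rintro rfl; exact hm hp), zero_smul]

lemma kronEval_mul_vtx {c : (Fin 2 →₀ ℕ) → K} {q p : Fin 2}
    (h : ∀ m, ¬ (Even m.degree ↔ q = p) → c m = 0) :
    kronEval K c * vtx K kronecker p = vtx K kronecker q * kronEval K c := by
  refine Lam.ext fun n => ?_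
  rw [map_mul, map_mul, projLam_kronEval]
  refine Eq.trans (map_mul (Ideal.Quotient.mk (augIdeal K kronecker ^ n)) _
    (preV K kronecker p)).symm ?_
  refine Eq.trans ?_ (map_mul (Ideal.Quotient.mk (augIdeal K kronecker ^ n))
    (preV K kronecker q) _)
  congr 1
  rw [kronTrunc, Finset.sum_mul, Finset.mul_sum]
  refine Finset.sum_congr rfl fun m _ => ?_
  by_cases hm : Even m.degree ↔ q = p
  · rw [smul_mul_assoc, mul_smul_comm, kronMon_mul_preV K hm]
  · rw [h m hm, zero_smul, zero_mul, mul_zero]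

lemma kronEval_mul (c d : (Fin 2 →₀ ℕ) → K) :
    kronEval K (fun m => ∑ p ∈ Finset.HasAntidiagonal.antidiagonal m, c p.1 * d p.2) =
      kronEval K c * kronEval K d := by
  classical
  refine Lam.ext fun n => ?_
  rw [map_mul, projLam_kronEval, projLam_kronEval, projLam_kronEval, ← map_mul, Ideal.Quotient.eq]
  have h1 : kronTrunc K c n * kronTrunc K d n =
      ∑ p ∈ lowMon n ×ˢ lowMon n, (c p.1 * d p.2) • kronMon K (p.1 + p.2) := by
    rw [kronTrunc, kronTrunc, Finset.sum_mul_sum, Finset.sum_product]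
    refine Finset.sum_congr rfl fun p _ => Finset.sum_congr rfl fun q _ => ?_
    rw [kronMon_add, smul_mul_smul_comm]
  have h2 : kronTrunc K (fun m => ∑ p ∈ Finset.HasAntidiagonal.antidiagonal m, c p.1 * d p.2) n =
      ∑ p ∈ (lowMon n ×ˢ lowMon n).filter fun p => p.1 + p.2 ∈ lowMon n,
        (c p.1 * d p.2) • kronMon K (p.1 + p.2) := by
    rw [kronTrunc, ← Finset.sum_fiberwise_of_maps_to (t := lowMon n)
      (g := fun p : (Fin 2 →₀ ℕ) × (Fin 2 →₀ ℕ) => p.1 + p.2)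
      (fun p hp => (Finset.mem_filter.1 hp).2)]
    refine Finset.sum_congr rfl fun m hm => ?_
    rw [Finset.sum_smul]
    have h3 : ((lowMon n ×ˢ lowMon n).filter fun p => p.1 + p.2 ∈ lowMon n).filter
        (fun p => p.1 + p.2 = m) = Finset.HasAntidiagonal.antidiagonal m := by
      ext p
      simp only [Finset.mem_filter, Finset.mem_product, mem_lowMon,
        Finset.HasAntidiagonal.mem_antidiagonal]
      rw [mem_lowMon] at hm
      constructor
      · exact fun h => h.2
      · intro h
        have h4 := congrArg Finsupp.degree h
        rw [map_add] at h4
        refine ⟨⟨⟨?_, ?_⟩, ?_⟩, h⟩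
        · omega
        · omega
        · rwa [h]
    rw [h3]
    refine Finset.sum_congr rfl fun p hp => ?_
    rw [Finset.HasAntidiagonal.mem_antidiagonal.1 hp]
  -- The two truncations differ by terms of total degree at least `n`, which lie in `J ^ n`.
  rw [h1, h2, ← Finset.sum_filter_add_sum_filter_not (lowMon n ×ˢ lowMon n)
    (fun p => p.1 + p.2 ∈ lowMon n), sub_add_cancel_left]
  refine neg_mem (sum_mem fun p hp => ?_)
  have h5 := (Finset.mem_filter.1 hp).2
  rw [mem_lowMon, not_lt] at h5
  rw [Algebra.smul_def]
  exact Ideal.mul_mem_left _ _ (Ideal.pow_le_pow_right h5 (kronMon_mem K _))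

end KroneckerSeries

/-! ### Evaluation of vector-valued series in `B ⊗ Π`. -/

section TensorSeries

variable {K : Type u} [Field K]
variable {B B' B'' : Type*} [AddCommGroup B] [Module K B] [FiniteDimensional K B]
  [AddCommGroup B'] [Module K B'] [FiniteDimensional K B']
  [AddCommGroup B''] [Module K B''] [FiniteDimensional K B'']

/-- Evaluation of power series with coefficients in a finite dimensional space. -/
def serEval : ((Fin 2 →₀ ℕ) → B) →ₗ[K] B ⊗[K] PiAlg K :=
  ∑ i, TensorProduct.mk K B (PiAlg K) (Module.finBasis K B i) ∘ₗ kronEval K ∘ₗ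
    ((Module.finBasis K B).coord i).compLeft (Fin 2 →₀ ℕ)

lemma serEval_smul (c : (Fin 2 →₀ ℕ) → K) (b : B) :
    serEval (fun m => c m • b) = b ⊗ₜ[K] kronEval K c := by
  have h : ∀ i, ((Module.finBasis K B).coord i).compLeft (Fin 2 →₀ ℕ) (fun m => c m • b) =
      (Module.finBasis K B).coord i b • c := by
    intro i
    funext m
    simp [mul_comm]
  rw [serEval, LinearMap.sum_apply]
  simp only [LinearMap.comp_apply, h, map_smul, TensorProduct.mk_apply]
  conv_rhs => rw [← (Module.finBasis K B).sum_repr b, TensorProduct.sum_tmul]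
  refine Finset.sum_congr rfl fun i _ => ?_
  rw [TensorProduct.smul_tmul']
  rfl

/-- Series with coefficients in a finite dimensional space are sums of multiples of vectors by
scalar series. -/
lemma series_induction {p : ((Fin 2 →₀ ℕ) → B) → Prop}
    (hadd : ∀ F G, p F → p G → p (F + G)) (hsmul : ∀ (c : (Fin 2 →₀ ℕ) → K) (b : B), p (fun m => c m • b))
    (F : (Fin 2 →₀ ℕ) → B) : p F := by
  have h0 : p 0 := by
    have := hsmul 0 0
    simp only [smul_zero] at this
    exact this
  have hF : F = ∑ i, fun m => (Module.finBasis K B).coord i (F m) • Module.finBasis K B i := by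
    funext m
    rw [Finset.sum_apply]
    exact ((Module.finBasis K B).sum_repr (F m)).symm
  rw [hF]
  exact Finset.sum_induction _ p hadd h0 fun i _ => hsmul _ _

lemma serEval_map (φ : B →ₗ[K] B') (F : (Fin 2 →₀ ℕ) → B) :
    serEval (fun m => φ (F m)) = φ.rTensor (PiAlg K) (serEval F) := by
  refine series_induction (K := K) (p := fun F => serEval (fun m => φ (F m)) =
    φ.rTensor (PiAlg K) (serEval F)) (fun F G hF hG => ?_) (fun c b => ?_) F
  · rw [map_add, map_add, ← hF, ← hG, ← map_add]
    congr 1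
    funext m
    exact map_add _ _ _
  · simp only [map_smul]
    rw [serEval_smul, serEval_smul, LinearMap.rTensor_tmul]

lemma serEval_mul (μ : B →ₗ[K] B' →ₗ[K] B'') (F : (Fin 2 →₀ ℕ) → B) (G : (Fin 2 →₀ ℕ) → B') :
    TensorProduct.map₂ μ (LinearMap.mul K (PiAlg K)) (serEval F) (serEval G) =
      serEval (fun m => ∑ p ∈ Finset.HasAntidiagonal.antidiagonal m, μ (F p.1) (G p.2)) := by
  let p : ((Fin 2 →₀ ℕ) → B) → ((Fin 2 →₀ ℕ) → B') → Prop := fun F G =>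
    TensorProduct.map₂ μ (LinearMap.mul K (PiAlg K)) (serEval F) (serEval G) =
      serEval (fun m => ∑ p ∈ Finset.HasAntidiagonal.antidiagonal m, μ (F p.1) (G p.2))
  refine series_induction (K := K) (p := fun F => p F G) (fun F F' hF hF' => ?_) (fun c b => ?_) F
  · simp only [p] at hF hF' ⊢
    rw [map_add, map_add, LinearMap.add_apply, hF, hF', ← map_add]
    congr 1
    funext m
    simp [Finset.sum_add_distrib]
  · refine series_induction (K := K) (p := p _) (fun G G' hG hG' => ?_) (fun d b' => ?_) G
    · simp only [p] at hG hG' ⊢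
      rw [map_add, map_add, hG, hG', ← map_add]
      congr 1
      funext m
      simp [Finset.sum_add_distrib]
    · simp only [p]
      rw [serEval_smul, serEval_smul, TensorProduct.map₂_apply_tmul, TensorProduct.map_tmul, LinearMap.mul_apply',
        ← kronEval_mul, ← serEval_smul]
      congr 1
      funext m
      rw [Finset.sum_smul]
      refine Finset.sum_congr rfl fun p _ => ?_
      simp [smul_smul, mul_comm]

lemma serEval_mem {F : (Fin 2 →₀ ℕ) → B} {n : ℕ} (h : ∀ m, m.degree < n → F m = 0) :
    serEval F ∈ Submodule.map₂ (TensorProduct.mk K B (PiAlg K)) ⊤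
      ((radIdeal K kronecker ^ n).restrictScalars K) := by
  rw [serEval, LinearMap.sum_apply]
  refine sum_mem fun i _ => Submodule.apply_mem_map₂ _ trivial ?_
  refine kronEval_mem fun m hm => ?_
  simp [h m hm]

lemma serEval_mul_vtx {F : (Fin 2 →₀ ℕ) → B} {q p : Fin 2}
    (h : ∀ m, ¬ (Even m.degree ↔ q = p) → F m = 0) :
    (LinearMap.mulRight K (vtx K kronecker p)).lTensor B (serEval F) =
      (LinearMap.mulLeft K (vtx K kronecker q)).lTensor B (serEval F) := by
  rw [serEval, LinearMap.sum_apply, map_sum, map_sum]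
  refine Finset.sum_congr rfl fun i _ => ?_
  simp only [LinearMap.comp_apply, TensorProduct.mk_apply, LinearMap.lTensor_tmul,
    LinearMap.mulRight_apply, LinearMap.mulLeft_apply]
  rw [kronEval_mul_vtx]
  intro m hm
  simp [h m hm]

end TensorSeries

/-! ### Parity, idempotents and leading terms of evaluated series. -/

section UniversalLiftingExists

variable {K : Type u} [Field K] {I H : Type} [Fintype I] [Fintype H] {Q : OrientedGraph I H}

variable (K) in
/-- Right multiplication of the coefficients by the idempotent `e_p`. -/
def rightVtx (B : Type*) [AddCommGroup B] [Module K B] (p : Fin 2) :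
    B ⊗[K] PiAlg K →ₗ[K] B ⊗[K] PiAlg K :=
  (LinearMap.mulRight K (vtx K kronecker p)).lTensor B

variable (K) in
/-- Left multiplication of the coefficients by the idempotent `e_q`. -/
def leftVtx (B : Type*) [AddCommGroup B] [Module K B] (q : Fin 2) :
    B ⊗[K] PiAlg K →ₗ[K] B ⊗[K] PiAlg K :=
  (LinearMap.mulLeft K (vtx K kronecker q)).lTensor B

section

variable {B : Type*} [AddCommGroup B] [Module K B]

lemma rightVtx_tmul (p : Fin 2) (b : B) (x : PiAlg K) :
    rightVtx K B p (b ⊗ₜ x) = b ⊗ₜ (x * vtx K kronecker p) := rfl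

lemma leftVtx_tmul (q : Fin 2) (b : B) (x : PiAlg K) :
    leftVtx K B q (b ⊗ₜ x) = b ⊗ₜ (vtx K kronecker q * x) := rfl

lemma rightVtx_rightVtx (p : Fin 2) (t : B ⊗[K] PiAlg K) :
    rightVtx K B p (rightVtx K B p t) = rightVtx K B p t := by
  induction t with
  | zero => simp
  | add x y hx hy => rw [map_add, map_add, hx, hy]
  | tmul b x => rw [rightVtx_tmul, rightVtx_tmul, mul_assoc, vtx_mul, if_pos rfl]

lemma leftVtx_rightVtx (q p : Fin 2) (t : B ⊗[K] PiAlg K) :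
    leftVtx K B q (rightVtx K B p t) = rightVtx K B p (leftVtx K B q t) := by
  induction t with
  | zero => simp
  | add x y hx hy => rw [map_add, map_add, hx, hy, map_add, map_add]
  | tmul b x => rw [rightVtx_tmul, leftVtx_tmul, leftVtx_tmul, rightVtx_tmul, mul_assoc]

lemma rightVtx_mem {n : ℕ} (p : Fin 2) {t : B ⊗[K] PiAlg K}
    (ht : t ∈ Submodule.map₂ (TensorProduct.mk K B (PiAlg K)) ⊤
      ((radIdeal K kronecker ^ n).restrictScalars K)) :
    rightVtx K B p t ∈ Submodule.map₂ (TensorProduct.mk K B (PiAlg K)) ⊤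
      ((radIdeal K kronecker ^ n).restrictScalars K) := by
  suffices h : Submodule.map₂ (TensorProduct.mk K B (PiAlg K)) ⊤
      ((radIdeal K kronecker ^ n).restrictScalars K) ≤
      (Submodule.map₂ (TensorProduct.mk K B (PiAlg K)) ⊤
      ((radIdeal K kronecker ^ n).restrictScalars K)).comap (rightVtx K B p) from h ht
  rw [Submodule.map₂_le]
  intro b _ x hx
  rw [Submodule.mem_comap, TensorProduct.mk_apply, rightVtx_tmul]
  exact Submodule.apply_mem_map₂ (TensorProduct.mk K B (PiAlg K)) trivial
    (Ideal.IsTwoSided.mul_mem_of_left (I := radIdeal K kronecker ^ n) _ hx)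

end

variable {M N L : ModuleCat.{u} (Lam K Q)}

lemma mulPi_rightVtx_left (s : (N →ₗ[K] L) ⊗[K] PiAlg K) (t : (M →ₗ[K] N) ⊗[K] PiAlg K)
    (r : Fin 2) : mulPi M N L (rightVtx K _ r s) t = mulPi M N L s (leftVtx K _ r t) := by
  induction s with
  | zero => simp
  | add x y hx hy => rw [map_add, map_add, map_add, LinearMap.add_apply, LinearMap.add_apply, hx, hy]
  | tmul f x =>
    induction t with
    | zero => simp
    | add x y hx hy => rw [map_add, map_add, map_add, hx, hy]
    | tmul g y =>
      simp only [mulPi, rightVtx_tmul, leftVtx_tmul, TensorProduct.map₂_apply_tmul,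
        TensorProduct.map_tmul, LinearMap.mul_apply', mul_assoc]

lemma mulPi_rightVtx_right (s : (N →ₗ[K] L) ⊗[K] PiAlg K) (t : (M →ₗ[K] N) ⊗[K] PiAlg K)
    (r : Fin 2) : mulPi M N L s (rightVtx K _ r t) = rightVtx K _ r (mulPi M N L s t) := by
  induction s with
  | zero => simp
  | add x y hx hy => rw [map_add, LinearMap.add_apply, LinearMap.add_apply, hx, hy, map_add]
  | tmul f x =>
    induction t with
    | zero => simp
    | add x y hx hy => rw [map_add, map_add, map_add, map_add, hx, hy]
    | tmul g y =>
      simp only [mulPi, rightVtx_tmul, TensorProduct.map₂_apply_tmul,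
        TensorProduct.map_tmul, LinearMap.mul_apply', mul_assoc]

variable [FiniteDimensional K M] [FiniteDimensional K N] [FiniteDimensional K L]

/-- By parity of `G`, the idempotent `e_r` between the two factors moves through `G` and becomes
`e_p` on the right, where it is absorbed. Block products are thus products of series. -/
lemma mulPi_serEval {F : (Fin 2 →₀ ℕ) → (N →ₗ[K] L)} {G : (Fin 2 →₀ ℕ) → (M →ₗ[K] N)} {r p : Fin 2}
    (hG : ∀ m, ¬ (Even m.degree ↔ r = p) → G m = 0) :
    mulPi M N L (rightVtx K _ r (serEval F)) (rightVtx K _ p (serEval G)) =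
      rightVtx K _ p (serEval fun m =>
        ∑ q ∈ Finset.HasAntidiagonal.antidiagonal m, F q.1 ∘ₗ G q.2) := by
  have h : leftVtx K _ r (serEval G) = rightVtx K _ p (serEval G) := (serEval_mul_vtx hG).symm
  rw [mulPi_rightVtx_left, leftVtx_rightVtx, h, rightVtx_rightVtx, mulPi_rightVtx_right]
  congr 1
  exact serEval_mul _ _ _

lemma rightVtx_serEval_mem {F : (Fin 2 →₀ ℕ) → (M →ₗ[K] N)} {a : H} {q p : Fin 2}
    (hF : ∀ m, F m ∈ homComp M N (Q.s a) (Q.t a)) (hq : ∀ m, ¬ (Even m.degree ↔ q = p) → F m = 0) :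
    rightVtx K _ p (serEval F) ∈ liftSpace M N a q p := by
  let P : (M →ₗ[K] N) →ₗ[K] (M →ₗ[K] N) :=
    (LinearMap.llcomp K M N N (lact N (vtx K Q (Q.t a)))) ∘ₗ
      (LinearMap.lcomp K N (lact M (vtx K Q (Q.s a))))
  have hP : ∀ f, P f = lact N (vtx K Q (Q.t a)) ∘ₗ f ∘ₗ lact M (vtx K Q (Q.s a)) := fun f => rfl
  have hPF : (fun m => P (F m)) = F := by
    funext m
    rw [hP, (hF m).2, (hF m).1]
  have h1 : leftVtx K _ q (serEval F) = rightVtx K _ p (serEval F) := (serEval_mul_vtx hq).symm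
  rw [← rightVtx_rightVtx, ← h1, ← hPF, serEval_map]
  generalize (serEval F : (M →ₗ[K] N) ⊗[K] PiAlg K) = t
  have hidem : ∀ i, lact M (vtx K Q i) ∘ₗ lact M (vtx K Q i) = lact M (vtx K Q i) :=
    (repOf M).E_idem
  have hidem' : ∀ i, lact N (vtx K Q i) ∘ₗ lact N (vtx K Q i) = lact N (vtx K Q i) :=
    (repOf N).E_idem
  induction t with
  | zero => simp
  | add x y hx hy =>
    rw [map_add, map_add, map_add]
    exact add_mem hx hy
  | tmul f x =>
    rw [LinearMap.rTensor_tmul, leftVtx_tmul, rightVtx_tmul]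
    refine Submodule.apply_mem_map₂ _ ⟨?_, ?_⟩ ⟨?_, ?_⟩
    · rw [hP, ← LinearMap.comp_assoc, hidem']
    · rw [hP, LinearMap.comp_assoc, LinearMap.comp_assoc, hidem]
    · rw [← mul_assoc, ← mul_assoc, vtx_mul, if_pos rfl]
    · rw [mul_assoc, vtx_mul, if_pos rfl]

lemma kronEval_one : kronEval K (Pi.single 0 1) = 1 := by
  rw [kronEval_single, kronMon_zero, map_one]

/-- There is no term of degree one, so the error starts in degree two. -/
lemma rightVtx_serEval_sub_mem_even {F : (Fin 2 →₀ ℕ) → (M →ₗ[K] N)} (p : Fin 2)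
    (hF : ∀ m, m.degree = 1 → F m = 0) :
    rightVtx K _ p (serEval F) - F 0 ⊗ₜ vtx K kronecker p ∈ liftFil M N 2 := by
  have h : F 0 ⊗ₜ vtx K kronecker p =
      rightVtx K _ p (serEval fun m => (Pi.single 0 1 : (Fin 2 →₀ ℕ) → K) m • F 0) := by
    rw [serEval_smul, kronEval_one, rightVtx_tmul, one_mul]
  rw [h, ← map_sub, ← map_sub]
  refine rightVtx_mem p (serEval_mem fun m hm => ?_)
  rw [Pi.sub_apply]
  by_cases h0 : m = 0
  · subst h0
    simp
  · have h1 : m.degree ≠ 0 := by rwa [Ne, Finsupp.degree_eq_zero_iff]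
    rw [hF m (by omega), Pi.single_eq_of_ne h0, zero_smul, sub_zero]

/-- Only odd degrees occur, so after the linear terms the error starts in degree three. -/
lemma rightVtx_serEval_sub_mem_odd {F : (Fin 2 →₀ ℕ) → (M →ₗ[K] N)} (p : Fin 2)
    (hF : ∀ m, Even m.degree → F m = 0) :
    rightVtx K _ p (serEval F) -
      (F (Finsupp.single 0 1) ⊗ₜ toLam K kronecker (kronX K * preV K kronecker p) +
      F (Finsupp.single 1 1) ⊗ₜ toLam K kronecker (kronY K * preV K kronecker p)) ∈
      liftFil M N 3 := by
  have h : F (Finsupp.single 0 1) ⊗ₜ toLam K kronecker (kronX K * preV K kronecker p) +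
      F (Finsupp.single 1 1) ⊗ₜ toLam K kronecker (kronY K * preV K kronecker p) =
      rightVtx K _ p (serEval
        ((fun m => (Pi.single (Finsupp.single 0 1) 1 : (Fin 2 →₀ ℕ) → K) m • F (Finsupp.single 0 1)) +
        fun m => (Pi.single (Finsupp.single 1 1) 1 : (Fin 2 →₀ ℕ) → K) m • F (Finsupp.single 1 1))) := by
    rw [map_add, serEval_smul, serEval_smul, kronEval_single, kronEval_single, map_add,
      rightVtx_tmul, rightVtx_tmul, kronMon_single_zero, kronMon_single_one, map_mul, map_mul]
    rfl
  rw [h, ← map_sub, ← map_sub]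
  refine rightVtx_mem p (serEval_mem fun m hm => ?_)
  rw [Pi.sub_apply, Pi.add_apply]
  have h01 : (Finsupp.single 0 1 : Fin 2 →₀ ℕ) ≠ Finsupp.single 1 1 := by
    intro h
    simpa using congrArg (fun f => f 0) h
  by_cases h1 : m.degree = 1
  · rcases degree_eq_one h1 with rfl | rfl
    · rw [Pi.single_eq_same, Pi.single_eq_of_ne h01, one_smul, zero_smul, add_zero, sub_self]
    · rw [Pi.single_eq_same, Pi.single_eq_of_ne h01.symm, one_smul, zero_smul, zero_add, sub_self]
  · have h2 : Even m.degree := by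
      rw [Nat.even_iff]
      omega
    rw [hF m h2, Pi.single_eq_of_ne, Pi.single_eq_of_ne, zero_smul, zero_smul, add_zero, sub_zero]
    · rintro rfl
      simp at h1
    · rintro rfl
      simp at h1

/-- Cutting the two commuting variables with the idempotents recovers the four arrows. The sign
appears only at `β̄`. -/
lemma kronX_mul_preV_zero : kronX K * preV K kronecker 0 = preA K kronecker (0, false) := by
  rw [kronX, sub_mul, preA_mul_preV, preA_mul_preV, if_pos (by decide), if_neg (by decide),
    sub_zero]

lemma kronX_mul_preV_one : kronX K * preV K kronecker 1 = - preA K kronecker (1, true) := by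
  rw [kronX, sub_mul, preA_mul_preV, preA_mul_preV, if_neg (by decide), if_pos (by decide),
    zero_sub]

lemma kronY_mul_preV_zero : kronY K * preV K kronecker 0 = preA K kronecker (1, false) := by
  rw [kronY, add_mul, preA_mul_preV, preA_mul_preV, if_pos (by decide), if_neg (by decide),
    add_zero]

lemma kronY_mul_preV_one : kronY K * preV K kronecker 1 = preA K kronecker (0, true) := by
  rw [kronY, add_mul, preA_mul_preV, preA_mul_preV, if_neg (by decide), if_pos (by decide),
    zero_add]

end UniversalLiftingExists

/-! ### Construction of a universal lifting from a solution in power series. -/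

section UniversalLiftingConstruction

open MvPowerSeries

variable {K : Type u} [Field K] {I H : Type} [Fintype I] [Fintype H] {Q : OrientedGraph I H}
variable {S R : ModuleCat.{u} (Lam K Q)}

lemma IsHallPair.isBrickPair (hS : Module.Finite K S) (hR : Module.Finite K R)
    (h : IsHallPair S R) : (repOf S).IsBrickPair (repOf R) where
  end_left f hf := by
    obtain ⟨c, hc⟩ := h.end_S.2 (hf.hom hS hS)
    refine ⟨c, LinearMap.ext fun m => ?_⟩
    rw [← hf.hom_apply hS hS, ← hc]
    rfl
  end_right f hf := by
    obtain ⟨c, hc⟩ := h.end_R.2 (hf.hom hR hR)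
    refine ⟨c, LinearMap.ext fun m => ?_⟩
    rw [← hf.hom_apply hR hR, ← hc]
    rfl
  hom_left f hf := LinearMap.ext fun m => by
    rw [← hf.hom_apply hS hR, @Subsingleton.elim _ h.hom_SR (hf.hom hS hR) 0]
    rfl
  hom_right f hf := LinearMap.ext fun m => by
    rw [← hf.hom_apply hR hS, @Subsingleton.elim _ h.hom_RS (hf.hom hR hS) 0]
    rfl

lemma Par.diag_eq_zero {M N : Type u} [AddCommGroup M] [Module K M] [AddCommGroup N] [Module K N]
    {f : Module.End K (M × N)} (hf : f ∈ Par 1) :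
    LinearMap.fst K M N ∘ₗ f ∘ₗ LinearMap.inl K M N = 0 ∧
      LinearMap.snd K M N ∘ₗ f ∘ₗ LinearMap.inr K M N = 0 := by
  constructor
  · refine LinearMap.ext fun x => ?_
    simpa [proj] using congrArg (fun g => (g (x, 0)).1) (hf 0)
  · refine LinearMap.ext fun x => ?_
    have := congrArg (fun g => (g (0, x)).2) (hf 1)
    rw [show (1 : ZMod 2) + 1 = 0 from rfl] at this
    simpa [proj] using this

lemma Par.offDiag_eq_zero {M N : Type u} [AddCommGroup M] [Module K M] [AddCommGroup N] [Module K N]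
    {f : Module.End K (M × N)} (hf : f ∈ Par 0) :
    LinearMap.snd K M N ∘ₗ f ∘ₗ LinearMap.inl K M N = 0 ∧
      LinearMap.fst K M N ∘ₗ f ∘ₗ LinearMap.inr K M N = 0 := by
  constructor
  · refine LinearMap.ext fun x => ?_
    simpa [proj] using congrArg (fun g => (g (x, 0)).2) (hf 0)
  · refine LinearMap.ext fun x => ?_
    simpa [proj] using congrArg (fun g => (g (0, x)).1) (hf 1)

lemma snd_offDiag_inl {M N : Type u} [AddCommGroup M] [Module K M] [AddCommGroup N] [Module K N]
    (f : M →ₗ[K] N) (g : N →ₗ[K] M) :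
    LinearMap.snd K M N ∘ₗ offDiag f g ∘ₗ LinearMap.inl K M N = f :=
  LinearMap.ext fun x => by simp

lemma fst_offDiag_inr {M N : Type u} [AddCommGroup M] [Module K M] [AddCommGroup N] [Module K N]
    (f : M →ₗ[K] N) (g : N →ₗ[K] M) :
    LinearMap.fst K M N ∘ₗ offDiag f g ∘ₗ LinearMap.inr K M N = g :=
  LinearMap.ext fun x => by simp

/-- The relation at a vertex, as a series. -/
def relVtx (X : H → MvPowerSeries (Fin 2) (Module.End K (S × R))) (i : I) (m : Fin 2 →₀ ℕ) :
    Module.End K (S × R) :=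
  ∑ a ∈ Q.out i, Q.ε K a •
    ∑ q ∈ Finset.HasAntidiagonal.antidiagonal m, coeff q.1 (X (Q.bar a)) * coeff q.2 (X a)

lemma relVtx_eq_zero {X : H → MvPowerSeries (Fin 2) (Module.End K (S × R))}
    (hX : ∀ a m, coeff m (X a) ∈
      ((repOf S).prod (repOf R)).homG ((repOf S).prod (repOf R)) (Q.s a) (Q.t a))
    (hrel : relB K Q X X = 0) (i : I) (m : Fin 2 →₀ ℕ) : relVtx X i m = 0 := by
  classical
  have h1 : ∀ j, relVtx X j m ∈
      ((repOf S).prod (repOf R)).homG ((repOf S).prod (repOf R)) j j := by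
    intro j
    refine sum_mem fun a ha => Submodule.smul_mem _ _ (sum_mem fun q _ => ?_)
    rw [Q.mem_out] at ha
    subst ha
    exact Rep.walk_mem _ _ (g := fun a => coeff q.2 (X a)) (g' := fun a => coeff q.1 (X a))
      (Rep.mem_C1.2 fun a => hX a _) (Rep.mem_C1.2 fun a => hX a _) a
  have h2 : ∑ j, relVtx X j m = 0 := by
    have h3 := congrArg (coeff m) hrel
    rw [coeff_relB, coeff_zero] at h3
    simp only [relVtx]
    rw [Q.sum_out (fun a => Q.ε K a • ∑ q ∈ Finset.HasAntidiagonal.antidiagonal m,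
      coeff q.1 (X (Q.bar a)) * coeff q.2 (X a)), ← h3]
    exact Finset.sum_congr rfl fun a _ => by rw [coeff_mul]
  have h3 := Rep.sum_comp_E _ _ h1 i
  rw [← h3]
  exact (congrArg (· ∘ₗ _) h2).trans (LinearMap.zero_comp _)

/-- With `π` a projection and `ι` an inclusion, the four relations of a universal lifting are the
four blocks of a single relation between series. -/
lemma sum_mulPi_block [FiniteDimensional K S] [FiniteDimensional K R]
    {X : H → MvPowerSeries (Fin 2) (Module.End K (S × R))} {i : I}
    (hX : ∀ m, relVtx X i m = 0) {M N : ModuleCat.{u} (Lam K Q)} [FiniteDimensional K M]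
    [FiniteDimensional K N] (π : S × R →ₗ[K] N) (ι : M →ₗ[K] S × R) (p : Fin 2)
    (h0 : ∀ a m, ¬ (Even m.degree ↔ 0 = p) →
      LinearMap.fst K S R ∘ₗ coeff m (X a) ∘ₗ ι = 0)
    (h1 : ∀ a m, ¬ (Even m.degree ↔ 1 = p) →
      LinearMap.snd K S R ∘ₗ coeff m (X a) ∘ₗ ι = 0) :
    ∑ a ∈ Q.out i, Q.ε K a •
      (mulPi M S N
        (rightVtx K _ 0 (serEval fun m => π ∘ₗ coeff m (X (Q.bar a)) ∘ₗ LinearMap.inl K S R))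
        (rightVtx K _ p (serEval fun m => LinearMap.fst K S R ∘ₗ coeff m (X a) ∘ₗ ι)) +
      mulPi M R N
        (rightVtx K _ 1 (serEval fun m => π ∘ₗ coeff m (X (Q.bar a)) ∘ₗ LinearMap.inr K S R))
        (rightVtx K _ p (serEval fun m => LinearMap.snd K S R ∘ₗ coeff m (X a) ∘ₗ ι))) = 0 := by
  have h : ∀ a, mulPi M S N
        (rightVtx K _ 0 (serEval fun m => π ∘ₗ coeff m (X (Q.bar a)) ∘ₗ LinearMap.inl K S R))
        (rightVtx K _ p (serEval fun m => LinearMap.fst K S R ∘ₗ coeff m (X a) ∘ₗ ι)) +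
      mulPi M R N
        (rightVtx K _ 1 (serEval fun m => π ∘ₗ coeff m (X (Q.bar a)) ∘ₗ LinearMap.inr K S R))
        (rightVtx K _ p (serEval fun m => LinearMap.snd K S R ∘ₗ coeff m (X a) ∘ₗ ι)) =
      rightVtx K _ p (serEval fun m => π ∘ₗ (∑ q ∈ Finset.HasAntidiagonal.antidiagonal m,
        coeff q.1 (X (Q.bar a)) * coeff q.2 (X a)) ∘ₗ ι) := by
    intro a
    rw [mulPi_serEval (h0 a), mulPi_serEval (h1 a), ← map_add, ← map_add]
    congr 2
    funext m
    refine LinearMap.ext fun x => ?_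
    simp only [Pi.add_apply, LinearMap.add_apply, LinearMap.sum_apply, LinearMap.comp_apply,
      ← Finset.sum_add_distrib, map_sum]
    refine Finset.sum_congr rfl fun q _ => ?_
    rw [← map_add, ← map_add]
    simp
  simp only [h, ← map_smul, ← map_sum]
  rw [← map_zero (rightVtx K (M →ₗ[K] N) p), ← map_zero (serEval (K := K) (B := M →ₗ[K] N))]
  congr 2
  funext m
  have h2 := hX m
  rw [relVtx] at h2
  have h3 : π ∘ₗ (0 : Module.End K (S × R)) ∘ₗ ι = 0 := by
    rw [LinearMap.zero_comp, LinearMap.comp_zero]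
  rw [← h2] at h3
  rw [Finset.sum_apply, Pi.zero_apply]
  refine Eq.trans ?_ h3
  refine LinearMap.ext fun x => ?_
  simp only [Pi.smul_apply, LinearMap.sum_apply, LinearMap.comp_apply, LinearMap.smul_apply, map_sum,
    map_smul]

lemma exists_universalLifting [CharZero K] (hS : Module.Finite K S) (hR : Module.Finite K R)
    (h : IsHallPair S R) (D : DualCocycles S R) : Nonempty (UniversalLifting D) := by
  have hbp := h.isBrickPair hS hR
  have hξ : D.ξ ∈ (repOf S).Z1 (repOf R) := mem_Z1_iff.2 ⟨D.ξ_mem, D.d_ξ⟩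
  have hη : D.η ∈ (repOf S).Z1 (repOf R) := mem_Z1_iff.2 ⟨D.η_mem, D.d_η⟩
  have hξ' : D.ξ' ∈ (repOf R).Z1 (repOf S) := mem_Z1_iff.2 ⟨D.ξ'_mem, D.d_ξ'⟩
  have hη' : D.η' ∈ (repOf R).Z1 (repOf S) := mem_Z1_iff.2 ⟨D.η'_mem, D.d_η'⟩
  have t1 : Rep.tau K Q R S D.ξ' D.ξ = -1 := by rw [Rep.tau_swap, ← tauOne_eq, D.τ_ξξ']
  have t2 : Rep.tau K Q R S D.η' D.η = -1 := by rw [Rep.tau_swap, ← tauOne_eq, D.τ_ηη']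
  have t3 : Rep.tau K Q R S D.η' D.ξ = 0 := by rw [Rep.tau_swap, ← tauOne_eq, D.τ_ξη', neg_zero]
  have t4 : Rep.tau K Q R S D.ξ' D.η = 0 := by rw [Rep.tau_swap, ← tauOne_eq, D.τ_ηξ', neg_zero]
  -- The first variable stands for `α - β̄` and the second for `β + ᾱ`, so their coefficients are
  -- the pairs `(ξ, -η')` and `(η, ξ')`. With this sign the obstruction in degree two cancels:
  -- `τ₁(-η', η) + τ₁(ξ', ξ) = 1 - 1`.
  obtain ⟨X, hXg, hXp, hX0, hX1, hXr⟩ := exists_relB_eq_zero hbp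
    (f := ![D.ξ, D.η]) (g := ![-D.η', D.ξ']) (k := ![D.ξ', D.η'])
    (by intro i; fin_cases i <;> assumption)
    (by
      intro i
      fin_cases i
      · exact neg_mem hη'
      · exact hξ')
    (by
      intro i j
      fin_cases i <;> fin_cases j <;> simp [t1, t2, t3, t4])
    (by
      intro i
      fin_cases i <;> simp [t3, t4])
    (by intro i; fin_cases i <;> assumption)
    (by
      intro i j
      fin_cases i <;> fin_cases j <;> simp [t1, t2, t3, t4])
  have hrel := relVtx_eq_zero hXg hXr
  have hodd : ∀ a m, ¬ Even m.degree → coeff m (X a) ∈ Par 1 := fun a m hm => by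
    have := hXp a m
    rwa [ZMod.natCast_eq_one_iff_odd.2 (Nat.not_even_iff_odd.1 hm)] at this
  have heven : ∀ a m, Even m.degree → coeff m (X a) ∈ Par 0 := fun a m hm => by
    have := hXp a m
    rwa [ZMod.natCast_eq_zero_iff_even.2 hm] at this
  have hSS : ∀ a m, ¬ (Even m.degree ↔ (0 : Fin 2) = 0) →
      LinearMap.fst K S R ∘ₗ coeff m (X a) ∘ₗ LinearMap.inl K S R = 0 :=
    fun a m hm => (Par.diag_eq_zero (hodd a m (by simpa using hm))).1
  have hRR : ∀ a m, ¬ (Even m.degree ↔ (1 : Fin 2) = 1) →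
      LinearMap.snd K S R ∘ₗ coeff m (X a) ∘ₗ LinearMap.inr K S R = 0 :=
    fun a m hm => (Par.diag_eq_zero (hodd a m (by simpa using hm))).2
  have hSR : ∀ a m, ¬ (Even m.degree ↔ (1 : Fin 2) = 0) →
      LinearMap.snd K S R ∘ₗ coeff m (X a) ∘ₗ LinearMap.inl K S R = 0 :=
    fun a m hm => (Par.offDiag_eq_zero (heven a m (by simpa using hm))).1
  have hRS : ∀ a m, ¬ (Even m.degree ↔ (0 : Fin 2) = 1) →
      LinearMap.fst K S R ∘ₗ coeff m (X a) ∘ₗ LinearMap.inr K S R = 0 :=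
    fun a m hm => (Par.offDiag_eq_zero (heven a m (by simpa using hm))).2
  have hg1 : ∀ a m x, ((repOf S).E (Q.t a) (coeff m (X a) x).1, (repOf R).E (Q.t a) (coeff m (X a) x).2) =
      coeff m (X a) x := fun a m x => congrArg (fun f => f x) (hXg a m).1
  have hg2 : ∀ a m x, coeff m (X a) ((repOf S).E (Q.s a) x.1, (repOf R).E (Q.s a) x.2) =
      coeff m (X a) x := fun a m x => congrArg (fun f => f x) (hXg a m).2
  refine ⟨{
    matS := fun a => rightVtx K _ 0 (serEval fun m =>
      LinearMap.fst K S R ∘ₗ coeff m (X a) ∘ₗ LinearMap.inl K S R)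
    matR := fun a => rightVtx K _ 1 (serEval fun m =>
      LinearMap.snd K S R ∘ₗ coeff m (X a) ∘ₗ LinearMap.inr K S R)
    matP := fun a => rightVtx K _ 0 (serEval fun m =>
      LinearMap.snd K S R ∘ₗ coeff m (X a) ∘ₗ LinearMap.inl K S R)
    matQ := fun a => rightVtx K _ 1 (serEval fun m =>
      LinearMap.fst K S R ∘ₗ coeff m (X a) ∘ₗ LinearMap.inr K S R)
    matS_mem := fun a => rightVtx_serEval_mem (fun m => ?_) (hSS a)
    matR_mem := fun a => rightVtx_serEval_mem (fun m => ?_) (hRR a)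
    matP_mem := fun a => rightVtx_serEval_mem (fun m => ?_) (hSR a)
    matQ_mem := fun a => rightVtx_serEval_mem (fun m => ?_) (hRS a)
    matS_congr := fun a => ?_
    matR_congr := fun a => ?_
    matP_congr := fun a => ?_
    matQ_congr := fun a => ?_
    rel_SS := fun i => sum_mulPi_block (hrel i) (LinearMap.fst K S R) (LinearMap.inl K S R) 0 hSS hSR
    rel_SQ := fun i => sum_mulPi_block (hrel i) (LinearMap.fst K S R) (LinearMap.inr K S R) 1 hRS hRR
    rel_PS := fun i => sum_mulPi_block (hrel i) (LinearMap.snd K S R) (LinearMap.inl K S R) 0 hSS hSR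
    rel_PQ := fun i => sum_mulPi_block (hrel i) (LinearMap.snd K S R) (LinearMap.inr K S R) 1 hRS hRR
    }⟩
  · exact ⟨LinearMap.ext fun x => congrArg Prod.fst (hg1 a m (x, 0)), LinearMap.ext fun x => by
      have := congrArg Prod.fst (hg2 a m (x, 0))
      simp only [map_zero] at this
      exact this⟩
  · exact ⟨LinearMap.ext fun x => congrArg Prod.snd (hg1 a m (0, x)), LinearMap.ext fun x => by
      have := congrArg Prod.snd (hg2 a m (0, x))
      simp only [map_zero] at this
      exact this⟩
  · exact ⟨LinearMap.ext fun x => congrArg Prod.snd (hg1 a m (x, 0)), LinearMap.ext fun x => by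
      have := congrArg Prod.snd (hg2 a m (x, 0))
      simp only [map_zero] at this
      exact this⟩
  · exact ⟨LinearMap.ext fun x => congrArg Prod.fst (hg1 a m (0, x)), LinearMap.ext fun x => by
      have := congrArg Prod.fst (hg2 a m (0, x))
      simp only [map_zero] at this
      exact this⟩
  · have := rightVtx_serEval_sub_mem_even (M := S) (N := S)
      (F := fun m => LinearMap.fst K S R ∘ₗ coeff m (X a) ∘ₗ LinearMap.inl K S R) 0
      (fun m hm => hSS a m (by simp [hm]))
    rw [hX0] at this
    exact this
  · have := rightVtx_serEval_sub_mem_even (M := R) (N := R)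
      (F := fun m => LinearMap.snd K S R ∘ₗ coeff m (X a) ∘ₗ LinearMap.inr K S R) 1
      (fun m hm => hRR a m (by simp [hm]))
    rw [hX0] at this
    exact this
  · have := rightVtx_serEval_sub_mem_odd (M := S) (N := R)
      (F := fun m => LinearMap.snd K S R ∘ₗ coeff m (X a) ∘ₗ LinearMap.inl K S R) 0
      (fun m hm => hSR a m (by simp [hm]))
    rw [hX1, hX1, kronX_mul_preV_zero, kronY_mul_preV_zero, snd_offDiag_inl, snd_offDiag_inl] at this
    exact this
  · have := rightVtx_serEval_sub_mem_odd (M := R) (N := S)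
      (F := fun m => LinearMap.fst K S R ∘ₗ coeff m (X a) ∘ₗ LinearMap.inr K S R) 1
      (fun m hm => hRS a m (by simp [hm]))
    rw [hX1, hX1, kronX_mul_preV_one, kronY_mul_preV_one, fst_offDiag_inr, fst_offDiag_inr] at this
    have h2 : (-D.η' a) ⊗ₜ[K] toLam K kronecker (-preA K kronecker (1, true)) +
        D.ξ' a ⊗ₜ[K] toLam K kronecker (preA K kronecker (0, true)) =
        D.ξ' a ⊗ₜ arr K kronecker (0, true) + D.η' a ⊗ₜ arr K kronecker (1, true) := by
      rw [map_neg, TensorProduct.neg_tmul, TensorProduct.tmul_neg, neg_neg, add_comm]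
      rfl
    rw [← h2]
    exact this

end UniversalLiftingConstruction

/-! ### The radical filtration of a module and its annihilators. -/

section Filtration

variable {K : Type u} [Field K] {I H : Type} [Fintype I] [Fintype H] {Q : OrientedGraph I H}

/-- The radical filtration of a module. -/
def fil (V : ModuleCat.{u} (Lam K Q)) (i : ℕ) : Submodule K V :=
  Submodule.span K {w | ∃ x ∈ radIdeal K Q ^ i, ∃ m : V, x • m = w}

variable {V : ModuleCat.{u} (Lam K Q)}

lemma smul_mem_fil_add {k i : ℕ} {x : Lam K Q} (hx : x ∈ radIdeal K Q ^ k) {w : V}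
    (hw : w ∈ fil V i) : x • w ∈ fil V (k + i) := by
  suffices h : fil V i ≤ (fil V (k + i)).comap (lact V x) from h hw
  refine Submodule.span_le.2 ?_
  rintro _ ⟨y, hy, m, rfl⟩
  refine Submodule.subset_span ⟨x * y, ?_, m, (smul_smul x y m).symm⟩
  rw [Ideal.IsTwoSided.pow_add]
  exact Ideal.mul_mem_mul hx hy

lemma smul_mem_fil {i : ℕ} (x : Lam K Q) {w : V} (hw : w ∈ fil V i) : x • w ∈ fil V i := by
  have := smul_mem_fil_add (k := 0) (x := x) (by rw [Submodule.pow_zero]; simp) hw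
  rwa [zero_add] at this

lemma fil_antitone {i j : ℕ} (h : i ≤ j) : fil V j ≤ fil V i := by
  refine Submodule.span_mono ?_
  rintro _ ⟨x, hx, m, rfl⟩
  exact ⟨x, Ideal.pow_le_pow_right h hx, m, rfl⟩

lemma mem_fil_zero (w : V) : w ∈ fil V 0 :=
  Submodule.subset_span ⟨1, by rw [Submodule.pow_zero]; simp, w, one_smul _ _⟩

variable (V) in
lemma exists_fil_eq_bot (hV : Module.Finite K V) : ∃ n, fil V n = ⊥ := by
  obtain ⟨n, hn⟩ := exists_radIdeal_pow_smul_eq_zero V hV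
  refine ⟨n, ?_⟩
  rw [fil, Submodule.span_eq_bot]
  rintro _ ⟨x, hx, m, rfl⟩
  exact hn x hx m

variable (V) in
/-- The functionals that vanish on a step of the radical filtration. -/
def perp (j : ℕ) : Submodule K (V →ₗ[K] K) where
  carrier := {l | ∀ w ∈ fil V j, l w = 0}
  add_mem' hl hl' w hw := by rw [LinearMap.add_apply, hl w hw, hl' w hw, add_zero]
  zero_mem' _ _ := rfl
  smul_mem' c l hl w hw := by rw [LinearMap.smul_apply, hl w hw, smul_zero]

lemma perp_zero {l : V →ₗ[K] K} (hl : l ∈ perp V 0) : l = 0 :=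
  LinearMap.ext fun w => hl w (mem_fil_zero w)

lemma perp_comp_lact {j : ℕ} (x : Lam K Q) {l : V →ₗ[K] K} (hl : l ∈ perp V j) :
    l ∘ₗ lact V x ∈ perp V j := fun w hw => hl _ (smul_mem_fil x hw)

lemma perp_comp_lact_of_mem {j : ℕ} {x : Lam K Q} (hx : x ∈ radIdeal K Q) {l : V →ₗ[K] K}
    (hl : l ∈ perp V (j + 1)) : l ∘ₗ lact V x ∈ perp V j := fun w hw => hl _ (by
  rw [add_comm]
  exact smul_mem_fil_add (by rwa [Submodule.pow_one]) hw)

end Filtration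

/-! ### Contractions with functionals and evaluation of elements of `Hom_K(M, N) ⊗ Π`. -/

section Evaluation

variable {K : Type u} [Field K] {I H : Type} [Fintype I] [Fintype H] {Q : OrientedGraph I H}

/-- The contraction `N ⊗ W_p → N` with a functional on `W`. -/
def con (N : ModuleCat.{u} (Lam K Q)) (W : ModuleCat.{u} (PiAlg K)) (p : Fin 2) (l : W →ₗ[K] K) :
    N ⊗[K] compo W p →ₗ[K] N :=
  (TensorProduct.rid K N).toLinearMap ∘ₗ (l ∘ₗ (compo W p).subtype).lTensor N

lemma con_tmul {N : ModuleCat.{u} (Lam K Q)} {W : ModuleCat.{u} (PiAlg K)} {p : Fin 2}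
    (l : W →ₗ[K] K) (n : N) (w : compo W p) : con N W p l (n ⊗ₜ w) = l w • n := by
  simp [con]

/-- Coordinates on `W_p` extend to functionals on `W`, and a tensor is recovered from its
contractions with them. -/
lemma eq_zero_of_con {N : ModuleCat.{u} (Lam K Q)} {W : ModuleCat.{u} (PiAlg K)} {p : Fin 2}
    [FiniteDimensional K W] {t : N ⊗[K] compo W p} (h : ∀ l, con N W p l t = 0) : t = 0 := by
  let b := Module.finBasis K (compo W p)
  have hl : ∀ i, ∃ l : W →ₗ[K] K, l ∘ₗ (compo W p).subtype = b.coord i :=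
    fun i => LinearMap.exists_extend _
  choose l hl using hl
  have key : ∀ t : N ⊗[K] compo W p, t = ∑ i, con N W p (l i) t ⊗ₜ b i := by
    intro t
    induction t with
    | zero => simp
    | add x y hx hy =>
      conv_lhs => rw [hx, hy]
      simp only [map_add, TensorProduct.add_tmul, Finset.sum_add_distrib]
    | tmul n w =>
      have h2 : ∀ i, l i w = b.repr w i := fun i => congrArg (fun f => f w) (hl i)
      simp only [con_tmul, h2, TensorProduct.smul_tmul]
      rw [← TensorProduct.tmul_sum, b.sum_repr]
  rw [key t]
  simp [h]

variable {V W U : ModuleCat.{u} (PiAlg K)}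

/-- The block `V_p → W_q` of a linear map `V → W`. -/
def blk (V W : ModuleCat.{u} (PiAlg K)) (q p : Fin 2) :
    (V →ₗ[K] W) →ₗ[K] (compo V p →ₗ[K] compo W q) where
  toFun f := LinearMap.codRestrict (compo W q) (lact W (vtx K kronecker q) ∘ₗ f ∘ₗ
    (compo V p).subtype) fun v => ⟨f v, rfl⟩
  map_add' f g := LinearMap.ext fun v => Subtype.ext (smul_add (vtx K kronecker q) (f v) (g v))
  map_smul' c f := LinearMap.ext fun v => Subtype.ext (smul_comm (vtx K kronecker q) c (f v))

lemma coe_blk (q p : Fin 2) (f : V →ₗ[K] W) (v : compo V p) :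
    (blk V W q p f v : W) = vtx K kronecker q • f v := rfl

lemma vtx_smul_compo {V : ModuleCat.{u} (Lam K Q)} {i : I} (v : compo V i) :
    vtx K Q i • (v : V) = v := by
  obtain ⟨w, hw⟩ := v.2
  rw [← hw]
  change vtx K Q i • (vtx K Q i • w) = vtx K Q i • w
  rw [smul_smul, vtx_mul, if_pos rfl]

lemma mem_compo_iff {V : ModuleCat.{u} (Lam K Q)} {i : I} {v : V} :
    v ∈ compo V i ↔ vtx K Q i • v = v :=
  ⟨fun h => vtx_smul_compo ⟨v, h⟩, fun h => ⟨v, h⟩⟩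

/-- The action of an algebra on a module, as a linear map. -/
def lactL (V : ModuleCat.{u} (Lam K Q)) : Lam K Q →ₗ[K] (V →ₗ[K] V) where
  toFun x := lact V x
  map_add' x y := by ext; simp [lact]
  map_smul' c x := by ext; simp [lact]

lemma lactL_apply (V : ModuleCat.{u} (Lam K Q)) (x : Lam K Q) (v : V) : lactL V x v = x • v := rfl

/-- Evaluation of `Hom_K(M, N) ⊗ Π` by means of a linear map `Π → Hom_K(V, W)`. -/
def evD (M N : ModuleCat.{u} (Lam K Q)) (D : PiAlg K →ₗ[K] (V →ₗ[K] W)) (q p : Fin 2) :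
    (M →ₗ[K] N) ⊗[K] PiAlg K →ₗ[K] (M ⊗[K] compo V p →ₗ[K] N ⊗[K] compo W q) :=
  TensorProduct.lift
    ((TensorProduct.mapBilinear (RingHom.id K) M (compo V p) N (compo W q)).compl₂
      (blk V W q p ∘ₗ D))

variable {M N L : ModuleCat.{u} (Lam K Q)}

lemma evD_tmul (D : PiAlg K →ₗ[K] (V →ₗ[K] W)) (q p : Fin 2) (f : M →ₗ[K] N) (x : PiAlg K) :
    evD M N D q p (f ⊗ₜ x) = TensorProduct.map f (blk V W q p (D x)) := rfl

lemma evalPi_eq_evD (q p : Fin 2) : evalPi M N V q p = evD M N (lactL V) q p := by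
  refine TensorProduct.ext' fun f x => ?_
  rw [evD_tmul]
  change TensorProduct.map f (actComp V q p x) = _
  congr 1
  ext v
  exact (smul_smul _ _ _).symm

lemma con_evD_tmul_tmul (D : PiAlg K →ₗ[K] (V →ₗ[K] W)) (q p : Fin 2) (f : M →ₗ[K] N)
    (x : PiAlg K) (l : W →ₗ[K] K) (m : M) (v : compo V p) :
    con N W q l (evD M N D q p (f ⊗ₜ x) (m ⊗ₜ v)) = l (vtx K kronecker q • D x v) • f m := by
  rw [evD_tmul, TensorProduct.map_tmul, con_tmul, coe_blk]

/-- Contraction moves the coefficient `x` onto the functional. Conditions modulo the radical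
filtration thereby become conditions on functionals, with no need for submodules of tensor products.
-/
lemma con_evD_lactL (q p : Fin 2) (f : M →ₗ[K] N) (x : PiAlg K) (l : V →ₗ[K] K)
    (t : M ⊗[K] compo V p) : con N V q l (evD M N (lactL V) q p (f ⊗ₜ x) t) =
      f (con M V p (l ∘ₗ lact V (vtx K kronecker q * x)) t) := by
  induction t with
  | zero => simp
  | add t t' h h' => rw [map_add, map_add, h, h', map_add, map_add]
  | tmul m v =>
    rw [con_evD_tmul_tmul, con_tmul, LinearMap.map_smul f, lactL_apply, smul_smul]
    rfl

lemma eq_of_liftSpace {A : Type*} [AddCommGroup A] [Module K A]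
    (φ ψ : (M →ₗ[K] N) ⊗[K] PiAlg K →ₗ[K] A) {a : H} {q p : Fin 2}
    (h : ∀ f ∈ homComp M N (Q.s a) (Q.t a), ∀ x ∈ corner K kronecker q p, φ (f ⊗ₜ x) = ψ (f ⊗ₜ x))
    {t : (M →ₗ[K] N) ⊗[K] PiAlg K} (ht : t ∈ liftSpace M N a q p) : φ t = ψ t := by
  have : liftSpace M N a q p ≤ LinearMap.eqLocus φ ψ := Submodule.map₂_le.2 h
  exact this ht

lemma eq_zero_of_liftFil {A : Type*} [AddCommGroup A] [Module K A]
    (φ : (M →ₗ[K] N) ⊗[K] PiAlg K →ₗ[K] A) {k : ℕ}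
    (h : ∀ f, ∀ x ∈ radIdeal K kronecker ^ k, φ (f ⊗ₜ x) = 0)
    {t : (M →ₗ[K] N) ⊗[K] PiAlg K} (ht : t ∈ liftFil M N k) : φ t = 0 := by
  have : liftFil M N k ≤ LinearMap.ker φ := Submodule.map₂_le.2 fun f _ x hx => h f x hx
  exact this ht

/-- Composition of evaluations. -/
lemma evD_comp_add {W' : ModuleCat.{u} (PiAlg K)} {D₁ : PiAlg K →ₗ[K] (W →ₗ[K] U)}
    {D₂ : PiAlg K →ₗ[K] (W' →ₗ[K] U)} {D₁' : PiAlg K →ₗ[K] (V →ₗ[K] W)}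
    {D₂' : PiAlg K →ₗ[K] (V →ₗ[K] W')}
    {D : PiAlg K →ₗ[K] (V →ₗ[K] U)} {q r p : Fin 2}
    (h : ∀ x ∈ corner K kronecker q r, ∀ y ∈ corner K kronecker r p, ∀ v : compo V p,
      vtx K kronecker q • D₁ x (vtx K kronecker r • D₁' y v) +
      vtx K kronecker q • D₂ x (vtx K kronecker r • D₂' y v) = vtx K kronecker q • D (x * y) v)
    {a b : H} {s : (N →ₗ[K] L) ⊗[K] PiAlg K} {t : (M →ₗ[K] N) ⊗[K] PiAlg K}
    (hs : s ∈ liftSpace N L b q r) (ht : t ∈ liftSpace M N a r p) :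
    evD N L D₁ q r s ∘ₗ evD M N D₁' r p t + evD N L D₂ q r s ∘ₗ evD M N D₂' r p t =
      evD M L D q p (mulPi M N L s t) := by
  refine eq_of_liftSpace
    ((LinearMap.lcomp K _ (evD M N D₁' r p t)) ∘ₗ evD N L D₁ q r +
      (LinearMap.lcomp K _ (evD M N D₂' r p t)) ∘ₗ evD N L D₂ q r)
    (evD M L D q p ∘ₗ (mulPi M N L).flip t) (fun f _ x hx => ?_) hs
  refine eq_of_liftSpace
    (LinearMap.llcomp K _ _ _ (evD N L D₁ q r (f ⊗ₜ x)) ∘ₗ evD M N D₁' r p +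
      LinearMap.llcomp K _ _ _ (evD N L D₂ q r (f ⊗ₜ x)) ∘ₗ evD M N D₂' r p)
    (evD M L D q p ∘ₗ mulPi M N L (f ⊗ₜ x)) (fun g _ y hy => ?_) ht
  refine TensorProduct.ext' fun m v => ?_
  simp only [LinearMap.add_apply, LinearMap.comp_apply, LinearMap.llcomp_apply, mulPi,
    TensorProduct.map₂_apply_tmul, evD_tmul, TensorProduct.map_tmul]
  rw [← TensorProduct.tmul_add]
  refine congrArg (f (g m) ⊗ₜ[K] ·) (Subtype.ext ?_)
  exact h x hx y hy v

end Evaluation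

/-! ### The representation obtained by evaluating a universal lifting. -/

section HallRep

variable {K : Type u} [Field K] {I H : Type} [Fintype I] [Fintype H] {Q : OrientedGraph I H}
variable {S R : ModuleCat.{u} (Lam K Q)} {D : DualCocycles S R} (L : UniversalLifting D)
variable {V W U : ModuleCat.{u} (PiAlg K)}

/-- Evaluation of the matrices of a universal lifting by means of a linear map
`Π → Hom_K(V, W)`. -/
def hallD (d : PiAlg K →ₗ[K] (V →ₗ[K] W)) (a : H) : hallSpace S R V →ₗ[K] hallSpace S R W :=
  LinearMap.prod
    (LinearMap.coprod (evD S S d 0 0 (L.matS a)) (evD R S d 0 1 (L.matQ a)))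
    (LinearMap.coprod (evD S R d 1 0 (L.matP a)) (evD R R d 1 1 (L.matR a)))

lemma hallD_fst (d : PiAlg K →ₗ[K] (V →ₗ[K] W)) (a : H) (t : hallSpace S R V) :
    (hallD L d a t).1 = evD S S d 0 0 (L.matS a) t.1 + evD R S d 0 1 (L.matQ a) t.2 := rfl

lemma hallD_snd (d : PiAlg K →ₗ[K] (V →ₗ[K] W)) (a : H) (t : hallSpace S R V) :
    (hallD L d a t).2 = evD S R d 1 0 (L.matP a) t.1 + evD R R d 1 1 (L.matR a) t.2 := rfl

lemma hallArr_eq_hallD (a : H) : hallArr L V a = hallD L (lactL V) a := by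
  unfold hallArr hallD
  rw [evalPi_eq_evD, evalPi_eq_evD, evalPi_eq_evD, evalPi_eq_evD]

lemma evD_mem_homComp {M N : ModuleCat.{u} (Lam K Q)} (d : PiAlg K →ₗ[K] (V →ₗ[K] W)) {q p : Fin 2}
    {a : H} {t : (M →ₗ[K] N) ⊗[K] PiAlg K} (ht : t ∈ liftSpace M N a q p)
    (x : M ⊗[K] compo V p) :
    (lact N (vtx K Q (Q.t a))).rTensor (compo W q) (evD M N d q p t x) = evD M N d q p t x ∧
      evD M N d q p t ((lact M (vtx K Q (Q.s a))).rTensor (compo V p) x) = evD M N d q p t x := by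
  constructor
  · refine eq_of_liftSpace (((lact N (vtx K Q (Q.t a))).rTensor (compo W q)) ∘ₗ
      (evD M N d q p).flip x) ((evD M N d q p).flip x) (fun f hf y _ => ?_) ht
    simp only [LinearMap.comp_apply, LinearMap.flip_apply, evD_tmul]
    rw [← LinearMap.comp_apply, LinearMap.rTensor_comp_map, hf.1]
  · refine eq_of_liftSpace ((evD M N d q p).flip
      ((lact M (vtx K Q (Q.s a))).rTensor (compo V p) x)) ((evD M N d q p).flip x)
      (fun f hf y _ => ?_) ht
    simp only [LinearMap.flip_apply, evD_tmul]
    rw [← LinearMap.comp_apply, LinearMap.map_comp_rTensor, hf.2]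

lemma hallVtx_hallD (d : PiAlg K →ₗ[K] (V →ₗ[K] W)) (a : H) :
    hallVtx S R W (Q.t a) ∘ₗ hallD L d a = hallD L d a := by
  refine LinearMap.ext fun t => Prod.ext ?_ ?_
  · change (lact S (vtx K Q (Q.t a))).rTensor (compo W 0) (hallD L d a t).1 = (hallD L d a t).1
    rw [hallD_fst, map_add, (evD_mem_homComp d (L.matS_mem a) _).1,
      (evD_mem_homComp d (L.matQ_mem a) _).1]
  · change (lact R (vtx K Q (Q.t a))).rTensor (compo W 1) (hallD L d a t).2 = (hallD L d a t).2
    rw [hallD_snd, map_add, (evD_mem_homComp d (L.matP_mem a) _).1,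
      (evD_mem_homComp d (L.matR_mem a) _).1]

lemma hallD_hallVtx (d : PiAlg K →ₗ[K] (V →ₗ[K] W)) (a : H) :
    hallD L d a ∘ₗ hallVtx S R V (Q.s a) = hallD L d a := by
  refine LinearMap.ext fun t => Prod.ext ?_ ?_
  · change _ = (hallD L d a t).1
    rw [LinearMap.comp_apply, hallD_fst, hallD_fst, ← (evD_mem_homComp d (L.matS_mem a) t.1).2,
      ← (evD_mem_homComp d (L.matQ_mem a) t.2).2]
    rfl
  · change _ = (hallD L d a t).2
    rw [LinearMap.comp_apply, hallD_snd, hallD_snd, ← (evD_mem_homComp d (L.matP_mem a) t.1).2,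
      ← (evD_mem_homComp d (L.matR_mem a) t.2).2]
    rfl

/-- The relations of a universal lifting, evaluated by means of a "derivation". -/
lemma sum_hallD_comp {W' : ModuleCat.{u} (PiAlg K)} {d₁ : PiAlg K →ₗ[K] (W →ₗ[K] U)}
    {d₂ : PiAlg K →ₗ[K] (W' →ₗ[K] U)} {d₁' : PiAlg K →ₗ[K] (V →ₗ[K] W)}
    {d₂' : PiAlg K →ₗ[K] (V →ₗ[K] W')}
    {d : PiAlg K →ₗ[K] (V →ₗ[K] U)}
    (h : ∀ q r p, ∀ x ∈ corner K kronecker q r, ∀ y ∈ corner K kronecker r p, ∀ v : compo V p,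
      vtx K kronecker q • d₁ x (vtx K kronecker r • d₁' y v) +
      vtx K kronecker q • d₂ x (vtx K kronecker r • d₂' y v) = vtx K kronecker q • d (x * y) v)
    (i : I) : ∑ a ∈ Q.out i, Q.ε K a • (hallD L d₁ (Q.bar a) ∘ₗ hallD L d₁' a +
      hallD L d₂ (Q.bar a) ∘ₗ hallD L d₂' a) = 0 := by
  have hSS := congrArg (evD S S d 0 0) (L.rel_SS i)
  have hSQ := congrArg (evD R S d 0 1) (L.rel_SQ i)
  have hPS := congrArg (evD S R d 1 0) (L.rel_PS i)
  have hPQ := congrArg (evD R R d 1 1) (L.rel_PQ i)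
  simp only [map_sum, map_smul, map_add, map_zero] at hSS hSQ hPS hPQ
  simp only [← evD_comp_add (h 0 0 0) (L.matS_mem _) (L.matS_mem _),
    ← evD_comp_add (h 0 1 0) (L.matQ_mem _) (L.matP_mem _)] at hSS
  simp only [← evD_comp_add (h 0 0 1) (L.matS_mem _) (L.matQ_mem _),
    ← evD_comp_add (h 0 1 1) (L.matQ_mem _) (L.matR_mem _)] at hSQ
  simp only [← evD_comp_add (h 1 0 0) (L.matP_mem _) (L.matS_mem _),
    ← evD_comp_add (h 1 1 0) (L.matR_mem _) (L.matP_mem _)] at hPS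
  simp only [← evD_comp_add (h 1 0 1) (L.matP_mem _) (L.matQ_mem _),
    ← evD_comp_add (h 1 1 1) (L.matR_mem _) (L.matR_mem _)] at hPQ
  refine LinearMap.ext fun t => Prod.ext ?_ ?_
  · have h1 := congrArg (fun f => f t.1) hSS
    have h2 := congrArg (fun f => f t.2) hSQ
    have h3 := congrArg₂ (· + ·) h1 h2
    simp only [LinearMap.sum_apply, LinearMap.smul_apply, LinearMap.add_apply, LinearMap.comp_apply,
      LinearMap.zero_apply, ← Finset.sum_add_distrib, add_zero] at h3
    simp only [LinearMap.sum_apply, Prod.fst_sum]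
    refine Eq.trans (Finset.sum_congr rfl fun a _ => ?_) h3
    simp only [LinearMap.smul_apply, LinearMap.add_apply, LinearMap.comp_apply, Prod.smul_fst,
      Prod.fst_add, hallD_fst, hallD_snd, map_add, ← smul_add]
    congr 1
    abel
  · have h1 := congrArg (fun f => f t.1) hPS
    have h2 := congrArg (fun f => f t.2) hPQ
    have h3 := congrArg₂ (· + ·) h1 h2
    simp only [LinearMap.sum_apply, LinearMap.smul_apply, LinearMap.add_apply, LinearMap.comp_apply,
      LinearMap.zero_apply, ← Finset.sum_add_distrib, add_zero] at h3
    simp only [LinearMap.sum_apply, Prod.snd_sum]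
    refine Eq.trans (Finset.sum_congr rfl fun a _ => ?_) h3
    simp only [LinearMap.smul_apply, LinearMap.add_apply, LinearMap.comp_apply, Prod.smul_snd,
      Prod.snd_add, hallD_fst, hallD_snd, map_add, ← smul_add]
    congr 1
    abel

lemma hallD_zero (a : H) : hallD L (0 : PiAlg K →ₗ[K] (V →ₗ[K] W)) a = 0 := by
  have h : ∀ (M N : ModuleCat.{u} (Lam K Q)) (q p : Fin 2),
      evD M N (0 : PiAlg K →ₗ[K] (V →ₗ[K] W)) q p = 0 := by
    intro M N q p
    refine TensorProduct.ext' fun f x => ?_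
    rw [evD_tmul, LinearMap.zero_apply, map_zero, TensorProduct.map_zero_right]
    rfl
  refine LinearMap.ext fun t => Prod.ext ?_ ?_
  · rw [hallD_fst, h, h]
    simp
  · rw [hallD_snd, h, h]
    simp

lemma sum_rTensor_apply {M N : ModuleCat.{u} (Lam K Q)} {P : Type*} [AddCommGroup P] [Module K P]
    {ι : Type*} (s : Finset ι) (f : ι → M →ₗ[K] N) (t : M ⊗[K] P) :
    (∑ i ∈ s, f i).rTensor P t = ∑ i ∈ s, (f i).rTensor P t := by
  have := map_sum (LinearMap.rTensorHom (R := K) (N := M) (P := N) P) f s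
  exact (congrArg (fun g => g t) this).trans (LinearMap.sum_apply _ _ _)

variable (V) in
/-- The representation defined by the evaluation of a universal lifting. -/
def hallRep : Rep K Q (hallSpace S R V) where
  E i := hallVtx S R V i
  A a := hallArr L V a
  E_idem i := by
    unfold hallVtx
    rw [LinearMap.prodMap_comp, ← LinearMap.rTensor_comp, ← LinearMap.rTensor_comp]
    congr 2
    · exact (repOf S).E_idem i
    · exact (repOf R).E_idem i
  E_ortho i j h := by
    have h1 := (repOf S).E_ortho i j h
    have h2 := (repOf R).E_ortho i j h
    unfold hallVtx
    rw [LinearMap.prodMap_comp, ← LinearMap.rTensor_comp, ← LinearMap.rTensor_comp]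
    change LinearMap.prodMap (LinearMap.rTensor _ ((repOf S).E i ∘ₗ (repOf S).E j))
      (LinearMap.rTensor _ ((repOf R).E i ∘ₗ (repOf R).E j)) = 0
    rw [h1, h2, LinearMap.rTensor_zero, LinearMap.rTensor_zero]
    rfl
  E_sum := by
    have h1 : ∑ i, lact S (vtx K Q i) = LinearMap.id := (repOf S).E_sum
    have h2 : ∑ i, lact R (vtx K Q i) = LinearMap.id := (repOf R).E_sum
    refine LinearMap.ext fun t => Prod.ext ?_ ?_
    · rw [LinearMap.sum_apply, Prod.fst_sum]
      have := congrArg (fun f => LinearMap.rTensor (compo V 0) f t.1) h1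
      rw [LinearMap.rTensor_id] at this
      refine Eq.trans ?_ this
      exact (sum_rTensor_apply _ _ _).symm
    · rw [LinearMap.sum_apply, Prod.snd_sum]
      have := congrArg (fun f => LinearMap.rTensor (compo V 1) f t.2) h2
      rw [LinearMap.rTensor_id] at this
      refine Eq.trans ?_ this
      exact (sum_rTensor_apply _ _ _).symm
  E_A a := by rw [hallArr_eq_hallD, hallVtx_hallD]
  A_E a := by rw [hallArr_eq_hallD, hallD_hallVtx]
  rel i := by
    -- With `d₂ = 0` the hypothesis is multiplicativity of the action; the second product is needed
    -- later for the Leibniz rule.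
    have := sum_hallD_comp L (V := V) (d₁ := lactL V) (d₁' := lactL V) (d := lactL V)
      (d₂ := (0 : PiAlg K →ₗ[K] (V →ₗ[K] V))) (d₂' := 0) (fun q r p x hx y hy v => by
        simp only [LinearMap.zero_apply, smul_zero, add_zero, lactL_apply, smul_smul]
        congr 1
        rw [hy.1]) i
    simp only [hallD_zero, LinearMap.comp_zero, add_zero, ← hallArr_eq_hallD] at this
    exact this

lemma hallRep_E (i : I) : (hallRep L V).E i = hallVtx S R V i := rfl

lemma hallRep_A (a : H) : (hallRep L V).A a = hallD L (lactL V) a := hallArr_eq_hallD L a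

end HallRep

/-! ### Nilpotency of the evaluated representation. -/

section HallNilpotent

variable {K : Type u} [Field K] {I H : Type} [Fintype I] [Fintype H] {Q : OrientedGraph I H}
variable {S R : ModuleCat.{u} (Lam K Q)} {D : DualCocycles S R} (L : UniversalLifting D)
variable {V W : ModuleCat.{u} (PiAlg K)}

/-- If contractions with `l ∘ x` vanish for `x` in the radical, then the off-diagonal blocks of a
universal lifting do not contribute. -/
lemma con_matP_eq_zero (l : V →ₗ[K] K) (t : S ⊗[K] compo V 0)
    (h : ∀ x ∈ radIdeal K kronecker, con S V 0 (l ∘ₗ lact V x) t = 0) (a : H) :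
    con R V 1 l (evD S R (lactL V) 1 0 (L.matP a) t) = 0 := by
  have h2 : ∀ f : S →ₗ[K] R, ∀ x ∈ radIdeal K kronecker,
      con R V 1 l (evD S R (lactL V) 1 0 (f ⊗ₜ x) t) = 0 := by
    intro f x hx
    rw [con_evD_lactL, h _ (Ideal.mul_mem_left _ _ hx), map_zero]
  have h3 := eq_zero_of_liftFil (con R V 1 l ∘ₗ (evD S R (lactL V) 1 0).flip t)
    (fun f x hx => h2 f x (Ideal.pow_le_self (by norm_num) hx)) (L.matP_congr a)
  rw [map_sub, map_add, sub_eq_zero] at h3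
  simp only [LinearMap.comp_apply, LinearMap.flip_apply] at h3
  rw [h3, h2 _ _ (arr_mem_radIdeal _), h2 _ _ (arr_mem_radIdeal _), add_zero]

lemma con_matQ_eq_zero (l : V →ₗ[K] K) (t : R ⊗[K] compo V 1)
    (h : ∀ x ∈ radIdeal K kronecker, con R V 1 (l ∘ₗ lact V x) t = 0) (a : H) :
    con S V 0 l (evD R S (lactL V) 0 1 (L.matQ a) t) = 0 := by
  have h2 : ∀ f : R →ₗ[K] S, ∀ x ∈ radIdeal K kronecker,
      con S V 0 l (evD R S (lactL V) 0 1 (f ⊗ₜ x) t) = 0 := by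
    intro f x hx
    rw [con_evD_lactL, h _ (Ideal.mul_mem_left _ _ hx), map_zero]
  have h3 := eq_zero_of_liftFil (con S V 0 l ∘ₗ (evD R S (lactL V) 0 1).flip t)
    (fun f x hx => h2 f x (Ideal.pow_le_self (by norm_num) hx)) (L.matQ_congr a)
  rw [map_sub, map_add, sub_eq_zero] at h3
  simp only [LinearMap.comp_apply, LinearMap.flip_apply] at h3
  rw [h3, h2 _ _ (arr_mem_radIdeal _), h2 _ _ (arr_mem_radIdeal _), add_zero]

lemma con_comp_vtx {N : ModuleCat.{u} (Lam K Q)} {p : Fin 2} (l : V →ₗ[K] K)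
    (t : N ⊗[K] compo V p) : con N V p (l ∘ₗ lact V (vtx K kronecker p)) t = con N V p l t := by
  induction t with
  | zero => simp
  | add x y hx hy => rw [map_add, map_add, hx, hy]
  | tmul n v =>
    rw [con_tmul, con_tmul, LinearMap.comp_apply]
    change l (vtx K kronecker p • (v : V)) • n = _
    rw [vtx_smul_compo]

/-- Modulo `J ^ 2` the block is `S_a ⊗ e₀`, and coefficients in the radical disappear after
contraction. On the associated graded space the arrow therefore acts through `S` alone. -/
lemma con_matS_eq (l : V →ₗ[K] K) (t : S ⊗[K] compo V 0)
    (h : ∀ x ∈ radIdeal K kronecker, con S V 0 (l ∘ₗ lact V x) t = 0) (a : H) :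
    con S V 0 l (evD S S (lactL V) 0 0 (L.matS a) t) = arr K Q a • con S V 0 l t := by
  have h3 := eq_zero_of_liftFil (con S V 0 l ∘ₗ (evD S S (lactL V) 0 0).flip t)
    (fun f x hx => by
      rw [LinearMap.comp_apply, LinearMap.flip_apply, con_evD_lactL,
        h _ (Ideal.mul_mem_left _ _ (Ideal.pow_le_self (by norm_num) hx)), map_zero])
    (L.matS_congr a)
  rw [map_sub, sub_eq_zero] at h3
  simp only [LinearMap.comp_apply, LinearMap.flip_apply] at h3
  rw [h3, con_evD_lactL, vtx_mul, if_pos rfl, con_comp_vtx]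
  rfl

lemma con_matR_eq (l : V →ₗ[K] K) (t : R ⊗[K] compo V 1)
    (h : ∀ x ∈ radIdeal K kronecker, con R V 1 (l ∘ₗ lact V x) t = 0) (a : H) :
    con R V 1 l (evD R R (lactL V) 1 1 (L.matR a) t) = arr K Q a • con R V 1 l t := by
  have h3 := eq_zero_of_liftFil (con R V 1 l ∘ₗ (evD R R (lactL V) 1 1).flip t)
    (fun f x hx => by
      rw [LinearMap.comp_apply, LinearMap.flip_apply, con_evD_lactL,
        h _ (Ideal.mul_mem_left _ _ (Ideal.pow_le_self (by norm_num) hx)), map_zero])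
    (L.matR_congr a)
  rw [map_sub, sub_eq_zero] at h3
  simp only [LinearMap.comp_apply, LinearMap.flip_apply] at h3
  rw [h3, con_evD_lactL, vtx_mul, if_pos rfl, con_comp_vtx]
  rfl

variable (S R V) in
/-- The filtration of `hallSpace S R V` induced by the radical filtration of `V`. -/
def hallFil (k : ℕ) : Submodule K (hallSpace S R V) where
  carrier := {t | ∀ l ∈ perp V k, con S V 0 l t.1 = 0 ∧ con R V 1 l t.2 = 0}
  add_mem' hs ht l hl := ⟨by rw [Prod.fst_add, map_add, (hs l hl).1, (ht l hl).1, add_zero],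
    by rw [Prod.snd_add, map_add, (hs l hl).2, (ht l hl).2, add_zero]⟩
  zero_mem' l _ := ⟨map_zero _, map_zero _⟩
  smul_mem' c t ht l hl := ⟨by rw [Prod.smul_fst, map_smul, (ht l hl).1, smul_zero],
    by rw [Prod.smul_snd, map_smul, (ht l hl).2, smul_zero]⟩

lemma perp_mono {j k : ℕ} (h : j ≤ k) : perp V j ≤ perp V k :=
  fun _ hl w hw => hl w (fil_antitone h hw)

lemma con_lact_of_mem_hallFil {k : ℕ} {t : hallSpace S R V} (ht : t ∈ hallFil S R V k)
    {l : V →ₗ[K] K} (hl : l ∈ perp V (k + 1)) {x : PiAlg K} (hx : x ∈ radIdeal K kronecker) :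
    con S V 0 (l ∘ₗ lact V x) t.1 = 0 ∧ con R V 1 (l ∘ₗ lact V x) t.2 = 0 :=
  ht _ (perp_comp_lact_of_mem hx hl)

/-- On the associated graded of the filtration the preprojective algebra acts through its action on
the tensor factors `S` and `R`. -/
lemma con_lift_of_mem_hallFil {k : ℕ} (z : Pre K Q) : ∀ t ∈ hallFil S R V k,
    (hallRep L V).lift z t ∈ hallFil S R V k ∧ ∀ l ∈ perp V (k + 1),
      con S V 0 l ((hallRep L V).lift z t).1 = toLam K Q z • con S V 0 l t.1 ∧
      con R V 1 l ((hallRep L V).lift z t).2 = toLam K Q z • con R V 1 l t.2 := by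
  suffices h : ∀ t ∈ hallFil S R V k, ∀ l ∈ perp V (k + 1),
      con S V 0 l ((hallRep L V).lift z t).1 = toLam K Q z • con S V 0 l t.1 ∧
      con R V 1 l ((hallRep L V).lift z t).2 = toLam K Q z • con R V 1 l t.2 by
    refine fun t ht => ⟨fun l hl => ?_, h t ht⟩
    have := h t ht l (perp_mono k.le_succ hl)
    rw [(ht l hl).1, (ht l hl).2, smul_zero, smul_zero] at this
    exact this
  induction z using Pre.induction with
  | halg c =>
    intro t _ l _
    rw [AlgHom.commutes, AlgHom.commutes]
    constructor
    · rw [algebraMap_smul, ← map_smul]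
      rfl
    · rw [algebraMap_smul, ← map_smul]
      rfl
  | hV i =>
    intro t _ l _
    rw [Rep.lift_preV]
    have key : ∀ (N : ModuleCat.{u} (Lam K Q)) (p : Fin 2) (t : N ⊗[K] compo V p),
        con N V p l ((lact N (vtx K Q i)).rTensor (compo V p) t) = vtx K Q i • con N V p l t := by
      intro N p t
      induction t with
      | zero => simp
      | add x y hx hy => rw [map_add, map_add, hx, hy, map_add, smul_add]
      | tmul n v =>
        rw [LinearMap.rTensor_tmul, con_tmul, con_tmul]
        exact smul_comm _ _ _
    exact ⟨key S 0 t.1, key R 1 t.2⟩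
  | hA a =>
    intro t ht l hl
    rw [Rep.lift_preA, hallRep_A, hallD_fst, hallD_snd, map_add, map_add]
    have h1 := fun x hx => (con_lact_of_mem_hallFil ht hl (x := x) hx).1
    have h2 := fun x hx => (con_lact_of_mem_hallFil ht hl (x := x) hx).2
    rw [con_matS_eq L l _ h1, con_matR_eq L l _ h2, con_matP_eq_zero L l _ h1,
      con_matQ_eq_zero L l _ h2, add_zero, zero_add]
    exact ⟨rfl, rfl⟩
  | hadd z w hz hw =>
    intro t ht l hl
    rw [map_add, map_add, LinearMap.add_apply, Prod.fst_add, Prod.snd_add, map_add, map_add,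
      (hz t ht l hl).1, (hz t ht l hl).2, (hw t ht l hl).1, (hw t ht l hl).2, add_smul, add_smul]
    exact ⟨rfl, rfl⟩
  | hmul z w hz hw =>
    intro t ht l hl
    have hwt : (hallRep L V).lift w t ∈ hallFil S R V k := by
      intro l hl
      have := hw t ht l (perp_mono k.le_succ hl)
      rw [(ht l hl).1, (ht l hl).2, smul_zero, smul_zero] at this
      exact this
    rw [map_mul, map_mul, Module.End.mul_apply, (hz _ hwt l hl).1, (hz _ hwt l hl).2,
      (hw t ht l hl).1, (hw t ht l hl).2, smul_smul, smul_smul]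
    exact ⟨rfl, rfl⟩

lemma hallFil_zero (t : hallSpace S R V) : t ∈ hallFil S R V 0 := by
  intro l hl
  rw [perp_zero hl]
  have h : ∀ (N : ModuleCat.{u} (Lam K Q)) (p : Fin 2), con N V p 0 = 0 := by
    intro N p
    refine TensorProduct.ext' fun n v => ?_
    rw [con_tmul]
    simp
  rw [h, h]
  exact ⟨rfl, rfl⟩

lemma eq_zero_of_mem_hallFil [FiniteDimensional K V] {n : ℕ} (hn : fil V n = ⊥)
    {t : hallSpace S R V} (ht : t ∈ hallFil S R V n) : t = 0 := by
  have hl : ∀ l, l ∈ perp V n := by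
    intro l w hw
    rw [hn, Submodule.mem_bot] at hw
    rw [hw, map_zero]
  exact Prod.ext (eq_zero_of_con fun l => (ht l (hl l)).1) (eq_zero_of_con fun l => (ht l (hl l)).2)

/-- On the associated graded space the algebra acts through `S` and `R`. A power of the augmentation
ideal that annihilates both modules therefore moves `hallFil` down one step, and the filtration is
finite. -/
lemma hallRep_isNilp (hS : Module.Finite K S) (hR : Module.Finite K R) (hV : Module.Finite K V) :
    (hallRep L V).IsNilp := by
  obtain ⟨n, hn⟩ := exists_fil_eq_bot V hV
  obtain ⟨a, ha⟩ := exists_radIdeal_pow_smul_eq_zero S hS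
  obtain ⟨b, hb⟩ := exists_radIdeal_pow_smul_eq_zero R hR
  have hstep : ∀ k, ∀ z ∈ augIdeal K Q ^ (a + b), ∀ t ∈ hallFil S R V k,
      (hallRep L V).lift z t ∈ hallFil S R V (k + 1) := by
    intro k z hz t ht l hl
    have h1 := (con_lift_of_mem_hallFil L z t ht).2 l hl
    have h2 : toLam K Q z ∈ radIdeal K Q ^ (a + b) := by
      rw [radIdeal_pow_eq]
      exact toLam_mem_kerLam.2 hz
    rw [ha _ (Ideal.pow_le_pow_right (Nat.le_add_right a b) h2),
      hb _ (Ideal.pow_le_pow_right (Nat.le_add_left b a) h2)] at h1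
    exact h1
  have hpow : ∀ k, ∀ z ∈ augIdeal K Q ^ ((a + b) * k), ∀ t,
      (hallRep L V).lift z t ∈ hallFil S R V k := by
    intro k
    induction k with
    | zero => exact fun z _ t => hallFil_zero _
    | succ k ih =>
      intro z hz t
      rw [Nat.mul_succ, add_comm, Ideal.IsTwoSided.pow_add] at hz
      induction hz using Submodule.mul_induction_on' with
      | mem_mul_mem x hx y hy =>
        rw [map_mul, Module.End.mul_apply]
        exact hstep k x hx _ (ih y hy t)
      | add x _ y _ hx hy =>
        rw [map_add, LinearMap.add_apply]
        exact add_mem hx hy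
  refine ⟨(a + b) * n, fun z hz => LinearMap.ext fun t => ?_⟩
  exact eq_zero_of_mem_hallFil hn (hpow n z hz t)

end HallNilpotent

/-! ### Action on morphisms and existence of the functor. -/

section HallFunctorExists

variable {K : Type u} [Field K] {I H : Type} [Fintype I] [Fintype H] {Q : OrientedGraph I H}
variable {S R : ModuleCat.{u} (Lam K Q)} {D : DualCocycles S R} (L : UniversalLifting D)
variable {V W U : ModuleCat.{u} (PiAlg K)}

variable (S R) in
/-- The map `(S ⊗ V₀) ⊕ (R ⊗ V₁) → (S ⊗ W₀) ⊕ (R ⊗ W₁)` induced by a graded linear map `V → W`. -/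
def hallLin (φ : V →ₗ[K] W) : hallSpace S R V →ₗ[K] hallSpace S R W :=
  ((blk V W 0 0 φ).lTensor S).prodMap ((blk V W 1 1 φ).lTensor R)

lemma hallMap_eq_hallLin (f : V ⟶ W) : hallMap S R f = hallLin S R (f.hom.restrictScalars K) := by
  have h : ∀ p, compMap f p = blk V W p p (f.hom.restrictScalars K) := by
    intro p
    ext v
    rw [coe_blk]
    change f.hom v = vtx K kronecker p • f.hom v
    rw [← map_smul, vtx_smul_compo]
  rw [hallMap, hallLin, h, h]

/-- Graded linear maps. -/
def IsGraded (φ : V →ₗ[K] W) : Prop :=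
  ∀ (p : Fin 2) (v : V), φ (vtx K kronecker p • v) = vtx K kronecker p • φ v

lemma isGraded_hom (f : V ⟶ W) : IsGraded (f.hom.restrictScalars K) := fun p v => map_smul f.hom _ v

variable {M N : ModuleCat.{u} (Lam K Q)}

lemma lTensor_blk_evD {φ : W →ₗ[K] U} (hφ : IsGraded φ) (d : PiAlg K →ₗ[K] (V →ₗ[K] W))
    (q p : Fin 2) (t : (M →ₗ[K] N) ⊗[K] PiAlg K) (x : M ⊗[K] compo V p) :
    (blk W U q q φ).lTensor N (evD M N d q p t x) =
      evD M N (LinearMap.llcomp K V W U φ ∘ₗ d) q p t x := by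
  induction t with
  | zero => simp
  | add s t hs ht =>
    rw [map_add, LinearMap.add_apply, map_add, hs, ht, map_add, LinearMap.add_apply]
  | tmul f y =>
    rw [evD_tmul, evD_tmul, ← LinearMap.comp_apply, LinearMap.lTensor_comp_map]
    congr 2
    ext v
    change vtx K kronecker q • φ (vtx K kronecker q • d y v) = vtx K kronecker q • φ (d y v)
    rw [hφ, smul_smul, vtx_mul, if_pos rfl]

lemma evD_lTensor_blk {φ : V →ₗ[K] W} (hφ : IsGraded φ) (d : PiAlg K →ₗ[K] (W →ₗ[K] U))
    (q p : Fin 2) (t : (M →ₗ[K] N) ⊗[K] PiAlg K) (x : M ⊗[K] compo V p) :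
    evD M N d q p t ((blk V W p p φ).lTensor M x) =
      evD M N (LinearMap.lcomp K U φ ∘ₗ d) q p t x := by
  induction t with
  | zero => simp
  | add s t hs ht => rw [map_add, LinearMap.add_apply, hs, ht, map_add, LinearMap.add_apply]
  | tmul f y =>
    rw [evD_tmul, evD_tmul, ← LinearMap.comp_apply, LinearMap.map_comp_lTensor]
    congr 2
    ext v
    change vtx K kronecker q • d y (vtx K kronecker p • φ v) = vtx K kronecker q • d y (φ v)
    rw [← hφ, vtx_smul_compo]

lemma hallLin_hallD {φ : W →ₗ[K] U} (hφ : IsGraded φ) (d : PiAlg K →ₗ[K] (V →ₗ[K] W)) (a : H)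
    (t : hallSpace S R V) : hallLin S R φ (hallD L d a t) =
      hallD L (LinearMap.llcomp K V W U φ ∘ₗ d) a t := by
  refine Prod.ext ?_ ?_
  · rw [hallD_fst, ← lTensor_blk_evD hφ, ← lTensor_blk_evD hφ, ← map_add]
    rfl
  · rw [hallD_snd, ← lTensor_blk_evD hφ, ← lTensor_blk_evD hφ, ← map_add]
    rfl

lemma hallD_hallLin {φ : V →ₗ[K] W} (hφ : IsGraded φ) (d : PiAlg K →ₗ[K] (W →ₗ[K] U)) (a : H)
    (t : hallSpace S R V) : hallD L d a (hallLin S R φ t) =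
      hallD L (LinearMap.lcomp K U φ ∘ₗ d) a t := by
  refine Prod.ext ?_ ?_
  · rw [hallD_fst, hallD_fst, ← evD_lTensor_blk hφ, ← evD_lTensor_blk hφ]
    rfl
  · rw [hallD_snd, hallD_snd, ← evD_lTensor_blk hφ, ← evD_lTensor_blk hφ]
    rfl

lemma evD_add (d d' : PiAlg K →ₗ[K] (V →ₗ[K] W)) (q p : Fin 2) :
    evD M N (d + d') q p = evD M N d q p + evD M N d' q p := by
  refine TensorProduct.ext' fun f x => ?_
  rw [LinearMap.add_apply, evD_tmul, evD_tmul, evD_tmul, LinearMap.add_apply, map_add,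
    TensorProduct.map_add_right]

lemma evD_smul (c : K) (d : PiAlg K →ₗ[K] (V →ₗ[K] W)) (q p : Fin 2) :
    evD M N (c • d) q p = c • evD M N d q p := by
  refine TensorProduct.ext' fun f x => ?_
  rw [LinearMap.smul_apply, evD_tmul, evD_tmul, LinearMap.smul_apply, map_smul,
    TensorProduct.map_smul_right]

/-- Evaluation of the matrices of a universal lifting, as a linear function. -/
def hallDL (V W : ModuleCat.{u} (PiAlg K)) :
    (PiAlg K →ₗ[K] (V →ₗ[K] W)) →ₗ[K] (H → hallSpace S R V →ₗ[K] hallSpace S R W) where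
  toFun d a := hallD L d a
  map_add' d d' := by
    funext a
    refine LinearMap.ext fun t => Prod.ext ?_ ?_
    · simp only [Pi.add_apply, LinearMap.add_apply, Prod.fst_add, hallD_fst, evD_add]
      abel
    · simp only [Pi.add_apply, LinearMap.add_apply, Prod.snd_add, hallD_snd, evD_add]
      abel
  map_smul' c d := by
    funext a
    refine LinearMap.ext fun t => Prod.ext ?_ ?_
    · simp only [Pi.smul_apply, LinearMap.smul_apply, Prod.smul_fst, hallD_fst, evD_smul,
        RingHom.id_apply, smul_add]
    · simp only [Pi.smul_apply, LinearMap.smul_apply, Prod.smul_snd, hallD_snd, evD_smul,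
        RingHom.id_apply, smul_add]

lemma hallLin_mem_C0 (φ : V →ₗ[K] W) : hallLin S R φ ∈ (hallRep L V).C0 (hallRep L W) := by
  intro i
  rw [hallRep_E, hallRep_E, hallVtx, hallVtx, hallLin, LinearMap.prodMap_comp,
    LinearMap.prodMap_comp, LinearMap.rTensor_comp_lTensor, LinearMap.rTensor_comp_lTensor,
    LinearMap.lTensor_comp_rTensor, LinearMap.lTensor_comp_rTensor]

/-- The inner derivation `x ↦ x φ - φ x`. -/
def commL (φ : V →ₗ[K] W) : PiAlg K →ₗ[K] (V →ₗ[K] W) :=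
  LinearMap.lcomp K W φ ∘ₗ lactL W - LinearMap.llcomp K V V W φ ∘ₗ lactL V

lemma commL_apply (φ : V →ₗ[K] W) (x : PiAlg K) (v : V) : commL φ x v = x • φ v - φ (x • v) := rfl

/-- Evaluating after or before applying `φ` differs by the commutator of `φ` with the action. Hence
morphisms give intertwining operators, and inner derivations give coboundaries. -/
lemma dZero_hallLin {φ : V →ₗ[K] W} (hφ : IsGraded φ) :
    (hallRep L V).dZero (hallRep L W) (hallLin S R φ) = hallDL L V W (commL φ) := by
  rw [commL, map_sub]
  funext a
  refine LinearMap.ext fun t => ?_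
  rw [Rep.dZero_apply, hallRep_A, hallRep_A]
  exact congrArg₂ (· - ·) (hallD_hallLin L hφ _ a t) (hallLin_hallD L hφ _ a t)

lemma hallMap_intertwines (f : V ⟶ W) :
    (hallRep L V).Intertwines (hallRep L W) (hallMap S R f) := by
  rw [hallMap_eq_hallLin, Rep.intertwines_iff]
  refine ⟨hallLin_mem_C0 L _, ?_⟩
  have h : commL (f.hom.restrictScalars K) = 0 :=
    LinearMap.ext fun x => LinearMap.ext fun v => sub_eq_zero.2 (map_smul f.hom x v).symm
  rw [dZero_hallLin L (isGraded_hom f), h, map_zero]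

lemma hallMap_id : hallMap S R (𝟙 V) = LinearMap.id := by
  have h : ∀ p, compMap (𝟙 V) p = LinearMap.id := fun p => rfl
  rw [hallMap, h, h, LinearMap.lTensor_id, LinearMap.lTensor_id]
  rfl

lemma hallMap_comp (f : V ⟶ W) (g : W ⟶ U) :
    hallMap S R (f ≫ g) = hallMap S R g ∘ₗ hallMap S R f := by
  have h : ∀ p, compMap (f ≫ g) p = compMap g p ∘ₗ compMap f p := fun p => rfl
  rw [hallMap, h, h, LinearMap.lTensor_comp, LinearMap.lTensor_comp, hallMap, hallMap,
    LinearMap.prodMap_comp]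

lemma hallSpace_finite (hS : Module.Finite K S) (hR : Module.Finite K R) (hV : Module.Finite K V) :
    Module.Finite K (hallSpace S R V) :=
  inferInstance

lemma exists_hallFunctor (hS : Module.Finite K S) (hR : Module.Finite K R) :
    ∃ F : FDMod K kronecker ⥤ FDMod K Q, IsHallFunctor L F := by
  choose X e hE hA using fun V : FDMod K kronecker =>
    (hallRep_isNilp L hS hR V.property).exists_module
  have hX : ∀ V, Module.Finite K (X V) := fun V =>
    have := hallSpace_finite hS hR V.property
    Module.Finite.equiv (e V).symm
  have hint : ∀ {V W : FDMod K kronecker} (f : V ⟶ W), (repOf (X V)).Intertwines (repOf (X W))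
      ((e W).symm.toLinearMap ∘ₗ hallMap S R f.hom ∘ₗ (e V).toLinearMap) := by
    intro V W f
    have h := hallMap_intertwines L f.hom
    constructor
    · intro i m
      apply (e W).injective
      have h1 := h.1 i (e V m)
      simp only [LinearMap.comp_apply, LinearEquiv.coe_coe, LinearEquiv.apply_symm_apply, repOf_E,
        hE]
      exact h1
    · intro a m
      apply (e W).injective
      have h1 := h.2 a (e V m)
      simp only [LinearMap.comp_apply, LinearEquiv.coe_coe, LinearEquiv.apply_symm_apply, repOf_A,
        hA]
      exact h1
  let F : FDMod K kronecker ⥤ FDMod K Q :=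
    { obj := fun V => ⟨X V, hX V⟩
      map := fun {V W} f => ObjectProperty.homMk ((hint f).hom (hX V) (hX W))
      map_id := fun V => by
        apply ObjectProperty.hom_ext
        refine ModuleCat.hom_ext (LinearMap.ext fun m => ?_)
        change (e V).symm (hallMap S R (𝟙 V.obj) (e V m)) = m
        rw [hallMap_id, LinearMap.id_apply, LinearEquiv.symm_apply_apply]
      map_comp := fun {V W U} f g => by
        apply ObjectProperty.hom_ext
        refine ModuleCat.hom_ext (LinearMap.ext fun m => ?_)
        change (e U).symm (hallMap S R (f.hom ≫ g.hom) (e V m)) = (e U).symm (hallMap S R g.hom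
          (e W ((e W).symm (hallMap S R f.hom (e V m)))))
        rw [hallMap_comp, LinearEquiv.apply_symm_apply]
        rfl }
  refine ⟨F, e, hE, hA, fun V W f m => ?_⟩
  exact (e W).apply_symm_apply _

end HallFunctorExists

/-! ### Maps that are morphisms up to a derivation, studied along the radical filtrations. -/

section Fullness

variable {K : Type u} [Field K] {I H : Type} [Fintype I] [Fintype H] {Q : OrientedGraph I H}
variable {S R : ModuleCat.{u} (Lam K Q)} {D : DualCocycles S R} (L : UniversalLifting D)
variable {V W : ModuleCat.{u} (PiAlg K)} {M N : ModuleCat.{u} (Lam K Q)}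

lemma con_rTensor {p : Fin 2} (l : V →ₗ[K] K) (x : Lam K Q) (t : N ⊗[K] compo V p) :
    con N V p l ((lact N x).rTensor (compo V p) t) = x • con N V p l t := by
  induction t with
  | zero => simp
  | add x y hx hy => rw [map_add, map_add, hx, hy, map_add, smul_add]
  | tmul n v =>
    rw [LinearMap.rTensor_tmul, con_tmul, con_tmul]
    exact smul_comm _ _ _

lemma apply_evD_lactL_tmul_eq_zero {A : Type*} [AddCommGroup A] [Module K A] {q p : Fin 2} {i : ℕ}
    (ψ : N ⊗[K] compo V q →ₗ[K] A) (hψ : ∀ v : compo V q, (v : V) ∈ fil V (i + 1) →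
      ∀ n, ψ (n ⊗ₜ v) = 0) (f : M →ₗ[K] N) {x : PiAlg K} (hx : x ∈ radIdeal K kronecker)
    (m : M) (v : compo V p) (hv : (v : V) ∈ fil V i) :
    ψ (evD M N (lactL V) q p (f ⊗ₜ x) (m ⊗ₜ v)) = 0 := by
  rw [evD_tmul, TensorProduct.map_tmul]
  refine hψ _ ?_ _
  rw [coe_blk, add_comm]
  exact smul_mem_fil _ (smul_mem_fil_add (by rwa [Submodule.pow_one]) hv)

lemma apply_evD_lactL_eq_zero {A : Type*} [AddCommGroup A] [Module K A] {q p : Fin 2} {i : ℕ}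
    (ψ : N ⊗[K] compo V q →ₗ[K] A) (hψ : ∀ v : compo V q, (v : V) ∈ fil V (i + 1) →
      ∀ n, ψ (n ⊗ₜ v) = 0) {t : (M →ₗ[K] N) ⊗[K] PiAlg K} {k : ℕ} (hk : k ≠ 0)
    (ht : t ∈ liftFil M N k) (m : M) (v : compo V p) (hv : (v : V) ∈ fil V i) :
    ψ (evD M N (lactL V) q p t (m ⊗ₜ v)) = 0 :=
  eq_zero_of_liftFil (ψ ∘ₗ (evD M N (lactL V) q p).flip (m ⊗ₜ v)) (fun f _ hx =>
    apply_evD_lactL_tmul_eq_zero ψ hψ f (Ideal.pow_le_self hk hx) m v hv) ht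

lemma con_evD_eq_zero {d : PiAlg K →ₗ[K] (V →ₗ[K] W)} {q p : Fin 2} {i j k k' : ℕ}
    (h : ∀ x ∈ radIdeal K kronecker ^ k, ∀ v ∈ fil V i, ∀ l ∈ perp W j, l (d x v) = 0)
    (hk : k ≤ k') {t : (M →ₗ[K] N) ⊗[K] PiAlg K} (ht : t ∈ liftFil M N k') (m : M) (v : compo V p)
    (hv : (v : V) ∈ fil V i) {l : W →ₗ[K] K} (hl : l ∈ perp W j) :
    con N W q l (evD M N d q p t (m ⊗ₜ v)) = 0 :=
  eq_zero_of_liftFil (con N W q l ∘ₗ (evD M N d q p).flip (m ⊗ₜ v)) (fun f x hx => by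
    rw [LinearMap.comp_apply, LinearMap.flip_apply, con_evD_tmul_tmul]
    have := h x (Ideal.pow_le_pow_right hk hx) v hv _ (perp_comp_lact (vtx K kronecker q) hl)
    rw [LinearMap.comp_apply] at this
    exact (congrArg (· • f m) this).trans (zero_smul _ _)) ht

/-- The vanishing of the components of a deformation datum between two steps of the radical
filtrations. -/
structure VanishAt (u : hallSpace S R V →ₗ[K] hallSpace S R W) (d : PiAlg K →ₗ[K] (V →ₗ[K] W))
    (i j : ℕ) : Prop where
  left : ∀ v : compo V 0, (v : V) ∈ fil V i → ∀ l ∈ perp W j, ∀ s : S,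
    con S W 0 l (u (s ⊗ₜ v, 0)).1 = 0 ∧ con R W 1 l (u (s ⊗ₜ v, 0)).2 = 0
  right : ∀ v : compo V 1, (v : V) ∈ fil V i → ∀ l ∈ perp W j, ∀ r : R,
    con S W 0 l (u (0, r ⊗ₜ v)).1 = 0 ∧ con R W 1 l (u (0, r ⊗ₜ v)).2 = 0
  der : ∀ v ∈ fil V i, ∀ l ∈ perp W j, ∀ x ∈ radIdeal K kronecker, l (d x v) = 0

variable {u : hallSpace S R V →ₗ[K] hallSpace S R W} {d : PiAlg K →ₗ[K] (V →ₗ[K] W)} {i j : ℕ}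

lemma radIdeal_sq : radIdeal K Q ^ 2 = radIdeal K Q * radIdeal K Q := by
  have := Submodule.pow_succ (n := 1) (radIdeal K Q)
  rwa [Submodule.pow_one] at this

/-- In `d(xy) = x d(y) + d(x) y`, the first term gains a step in `W` from `x`, and the second gains
a step in `V` from `y`. -/
lemma VanishAt.der_sq (hd : d ∈ Der0 V W) (h : VanishAt u d (i + 1) (j + 1)) (h' : VanishAt u d i j) :
    ∀ x ∈ radIdeal K kronecker ^ 2, ∀ v ∈ fil V i, ∀ l ∈ perp W (j + 1), l (d x v) = 0 := by
  intro x hx v hv l hl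
  rw [radIdeal_sq] at hx
  induction hx using Submodule.mul_induction_on' with
  | mem_mul_mem x hx y hy =>
    rw [hd.1, map_add]
    have h1 := h'.der v hv _ (perp_comp_lact_of_mem hx hl) y hy
    have h2 := h.der (y • v) (by
      rw [add_comm]; exact smul_mem_fil_add (by rwa [Submodule.pow_one]) hv) l hl x hx
    rw [h2, add_zero]
    exact h1
  | add x _ y _ hx hy => rw [map_add, LinearMap.add_apply, map_add, hx, hy, add_zero]

lemma vtx_smul_der (hd : d ∈ Der0 V W) (i : Fin 2) (x : PiAlg K) (v : V) :
    vtx K kronecker i • d x v = d (vtx K kronecker i * x) v := by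
  rw [hd.1, hd.2, LinearMap.zero_apply, add_zero]

lemma vtx_arr_kronecker (k : Fin 2) :
    vtx K kronecker 1 * arr K kronecker (k, false) = arr K kronecker (k, false) ∧
      vtx K kronecker 0 * arr K kronecker (k, true) = arr K kronecker (k, true) :=
  ⟨vtx_arr (Q := kronecker) (k, false), vtx_arr (Q := kronecker) (k, true)⟩

/-- Modulo the next step of the filtration of `V`, every radical coefficient of the lifting
disappears and the arrow acts on the factor `S` only. -/
lemma apply_hallD_left {A : Type*} [AddCommGroup A] [Module K A] (g : hallSpace S R V →ₗ[K] A)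
    (hg1 : ∀ v : compo V 0, (v : V) ∈ fil V (i + 1) → ∀ s : S, g (s ⊗ₜ v, 0) = 0)
    (hg2 : ∀ v : compo V 1, (v : V) ∈ fil V (i + 1) → ∀ r : R, g (0, r ⊗ₜ v) = 0)
    (v : compo V 0) (hv : (v : V) ∈ fil V i) (s : S) (a : H) :
    g (hallD L (lactL V) a (s ⊗ₜ v, 0)) = g ((arr K Q a • s) ⊗ₜ v, 0) := by
  have e1 := apply_evD_lactL_eq_zero (p := 0) (g ∘ₗ LinearMap.inl K _ _) hg1 two_ne_zero
    (L.matS_congr a) s v hv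
  have e2 := apply_evD_lactL_eq_zero (p := 0) (g ∘ₗ LinearMap.inr K _ _) hg2 three_ne_zero
    (L.matP_congr a) s v hv
  rw [map_sub, map_add, LinearMap.sub_apply, LinearMap.add_apply, map_sub, map_add,
    apply_evD_lactL_tmul_eq_zero (i := i) _ hg2 _ (arr_mem_radIdeal _) _ _ hv,
    apply_evD_lactL_tmul_eq_zero (i := i) _ hg2 _ (arr_mem_radIdeal _) _ _ hv, add_zero,
    sub_zero] at e2
  rw [map_sub, LinearMap.sub_apply, map_sub, sub_eq_zero, evD_tmul (lactL V),
    TensorProduct.map_tmul] at e1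
  have e3 : hallD L (lactL V) a (s ⊗ₜ v, 0) =
      LinearMap.inl K _ _ (evD S S (lactL V) 0 0 (L.matS a) (s ⊗ₜ v))
      + LinearMap.inr K _ _ (evD S R (lactL V) 1 0 (L.matP a) (s ⊗ₜ v)) := by
    refine Prod.ext ?_ ?_
    · rw [hallD_fst]; simp
    · rw [hallD_snd]; simp
  rw [e3, map_add]
  refine (congrArg₂ (· + ·) e1 e2).trans ?_
  rw [add_zero]
  have e4 : blk V V 0 0 (lactL V (vtx K kronecker 0)) v = v := by
    refine Subtype.ext ?_
    rw [coe_blk, lactL_apply, vtx_smul_compo, vtx_smul_compo]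
  rw [e4]
  rfl

/-- The leading term of the equation for `u` and `d`. The `S → S` component commutes with the
arrows, and the boundary of the `S → R` component is a combination of `ξ` and `η` whose coefficients
are values of `d` on `α` and `β`. -/
lemma con_hallD_left (hd : d ∈ Der0 V W) (h : VanishAt u d (i + 1) (j + 1))
    (h' : VanishAt u d i j) (hu : (hallRep L V).dZero (hallRep L W) u + hallDL L V W d = 0)
    (v : compo V 0) (hv : (v : V) ∈ fil V i) {l : W →ₗ[K] K} (hl : l ∈ perp W (j + 1)) (s : S)
    (a : H) :
    con S W 0 l (u ((arr K Q a • s) ⊗ₜ v, 0)).1 = arr K Q a • con S W 0 l (u (s ⊗ₜ v, 0)).1 ∧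
    arr K Q a • con R W 1 l (u (s ⊗ₜ v, 0)).2 - con R W 1 l (u ((arr K Q a • s) ⊗ₜ v, 0)).2 +
      (l (d (arr K kronecker (0, false)) v) • D.ξ a s +
        l (d (arr K kronecker (1, false)) v) • D.η a s) = 0 := by
  have hsq := h.der_sq hd h'
  set t : hallSpace S R V := (s ⊗ₜ v, 0) with ht
  have h0 : hallD L (lactL W) a (u t) - u (hallD L (lactL V) a t) + hallD L d a t = 0 := by
    have := congrArg (fun g => g a t) hu
    rw [← hallRep_A, ← hallRep_A]
    exact this
  have hx1 : ∀ x ∈ radIdeal K kronecker, con S W 0 (l ∘ₗ lact W x) (u t).1 = 0 := fun x hx =>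
    (h'.left v hv _ (perp_comp_lact_of_mem hx hl) s).1
  have hx2 : ∀ x ∈ radIdeal K kronecker, con R W 1 (l ∘ₗ lact W x) (u t).2 = 0 := fun x hx =>
    (h'.left v hv _ (perp_comp_lact_of_mem hx hl) s).2
  have hu1 : ∀ {A : Type u} [AddCommGroup A] [Module K A] (g : hallSpace S R W →ₗ[K] A),
      (∀ v : compo V 0, (v : V) ∈ fil V (i + 1) → ∀ s : S, g (u (s ⊗ₜ v, 0)) = 0) →
      (∀ v : compo V 1, (v : V) ∈ fil V (i + 1) → ∀ r : R, g (u (0, r ⊗ₜ v)) = 0) →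
      g (u (hallD L (lactL V) a t)) = g (u ((arr K Q a • s) ⊗ₜ v, 0)) :=
    fun g hg1 hg2 => apply_hallD_left L (g ∘ₗ u) hg1 hg2 v hv s a
  constructor
  · have h1 := congrArg (fun t => con S W 0 l t.1) h0
    simp only [Prod.fst_add, Prod.fst_sub, map_add, map_sub, Prod.fst_zero, map_zero] at h1
    rw [hallD_fst, map_add, con_matS_eq L l _ hx1, con_matQ_eq_zero L l _ hx2, add_zero,
      hallD_fst, ht] at h1
    have e1 := con_evD_eq_zero (q := 0) hsq le_rfl (L.matS_congr a) s v hv hl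
    rw [map_sub, LinearMap.sub_apply, map_sub, evD_tmul, hd.2, map_zero,
      TensorProduct.map_zero_right, LinearMap.zero_apply, map_zero, sub_zero] at e1
    have e2 := hu1 (con S W 0 l ∘ₗ LinearMap.fst K _ _) (fun v hv s => (h.left v hv l hl s).1)
      (fun v hv r => (h.right v hv l hl r).1)
    simp only [map_zero, add_zero, e1] at h1
    rw [sub_eq_zero] at h1
    exact e2.symm.trans h1.symm
  · have h1 := congrArg (fun t => con R W 1 l t.2) h0
    simp only [Prod.snd_add, Prod.snd_sub, map_add, map_sub, Prod.snd_zero, map_zero] at h1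
    rw [hallD_snd, map_add, con_matR_eq L l _ hx2, con_matP_eq_zero L l _ hx1, zero_add,
      hallD_snd, ht] at h1
    -- The error in the off-diagonal block lies in `J ^ 3`, so `d` of its coefficients already
    -- vanishes by `hsq`, which only needs `J ^ 2`.
    have e1 := con_evD_eq_zero (q := 1) hsq (Nat.le_succ 2) (L.matP_congr a) s v hv hl
    rw [map_sub, map_add, LinearMap.sub_apply, LinearMap.add_apply, map_sub, map_add,
      con_evD_tmul_tmul, con_evD_tmul_tmul, vtx_smul_der hd, vtx_smul_der hd,
      (vtx_arr_kronecker 0).1, (vtx_arr_kronecker 1).1, sub_eq_zero] at e1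
    have e2 := hu1 (con R W 1 l ∘ₗ LinearMap.snd K _ _) (fun v hv s => (h.left v hv l hl s).2)
      (fun v hv r => (h.right v hv l hl r).2)
    simp only [map_zero, add_zero, e1] at h1
    rw [← h1]
    congr 2
    exact e2.symm

lemma apply_hallD_right {A : Type*} [AddCommGroup A] [Module K A] (g : hallSpace S R V →ₗ[K] A)
    (hg1 : ∀ v : compo V 0, (v : V) ∈ fil V (i + 1) → ∀ s : S, g (s ⊗ₜ v, 0) = 0)
    (hg2 : ∀ v : compo V 1, (v : V) ∈ fil V (i + 1) → ∀ r : R, g (0, r ⊗ₜ v) = 0)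
    (v : compo V 1) (hv : (v : V) ∈ fil V i) (r : R) (a : H) :
    g (hallD L (lactL V) a (0, r ⊗ₜ v)) = g (0, (arr K Q a • r) ⊗ₜ v) := by
  have e1 := apply_evD_lactL_eq_zero (p := 1) (g ∘ₗ LinearMap.inr K _ _) hg2 two_ne_zero
    (L.matR_congr a) r v hv
  have e2 := apply_evD_lactL_eq_zero (p := 1) (g ∘ₗ LinearMap.inl K _ _) hg1 three_ne_zero
    (L.matQ_congr a) r v hv
  rw [map_sub, map_add, LinearMap.sub_apply, LinearMap.add_apply, map_sub, map_add,
    apply_evD_lactL_tmul_eq_zero (i := i) _ hg1 _ (arr_mem_radIdeal _) _ _ hv,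
    apply_evD_lactL_tmul_eq_zero (i := i) _ hg1 _ (arr_mem_radIdeal _) _ _ hv, add_zero,
    sub_zero] at e2
  rw [map_sub, LinearMap.sub_apply, map_sub, sub_eq_zero, evD_tmul (lactL V),
    TensorProduct.map_tmul] at e1
  have e3 : hallD L (lactL V) a (0, r ⊗ₜ v) =
      LinearMap.inr K _ _ (evD R R (lactL V) 1 1 (L.matR a) (r ⊗ₜ v))
      + LinearMap.inl K _ _ (evD R S (lactL V) 0 1 (L.matQ a) (r ⊗ₜ v)) := by
    refine Prod.ext ?_ ?_
    · rw [hallD_fst]; simp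
    · rw [hallD_snd]; simp
  rw [e3, map_add]
  refine (congrArg₂ (· + ·) e1 e2).trans ?_
  rw [add_zero]
  have e4 : blk V V 1 1 (lactL V (vtx K kronecker 1)) v = v := by
    refine Subtype.ext ?_
    rw [coe_blk, lactL_apply, vtx_smul_compo, vtx_smul_compo]
  rw [e4]
  rfl

lemma con_hallD_right (hd : d ∈ Der0 V W) (h : VanishAt u d (i + 1) (j + 1))
    (h' : VanishAt u d i j) (hu : (hallRep L V).dZero (hallRep L W) u + hallDL L V W d = 0)
    (v : compo V 1) (hv : (v : V) ∈ fil V i) {l : W →ₗ[K] K} (hl : l ∈ perp W (j + 1)) (r : R)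
    (a : H) :
    con R W 1 l (u (0, (arr K Q a • r) ⊗ₜ v)).2 = arr K Q a • con R W 1 l (u (0, r ⊗ₜ v)).2 ∧
    arr K Q a • con S W 0 l (u (0, r ⊗ₜ v)).1 - con S W 0 l (u (0, (arr K Q a • r) ⊗ₜ v)).1 +
      (l (d (arr K kronecker (0, true)) v) • D.ξ' a r +
        l (d (arr K kronecker (1, true)) v) • D.η' a r) = 0 := by
  have hsq := h.der_sq hd h'
  set t : hallSpace S R V := (0, r ⊗ₜ v) with ht
  have h0 : hallD L (lactL W) a (u t) - u (hallD L (lactL V) a t) + hallD L d a t = 0 := by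
    have := congrArg (fun g => g a t) hu
    rw [← hallRep_A, ← hallRep_A]
    exact this
  have hx1 : ∀ x ∈ radIdeal K kronecker, con S W 0 (l ∘ₗ lact W x) (u t).1 = 0 := fun x hx =>
    (h'.right v hv _ (perp_comp_lact_of_mem hx hl) r).1
  have hx2 : ∀ x ∈ radIdeal K kronecker, con R W 1 (l ∘ₗ lact W x) (u t).2 = 0 := fun x hx =>
    (h'.right v hv _ (perp_comp_lact_of_mem hx hl) r).2
  have hu1 : ∀ {A : Type u} [AddCommGroup A] [Module K A] (g : hallSpace S R W →ₗ[K] A),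
      (∀ v : compo V 0, (v : V) ∈ fil V (i + 1) → ∀ s : S, g (u (s ⊗ₜ v, 0)) = 0) →
      (∀ v : compo V 1, (v : V) ∈ fil V (i + 1) → ∀ r : R, g (u (0, r ⊗ₜ v)) = 0) →
      g (u (hallD L (lactL V) a t)) = g (u (0, (arr K Q a • r) ⊗ₜ v)) :=
    fun g hg1 hg2 => apply_hallD_right L (g ∘ₗ u) hg1 hg2 v hv r a
  constructor
  · have h1 := congrArg (fun t => con R W 1 l t.2) h0
    simp only [Prod.snd_add, Prod.snd_sub, map_add, map_sub, Prod.snd_zero, map_zero] at h1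
    rw [hallD_snd, map_add, con_matR_eq L l _ hx2, con_matP_eq_zero L l _ hx1, zero_add,
      hallD_snd, ht] at h1
    have e1 := con_evD_eq_zero (q := 1) hsq le_rfl (L.matR_congr a) r v hv hl
    rw [map_sub, LinearMap.sub_apply, map_sub, evD_tmul, hd.2, map_zero,
      TensorProduct.map_zero_right, LinearMap.zero_apply, map_zero, sub_zero] at e1
    have e2 := hu1 (con R W 1 l ∘ₗ LinearMap.snd K _ _) (fun v hv s => (h.left v hv l hl s).2)
      (fun v hv r => (h.right v hv l hl r).2)
    simp only [map_zero, zero_add, add_zero, e1] at h1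
    rw [sub_eq_zero] at h1
    exact e2.symm.trans h1.symm
  · have h1 := congrArg (fun t => con S W 0 l t.1) h0
    simp only [Prod.fst_add, Prod.fst_sub, map_add, map_sub, Prod.fst_zero, map_zero] at h1
    rw [hallD_fst, map_add, con_matS_eq L l _ hx1, con_matQ_eq_zero L l _ hx2, add_zero,
      hallD_fst, ht] at h1
    have e1 := con_evD_eq_zero (q := 0) hsq (Nat.le_succ 2) (L.matQ_congr a) r v hv hl
    rw [map_sub, map_add, LinearMap.sub_apply, LinearMap.add_apply, map_sub, map_add,
      con_evD_tmul_tmul, con_evD_tmul_tmul, vtx_smul_der hd, vtx_smul_der hd,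
      (vtx_arr_kronecker 0).2, (vtx_arr_kronecker 1).2, sub_eq_zero] at e1
    have e2 := hu1 (con S W 0 l ∘ₗ LinearMap.fst K _ _) (fun v hv s => (h.left v hv l hl s).1)
      (fun v hv r => (h.right v hv l hl r).1)
    simp only [map_zero, zero_add, e1] at h1
    rw [← h1]
    congr 2
    exact e2.symm

/-- The contraction of a block of `u`, as a linear map `M → N`. -/
def conLin {A : Type u} [AddCommGroup A] [Module K A] {p : Fin 2} (g : A →ₗ[K] N)
    (v : compo V p) (f : M ⊗[K] compo V p →ₗ[K] A) : M →ₗ[K] N :=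
  g ∘ₗ f ∘ₗ (TensorProduct.mk K M (compo V p)).flip v

/-- The radical is spanned by its square and the arrows, up to multiplication by idempotents. -/
lemma l_der_eq_zero (hd : d ∈ Der0 V W)
    (hsq : ∀ x ∈ radIdeal K kronecker ^ 2, ∀ v ∈ fil V i, ∀ l ∈ perp W j, l (d x v) = 0)
    (h : ∀ a, ∀ v : compo V (kronecker.s a), (v : V) ∈ fil V i → ∀ l ∈ perp W j,
      l (d (arr K kronecker a) v) = 0) :
    ∀ v ∈ fil V i, ∀ l ∈ perp W j, ∀ x ∈ radIdeal K kronecker, l (d x v) = 0 := by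
  have h1 : ∀ a, ∀ v ∈ fil V i, ∀ l ∈ perp W j, l (d (arr K kronecker a) v) = 0 := by
    intro a v hv l hl
    have e : d (arr K kronecker a) v =
        d (arr K kronecker a) (vtx K kronecker (kronecker.s a) • v) := by
      conv_lhs => rw [← arr_vtx]
      rw [hd.1, hd.2, LinearMap.zero_apply, smul_zero, zero_add]
    rw [e]
    exact h a ⟨_, ⟨v, rfl⟩⟩ (smul_mem_fil _ hv) l hl
  intro v hv l hl x hx
  obtain ⟨y, rfl⟩ := exists_of_mem_radIdeal hx
  rw [map_sum, LinearMap.sum_apply, map_sum]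
  refine Finset.sum_eq_zero fun a _ => ?_
  obtain ⟨c, hc⟩ := exists_sub_vtx_mem (y a)
  have h2 := hsq ((y a - ∑ i, c i • vtx K kronecker i) * arr K kronecker a) (by
    rw [radIdeal_sq]
    exact Ideal.mul_mem_mul hc (arr_mem_radIdeal a)) v hv l hl
  have h3 : ∀ i, l (d (vtx K kronecker i * arr K kronecker a) v) = 0 := by
    intro i
    rw [← vtx_smul_der hd]
    exact h1 a v hv _ (perp_comp_lact _ hl)
  rw [sub_mul, Finset.sum_mul, map_sub, LinearMap.sub_apply, map_sub, map_sum, LinearMap.sum_apply,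
    map_sum, Finset.sum_eq_zero, sub_zero] at h2
  · exact h2
  · intro i _
    rw [smul_mul_assoc, map_smul, LinearMap.smul_apply, map_smul, h3, smul_zero]

/-- Cocycles that are dual to the pair `(f, g)` show that no combination of `f` and `g` is a
coboundary. -/
lemma eq_zero_of_dZero_add (hS : Module.Finite K M) (hR : Module.Finite K N) {c : M →ₗ[K] N}
    {f g : H → M →ₗ[K] N} {f' g' : H → N →ₗ[K] M} (hf' : f' ∈ (repOf N).Z1 (repOf M))
    (hg' : g' ∈ (repOf N).Z1 (repOf M)) (h1 : Rep.tau K Q M N f f' ≠ 0)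
    (h2 : Rep.tau K Q M N g g' ≠ 0) (h3 : Rep.tau K Q M N f g' = 0)
    (h4 : Rep.tau K Q M N g f' = 0) {x y : K}
    (h : (repOf M).dZero (repOf N) c + (x • f + y • g) = 0) : x = 0 ∧ y = 0 := by
  have key : ∀ k ∈ (repOf N).Z1 (repOf M),
      x * Rep.tau K Q M N f k + y * Rep.tau K Q M N g k = 0 := by
    intro k hk
    have hk2 : (repOf N).dTot (repOf M) k = 0 := hk.2
    have e := congrArg (fun g => Rep.tau K Q M N g k) h
    simp only [map_add, map_smul, LinearMap.add_apply, LinearMap.smul_apply, map_zero,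
      LinearMap.zero_apply, smul_eq_mul, Rep.tau_dZero, hk2, LinearMap.comp_zero, neg_zero,
      zero_add] at e
    exact e
  have k1 := key f' hf'
  have k2 := key g' hg'
  rw [h4, mul_zero, add_zero] at k1
  rw [h3, mul_zero, zero_add] at k2
  exact ⟨(mul_eq_zero.1 k1).resolve_right h1, (mul_eq_zero.1 k2).resolve_right h2⟩

lemma hallVtx_apply (i : I) (t : hallSpace S R V) : hallVtx S R V i t =
    ((lact S (vtx K Q i)).rTensor (compo V 0) t.1, (lact R (vtx K Q i)).rTensor (compo V 1) t.2) :=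
  rfl

/-- One step towards zero. Diagonal leading terms are scalars because `S` and `R` are bricks, and
the normalization by `θ`, `θ'` kills them. The off-diagonal ones show that a combination of basis
cocycles of `Ext¹` is a coboundary. -/
lemma VanishAt.step (hS : Module.Finite K S) (hR : Module.Finite K R) (hSR : IsHallPair S R)
    (hd : d ∈ Der0 V W) (hu0 : u ∈ (hallRep L V).C0 (hallRep L W))
    (hu : (hallRep L V).dZero (hallRep L W) u + hallDL L V W d = 0)
    {s₀ : S} {θ : S →ₗ[K] K} (hs₀ : θ s₀ = 1) {r₀ : R} {θ' : R →ₗ[K] K} (hr₀ : θ' r₀ = 1)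
    (hθ : ∀ (v : compo V 0) (l : W →ₗ[K] K), θ (con S W 0 l (u (s₀ ⊗ₜ v, 0)).1) = 0)
    (hθ' : ∀ (v : compo V 1) (l : W →ₗ[K] K), θ' (con R W 1 l (u (0, r₀ ⊗ₜ v)).2) = 0)
    (h : VanishAt u d (i + 1) (j + 1)) (h' : VanishAt u d i j) : VanishAt u d i (j + 1) := by
  have hbp := hSR.isBrickPair hS hR
  have hE0 : ∀ (k : I) (s : S) (v : compo V 0), u ((vtx K Q k • s) ⊗ₜ v, 0) =
      hallVtx S R W k (u (s ⊗ₜ v, 0)) := by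
    intro k s v
    refine Eq.trans ?_ (Rep.C0.comm hu0 k (s ⊗ₜ v, 0)).symm
    refine congrArg u (Prod.ext rfl ?_)
    exact ((lact R (vtx K Q k)).rTensor (compo V 1)).map_zero.symm
  have hE1 : ∀ (k : I) (r : R) (v : compo V 1), u (0, (vtx K Q k • r) ⊗ₜ v) =
      hallVtx S R W k (u (0, r ⊗ₜ v)) := by
    intro k s v
    refine Eq.trans ?_ (Rep.C0.comm hu0 k (0, s ⊗ₜ v)).symm
    refine congrArg u (Prod.ext ?_ rfl)
    exact ((lact S (vtx K Q k)).rTensor (compo V 0)).map_zero.symm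
  have left : ∀ v : compo V 0, (v : V) ∈ fil V i → ∀ l ∈ perp W (j + 1),
      (∀ s : S, con S W 0 l (u (s ⊗ₜ v, 0)).1 = 0 ∧ con R W 1 l (u (s ⊗ₜ v, 0)).2 = 0) ∧
      l (d (arr K kronecker (0, false)) v) = 0 ∧ l (d (arr K kronecker (1, false)) v) = 0 := by
    intro v hv l hl
    have key := con_hallD_left L hd h h' hu v hv hl
    let c : S →ₗ[K] S := conLin (con S W 0 l ∘ₗ LinearMap.fst K _ _) v (u ∘ₗ LinearMap.inl K _ _)
    let c' : S →ₗ[K] R := conLin (con R W 1 l ∘ₗ LinearMap.snd K _ _) v (u ∘ₗ LinearMap.inl K _ _)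
    have hc : ∀ s, c s = con S W 0 l (u (s ⊗ₜ v, 0)).1 := fun _ => rfl
    have hc' : ∀ s, c' s = con R W 1 l (u (s ⊗ₜ v, 0)).2 := fun _ => rfl
    have hcE : ∀ k s, c (vtx K Q k • s) = vtx K Q k • c s := by
      intro k s
      rw [hc, hc, hE0, hallVtx_apply, con_rTensor]
    have hcE' : ∀ k s, c' (vtx K Q k • s) = vtx K Q k • c' s := by
      intro k s
      rw [hc', hc', hE0, hallVtx_apply, con_rTensor]
    obtain ⟨z, hz⟩ := hbp.end_left c ⟨hcE, fun a s => (key s a).1⟩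
    have hz0 : z = 0 := by
      have := hθ v l
      rw [← hc, hz, LinearMap.smul_apply, LinearMap.id_apply, map_smul, hs₀, smul_eq_mul,
        mul_one] at this
      exact this
    have e1 : (repOf S).dZero (repOf R) c' + (l (d (arr K kronecker (0, false)) v) • D.ξ +
        l (d (arr K kronecker (1, false)) v) • D.η) = 0 := by
      funext a
      exact LinearMap.ext fun s => (key s a).2
    -- Pairing with the dual cocycles kills the values of `d`; what is left of `e1` says that `c'`
    -- is a homomorphism `S → R`, hence zero.
    obtain ⟨e2, e3⟩ := eq_zero_of_dZero_add hS hR (mem_Z1_iff.2 ⟨D.ξ'_mem, D.d_ξ'⟩)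
      (mem_Z1_iff.2 ⟨D.η'_mem, D.d_η'⟩) (by rw [← tauOne_eq, D.τ_ξξ']; exact one_ne_zero)
      (by rw [← tauOne_eq, D.τ_ηη']; exact one_ne_zero) (by rw [← tauOne_eq, D.τ_ξη'])
      (by rw [← tauOne_eq, D.τ_ηξ']) e1
    rw [e2, e3, zero_smul, zero_smul, add_zero, add_zero] at e1
    have e4 := hbp.hom_left c' ((Rep.intertwines_iff _ _).2
      ⟨fun k => LinearMap.ext fun s => (hcE' k s).symm, e1⟩)
    refine ⟨fun s => ⟨?_, ?_⟩, e2, e3⟩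
    · rw [← hc, hz, hz0, zero_smul]
      rfl
    · rw [← hc', e4]
      rfl
  have right : ∀ v : compo V 1, (v : V) ∈ fil V i → ∀ l ∈ perp W (j + 1),
      (∀ r : R, con S W 0 l (u (0, r ⊗ₜ v)).1 = 0 ∧ con R W 1 l (u (0, r ⊗ₜ v)).2 = 0) ∧
      l (d (arr K kronecker (0, true)) v) = 0 ∧ l (d (arr K kronecker (1, true)) v) = 0 := by
    intro v hv l hl
    have key := con_hallD_right L hd h h' hu v hv hl
    let c : R →ₗ[K] R := conLin (con R W 1 l ∘ₗ LinearMap.snd K _ _) v (u ∘ₗ LinearMap.inr K _ _)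
    let c' : R →ₗ[K] S := conLin (con S W 0 l ∘ₗ LinearMap.fst K _ _) v (u ∘ₗ LinearMap.inr K _ _)
    have hc : ∀ r, c r = con R W 1 l (u (0, r ⊗ₜ v)).2 := fun _ => rfl
    have hc' : ∀ r, c' r = con S W 0 l (u (0, r ⊗ₜ v)).1 := fun _ => rfl
    have hcE : ∀ k r, c (vtx K Q k • r) = vtx K Q k • c r := by
      intro k s
      rw [hc, hc, hE1, hallVtx_apply, con_rTensor]
    have hcE' : ∀ k r, c' (vtx K Q k • r) = vtx K Q k • c' r := by
      intro k s
      rw [hc', hc', hE1, hallVtx_apply, con_rTensor]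
    obtain ⟨z, hz⟩ := hbp.end_right c ⟨hcE, fun a s => (key s a).1⟩
    have hz0 : z = 0 := by
      have := hθ' v l
      rw [← hc, hz, LinearMap.smul_apply, LinearMap.id_apply, map_smul, hr₀, smul_eq_mul,
        mul_one] at this
      exact this
    have e1 : (repOf R).dZero (repOf S) c' + (l (d (arr K kronecker (0, true)) v) • D.ξ' +
        l (d (arr K kronecker (1, true)) v) • D.η') = 0 := by
      funext a
      exact LinearMap.ext fun s => (key s a).2
    obtain ⟨e2, e3⟩ := eq_zero_of_dZero_add hR hS (mem_Z1_iff.2 ⟨D.ξ_mem, D.d_ξ⟩)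
      (mem_Z1_iff.2 ⟨D.η_mem, D.d_η⟩)
      (by rw [Rep.tau_swap, ← tauOne_eq, D.τ_ξξ']; exact neg_ne_zero.2 one_ne_zero)
      (by rw [Rep.tau_swap, ← tauOne_eq, D.τ_ηη']; exact neg_ne_zero.2 one_ne_zero)
      (by rw [Rep.tau_swap, ← tauOne_eq, D.τ_ηξ', neg_zero])
      (by rw [Rep.tau_swap, ← tauOne_eq, D.τ_ξη', neg_zero]) e1
    rw [e2, e3, zero_smul, zero_smul, add_zero, add_zero] at e1
    have e4 := hbp.hom_right c' ((Rep.intertwines_iff _ _).2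
      ⟨fun k => LinearMap.ext fun s => (hcE' k s).symm, e1⟩)
    refine ⟨fun s => ⟨?_, ?_⟩, e2, e3⟩
    · rw [← hc', e4]
      rfl
    · rw [← hc, hz, hz0, zero_smul]
      rfl
  refine ⟨fun v hv l hl => (left v hv l hl).1, fun v hv l hl => (right v hv l hl).1, ?_⟩
  refine l_der_eq_zero hd (h.der_sq hd h') ?_
  rintro ⟨k, _ | _⟩ v hv l hl
  · fin_cases k
    · exact (left v hv l hl).2.1
    · exact (left v hv l hl).2.2
  · fin_cases k
    · exact (right v hv l hl).2.1
    · exact (right v hv l hl).2.2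

/-- Double induction: upwards on the step `j` of the filtration of `W`, and for fixed `j` downwards
on `i`, starting where the filtration of `V` is zero. -/
lemma vanishAt (hS : Module.Finite K S) (hR : Module.Finite K R) (hSR : IsHallPair S R)
    (hd : d ∈ Der0 V W) (hu0 : u ∈ (hallRep L V).C0 (hallRep L W))
    (hu : (hallRep L V).dZero (hallRep L W) u + hallDL L V W d = 0)
    {s₀ : S} {θ : S →ₗ[K] K} (hs₀ : θ s₀ = 1) {r₀ : R} {θ' : R →ₗ[K] K} (hr₀ : θ' r₀ = 1)
    (hθ : ∀ (v : compo V 0) (l : W →ₗ[K] K), θ (con S W 0 l (u (s₀ ⊗ₜ v, 0)).1) = 0)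
    (hθ' : ∀ (v : compo V 1) (l : W →ₗ[K] K), θ' (con R W 1 l (u (0, r₀ ⊗ₜ v)).2) = 0)
    {n : ℕ} (hn : fil V n = ⊥) (j : ℕ) : ∀ i, VanishAt u d i j := by
  have hc : ∀ (N : ModuleCat.{u} (Lam K Q)) (p : Fin 2) (t : N ⊗[K] compo W p),
      con N W p 0 t = 0 := by
    intro N p t
    have : con N W p 0 = 0 := TensorProduct.ext' fun n v => by rw [con_tmul]; simp
    rw [this, LinearMap.zero_apply]
  induction j with
  | zero =>
    intro i
    refine ⟨fun v _ l hl s => ?_, fun v _ l hl s => ?_, fun v _ l hl x _ => ?_⟩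
    · rw [perp_zero hl, hc, hc]
      exact ⟨rfl, rfl⟩
    · rw [perp_zero hl, hc, hc]
      exact ⟨rfl, rfl⟩
    · rw [perp_zero hl, LinearMap.zero_apply]
  | succ j ih =>
    have hbig : ∀ i ≥ n, VanishAt u d i (j + 1) := by
      intro i hi
      have h0 : ∀ v ∈ fil V i, v = 0 := by
        intro v hv
        have := fil_antitone hi hv
        rwa [hn, Submodule.mem_bot] at this
      have h1 : ∀ {p} (v : compo V p), (v : V) ∈ fil V i → v = 0 :=
        fun v hv => Subtype.ext (h0 _ hv)
      refine ⟨fun v hv l hl s => ?_, fun v hv l hl s => ?_, fun v hv l hl x _ => ?_⟩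
      · rw [h1 v hv, TensorProduct.tmul_zero, Prod.mk_zero_zero, map_zero, Prod.fst_zero,
          Prod.snd_zero, map_zero, map_zero]
        exact ⟨rfl, rfl⟩
      · rw [h1 v hv, TensorProduct.tmul_zero, Prod.mk_zero_zero, map_zero, Prod.fst_zero,
          Prod.snd_zero, map_zero, map_zero]
        exact ⟨rfl, rfl⟩
      · rw [h0 v hv, map_zero, map_zero]
    have hdown : ∀ m i, n ≤ i + m → VanishAt u d i (j + 1) := by
      intro m
      induction m with
      | zero => exact fun i hi => hbig i hi
      | succ m ihm =>
        intro i hi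
        exact VanishAt.step L hS hR hSR hd hu0 hu hs₀ hr₀ hθ hθ' (ihm (i + 1) (by omega)) (ih i)
    exact fun i => hdown n i (by omega)

lemma exists_dual_one (h : Function.Bijective fun c : K => c • 𝟙 M) :
    ∃ (m : M) (θ : M →ₗ[K] K), θ m = 1 := by
  obtain ⟨m, hm⟩ : ∃ m : M, m ≠ 0 := by
    by_contra! hm
    refine one_ne_zero (α := K) (h.1 ?_)
    ext m
    rw [hm m, map_zero, map_zero]
  obtain ⟨θ, hθ⟩ := Module.Projective.exists_dual_ne_zero K hm
  exact ⟨m, (θ m)⁻¹ • θ, inv_mul_cancel₀ hθ⟩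

/-- The contraction of the factor `M` of `M ⊗ W_p`. -/
def slice (θ : M →ₗ[K] K) (W : ModuleCat.{u} (PiAlg K)) (p : Fin 2) :
    M ⊗[K] compo W p →ₗ[K] compo W p :=
  (TensorProduct.lid K (compo W p)).toLinearMap ∘ₗ θ.rTensor (compo W p)

lemma slice_tmul {p : Fin 2} (θ : M →ₗ[K] K) (m : M) (w : compo W p) :
    slice θ W p (m ⊗ₜ w) = θ m • w := rfl

lemma apply_slice {p : Fin 2} (θ : M →ₗ[K] K) (l : W →ₗ[K] K) (t : M ⊗[K] compo W p) :
    l (slice θ W p t) = θ (con M W p l t) := by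
  induction t with
  | zero => simp
  | add x y hx hy => rw [map_add, Submodule.coe_add, map_add, hx, hy, map_add, map_add]
  | tmul m w => rw [slice_tmul, con_tmul, map_smul, Submodule.coe_smul, map_smul, smul_eq_mul,
      smul_eq_mul, mul_comm]

/-- The projection of a module onto a component. -/
def toCompo (V : ModuleCat.{u} (Lam K Q)) (i : I) : V →ₗ[K] compo V i :=
  (lact V (vtx K Q i)).rangeRestrict

lemma coe_toCompo (V : ModuleCat.{u} (Lam K Q)) (i : I) (v : V) :
    (toCompo V i v : V) = vtx K Q i • v := rfl

/-- Assembling a graded map from its components. -/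
lemma exists_isGraded (f : compo V 0 →ₗ[K] compo W 0) (g : compo V 1 →ₗ[K] compo W 1) :
    ∃ φ : V →ₗ[K] W, IsGraded φ ∧ blk V W 0 0 φ = f ∧ blk V W 1 1 φ = g := by
  have ho : ∀ {U : ModuleCat.{u} (PiAlg K)} (p q : Fin 2) (v : compo U p),
      vtx K kronecker q • (v : U) = if q = p then (v : U) else 0 := by
    intro U p q v
    rw [← vtx_smul_compo v, smul_smul, vtx_mul]
    split_ifs with h
    · rw [h]
    · rw [zero_smul]
  have ht : ∀ {U : ModuleCat.{u} (PiAlg K)} (p q : Fin 2) (v : U),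
      toCompo U p (vtx K kronecker q • v) = if p = q then toCompo U p v else 0 := by
    intro U p q v
    refine Subtype.ext ?_
    rw [coe_toCompo, smul_smul, vtx_mul]
    split_ifs with h
    · rfl
    · exact zero_smul _ _
  have hv : ∀ {U : ModuleCat.{u} (PiAlg K)} (p q : Fin 2) (v : compo U p),
      toCompo U q (v : U) = if h : q = p then h ▸ v else 0 := by
    intro U p q v
    refine Subtype.ext ?_
    rw [coe_toCompo, ho]
    split_ifs with h
    · subst h; rfl
    · rfl
  refine ⟨(compo W 0).subtype ∘ₗ f ∘ₗ toCompo V 0 + (compo W 1).subtype ∘ₗ g ∘ₗ toCompo V 1,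
    fun p v => ?_, ?_, ?_⟩
  · simp only [LinearMap.add_apply, LinearMap.comp_apply, Submodule.subtype_apply, ht, smul_add, ho]
    fin_cases p <;> simp
  · ext v
    rw [coe_blk]
    simp [hv, ho]
  · ext v
    rw [coe_blk]
    simp [hv, ho]

/-- Every map that is a morphism up to a twist by a derivation comes from a graded map. -/
lemma exists_eq_hallLin (hS : Module.Finite K S) (hR : Module.Finite K R) (hSR : IsHallPair S R)
    (hV : Module.Finite K V) (hW : Module.Finite K W) (hd : d ∈ Der0 V W)
    (hu0 : u ∈ (hallRep L V).C0 (hallRep L W))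
    (hu : (hallRep L V).dZero (hallRep L W) u + hallDL L V W d = 0) :
    ∃ φ : V →ₗ[K] W, IsGraded φ ∧ u = hallLin S R φ ∧ inner φ + d = 0 := by
  obtain ⟨s₀, θ, hs₀⟩ := exists_dual_one hSR.end_S
  obtain ⟨r₀, θ', hr₀⟩ := exists_dual_one hSR.end_R
  -- The only candidate: `φ` is read off from `u` by inserting `s₀`, `r₀` and contracting with `θ`,
  -- `θ'`. Subtracting its image normalizes `u` as required by `vanishAt`.
  obtain ⟨φ, hφ, hφ0, hφ1⟩ := exists_isGraded
    (slice θ W 0 ∘ₗ LinearMap.fst K _ _ ∘ₗ u ∘ₗ LinearMap.inl K _ _ ∘ₗ TensorProduct.mk K S _ s₀)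
    (slice θ' W 1 ∘ₗ LinearMap.snd K _ _ ∘ₗ u ∘ₗ LinearMap.inr K _ _ ∘ₗ TensorProduct.mk K R _ r₀)
  have hφC : φ ∈ (repOf V).C0 (repOf W) := fun p => LinearMap.ext fun v => (hφ p v).symm
  have hinner : inner φ = commL φ := rfl
  obtain ⟨n, hn⟩ := exists_fil_eq_bot V hV
  obtain ⟨m, hm⟩ := exists_fil_eq_bot W hW
  have hperp : ∀ l, l ∈ perp W m := by
    intro l w hw
    rw [hm, Submodule.mem_bot] at hw
    rw [hw, map_zero]
  have hu0' := sub_mem hu0 (hallLin_mem_C0 L φ)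
  have hu' : (hallRep L V).dZero (hallRep L W) (u - hallLin S R φ) +
      hallDL L V W (inner φ + d) = 0 := by
    rw [map_sub, map_add, dZero_hallLin L hφ, hinner]
    refine Eq.trans ?_ hu
    abel
  have key := vanishAt L hS hR hSR (add_mem (inner_mem hφC) hd) hu0' hu' hs₀ hr₀
    (fun v l => by
      rw [← apply_slice, LinearMap.sub_apply, Prod.fst_sub, map_sub, Submodule.coe_sub, map_sub,
        sub_eq_zero]
      refine congrArg (fun w : compo W 0 => l w) ?_
      have h1 : (hallLin S R φ (s₀ ⊗ₜ v, 0)).1 = s₀ ⊗ₜ blk V W 0 0 φ v := rfl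
      rw [h1, slice_tmul, hs₀, one_smul, hφ0]
      rfl)
    (fun v l => by
      rw [← apply_slice, LinearMap.sub_apply, Prod.snd_sub, map_sub, Submodule.coe_sub, map_sub,
        sub_eq_zero]
      refine congrArg (fun w : compo W 1 => l w) ?_
      have h1 : (hallLin S R φ (0, r₀ ⊗ₜ v)).2 = r₀ ⊗ₜ blk V W 1 1 φ v := rfl
      rw [h1, slice_tmul, hr₀, one_smul, hφ1]
      rfl) hn m 0
  refine ⟨φ, hφ, ?_, ?_⟩
  · rw [← sub_eq_zero]
    refine LinearMap.prod_ext (TensorProduct.ext' fun s v => ?_) (TensorProduct.ext' fun r v => ?_)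
    · exact Prod.ext (eq_zero_of_con fun l => (key.left v (mem_fil_zero _) l (hperp l) s).1)
        (eq_zero_of_con fun l => (key.left v (mem_fil_zero _) l (hperp l) s).2)
    · exact Prod.ext (eq_zero_of_con fun l => (key.right v (mem_fil_zero _) l (hperp l) r).1)
        (eq_zero_of_con fun l => (key.right v (mem_fil_zero _) l (hperp l) r).2)
  -- The filtration argument controls the derivation on the radical only; on the idempotents it
  -- vanishes by definition.
  · have hrad : ∀ x ∈ radIdeal K kronecker, (inner φ + d) x = 0 := by
      intro x hx
      refine LinearMap.ext fun v => ?_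
      by_contra hne
      obtain ⟨l, hl⟩ := Module.Projective.exists_dual_ne_zero K hne
      exact hl (key.der v (mem_fil_zero v) l (hperp l) x hx)
    refine LinearMap.ext fun x => ?_
    obtain ⟨c, hc⟩ := exists_sub_vtx_mem x
    have h1 := hrad _ hc
    rw [map_sub, map_sum, Finset.sum_eq_zero, sub_zero] at h1
    · exact h1
    · intro i _
      rw [map_smul, (add_mem (inner_mem hφC) hd).2, smul_zero]

end Fullness

/-! ### Dimension vectors and Euler forms. -/

section Dimensions

variable {K : Type u} [Field K] {I H : Type} [Fintype I] [Fintype H] {Q : OrientedGraph I H}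

section EulerForm

variable {M N : Type u} [AddCommGroup M] [Module K M] [AddCommGroup N] [Module K N]
  (ρ : Rep K Q M) (σ : Rep K Q N)

namespace Rep

/-- The dimension vector of a representation. -/
def dim (i : I) : ℕ := Module.finrank K (LinearMap.range (ρ.E i))

/-- The graded maps from the component `i` to the component `j`. -/
def homGEquiv (i j : I) :
    ρ.homG σ i j ≃ₗ[K] (LinearMap.range (ρ.E i) →ₗ[K] LinearMap.range (σ.E j)) where
  toFun f := (σ.E j).rangeRestrict ∘ₗ f.1 ∘ₗ (LinearMap.range (ρ.E i)).subtype
  map_add' f g := by rw [Submodule.coe_add, LinearMap.add_comp, LinearMap.comp_add]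
  map_smul' c f := by
    rw [Submodule.coe_smul, LinearMap.smul_comp, LinearMap.comp_smul, RingHom.id_apply]
  invFun g := ⟨(LinearMap.range (σ.E j)).subtype ∘ₗ g ∘ₗ (ρ.E i).rangeRestrict, by
    constructor
    · ext m
      obtain ⟨n, hn⟩ := (g ((ρ.E i).rangeRestrict m)).2
      simp only [LinearMap.comp_apply, Submodule.subtype_apply, ← hn, E_idem_apply]
    · ext m
      simp only [LinearMap.comp_apply]
      exact congrArg (fun n => (g n : N)) (Subtype.ext (ρ.E_idem_apply i m))⟩
  left_inv f := by
    refine Subtype.ext (LinearMap.ext fun m => ?_)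
    exact (homG.E_apply f.2 _).trans (homG.apply_E f.2 m)
  right_inv g := by
    refine LinearMap.ext fun m => Subtype.ext ?_
    obtain ⟨m, n, rfl⟩ := m
    obtain ⟨k, hk⟩ := (g ⟨ρ.E i n, n, rfl⟩).2
    have h : (ρ.E i).rangeRestrict (ρ.E i n) = ⟨ρ.E i n, n, rfl⟩ :=
      Subtype.ext (ρ.E_idem_apply i n)
    change σ.E j (g ((ρ.E i).rangeRestrict (ρ.E i n))).1 = (g ⟨ρ.E i n, n, rfl⟩).1
    rw [h, ← hk, E_idem_apply]

/-- Graded maps are given by their components. -/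
def C0Equiv : ρ.C0 σ ≃ₗ[K] ∀ i, ρ.homG σ i i where
  toFun f i := ⟨f.1 ∘ₗ ρ.E i, by
    rw [← LinearMap.comp_assoc, f.2 i, LinearMap.comp_assoc, ρ.E_idem],
    by rw [LinearMap.comp_assoc, ρ.E_idem]⟩
  map_add' f g := rfl
  map_smul' c f := rfl
  invFun f := ⟨∑ i, (f i).1, ρ.sum_mem_C0 σ fun i => (f i).2⟩
  left_inv f := by
    refine Subtype.ext ?_
    change ∑ i, f.1 ∘ₗ ρ.E i = f.1
    rw [← linearMap_comp_sum, ρ.E_sum, LinearMap.comp_id]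
  right_inv f := by
    funext i
    exact Subtype.ext (ρ.sum_comp_E σ (fun i => (f i).2) i)

/-- Families of graded maps are given by their components. -/
def C1Equiv : ρ.C1 σ ≃ₗ[K] ∀ a, ρ.homG σ (Q.s a) (Q.t a) where
  toFun g a := ⟨g.1 a, mem_C1.1 g.2 a⟩
  map_add' f g := rfl
  map_smul' c f := rfl
  invFun g := ⟨fun a => (g a).1, mem_C1.2 fun a => (g a).2⟩
  left_inv g := rfl
  right_inv g := rfl

variable [FiniteDimensional K M] [FiniteDimensional K N]

lemma finrank_homG (i j : I) : Module.finrank K (ρ.homG σ i j) = ρ.dim i * σ.dim j := by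
  rw [(ρ.homGEquiv σ i j).finrank_eq, Module.finrank_linearMap]
  rfl

lemma finrank_C0 : Module.finrank K (ρ.C0 σ) = ∑ i, ρ.dim i * σ.dim i := by
  rw [(ρ.C0Equiv σ).finrank_eq, Module.finrank_pi_fintype]
  exact Finset.sum_congr rfl fun i _ => ρ.finrank_homG σ i i

lemma finrank_C1 : Module.finrank K (ρ.C1 σ) = ∑ a, ρ.dim (Q.s a) * σ.dim (Q.t a) := by
  rw [(ρ.C1Equiv σ).finrank_eq, Module.finrank_pi_fintype]
  exact Finset.sum_congr rfl fun i _ => ρ.finrank_homG σ _ _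

/-- The Euler form. -/
lemma finrank_Z1_add : Module.finrank K (ρ.Z1 σ) + 2 * Module.finrank K (ρ.C0 σ) =
    Module.finrank K (ρ.C1 σ) + Module.finrank K (ρ.B1 σ) + Module.finrank K (ρ.homs σ) +
      Module.finrank K (σ.homs ρ) := by
  have h1 := ρ.finrank_Z1 σ
  have h2 := ρ.finrank_B1 σ
  have h3 := σ.finrank_B1 ρ
  have h4 := ρ.finrank_C0_comm σ
  omega

end Rep

end EulerForm

lemma finrank_range_prodMap {A B A' B' : Type*} [AddCommGroup A] [Module K A] [AddCommGroup B]
    [Module K B] [AddCommGroup A'] [Module K A'] [AddCommGroup B'] [Module K B]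
    [Module K B'] [FiniteDimensional K A'] [FiniteDimensional K B'] (f : A →ₗ[K] A')
    (g : B →ₗ[K] B') : Module.finrank K (LinearMap.range (f.prodMap g)) =
      Module.finrank K (LinearMap.range f) + Module.finrank K (LinearMap.range g) := by
  have h : f.prodMap g = ((LinearMap.range f).subtype.prodMap (LinearMap.range g).subtype) ∘ₗ
      (f.rangeRestrict.prodMap g.rangeRestrict) := rfl
  have h1 : LinearMap.range (f.rangeRestrict.prodMap g.rangeRestrict) = ⊤ :=
    LinearMap.range_eq_top.2 (Function.Surjective.prodMap f.surjective_rangeRestrict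
      g.surjective_rangeRestrict)
  rw [h, LinearMap.range_comp_of_range_eq_top _ h1, LinearMap.finrank_range_of_inj,
    Module.finrank_prod]
  exact Function.Injective.prodMap (Submodule.injective_subtype _) (Submodule.injective_subtype _)

lemma finrank_range_rTensor {A A' P : Type*} [AddCommGroup A] [Module K A] [AddCommGroup A']
    [Module K A'] [AddCommGroup P] [Module K P] (f : A →ₗ[K] A') :
    Module.finrank K (LinearMap.range (f.rTensor P)) =
      Module.finrank K (LinearMap.range f) * Module.finrank K P := by
  have h : f.rTensor P = (LinearMap.range f).subtype.rTensor P ∘ₗ f.rangeRestrict.rTensor P := by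
    rw [← LinearMap.rTensor_comp]
    rfl
  have h1 : LinearMap.range (f.rangeRestrict.rTensor P) = ⊤ :=
    LinearMap.range_eq_top.2 (LinearMap.rTensor_surjective P f.surjective_rangeRestrict)
  rw [h, LinearMap.range_comp_of_range_eq_top _ h1, LinearMap.finrank_range_of_inj,
    Module.finrank_tensorProduct]
  exact Module.Flat.rTensor_preserves_injective_linearMap _ (Submodule.injective_subtype _)

variable {S R : ModuleCat.{u} (Lam K Q)} {D : DualCocycles S R} (L : UniversalLifting D)
variable {V W : ModuleCat.{u} (PiAlg K)}

lemma hallRep_dim (hS : Module.Finite K S) (hR : Module.Finite K R) (hV : Module.Finite K V)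
    (i : I) : (hallRep L V).dim i =
      (repOf S).dim i * (repOf V).dim 0 + (repOf R).dim i * (repOf V).dim 1 := by
  unfold Rep.dim
  rw [hallRep_E, hallVtx, finrank_range_prodMap, finrank_range_rTensor, finrank_range_rTensor]
  rfl

lemma IsHallPair.finrank_homs (hS : Module.Finite K S) (hR : Module.Finite K R)
    (h : IsHallPair S R) :
    Module.finrank K ((repOf S).homs (repOf S)) = 1 ∧
    Module.finrank K ((repOf R).homs (repOf R)) = 1 ∧
    Module.finrank K ((repOf S).homs (repOf R)) = 0 ∧
    Module.finrank K ((repOf R).homs (repOf S)) = 0 := by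
  have hbp := h.isBrickPair hS hR
  have key : ∀ {M : ModuleCat.{u} (Lam K Q)} (hM : Function.Bijective fun c : K => c • 𝟙 M)
      (hE : ∀ f, (repOf M).Intertwines (repOf M) f → ∃ c : K, f = c • LinearMap.id),
      Module.finrank K ((repOf M).homs (repOf M)) = 1 := by
    intro M hM hE
    obtain ⟨m, θ, hθ⟩ := exists_dual_one hM
    have hid : LinearMap.id ∈ (repOf M).homs (repOf M) :=
      Rep.mem_homs.2 ⟨fun _ _ => rfl, fun _ _ => rfl⟩
    refine finrank_eq_one (⟨LinearMap.id, hid⟩ : (repOf M).homs (repOf M)) (fun h0 => ?_) ?_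
    · have h1 : (LinearMap.id : M →ₗ[K] M) = 0 := congrArg Subtype.val h0
      have h2 := congrArg (fun f => θ (f m)) h1
      simp [hθ] at h2
    · intro f
      obtain ⟨c, hc⟩ := hE f.1 (Rep.mem_homs.1 f.2)
      exact ⟨c, Subtype.ext hc.symm⟩
  refine ⟨key h.end_S hbp.end_left, key h.end_R hbp.end_right, ?_, ?_⟩
  · rw [(Submodule.eq_bot_iff _).2 fun f hf => hbp.hom_left f (Rep.mem_homs.1 hf), finrank_bot]
  · rw [(Submodule.eq_bot_iff _).2 fun f hf => hbp.hom_right f (Rep.mem_homs.1 hf), finrank_bot]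

lemma kronecker_dim_C0 (hV : Module.Finite K V) (hW : Module.Finite K W) :
    Module.finrank K ((repOf V).C0 (repOf W)) =
      (repOf V).dim 0 * (repOf W).dim 0 + (repOf V).dim 1 * (repOf W).dim 1 := by
  rw [Rep.finrank_C0, Fin.sum_univ_two]

lemma kronecker_dim_C1 (hV : Module.Finite K V) (hW : Module.Finite K W) :
    Module.finrank K ((repOf V).C1 (repOf W)) =
      2 * ((repOf V).dim 0 * (repOf W).dim 1) + 2 * ((repOf V).dim 1 * (repOf W).dim 0) := by
  rw [Rep.finrank_C1, Fintype.sum_prod_type, Fin.sum_univ_two, Fintype.sum_bool, Fintype.sum_bool]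
  have hs : ∀ k, kronecker.s (k, true) = 1 ∧ kronecker.t (k, true) = 0 ∧ kronecker.s (k, false) = 0 ∧
      kronecker.t (k, false) = 1 := fun k => ⟨rfl, rfl, rfl, rfl⟩
  rw [(hs 0).1, (hs 0).2.1, (hs 0).2.2.1, (hs 0).2.2.2, (hs 1).1, (hs 1).2.1, (hs 1).2.2.1,
    (hs 1).2.2.2]
  ring

/-- The Euler form on the images of `V` and `W` is the Euler form on `V` and `W`. -/
lemma euler_hallRep (hS : Module.Finite K S) (hR : Module.Finite K R) (hSR : IsHallPair S R)
    (hV : Module.Finite K V) (hW : Module.Finite K W) :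
    Module.finrank K ((hallRep L V).C1 (hallRep L W)) +
        2 * Module.finrank K ((repOf V).C0 (repOf W)) =
      Module.finrank K ((repOf V).C1 (repOf W)) +
        2 * Module.finrank K ((hallRep L V).C0 (hallRep L W)) := by
  obtain ⟨h1, h2, h3, h4⟩ := hSR.finrank_homs hS hR
  have e1 := (repOf S).finrank_Z1_add (repOf S)
  have e2 := (repOf R).finrank_Z1_add (repOf R)
  have e3 := (repOf S).finrank_Z1_add (repOf R)
  rw [Z1_eq_B1_of_subsingleton hS hS hSR.rigid_S, h1, Rep.finrank_C0, Rep.finrank_C1] at e1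
  rw [Z1_eq_B1_of_subsingleton hR hR hSR.rigid_R, h2, Rep.finrank_C0, Rep.finrank_C1] at e2
  rw [finrank_Z1_eq hS hR, hSR.ext_SR, h3, h4, Rep.finrank_C0, Rep.finrank_C1] at e3
  have e4 := (repOf S).finrank_C1_comm (repOf R)
  rw [Rep.finrank_C1, Rep.finrank_C1] at e4
  rw [kronecker_dim_C0 hV hW, kronecker_dim_C1 hV hW, Rep.finrank_C0, Rep.finrank_C1]
  simp only [hallRep_dim L hS hR hV, hallRep_dim L hS hR hW]
  set v0 := (repOf V).dim 0
  set v1 := (repOf V).dim 1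
  set w0 := (repOf W).dim 0
  set w1 := (repOf W).dim 1
  have expand : ∀ {ι : Type} [Fintype ι] (s r s' r' : ι → ℕ),
      ∑ i, (s i * v0 + r i * v1) * (s' i * w0 + r' i * w1) =
        (∑ i, s i * s' i) * (v0 * w0) + (∑ i, s i * r' i) * (v0 * w1) +
        (∑ i, r i * s' i) * (v1 * w0) + (∑ i, r i * r' i) * (v1 * w1) := by
    intro ι _ s r s' r'
    simp only [Finset.sum_mul, ← Finset.sum_add_distrib]
    exact Finset.sum_congr rfl fun i _ => by ring
  rw [expand, expand]
  have e5 : ∑ i, (repOf R).dim i * (repOf S).dim i = ∑ i, (repOf S).dim i * (repOf R).dim i :=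
    Finset.sum_congr rfl fun i _ => mul_comm _ _
  rw [e5, ← e4]
  generalize (∑ i, (repOf S).dim i * (repOf S).dim i) = c1 at *
  generalize (∑ i, (repOf R).dim i * (repOf R).dim i) = c2 at *
  generalize (∑ i, (repOf S).dim i * (repOf R).dim i) = c3 at *
  generalize (∑ a, (repOf S).dim (Q.s a) * (repOf S).dim (Q.t a)) = d1 at *
  generalize (∑ a, (repOf R).dim (Q.s a) * (repOf R).dim (Q.t a)) = d2 at *
  generalize (∑ a, (repOf S).dim (Q.s a) * (repOf R).dim (Q.t a)) = d3 at *
  -- The symmetric Euler form takes the values `2`, `2` and `-2` on `(S, S)`, `(R, R)` and `(S, R)`,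
  -- exactly as on the two simple `Π`-modules.
  have f1 : 2 * c1 = d1 + 2 := by omega
  have f2 : 2 * c2 = d2 + 2 := by omega
  have f3 : 2 + 2 * c3 = d3 := by omega
  subst f3
  have g1 : 2 * c1 * (v0 * w0) = (d1 + 2) * (v0 * w0) := by rw [f1]
  have g2 : 2 * c2 * (v1 * w1) = (d2 + 2) * (v1 * w1) := by rw [f2]
  linarith [g1, g2]

end Dimensions

/-! ### Surjectivity on `Ext¹` by a dimension count. -/

section Cocycles

variable {K : Type u} [Field K] {I H : Type} [Fintype I] [Fintype H] {Q : OrientedGraph I H}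
variable {S R : ModuleCat.{u} (Lam K Q)} {D : DualCocycles S R} (L : UniversalLifting D)
variable {V W : ModuleCat.{u} (PiAlg K)}

variable (S R V W) in
/-- The map on morphisms, as a linear map. -/
def hallLinL : (V →ₗ[K] W) →ₗ[K] (hallSpace S R V →ₗ[K] hallSpace S R W) where
  toFun φ := hallLin S R φ
  map_add' φ ψ := by
    refine LinearMap.prod_ext (TensorProduct.ext' fun s v => ?_) (TensorProduct.ext' fun r v => ?_)
    · refine Prod.ext ?_ ?_ <;> simp [hallLin, TensorProduct.tmul_add]
    · refine Prod.ext ?_ ?_ <;> simp [hallLin, TensorProduct.tmul_add]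
  map_smul' c φ := by
    refine LinearMap.prod_ext (TensorProduct.ext' fun s v => ?_) (TensorProduct.ext' fun r v => ?_)
    · refine Prod.ext ?_ ?_ <;> simp [hallLin]
    · refine Prod.ext ?_ ?_ <;> simp [hallLin]

lemma isGraded_iff {φ : V →ₗ[K] W} : IsGraded φ ↔ φ ∈ (repOf V).C0 (repOf W) :=
  ⟨fun h p => LinearMap.ext fun v => (h p v).symm, fun h p v => (Rep.C0.comm h p v).symm⟩

lemma mem_homs_of_inner {φ : V →ₗ[K] W} (hφ : IsGraded φ) (h : inner φ = 0) :
    φ ∈ (repOf V).homs (repOf W) := by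
  refine Rep.mem_homs.2 ((Rep.intertwines_iff _ _).2 ⟨isGraded_iff.1 hφ, ?_⟩)
  rw [← ev_inner, h, map_zero]

lemma finrank_homs_hallRep_le (hS : Module.Finite K S) (hR : Module.Finite K R)
    (hSR : IsHallPair S R) (hV : Module.Finite K V) (hW : Module.Finite K W) :
    Module.finrank K ((hallRep L V).homs (hallRep L W)) ≤
      Module.finrank K ((repOf V).homs (repOf W)) := by
  have h : (hallRep L V).homs (hallRep L W) ≤
      ((repOf V).homs (repOf W)).map (hallLinL S R V W) := by
    intro u hu
    have hu2 : (hallRep L V).dZero (hallRep L W) u = 0 := hu.2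
    obtain ⟨φ, hφ, rfl, hi⟩ := exists_eq_hallLin L hS hR hSR hV hW (zero_mem (Der0 V W)) hu.1
      (by rw [hu2, map_zero, add_zero])
    rw [add_zero] at hi
    exact ⟨φ, mem_homs_of_inner hφ hi, rfl⟩
  exact (Submodule.finrank_mono h).trans (Submodule.finrank_map_le _ _)

/-- The relations of the lifting, evaluated with the Leibniz rule `d(xy) = x d(y) + d(x) y`, become
the cocycle condition. -/
lemma hallDL_mem_Z1 {d : PiAlg K →ₗ[K] (V →ₗ[K] W)} (hd : d ∈ Der0 V W) :
    hallDL L V W d ∈ (hallRep L V).Z1 (hallRep L W) := by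
  have h1 : hallDL L V W d ∈ (hallRep L V).C1 (hallRep L W) :=
    Rep.mem_C1.2 fun a => ⟨hallVtx_hallD L d a, hallD_hallVtx L d a⟩
  refine ⟨h1, (Rep.dTot_eq_zero_iff _ _ h1).2 fun i => ?_⟩
  have h2 := sum_hallD_comp L (d₁ := lactL W) (d₁' := d) (d₂ := d) (d₂' := lactL V) (d := d)
    (fun q r p x _ y hy v => by
      rw [hd.1 x y, smul_add, vtx_smul_der hd, hy.1]
      congr 2
      rw [lactL_apply, smul_smul, hy.1]) i
  rw [Rep.dVtx]
  simp only [hallRep_A]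
  exact h2

/-- Rank–nullity for the sum of `f` and `g` on `p × q`; the hypothesis bounds the kernel by the
dimension of `t`. -/
lemma finrank_add_finrank_le {X Y Z T : Type*} [AddCommGroup X] [Module K X] [AddCommGroup Y]
    [Module K Y] [AddCommGroup Z] [Module K Z] [AddCommGroup T] [Module K T]
    (p : Submodule K X) (q : Submodule K Y) (t : Submodule K T) [FiniteDimensional K p]
    [FiniteDimensional K q] [FiniteDimensional K t] (f : X →ₗ[K] Z) (g : Y →ₗ[K] Z)
    (k : T →ₗ[K] X) (l : T →ₗ[K] Y)
    (h : ∀ x ∈ p, ∀ y ∈ q, f x + g y = 0 → ∃ s ∈ t, k s = x ∧ l s = y) :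
    Module.finrank K p + Module.finrank K q ≤
      Module.finrank K (p.map f ⊔ q.map g : Submodule K Z) + Module.finrank K t := by
  let F : p × q →ₗ[K] Z := (f ∘ₗ p.subtype).coprod (g ∘ₗ q.subtype)
  let G : t →ₗ[K] X × Y := (k ∘ₗ t.subtype).prod (l ∘ₗ t.subtype)
  have hker : (LinearMap.ker F).map (p.subtype.prodMap q.subtype) ≤ LinearMap.range G := by
    rintro _ ⟨⟨x, y⟩, hp, rfl⟩
    obtain ⟨s, hs, h1, h2⟩ := h x.1 x.2 y.1 y.2 (LinearMap.mem_ker.1 hp)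
    exact ⟨⟨s, hs⟩, Prod.ext h1 h2⟩
  have hinj : Function.Injective (p.subtype.prodMap q.subtype) :=
    Function.Injective.prodMap p.injective_subtype q.injective_subtype
  have k1 := LinearMap.finrank_range_add_finrank_ker F
  have k2 := (Submodule.finrank_mono hker).trans (LinearMap.finrank_range_le _)
  rw [← (Submodule.equivMapOfInjective _ hinj _).finrank_eq] at k2
  have k3 : LinearMap.range F = p.map f ⊔ q.map g := by
    rw [LinearMap.range_coprod, LinearMap.range_comp, LinearMap.range_comp, Submodule.range_subtype,
      Submodule.range_subtype]
  rw [Module.finrank_prod, k3] at k1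
  omega

/-- The map that sends a linear map to minus its inner derivation. -/
def negInner (V W : ModuleCat.{u} (PiAlg K)) : (V →ₗ[K] W) →ₗ[K] PiAlg K →ₗ[K] V →ₗ[K] W where
  toFun φ := -inner φ
  map_add' φ ψ := by
    refine LinearMap.ext fun x => LinearMap.ext fun v => ?_
    simp only [LinearMap.add_apply, LinearMap.neg_apply, inner_apply, smul_add]
    abel
  map_smul' c φ := by
    refine LinearMap.ext fun x => LinearMap.ext fun v => ?_
    simp only [LinearMap.smul_apply, LinearMap.neg_apply,
      inner_apply, RingHom.id_apply, smul_neg, smul_sub]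
    rw [smul_comm x c]

lemma Der0.finite (hV : Module.Finite K V) (hW : Module.Finite K W) :
    Module.Finite K (Der0 V W) := by
  have hinj : Function.Injective ((Der0.ev V W).domRestrict (Der0 V W)) := by
    rw [injective_iff_map_eq_zero]
    exact fun δ hδ => Subtype.ext (Der0.eq_zero_of_ev hV hW δ.2 hδ)
  exact Module.Finite.of_injective _ hinj

/-- Every cocycle is, up to a coboundary, the image of a derivation. -/
lemma map_hallDL_sup_B1 (hS : Module.Finite K S) (hR : Module.Finite K R)
    (hSR : IsHallPair S R) (hV : Module.Finite K V) (hW : Module.Finite K W) :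
    (Der0 V W).map (hallDL L V W) ⊔ (hallRep L V).B1 (hallRep L W) =
      (hallRep L V).Z1 (hallRep L W) := by
  have hfin := Der0.finite hV hW
  have hle : (Der0 V W).map (hallDL L V W) ⊔ (hallRep L V).B1 (hallRep L W) ≤
      (hallRep L V).Z1 (hallRep L W) := by
    refine sup_le ?_ (Rep.B1_le_Z1 _ _)
    rintro _ ⟨d, hd, rfl⟩
    exact hallDL_mem_Z1 L hd
  -- By `exists_eq_hallLin`, a derivation and a graded map whose contributions cancel both come from
  -- one graded map `V → W`. This bounds the image from below.
  have k1 := finrank_add_finrank_le (Der0 V W) ((hallRep L V).C0 (hallRep L W))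
    ((repOf V).C0 (repOf W)) (hallDL L V W) ((hallRep L V).dZero (hallRep L W))
    (negInner V W) (hallLinL S R V W) (fun δ hδ f hf hp => by
      rw [add_comm] at hp
      obtain ⟨φ, hφ, h1, h2⟩ := exists_eq_hallLin L hS hR hSR hV hW hδ hf hp
      exact ⟨φ, isGraded_iff.1 hφ, neg_eq_of_add_eq_zero_right h2, h1.symm⟩)
  have k3 : Module.finrank K ((repOf V).Z1 (repOf W)) ≤ Module.finrank K (Der0 V W) := by
    rw [← Der0.map_ev hV hW]
    exact Submodule.finrank_map_le _ _
  have k4 := (repOf V).finrank_Z1 (repOf W)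
  have k5 := (repOf W).finrank_B1 (repOf V)
  have k6 := (hallRep L V).finrank_Z1 (hallRep L W)
  have k7 := (hallRep L W).finrank_B1 (hallRep L V)
  have k8 := (repOf V).finrank_C0_comm (repOf W)
  have k9 := (hallRep L V).finrank_C0_comm (hallRep L W)
  have k10 := euler_hallRep L hS hR hSR hV hW
  have k11 := finrank_homs_hallRep_le L hS hR hSR hW hV
  -- The dimension of the target follows from the Euler form equality `k10` and from `k11`, which is
  -- fullness in the opposite direction `W → V`.
  exact Submodule.eq_of_le_of_finrank_le hle (by
    rw [Rep.B1]
    omega)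

end Cocycles

/-! ### Formal properties of intertwining operators, kernels and cokernels. -/

section Intertwiners

variable {K : Type u} [Field K] {I H : Type} [Fintype I] [Fintype H] {Q : OrientedGraph I H}

namespace Rep

variable {M N P : Type u} [AddCommGroup M] [Module K M] [AddCommGroup N] [Module K N]
  [AddCommGroup P] [Module K P] {ρ : Rep K Q M} {σ : Rep K Q N} {τ : Rep K Q P}

lemma Intertwines.comp {g : N →ₗ[K] P} {f : M →ₗ[K] N} (hg : σ.Intertwines τ g)
    (hf : ρ.Intertwines σ f) : ρ.Intertwines τ (g ∘ₗ f) :=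
  ⟨fun i m => by rw [LinearMap.comp_apply, hf.1, hg.1]; rfl,
    fun a m => by rw [LinearMap.comp_apply, hf.2, hg.2]; rfl⟩

lemma Intertwines.of_comp_injective {g : N →ₗ[K] P} {f : M →ₗ[K] N} (hg : σ.Intertwines τ g)
    (hi : Function.Injective g) (h : ρ.Intertwines τ (g ∘ₗ f)) : ρ.Intertwines σ f :=
  ⟨fun i m => hi ((h.1 i m).trans (hg.1 i _).symm), fun a m => hi ((h.2 a m).trans (hg.2 a _).symm)⟩

lemma Intertwines.of_comp_surjective {g : N →ₗ[K] P} {f : M →ₗ[K] N} (hf : ρ.Intertwines σ f)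
    (hs : Function.Surjective f) (h : ρ.Intertwines τ (g ∘ₗ f)) : σ.Intertwines τ g := by
  constructor
  · intro i n
    obtain ⟨m, rfl⟩ := hs n
    rw [← hf.1]
    exact h.1 i m
  · intro a n
    obtain ⟨m, rfl⟩ := hs n
    rw [← hf.2]
    exact h.2 a m

lemma Intertwines.symm {e : M ≃ₗ[K] N} (h : ρ.Intertwines σ e.toLinearMap) :
    σ.Intertwines ρ e.symm.toLinearMap :=
  h.of_comp_injective e.injective (by
    rw [LinearEquiv.comp_symm]
    exact ⟨fun _ _ => rfl, fun _ _ => rfl⟩)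

end Rep

lemma intertwines_hom {M N : ModuleCat.{u} (Lam K Q)} (f : M ⟶ N) :
    (repOf M).Intertwines (repOf N) (f.hom.restrictScalars K) :=
  ⟨fun i m => map_smul f.hom (vtx K Q i) m, fun a m => map_smul f.hom (arr K Q a) m⟩

/-- Bijective intertwining operators are isomorphisms. -/
lemma Rep.Intertwines.nonempty_iso {M N : ModuleCat.{u} (Lam K Q)} (hM : Module.Finite K M)
    (hN : Module.Finite K N) {e : M ≃ₗ[K] N}
    (h : (repOf M).Intertwines (repOf N) e.toLinearMap) : Nonempty (M ≅ N) :=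
  ⟨LinearEquiv.toModuleIso (LinearEquiv.ofBijective (h.hom hM hN).hom e.bijective)⟩

lemma exists_equiv_of_range_eq {A B C : Type*} [AddCommGroup A] [Module K A] [AddCommGroup B]
    [Module K B] [AddCommGroup C] [Module K C] {i : A →ₗ[K] C} {j : B →ₗ[K] C}
    (hi : Function.Injective i) (hj : Function.Injective j)
    (h : LinearMap.range i = LinearMap.range j) : ∃ e : A ≃ₗ[K] B, j ∘ₗ e.toLinearMap = i := by
  refine ⟨LinearEquiv.ofInjective i hi ≪≫ₗ LinearEquiv.ofEq _ _ h ≪≫ₗ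
    (LinearEquiv.ofInjective j hj).symm, LinearMap.ext fun a => ?_⟩
  exact congrArg Subtype.val ((LinearEquiv.ofInjective j hj).apply_symm_apply
    (LinearEquiv.ofEq _ _ h (LinearEquiv.ofInjective i hi a)))

lemma exists_equiv_of_ker_eq {A B C : Type*} [AddCommGroup A] [Module K A] [AddCommGroup B]
    [Module K B] [AddCommGroup C] [Module K C] {p : C →ₗ[K] A} {q : C →ₗ[K] B}
    (hp : Function.Surjective p) (hq : Function.Surjective q)
    (h : LinearMap.ker p = LinearMap.ker q) : ∃ e : A ≃ₗ[K] B, e.toLinearMap ∘ₗ p = q := by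
  refine ⟨(p.quotKerEquivOfSurjective hp).symm ≪≫ₗ Submodule.quotEquivOfEq _ _ h ≪≫ₗ
    q.quotKerEquivOfSurjective hq, LinearMap.ext fun c => ?_⟩
  have h1 : (p.quotKerEquivOfSurjective hp).symm (p c) = (LinearMap.ker p).mkQ c := by
    rw [LinearEquiv.symm_apply_eq]
    rfl
  simp only [LinearMap.comp_apply, LinearEquiv.coe_coe, LinearEquiv.trans_apply, h1]
  rfl

lemma kernelFork_facts {X Y : ModuleCat.{u} (Lam K Q)} {f : X ⟶ Y} {k : Limits.KernelFork f}
    (hk : Limits.IsLimit k) : Function.Injective k.ι.hom ∧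
      ∀ x, f.hom x = 0 ↔ ∃ y, k.ι.hom y = x := by
  have hm : Mono k.ι := Limits.Fork.IsLimit.mono hk
  refine ⟨(ModuleCat.mono_iff_injective _).1 hm, fun x => ⟨fun hx => ?_, ?_⟩⟩
  · obtain ⟨l, hl⟩ := Limits.KernelFork.IsLimit.lift' hk
      (ModuleCat.ofHom (LinearMap.ker f.hom).subtype) (by
        refine ModuleCat.hom_ext (LinearMap.ext fun y => ?_)
        exact y.2)
    exact ⟨l.hom ⟨x, hx⟩, congrArg (fun g => g.hom ⟨x, hx⟩) hl⟩
  · rintro ⟨y, rfl⟩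
    exact congrArg (fun g => g.hom y) k.condition

lemma cokernelCofork_facts {X Y : ModuleCat.{u} (Lam K Q)} {f : X ⟶ Y}
    {k : Limits.CokernelCofork f} (hk : Limits.IsColimit k) : Function.Surjective k.π.hom ∧
      ∀ y, k.π.hom y = 0 ↔ ∃ x, f.hom x = y := by
  have hm : Epi k.π := Limits.Cofork.IsColimit.epi hk
  refine ⟨(ModuleCat.epi_iff_surjective _).1 hm, fun y => ⟨fun hy => ?_, ?_⟩⟩
  · obtain ⟨l, hl⟩ := Limits.CokernelCofork.IsColimit.desc' hk
      (ModuleCat.ofHom (LinearMap.range f.hom).mkQ) (by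
        refine ModuleCat.hom_ext (LinearMap.ext fun x => ?_)
        exact (Submodule.Quotient.mk_eq_zero _).2 ⟨x, rfl⟩)
    have h1 : (LinearMap.range f.hom).mkQ y = 0 := by
      refine (congrArg (fun g => g.hom y) hl).symm.trans ?_
      change l.hom (k.π.hom y) = 0
      rw [hy, map_zero]
    exact (Submodule.Quotient.mk_eq_zero _).1 h1
  · rintro ⟨x, rfl⟩
    exact congrArg (fun g => g.hom x) k.condition

end Intertwiners

/-! ### Exactness, faithfulness, and closure of the image under kernels and cokernels. -/

section HallExact

variable {K : Type u} [Field K] {I H : Type} [Fintype I] [Fintype H] {Q : OrientedGraph I H}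
variable {S R : ModuleCat.{u} (Lam K Q)} {V W U : ModuleCat.{u} (PiAlg K)}

lemma coe_compMap (f : V ⟶ W) (p : Fin 2) (v : compo V p) : (compMap f p v : W) = f.hom v := rfl

lemma compMap_injective {f : V ⟶ W} (hf : Function.Injective f.hom) (p : Fin 2) :
    Function.Injective (compMap f p) := fun v w h =>
  Subtype.ext (hf (congrArg Subtype.val h))

lemma exists_compo_of_hom (f : V ⟶ W) {p : Fin 2} (w : compo W p) (h : ∃ v, f.hom v = w) :
    ∃ v : compo V p, compMap f p v = w := by
  obtain ⟨v, hv⟩ := h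
  refine ⟨toCompo V p v, Subtype.ext ?_⟩
  rw [coe_compMap, coe_toCompo, map_smul, hv, vtx_smul_compo]

lemma compMap_exact {f : V ⟶ W} {g : W ⟶ U} (h : Function.Exact f.hom g.hom) (p : Fin 2) :
    Function.Exact (compMap f p) (compMap g p) := by
  intro w
  constructor
  · intro hw
    exact exists_compo_of_hom f w ((h w).1 (congrArg Subtype.val hw))
  · rintro ⟨v, rfl⟩
    exact Subtype.ext ((h (f.hom v)).2 ⟨v, rfl⟩)

lemma hallMap_injective {f : V ⟶ W} (hf : Function.Injective f.hom) :
    Function.Injective (hallMap S R f) :=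
  Function.Injective.prodMap
    (Module.Flat.lTensor_preserves_injective_linearMap _ (compMap_injective hf 0))
    (Module.Flat.lTensor_preserves_injective_linearMap _ (compMap_injective hf 1))

lemma hallMap_surjective {f : V ⟶ W} (hf : Function.Surjective f.hom) :
    Function.Surjective (hallMap S R f) :=
  Function.Surjective.prodMap
    (LinearMap.lTensor_surjective _ fun w => exists_compo_of_hom f w (hf w))
    (LinearMap.lTensor_surjective _ fun w => exists_compo_of_hom f w (hf w))

lemma hallMap_exact {f : V ⟶ W} {g : W ⟶ U} (h : Function.Exact f.hom g.hom) :
    Function.Exact (hallMap S R f) (hallMap S R g) := by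
  have h0 := Module.Flat.lTensor_exact S (compMap_exact h 0)
  have h1 := Module.Flat.lTensor_exact R (compMap_exact h 1)
  intro t
  constructor
  · intro ht
    obtain ⟨x, hx⟩ := (h0 t.1).1 (congrArg Prod.fst ht)
    obtain ⟨y, hy⟩ := (h1 t.2).1 (congrArg Prod.snd ht)
    exact ⟨(x, y), Prod.ext hx hy⟩
  · rintro ⟨x, rfl⟩
    exact Prod.ext (h0.apply_apply_eq_zero x.1) (h1.apply_apply_eq_zero x.2)

lemma hallMap_add (f g : V ⟶ W) : hallMap S R (f + g) = hallMap S R f + hallMap S R g := by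
  simp only [hallMap_eq_hallLin]
  exact (hallLinL S R V W).map_add (f.hom.restrictScalars K) (g.hom.restrictScalars K)

/-- A morphism is recovered from its image by inserting a vector of `S` or `R` and contracting with
a functional that takes the value `1` on it. -/
lemma hallMap_faithful (hSR : IsHallPair S R) {f g : V ⟶ W} (h : hallMap S R f = hallMap S R g) :
    f = g := by
  obtain ⟨s₀, θ, hs₀⟩ := exists_dual_one hSR.end_S
  obtain ⟨r₀, θ', hr₀⟩ := exists_dual_one hSR.end_R
  have h0 : ∀ v : compo V 0, f.hom v = g.hom v := by
    intro v
    have h1 := congrArg (fun k => slice θ W 0 (k (s₀ ⊗ₜ v, 0)).1) h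
    change slice θ W 0 (s₀ ⊗ₜ compMap f 0 v) = slice θ W 0 (s₀ ⊗ₜ compMap g 0 v) at h1
    rw [slice_tmul, slice_tmul, hs₀, one_smul, one_smul] at h1
    exact congrArg Subtype.val h1
  have h1 : ∀ v : compo V 1, f.hom v = g.hom v := by
    intro v
    have h1 := congrArg (fun k => slice θ' W 1 (k (0, r₀ ⊗ₜ v)).2) h
    change slice θ' W 1 (r₀ ⊗ₜ compMap f 1 v) = slice θ' W 1 (r₀ ⊗ₜ compMap g 1 v) at h1
    rw [slice_tmul, slice_tmul, hr₀, one_smul, one_smul] at h1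
    exact congrArg Subtype.val h1
  refine ModuleCat.hom_ext (LinearMap.ext fun v => ?_)
  have hv : (v : V) = toCompo V 0 v + toCompo V 1 v := by
    rw [coe_toCompo, coe_toCompo, ← add_smul, ← Fin.sum_univ_two, vtx_sum, one_smul]
  rw [hv, map_add, map_add, h0, h1]

variable {D : DualCocycles S R} (L : UniversalLifting D)

/-- Fullness is the case `d = 0` of `exists_eq_hallLin`. -/
lemma exists_eq_hallMap (hS : Module.Finite K S) (hR : Module.Finite K R) (hSR : IsHallPair S R)
    (hV : Module.Finite K V) (hW : Module.Finite K W)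
    {u : hallSpace S R V →ₗ[K] hallSpace S R W} (hu : (hallRep L V).Intertwines (hallRep L W) u) :
    ∃ f : V ⟶ W, u = hallMap S R f := by
  rw [Rep.intertwines_iff] at hu
  obtain ⟨φ, hφ, rfl, hi⟩ := exists_eq_hallLin L hS hR hSR hV hW (zero_mem (Der0 V W)) hu.1
    (by rw [hu.2, map_zero, add_zero])
  rw [add_zero] at hi
  refine ⟨(Rep.mem_homs.1 (mem_homs_of_inner hφ hi)).hom hV hW, ?_⟩
  rw [hallMap_eq_hallLin]
  rfl

/-- The modules that are isomorphic to the image of a module under the functor defined by a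
universal lifting. -/
def hallImage : ObjectProperty (ModuleCat.{u} (Lam K Q)) := fun M =>
  Module.Finite K M ∧ ∃ V : ModuleCat.{u} (PiAlg K), Module.Finite K V ∧
    ∃ e : M ≃ₗ[K] hallSpace S R V, (repOf M).Intertwines (hallRep L V) e.toLinearMap

lemma hallImage_le : hallImage L ≤ isFD K Q := fun _ h => h.1

lemma hallImage_isClosedUnderIsomorphisms : (hallImage L).IsClosedUnderIsomorphisms where
  of_iso := by
    rintro M N i ⟨hM, V, hV, e, he⟩
    let i' : N ≃ₗ[K] M := i.symm.toLinearEquiv.restrictScalars K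
    have hi' : (repOf N).Intertwines (repOf M) i'.toLinearMap := intertwines_hom i.inv
    exact ⟨Module.Finite.equiv i'.symm, V, hV, i' ≪≫ₗ e, he.comp hi'⟩

/-- Morphisms between objects of the image come from morphisms. -/
lemma exists_hom_of_equiv (hS : Module.Finite K S) (hR : Module.Finite K R) (hSR : IsHallPair S R)
    (hV : Module.Finite K V) (hW : Module.Finite K W) {M N : ModuleCat.{u} (Lam K Q)}
    {e : M ≃ₗ[K] hallSpace S R V} (he : (repOf M).Intertwines (hallRep L V) e.toLinearMap)
    {e' : N ≃ₗ[K] hallSpace S R W} (he' : (repOf N).Intertwines (hallRep L W) e'.toLinearMap)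
    (f : M ⟶ N) : ∃ g : V ⟶ W, ∀ m, e' (f.hom m) = hallMap S R g (e m) := by
  obtain ⟨g, hg⟩ := exists_eq_hallMap L hS hR hSR hV hW ((he'.comp (intertwines_hom f)).comp he.symm)
  refine ⟨g, fun m => ?_⟩
  rw [← hg]
  simp

/-- By fullness a morphism between images comes from some `g`, and by exactness its kernel is the
image of the kernel of `g`. -/
lemma hallImage_isClosedUnderKernels (hS : Module.Finite K S) (hR : Module.Finite K R)
    (hSR : IsHallPair S R) : (hallImage L).IsClosedUnderKernels where
  kernels_le := by
    rintro _ ⟨f, k, hk, ⟨hM, V, hV, e, he⟩, ⟨hN, W, hW, e', he'⟩⟩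
    obtain ⟨g, hg⟩ := exists_hom_of_equiv L hS hR hSR hV hW he he' f
    obtain ⟨h1, h2⟩ := kernelFork_facts hk
    let U : ModuleCat.{u} (PiAlg K) := ModuleCat.of _ (LinearMap.ker g.hom)
    let ι : U ⟶ V := ModuleCat.ofHom (LinearMap.ker g.hom).subtype
    have hι : Function.Injective ι.hom := (LinearMap.ker g.hom).injective_subtype
    have hU : Module.Finite K U := Module.Finite.of_injective (ι.hom.restrictScalars K) hι
    have hex : Function.Exact ι.hom g.hom := LinearMap.exact_subtype_ker_map g.hom
    let i : k.pt →ₗ[K] hallSpace S R V := e.toLinearMap ∘ₗ k.ι.hom.restrictScalars K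
    have hi : Function.Injective i := e.injective.comp h1
    have hr : LinearMap.range i = LinearMap.range (hallMap S R ι) := by
      ext t
      have h3 : t ∈ LinearMap.range (hallMap S R ι) ↔ hallMap S R g t = 0 :=
        (hallMap_exact (S := S) (R := R) hex t).symm
      rw [h3]
      have h4 := hg (e.symm t)
      rw [e.apply_symm_apply] at h4
      rw [← h4, LinearEquiv.map_eq_zero_iff, h2]
      constructor
      · rintro ⟨y, hy⟩
        exact ⟨y, by rw [← hy]; exact (e.symm_apply_apply _).symm⟩
      · rintro ⟨y, hy⟩
        exact ⟨y, (congrArg e hy).trans (e.apply_symm_apply t)⟩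
    obtain ⟨E, hE⟩ := exists_equiv_of_range_eq hi (hallMap_injective hι) hr
    refine ⟨Module.Finite.of_injective (k.ι.hom.restrictScalars K) h1, U, hU, E, ?_⟩
    refine (hallMap_intertwines L ι).of_comp_injective (hallMap_injective hι) ?_
    have hE' := he.comp (intertwines_hom k.ι)
    exact hE ▸ hE'

lemma hallImage_isClosedUnderCokernels (hS : Module.Finite K S) (hR : Module.Finite K R)
    (hSR : IsHallPair S R) : (hallImage L).IsClosedUnderCokernels where
  cokernels_le := by
    rintro _ ⟨f, k, hk, ⟨hM, V, hV, e, he⟩, ⟨hN, W, hW, e', he'⟩⟩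
    obtain ⟨g, hg⟩ := exists_hom_of_equiv L hS hR hSR hV hW he he' f
    obtain ⟨h1, h2⟩ := cokernelCofork_facts hk
    let U : ModuleCat.{u} (PiAlg K) := ModuleCat.of _ (W ⧸ LinearMap.range g.hom)
    let π : W ⟶ U := ModuleCat.ofHom (LinearMap.range g.hom).mkQ
    have hπ : Function.Surjective π.hom := (LinearMap.range g.hom).mkQ_surjective
    have hU : Module.Finite K U := Module.Finite.of_surjective (π.hom.restrictScalars K) hπ
    have hex : Function.Exact g.hom π.hom := LinearMap.exact_map_mkQ_range g.hom
    let p : hallSpace S R W →ₗ[K] k.pt := k.π.hom.restrictScalars K ∘ₗ e'.symm.toLinearMap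
    have hp : Function.Surjective p := h1.comp e'.symm.surjective
    have hr : LinearMap.ker p = LinearMap.ker (hallMap S R π) := by
      ext t
      have h3 : t ∈ LinearMap.ker (hallMap S R π) ↔ ∃ y, hallMap S R g y = t :=
        hallMap_exact (S := S) (R := R) hex t
      rw [h3]
      refine (h2 (e'.symm t)).trans ?_
      constructor
      · rintro ⟨x, hx⟩
        exact ⟨e x, by rw [← hg, hx, e'.apply_symm_apply]⟩
      · rintro ⟨y, rfl⟩
        refine ⟨e.symm y, ?_⟩
        rw [LinearEquiv.eq_symm_apply, hg, e.apply_symm_apply]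
    obtain ⟨E, hE⟩ := exists_equiv_of_ker_eq hp (hallMap_surjective hπ) hr
    refine ⟨Module.Finite.of_surjective (k.π.hom.restrictScalars K) h1, U, hU, E, ?_⟩
    have hp' := (intertwines_hom k.π).comp he'.symm
    refine Rep.Intertwines.of_comp_surjective hp' hp ?_
    have := hallMap_intertwines L π
    exact hE.symm ▸ this

end HallExact

/-! ### Closure of the image under extensions. -/

section HallImageExtensions

variable {K : Type u} [Field K] {I H : Type} [Fintype I] [Fintype H] {Q : OrientedGraph I H}
variable {S R : ModuleCat.{u} (Lam K Q)} {V W U : ModuleCat.{u} (PiAlg K)}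

lemma hallLin_comp {φ : V →ₗ[K] W} (hφ : IsGraded φ) (ψ : W →ₗ[K] U) (t : hallSpace S R V) :
    hallLin S R ψ (hallLin S R φ t) = hallLin S R (ψ ∘ₗ φ) t := by
  have h : ∀ p, blk V U p p (ψ ∘ₗ φ) = blk W U p p ψ ∘ₗ blk V W p p φ := by
    intro p
    ext v
    rw [LinearMap.comp_apply, coe_blk, coe_blk, coe_blk, ← hφ, vtx_smul_compo]
    rfl
  rw [hallLin, hallLin, hallLin, h, h, LinearMap.lTensor_comp, LinearMap.lTensor_comp]
  rfl

lemma hallLin_id (t : hallSpace S R V) : hallLin S R (LinearMap.id : V →ₗ[K] V) t = t := by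
  have := hallMap_eq_hallLin (S := S) (R := R) (𝟙 V)
  rw [hallMap_id] at this
  exact (congrArg (fun f => f t) this).symm

variable {D : DualCocycles S R} (L : UniversalLifting D)

/-- A short exact sequence of representations is given by a cocycle. -/
lemma Rep.exists_cocycle {M N P : Type u} [AddCommGroup M] [Module K M] [AddCommGroup N]
    [Module K N] [AddCommGroup P] [Module K P] {ρ : Rep K Q M} {σ : Rep K Q N} {τ : Rep K Q P}
    {α : M →ₗ[K] N} {β : N →ₗ[K] P} (hα : ρ.Intertwines σ α) (hβ : σ.Intertwines τ β)
    (hi : Function.Injective α) (hex : Function.Exact α β) (hs : Function.Surjective β) :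
    ∃ s ∈ τ.C0 σ, β ∘ₗ s = LinearMap.id ∧ ∃ g ∈ τ.Z1 ρ, ∀ a, α ∘ₗ g a = τ.dZero σ s a := by
  obtain ⟨s₀, hs₀⟩ := LinearMap.exists_rightInverse_of_surjective β (LinearMap.range_eq_top.2 hs)
  obtain ⟨r, hr⟩ := LinearMap.exists_leftInverse_of_injective α (LinearMap.ker_eq_bot.2 hi)
  have hs₀' : ∀ x, β (s₀ x) = x := fun x => congrArg (fun f => f x) hs₀
  have hr' : ∀ y, β y = 0 → α (r y) = y := by
    intro y hy
    obtain ⟨x, rfl⟩ := (hex y).1 hy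
    exact congrArg α (congrArg (fun f => f x) hr)
  set s := τ.gr σ s₀ with hs
  have hsC : s ∈ τ.C0 σ := τ.gr_mem σ s₀
  have hβs : ∀ x, β (s x) = x := by
    intro x
    rw [hs, Rep.gr, LinearMap.sum_apply, map_sum]
    simp only [LinearMap.comp_apply, hβ.1, hs₀', Rep.E_idem_apply, Rep.E_sum_apply]
  have hg : ∀ a, α ∘ₗ (r ∘ₗ τ.dZero σ s a) = τ.dZero σ s a := by
    intro a
    refine LinearMap.ext fun x => hr' _ ?_
    rw [Rep.dZero_apply, LinearMap.sub_apply, map_sub, LinearMap.comp_apply, LinearMap.comp_apply,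
      hβ.2, hβs, hβs, sub_self]
  have hdC := Rep.mem_C1.1 (τ.dZero_mem σ hsC)
  have hg1 : (fun a => r ∘ₗ τ.dZero σ s a) ∈ τ.C1 ρ := by
    refine Rep.mem_C1.2 fun a => ⟨?_, ?_⟩
    · refine LinearMap.ext fun x => hi ?_
      have h1 := congrArg (fun f => f x) (hg a)
      simp only [LinearMap.comp_apply] at h1 ⊢
      rw [hα.1, h1, Rep.homG.E_apply (hdC a)]
    · rw [LinearMap.comp_assoc, (hdC a).2]
  refine ⟨s, hsC, LinearMap.ext hβs, fun a => r ∘ₗ τ.dZero σ s a, ⟨hg1, ?_⟩, hg⟩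
  refine LinearMap.ext fun x => hi ?_
  have h2 := congrArg (fun f => f x) (τ.dTot_dZero σ s)
  rw [Rep.dTot_apply] at h2 ⊢
  simp only [LinearMap.sum_apply, map_sum, LinearMap.smul_apply, map_smul, LinearMap.add_apply,
    map_add, LinearMap.comp_apply, hα.2, LinearMap.zero_apply, map_zero] at h2 ⊢
  rw [← h2]
  refine Finset.sum_congr rfl fun a _ => ?_
  have h3 := congrArg (fun f => f x) (hg a)
  have h4 := congrArg (fun f => f (τ.A a x)) (hg (Q.bar a))
  simp only [LinearMap.comp_apply] at h3 h4
  rw [h3, h4]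

lemma hallDL_apply_hallLin {φ : V →ₗ[K] W} (hφ : IsGraded φ) (d : PiAlg K →ₗ[K] (W →ₗ[K] U))
    (a : H) (t : hallSpace S R V) : hallDL L W U d a (hallLin S R φ t) =
      hallDL L V U (LinearMap.lcomp K U φ ∘ₗ d) a t :=
  hallD_hallLin L hφ d a t

/-- Gluing an intertwining operator and a section with a given defect. -/
lemma Rep.intertwines_glue {M N P X : Type u} [AddCommGroup M] [Module K M] [AddCommGroup N]
    [Module K N] [AddCommGroup P] [Module K P] [AddCommGroup X] [Module K X] {ρ : Rep K Q M}
    {σ : Rep K Q N} {τ : Rep K Q P} {χ : Rep K Q X} {α : M →ₗ[K] N} (hα : ρ.Intertwines σ α)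
    {s : P →ₗ[K] N} (hs : s ∈ τ.C0 σ) {p₁ : X →ₗ[K] M} (hp₁ : p₁ ∈ χ.C0 ρ) {p₂ : X →ₗ[K] P}
    (hp₂ : χ.Intertwines τ p₂) {g : H → P →ₗ[K] M}
    (hsg : ∀ a t, σ.A a (s t) = s (τ.A a t) + α (g a t))
    (hg : ∀ a t, χ.dZero ρ p₁ a t = -g a (p₂ t)) : χ.Intertwines σ (α ∘ₗ p₁ + s ∘ₗ p₂) := by
  refine ⟨fun i t => ?_, fun a t => ?_⟩
  · change α (p₁ (χ.E i t)) + s (p₂ (χ.E i t)) = σ.E i (α (p₁ t) + s (p₂ t))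
    rw [map_add, ← hα.1, C0.comm hs, C0.comm hp₁, hp₂.1]
  · change α (p₁ (χ.A a t)) + s (p₂ (χ.A a t)) = σ.A a (α (p₁ t) + s (p₂ t))
    have h1 : p₁ (χ.A a t) = ρ.A a (p₁ t) + g a (p₂ t) := by
      have h := hg a t
      rw [dZero_apply, LinearMap.sub_apply, LinearMap.comp_apply, LinearMap.comp_apply] at h
      rw [← sub_eq_zero, ← neg_eq_zero, ← sub_eq_zero.2 h]
      abel
    rw [map_add, ← hα.2, hsg, h1, hp₂.2, map_add]
    abel

/-- The extension defined by a derivation is the image of the extension of modules defined by the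
same derivation. -/
lemma exists_equiv_of_hallDL (hV : Module.Finite K V) (hW : Module.Finite K W)
    {M : Type u} [AddCommGroup M] [Module K M] {σ : Rep K Q M}
    {α : hallSpace S R W →ₗ[K] M} {β : M →ₗ[K] hallSpace S R V}
    (hα : (hallRep L W).Intertwines σ α) (hi : Function.Injective α) (hex : Function.Exact α β)
    {s : hallSpace S R V →ₗ[K] M} (hs : s ∈ (hallRep L V).C0 σ) (hβs : β ∘ₗ s = LinearMap.id)
    {d : PiAlg K →ₗ[K] (V →ₗ[K] W)} (hd : d ∈ Der0 V W)
    (hsd : ∀ a t, σ.A a (s t) = s ((hallRep L V).A a t) + α (hallDL L V W d a t)) :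
    ∃ X : ModuleCat.{u} (PiAlg K), Module.Finite K X ∧
      ∃ e : hallSpace S R X ≃ₗ[K] M, (hallRep L X).Intertwines σ e.toLinearMap := by
  obtain ⟨X, e, he⟩ := Der0.exists_module hV hW hd
  have hX : Module.Finite K X := Module.Finite.equiv e.symm
  have he' : ∀ (x : PiAlg K) (m : X), e (x • m) = (x • (e m).1 + d x (e m).2, x • (e m).2) := by
    intro x m
    have := he x (e m)
    rwa [e.symm_apply_apply] at this
  let π₁ : X →ₗ[K] W := LinearMap.fst K W V ∘ₗ e.toLinearMap
  let π₂ : X →ₗ[K] V := LinearMap.snd K W V ∘ₗ e.toLinearMap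
  let ι₁ : W →ₗ[K] X := e.symm.toLinearMap ∘ₗ LinearMap.inl K W V
  let ι₂ : V →ₗ[K] X := e.symm.toLinearMap ∘ₗ LinearMap.inr K W V
  have hπ₁ : IsGraded π₁ := fun p v => by
    refine (congrArg Prod.fst (he' (vtx K kronecker p) v)).trans ?_
    rw [hd.2, LinearMap.zero_apply, add_zero]
    rfl
  have hπ₂ : IsGraded π₂ := fun p v => congrArg Prod.snd (he' (vtx K kronecker p) v)
  have hι₁ : IsGraded ι₁ := fun p w => by
    refine e.injective ?_
    refine (e.apply_symm_apply _).trans ((he (vtx K kronecker p) (w, 0)).trans ?_).symm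
    rw [hd.2, LinearMap.zero_apply, add_zero, smul_zero]
    rfl
  have hι₂ : IsGraded ι₂ := fun p w => by
    refine e.injective ?_
    refine (e.apply_symm_apply _).trans ((he (vtx K kronecker p) (0, w)).trans ?_).symm
    rw [hd.2, LinearMap.zero_apply, add_zero, smul_zero]
    rfl
  have hc₂ : commL π₂ = 0 := LinearMap.ext fun x => LinearMap.ext fun v =>
    sub_eq_zero.2 (congrArg Prod.snd (he' x v)).symm
  have hc₁ : commL π₁ = -(LinearMap.lcomp K W π₂ ∘ₗ d) :=
    LinearMap.ext fun x => LinearMap.ext fun v => by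
      have := congrArg Prod.fst (he' x v)
      rw [commL_apply]
      change x • (e v).1 - (e (x • v)).1 = -(d x (e v).2)
      rw [this]
      exact sub_add_cancel_left _ _
  -- The two extensions have the same ends and, after the choice of `s`, the same cocycle; `Θ` is
  -- the resulting identification of split vector spaces.
  let Θ : hallSpace S R X →ₗ[K] M := α ∘ₗ hallLin S R π₁ + s ∘ₗ hallLin S R π₂
  have hΘ : ∀ t, Θ t = α (hallLin S R π₁ t) + s (hallLin S R π₂ t) := fun _ => rfl
  have hβα : ∀ t, β (α t) = 0 := hex.apply_apply_eq_zero
  have hβs' : ∀ t, β (s t) = t := fun t => congrArg (fun f => f t) hβs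
  have h11 : ∀ t, hallLin S R π₁ (hallLin S R ι₁ t) = t := by
    intro t
    rw [hallLin_comp hι₁]
    have : π₁ ∘ₗ ι₁ = LinearMap.id := LinearMap.ext fun w =>
      congrArg Prod.fst (e.apply_symm_apply (w, 0))
    rw [this, hallLin_id]
  have h22 : ∀ t, hallLin S R π₂ (hallLin S R ι₂ t) = t := by
    intro t
    rw [hallLin_comp hι₂]
    have : π₂ ∘ₗ ι₂ = LinearMap.id := LinearMap.ext fun w =>
      congrArg Prod.snd (e.apply_symm_apply (0, w))
    rw [this, hallLin_id]
  have hz : ∀ {A B : ModuleCat.{u} (PiAlg K)} (t : hallSpace S R A),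
      hallLin S R (0 : A →ₗ[K] B) t = 0 := by
    intro A B t
    exact congrArg (fun f => f t) (hallLinL S R A B).map_zero
  have h12 : ∀ t, hallLin S R π₁ (hallLin S R ι₂ t) = 0 := by
    intro t
    rw [hallLin_comp hι₂]
    have : π₁ ∘ₗ ι₂ = 0 := LinearMap.ext fun w =>
      congrArg Prod.fst (e.apply_symm_apply (0, w))
    rw [this, hz]
  have h21 : ∀ t, hallLin S R π₂ (hallLin S R ι₁ t) = 0 := by
    intro t
    rw [hallLin_comp hι₁]
    have : π₂ ∘ₗ ι₁ = 0 := LinearMap.ext fun w =>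
      congrArg Prod.snd (e.apply_symm_apply (w, 0))
    rw [this, hz]
  have hsum : ∀ t, hallLin S R ι₁ (hallLin S R π₁ t) + hallLin S R ι₂ (hallLin S R π₂ t) = t := by
    intro t
    rw [hallLin_comp hπ₁, hallLin_comp hπ₂]
    have h3 := congrArg (fun f => f t) ((hallLinL S R X X).map_add (ι₁ ∘ₗ π₁) (ι₂ ∘ₗ π₂))
    refine h3.symm.trans ?_
    have : ι₁ ∘ₗ π₁ + ι₂ ∘ₗ π₂ = LinearMap.id := LinearMap.ext fun x => by
      refine e.injective ?_
      change e (e.symm ((e x).1, 0) + e.symm (0, (e x).2)) = e x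
      rw [map_add, e.apply_symm_apply, e.apply_symm_apply]
      simp
    rw [this]
    exact hallLin_id t
  have hinj : Function.Injective Θ := by
    rw [injective_iff_map_eq_zero]
    intro t ht
    have h2 : hallLin S R π₂ t = 0 := by
      have := congrArg β ht
      rwa [hΘ, map_add, hβα, hβs', zero_add, map_zero] at this
    have h1 : hallLin S R π₁ t = 0 := by
      rw [hΘ, h2, map_zero, add_zero] at ht
      exact hi (ht.trans (map_zero α).symm)
    rw [← hsum t, h1, h2, map_zero, map_zero, add_zero]
  have hsurj : Function.Surjective Θ := by
    intro y
    obtain ⟨w, hw⟩ := (hex (y - s (β y))).1 (by rw [map_sub, hβs', sub_self])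
    refine ⟨hallLin S R ι₁ w + hallLin S R ι₂ (β y), ?_⟩
    rw [hΘ, (hallLin S R π₁).map_add, (hallLin S R π₂).map_add, h11, h12, h21, h22, add_zero, zero_add, hw, sub_add_cancel]
  refine ⟨X, hX, LinearEquiv.ofBijective Θ ⟨hinj, hsurj⟩,
    Rep.intertwines_glue hα hs (hallLin_mem_C0 L π₁)
      ((Rep.intertwines_iff _ _).2 ⟨hallLin_mem_C0 L π₂, ?_⟩) hsd fun a t => ?_⟩
  · rw [dZero_hallLin L hπ₂, hc₂, map_zero]
  · rw [dZero_hallLin L hπ₁, hc₁, map_neg, hallDL_apply_hallLin L hπ₂]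
    rfl

/-- The cocycle of an extension between images is, up to a coboundary, the evaluation of a
derivation; the derivation defines a `Π`-module that maps to the given extension. -/
lemma hallImage_isClosedUnderExtensions (hS : Module.Finite K S) (hR : Module.Finite K R)
    (hSR : IsHallPair S R) : (hallImage L).IsClosedUnderExtensions where
  prop_X₂_of_shortExact := by
    rintro T hT ⟨hM, W, hW, e₁, he₁⟩ ⟨hN, V, hV, e₃, he₃⟩
    have hf : Function.Injective T.f.hom := (ModuleCat.mono_iff_injective _).1 hT.mono_f
    have hg : Function.Surjective T.g.hom := (ModuleCat.epi_iff_surjective _).1 hT.epi_g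
    have hex : Function.Exact T.f.hom T.g.hom :=
      (ShortComplex.ShortExact.moduleCat_exact_iff_function_exact _).1 hT.exact
    let α : hallSpace S R W →ₗ[K] T.X₂ := T.f.hom.restrictScalars K ∘ₗ e₁.symm.toLinearMap
    let β : T.X₂ →ₗ[K] hallSpace S R V := e₃.toLinearMap ∘ₗ T.g.hom.restrictScalars K
    have hα : (hallRep L W).Intertwines (repOf T.X₂) α := (intertwines_hom T.f).comp he₁.symm
    have hβ : (repOf T.X₂).Intertwines (hallRep L V) β := he₃.comp (intertwines_hom T.g)
    have hi : Function.Injective α := hf.comp e₁.symm.injective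
    have hs : Function.Surjective β := e₃.surjective.comp hg
    have hαβ : Function.Exact α β := by
      intro y
      refine (LinearEquiv.map_eq_zero_iff e₃).trans ((hex y).trans ?_)
      constructor
      · rintro ⟨x, hx⟩
        exact ⟨e₁ x, (congrArg T.f.hom (e₁.symm_apply_apply x)).trans hx⟩
      · rintro ⟨x, hx⟩
        exact ⟨e₁.symm x, hx⟩
    have hfin : Module.Finite K T.X₂ := by
      have h1 := hallSpace_finite hS hR hW
      have h3 := hallSpace_finite hS hR hV
      exact Module.Finite.of_exact hαβ hs
    obtain ⟨s, hsC, hβs, g, hgZ, hgs⟩ := Rep.exists_cocycle hα hβ hi hαβ hs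
    rw [← map_hallDL_sup_B1 L hS hR hSR hV hW] at hgZ
    obtain ⟨_, ⟨d, hd, rfl⟩, _, ⟨w, hw, rfl⟩, hdw⟩ := Submodule.mem_sup.1 hgZ
    have hαw : α ∘ₗ w ∈ (hallRep L V).C0 (repOf T.X₂) := by
      intro i
      refine LinearMap.ext fun t => ?_
      rw [LinearMap.comp_apply, LinearMap.comp_apply, ← hα.1, Rep.C0.comm hw]
      rfl
    -- The coboundary part is absorbed by changing the section from `s` to `s - α ∘ w`.
    obtain ⟨X, hX, e, he⟩ := exists_equiv_of_hallDL L hV hW hα hi hαβ (s := s - α ∘ₗ w)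
      (sub_mem hsC hαw) (by
        refine LinearMap.ext fun t => ?_
        have := congrArg (fun f => f t) hβs
        change β (s t - α (w t)) = t
        rw [map_sub, hαβ.apply_apply_eq_zero, sub_zero]
        exact this) hd (by
        intro a t
        have h1 := congrArg (fun f => f t) (hgs a)
        rw [← hdw] at h1
        change α (hallDL L V W d a t + ((hallRep L W).A a (w t) - w ((hallRep L V).A a t))) =
          (repOf T.X₂).A a (s t) - s ((hallRep L V).A a t) at h1
        rw [map_add, map_sub, hα.2] at h1
        simp only [LinearMap.sub_apply, LinearMap.comp_apply, map_sub]
        rw [eq_sub_iff_add_eq] at h1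
        rw [← h1]
        abel)
    exact ⟨hfin, X, hX, e.symm, he.symm⟩

end HallImageExtensions

/-! ### The simple `Π`-modules and their images `S` and `R`. -/

section HallSimple

variable {K : Type u} [Field K] {I H : Type} [Fintype I] [Fintype H] {Q : OrientedGraph I H}
variable {S R : ModuleCat.{u} (Lam K Q)} {D : DualCocycles S R} (L : UniversalLifting D)
variable {U : ModuleCat.{u} (PiAlg K)}

lemma mk_flip_bijective {P : Type*} [AddCommGroup P] [Module K P] {v : P} (hv : v ≠ 0)
    (hspan : ∀ w : P, ∃ c : K, w = c • v) (M : Type*) [AddCommGroup M] [Module K M] :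
    Function.Bijective ((TensorProduct.mk K M P).flip v) := by
  obtain ⟨l, hl⟩ := Module.Projective.exists_dual_ne_zero K hv
  constructor
  · rw [injective_iff_map_eq_zero]
    intro m hm
    have h := congrArg (fun t => TensorProduct.rid K M (l.lTensor M t)) hm
    simp only [LinearMap.flip_apply, TensorProduct.mk_apply, LinearMap.lTensor_tmul,
      TensorProduct.rid_tmul, map_zero] at h
    exact (smul_eq_zero.1 h).resolve_left hl
  · intro t
    induction t with
    | zero => exact ⟨0, map_zero _⟩
    | add x y hx hy =>
      obtain ⟨a, rfl⟩ := hx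
      obtain ⟨b, rfl⟩ := hy
      exact ⟨a + b, map_add _ _ _⟩
    | tmul m w =>
      obtain ⟨c, rfl⟩ := hspan w
      exact ⟨c • m, TensorProduct.smul_tmul c m v⟩

lemma fil_one_eq_bot {v : U} (hspan : ∀ w : U, ∃ c : K, w = c • v)
    (hrad : ∀ x ∈ radIdeal K kronecker, x • v = 0) : fil U 1 = ⊥ := by
  rw [fil, Submodule.span_eq_bot]
  rintro _ ⟨x, hx, m, rfl⟩
  rw [Submodule.pow_one] at hx
  obtain ⟨c, rfl⟩ := hspan m
  rw [smul_comm, hrad x hx, smul_zero]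

lemma compo_eq_zero {p q : Fin 2} (hpq : p ≠ q) {v : compo U p}
    (hspan : ∀ w : U, ∃ c : K, w = c • (v : U)) (w : compo U q) : w = 0 := by
  refine Subtype.ext ?_
  obtain ⟨c, hc⟩ := hspan w
  rw [← vtx_smul_compo w, hc, ← vtx_smul_compo v, smul_comm, smul_smul, vtx_mul, if_neg hpq.symm,
    zero_smul, smul_zero]
  rfl

lemma tensor_eq_zero {M P : Type*} [AddCommGroup M] [Module K M] [AddCommGroup P] [Module K P]
    (h : ∀ w : P, w = 0) (t : M ⊗[K] P) : t = 0 := by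
  induction t with
  | zero => rfl
  | add x y hx hy => rw [hx, hy, add_zero]
  | tmul m w => rw [h w, TensorProduct.tmul_zero]

/-- The functor sends the simple module at the vertex `0` to `S`. -/
lemma exists_equiv_left {v : compo U 0} (hv : v ≠ 0) (hspan : ∀ w : U, ∃ c : K, w = c • (v : U))
    (hrad : ∀ x ∈ radIdeal K kronecker, x • (v : U) = 0) :
    ∃ e : S ≃ₗ[K] hallSpace S R U, (repOf S).Intertwines (hallRep L U) e.toLinearMap := by
  have hfil := fil_one_eq_bot hspan hrad
  have h0 : ∀ {p} (w : compo U p), (w : U) ∈ fil U (0 + 1) → w = 0 := fun w hw =>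
    Subtype.ext (by rwa [zero_add, hfil, Submodule.mem_bot] at hw)
  have hb := mk_flip_bijective hv (fun w => by
    obtain ⟨c, hc⟩ := hspan w
    exact ⟨c, Subtype.ext hc⟩) S
  let f : S →ₗ[K] hallSpace S R U :=
    LinearMap.inl K _ _ ∘ₗ (TensorProduct.mk K S (compo U 0)).flip v
  have hf : ∀ s, f s = (s ⊗ₜ v, 0) := fun _ => rfl
  have hbij : Function.Bijective f := by
    refine ⟨LinearMap.inl_injective.comp hb.1, fun t => ?_⟩
    obtain ⟨s, hs⟩ := hb.2 t.1
    exact ⟨s, Prod.ext hs (tensor_eq_zero (compo_eq_zero zero_ne_one hspan) t.2).symm⟩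
  refine ⟨LinearEquiv.ofBijective f hbij, fun i s => ?_, fun a s => ?_⟩
  · exact Prod.ext rfl (map_zero ((lact R (vtx K Q i)).rTensor (compo U 1))).symm
  · change f (arr K Q a • s) = (hallRep L U).A a (f s)
    rw [hallRep_A, hf, hf]
    exact (apply_hallD_left L (i := 0) LinearMap.id
      (fun w hw s => by rw [h0 w hw, TensorProduct.tmul_zero]; rfl)
      (fun w hw r => by rw [h0 w hw, TensorProduct.tmul_zero]; rfl) v (mem_fil_zero _) s a).symm

/-- The functor sends the simple module at the vertex `1` to `R`. -/
lemma exists_equiv_right {v : compo U 1} (hv : v ≠ 0) (hspan : ∀ w : U, ∃ c : K, w = c • (v : U))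
    (hrad : ∀ x ∈ radIdeal K kronecker, x • (v : U) = 0) :
    ∃ e : R ≃ₗ[K] hallSpace S R U, (repOf R).Intertwines (hallRep L U) e.toLinearMap := by
  have hfil := fil_one_eq_bot hspan hrad
  have h0 : ∀ {p} (w : compo U p), (w : U) ∈ fil U (0 + 1) → w = 0 := fun w hw =>
    Subtype.ext (by rwa [zero_add, hfil, Submodule.mem_bot] at hw)
  have hb := mk_flip_bijective hv (fun w => by
    obtain ⟨c, hc⟩ := hspan w
    exact ⟨c, Subtype.ext hc⟩) R
  let f : R →ₗ[K] hallSpace S R U :=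
    LinearMap.inr K _ _ ∘ₗ (TensorProduct.mk K R (compo U 1)).flip v
  have hf : ∀ s, f s = (0, s ⊗ₜ v) := fun _ => rfl
  have hbij : Function.Bijective f := by
    refine ⟨LinearMap.inr_injective.comp hb.1, fun t => ?_⟩
    obtain ⟨s, hs⟩ := hb.2 t.2
    exact ⟨s, Prod.ext (tensor_eq_zero (compo_eq_zero one_ne_zero hspan) t.1).symm hs⟩
  refine ⟨LinearEquiv.ofBijective f hbij, fun i s => ?_, fun a s => ?_⟩
  · exact Prod.ext (map_zero ((lact S (vtx K Q i)).rTensor (compo U 0))).symm rfl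
  · change f (arr K Q a • s) = (hallRep L U).A a (f s)
    rw [hallRep_A, hf, hf]
    exact (apply_hallD_right L (i := 0) LinearMap.id
      (fun w hw s => by rw [h0 w hw, TensorProduct.tmul_zero]; rfl)
      (fun w hw r => by rw [h0 w hw, TensorProduct.tmul_zero]; rfl) v (mem_fil_zero _) s a).symm

/-- The simple modules of the completed preprojective algebra. -/
lemma exists_simple (p : Fin 2) : ∃ U : ModuleCat.{u} (PiAlg K), Module.Finite K U ∧
    ∃ v : compo U p, v ≠ 0 ∧ (∀ w : U, ∃ c : K, w = c • (v : U)) ∧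
      ∀ x ∈ radIdeal K kronecker, x • (v : U) = 0 := by
  classical
  let ρ : Rep K kronecker K :=
    { E := fun i => if i = p then LinearMap.id else 0
      A := fun _ => 0
      E_idem := fun i => by split_ifs <;> rfl
      E_ortho := fun i j h => by
        split_ifs with h1 h2
        · exact absurd (h1.trans h2.symm) h
        all_goals rfl
      E_sum := by rw [Finset.sum_ite_eq' Finset.univ p, if_pos (Finset.mem_univ p)]
      E_A := fun a => LinearMap.comp_zero _
      A_E := fun a => LinearMap.zero_comp _
      rel := fun i => Finset.sum_eq_zero fun a _ => by rw [LinearMap.comp_zero, smul_zero] }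
  have hρ : ρ.IsNilp := by
    refine ⟨1, fun z hz => ?_⟩
    rw [Submodule.pow_one] at hz
    obtain ⟨y, rfl⟩ := exists_of_mem_augIdeal hz
    rw [map_sum]
    refine Finset.sum_eq_zero fun a _ => ?_
    rw [map_mul, Rep.lift_preA]
    exact mul_zero _
  obtain ⟨U, e, hE, hA⟩ := hρ.exists_module
  have hU : Module.Finite K U := Module.Finite.equiv e.symm
  have hv : vtx K kronecker p • e.symm 1 = e.symm 1 := by
    rw [LinearEquiv.eq_symm_apply, hE, e.apply_symm_apply]
    change (if p = p then LinearMap.id else 0 : K →ₗ[K] K) 1 = 1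
    rw [if_pos rfl]
    rfl
  refine ⟨U, hU, ⟨e.symm 1, mem_compo_iff.2 hv⟩, fun h => ?_, fun w => ⟨e w, ?_⟩, fun x hx => ?_⟩
  · have := congrArg e (congrArg Subtype.val h)
    rw [e.apply_symm_apply] at this
    exact one_ne_zero (this.trans (map_zero e))
  · rw [← map_smul, smul_eq_mul, mul_one, e.symm_apply_apply]
  · obtain ⟨y, rfl⟩ := exists_of_mem_radIdeal hx
    rw [Finset.sum_smul]
    refine Finset.sum_eq_zero fun a _ => ?_
    have : arr K kronecker a • e.symm 1 = 0 := by
      refine e.injective ?_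
      rw [hA, map_zero]
      rfl
    rw [mul_smul, this, smul_zero]

lemma hallImage_left (hS : Module.Finite K S) : hallImage L S := by
  obtain ⟨U, hU, v, hv, hspan, hrad⟩ := exists_simple (K := K) 0
  exact ⟨hS, U, hU, exists_equiv_left L hv hspan hrad⟩

lemma hallImage_right (hR : Module.Finite K R) : hallImage L R := by
  obtain ⟨U, hU, v, hv, hspan, hrad⟩ := exists_simple (K := K) 1
  exact ⟨hR, U, hU, exists_equiv_right L hv hspan hrad⟩

lemma hallSubcategory_le_hallImage (hS : Module.Finite K S) (hR : Module.Finite K R)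
    (hSR : IsHallPair S R) : hallSubcategory S R ≤ hallImage L := fun _ hM =>
  hM _ (hallImage_le L) (hallImage_isClosedUnderIsomorphisms L)
    (hallImage_isClosedUnderKernels L hS hR hSR) (hallImage_isClosedUnderCokernels L hS hR hSR)
    (hallImage_isClosedUnderExtensions L hS hR hSR) (hallImage_left L hS) (hallImage_right L hR)

end HallSimple

/-! ### Homogeneous socle vectors. -/

section Socle

variable {K : Type u} [Field K] {I H : Type} [Fintype I] [Fintype H] {Q : OrientedGraph I H}

/-- A nonzero finite dimensional module has a nonzero homogeneous vector killed by the
augmentation ideal. -/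
lemma exists_socle {V : ModuleCat.{u} (Lam K Q)} (hV : Module.Finite K V) [Nontrivial V] :
    ∃ (p : I) (v : compo V p), v ≠ 0 ∧ ∀ x ∈ radIdeal K Q, x • (v : V) = 0 := by
  classical
  have hne := exists_fil_eq_bot V hV
  set n := Nat.find hne with hn
  have hn0 : n ≠ 0 := by
    intro h0
    have h1 := Nat.find_spec hne
    rw [← hn, h0] at h1
    obtain ⟨v, hv⟩ := exists_ne (0 : V)
    have := mem_fil_zero v
    rw [h1] at this
    exact hv ((Submodule.mem_bot K).1 this)
  obtain ⟨m, hm⟩ := Nat.exists_eq_succ_of_ne_zero hn0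
  have hm' : fil V m ≠ ⊥ := Nat.find_min hne (by omega)
  obtain ⟨w, hw, hw0⟩ := (Submodule.ne_bot_iff _).1 hm'
  have hsum : ∑ p, vtx K Q p • w = w := by rw [← Finset.sum_smul, vtx_sum, one_smul]
  obtain ⟨p, -, hp⟩ := Finset.exists_ne_zero_of_sum_ne_zero (hsum.symm ▸ hw0)
  refine ⟨p, ⟨vtx K Q p • w, ⟨w, rfl⟩⟩, fun h => hp (congrArg Subtype.val h), fun x hx => ?_⟩
  have h1 : x • vtx K Q p • w ∈ fil V (1 + m) :=
    smul_mem_fil_add (by rwa [Submodule.pow_one]) (smul_mem_fil _ hw)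
  have h2 : fil V (1 + m) = ⊥ := by
    rw [add_comm, ← Nat.succ_eq_add_one, ← hm]
    exact Nat.find_spec hne
  rw [h2] at h1
  exact (Submodule.mem_bot K).1 h1

/-- The submodule generated by a homogeneous vector killed by the augmentation ideal is a line. -/
lemma exists_smul_eq_of_mem_span {V : ModuleCat.{u} (Lam K Q)} {p : I} {v : compo V p}
    (hv : ∀ x ∈ radIdeal K Q, x • (v : V) = 0) {w : V}
    (hw : w ∈ Submodule.span (Lam K Q) {(v : V)}) : ∃ c : K, w = c • (v : V) := by
  classical
  obtain ⟨x, rfl⟩ := Submodule.mem_span_singleton.1 hw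
  obtain ⟨c, hc⟩ := exists_sub_vtx_mem x
  refine ⟨c p, ?_⟩
  have h1 := hv _ hc
  rw [sub_smul, sub_eq_zero, Finset.sum_smul] at h1
  rw [h1, Finset.sum_eq_single p]
  · rw [smul_assoc, vtx_smul_compo]
  · intro q _ hq
    rw [smul_assoc, ← vtx_smul_compo v, smul_smul, vtx_mul, if_neg hq, zero_smul, smul_zero]
  · exact fun h => absurd (Finset.mem_univ p) h

end Socle

/-! ### Exactness, the subcategory `⟨S, R⟩` and the equivalence. -/

section HallFunctor

variable {K : Type u} [Field K] {I H : Type} [Fintype I] [Fintype H] {Q : OrientedGraph I H}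
variable {S R : ModuleCat.{u} (Lam K Q)} {D : DualCocycles S R} {L : UniversalLifting D}
variable {F : FDMod K kronecker ⥤ FDMod K Q}

lemma IsHallFunctor.isExactFunctor (hF : IsHallFunctor L F) : IsExactFunctor F := by
  obtain ⟨φ, -, -, hmap⟩ := hF
  refine ⟨⟨fun {X Y f g} => ?_⟩, fun X Y Z f g hf hfg hg => ⟨?_, ?_, ?_⟩⟩
  · refine ObjectProperty.hom_ext _ (ModuleCat.hom_ext (LinearMap.ext fun m => (φ Y).injective ?_))
    rw [hmap]
    refine (congrArg (fun k => k (φ X m)) (hallMap_add f.hom g.hom)).trans ?_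
    refine Eq.trans ?_ (map_add (φ Y) ((F.map f).hom.hom m) ((F.map g).hom.hom m)).symm
    rw [hmap, hmap]
    rfl
  · intro m n h
    have := congrArg (φ Y) h
    rw [hmap, hmap] at this
    exact (φ X).injective (hallMap_injective hf this)
  · intro m
    rw [← (φ Z).map_eq_zero_iff, hmap]
    refine (hallMap_exact (S := S) (R := R) hfg (φ Y m)).trans ⟨?_, ?_⟩
    · rintro ⟨t, ht⟩
      refine ⟨(φ X).symm t, (φ Y).injective ?_⟩
      rw [hmap, (φ X).apply_symm_apply, ht]
    · rintro ⟨n, rfl⟩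
      exact ⟨φ X n, (hmap X Y f n).symm⟩
  · intro m
    obtain ⟨t, ht⟩ := hallMap_surjective (S := S) (R := R) hg (φ Z m)
    refine ⟨(φ Y).symm t, (φ Z).injective ?_⟩
    rw [hmap, (φ Y).apply_symm_apply, ht]

lemma IsHallFunctor.intertwines {φ : ∀ V : FDMod K kronecker, (F.obj V).obj ≃ₗ[K] hallSpace S R V.obj}
    (hE : ∀ (V : FDMod K kronecker) (i : I) (m : (F.obj V).obj),
      φ V (vtx K Q i • m) = hallVtx S R V.obj i (φ V m))
    (hA : ∀ (V : FDMod K kronecker) (a : H) (m : (F.obj V).obj),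
      φ V (arr K Q a • m) = hallArr L V.obj a (φ V m)) (V : FDMod K kronecker) :
    (repOf (F.obj V).obj).Intertwines (hallRep L V.obj) (φ V).toLinearMap :=
  ⟨hE V, hA V⟩

lemma IsHallFunctor.faithful (hSR : IsHallPair S R) (hF : IsHallFunctor L F) : F.Faithful := by
  obtain ⟨φ, -, -, hmap⟩ := hF
  refine ⟨fun {V W f g} h => ObjectProperty.hom_ext _ (hallMap_faithful hSR ?_)⟩
  refine LinearMap.ext fun t => ?_
  obtain ⟨m, rfl⟩ := (φ V).surjective t
  rw [← hmap, ← hmap, h]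

lemma IsHallFunctor.full (hS : Module.Finite K S) (hR : Module.Finite K R)
    (hSR : IsHallPair S R) (hF : IsHallFunctor L F) : F.Full := by
  obtain ⟨φ, hE, hA, hmap⟩ := hF
  refine ⟨fun {V W} f => ?_⟩
  obtain ⟨g, hg⟩ := exists_hom_of_equiv L hS hR hSR V.property W.property
    (IsHallFunctor.intertwines hE hA V) (IsHallFunctor.intertwines hE hA W) f.hom
  refine ⟨ObjectProperty.homMk g, ?_⟩
  refine ObjectProperty.hom_ext _ (ModuleCat.hom_ext (LinearMap.ext fun m => (φ W).injective ?_))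
  rw [hmap, hg]
  rfl

lemma IsHallFunctor.nonempty_iso {M : ModuleCat.{u} (Lam K Q)} (hF : IsHallFunctor L F)
    (hM : Module.Finite K M) (V : FDMod K kronecker) {e : M ≃ₗ[K] hallSpace S R V.obj}
    (he : (repOf M).Intertwines (hallRep L V.obj) e.toLinearMap) :
    Nonempty ((F.obj V).obj ≅ M) := by
  obtain ⟨φ, hE, hA, -⟩ := hF
  exact Rep.Intertwines.nonempty_iso (e := φ V ≪≫ₗ e.symm) (F.obj V).property hM
    (he.symm.comp (IsHallFunctor.intertwines hE hA V))

lemma IsHallFunctor.subsingleton (hF : IsHallFunctor L F) (V : FDMod K kronecker)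
    [Subsingleton V.obj] : Subsingleton (F.obj V).obj := by
  obtain ⟨φ, -⟩ := hF
  have h : ∀ p (w : compo V.obj p), w = 0 := fun p w => Subsingleton.elim _ _
  refine ⟨fun m n => (φ V).injective (Prod.ext ?_ ?_)⟩
  · rw [tensor_eq_zero (h 0) (φ V m).1, tensor_eq_zero (h 0) (φ V n).1]
  · rw [tensor_eq_zero (h 1) (φ V m).2, tensor_eq_zero (h 1) (φ V n).2]

/-- Induction on the dimension of `V`: a socle vector spans a simple submodule, whose image is `S`
or `R`, and exactness presents the image of `V` as an extension of the image of a smaller module by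
it. -/
lemma IsHallFunctor.hallSubcategory_obj (hS : Module.Finite K S) (hR : Module.Finite K R)
    (hF : IsHallFunctor L F) (V : FDMod K kronecker) : hallSubcategory S R (F.obj V).obj := by
  intro P hP hiso hker hcoker hext hPS hPR
  induction hn : Module.finrank K V.obj using Nat.strong_induction_on generalizing V with
  | _ n ih =>
  subst hn
  have hVf : Module.Finite K V.obj := V.property
  rcases subsingleton_or_nontrivial V.obj with h0 | h0
  · have := hF.subsingleton V
    have hz := ModuleCat.isZero_of_subsingleton (F.obj V).obj
    -- The zero module belongs to the subcategory as the kernel of an identity.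
    have hk : P (Limits.kernel (𝟙 S)) := P.prop_kernel _ hPS hPS
    exact P.prop_of_iso ((Limits.isZero_kernel_of_mono (𝟙 S)).iso hz) hk
  · obtain ⟨p, v, hv0, hv⟩ := exists_socle hVf
    let N : Submodule (PiAlg K) V.obj := Submodule.span (PiAlg K) {(v : V.obj)}
    let ι : ModuleCat.of (PiAlg K) N ⟶ V.obj := ModuleCat.ofHom N.subtype
    let π : V.obj ⟶ ModuleCat.of (PiAlg K) (V.obj ⧸ N) := ModuleCat.ofHom N.mkQ
    have hι : Function.Injective ι.hom := N.injective_subtype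
    have hπ : Function.Surjective π.hom := N.mkQ_surjective
    have hex : Function.Exact ι.hom π.hom := LinearMap.exact_subtype_mkQ N
    have hUf : Module.Finite K (ModuleCat.of (PiAlg K) N) :=
      Module.Finite.of_injective (ι.hom.restrictScalars K) hι
    have hTf : Module.Finite K (ModuleCat.of (PiAlg K) (V.obj ⧸ N)) :=
      Module.Finite.of_surjective (π.hom.restrictScalars K) hπ
    let U : FDMod K kronecker := ⟨ModuleCat.of (PiAlg K) N, hUf⟩
    let T : FDMod K kronecker := ⟨ModuleCat.of (PiAlg K) (V.obj ⧸ N), hTf⟩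
    let f : U ⟶ V := ObjectProperty.homMk ι
    let g : V ⟶ T := ObjectProperty.homMk π
    obtain ⟨h1, h2, h3⟩ := hF.isExactFunctor.2 U V T f g hι hex hπ
    have hmem : (v : V.obj) ∈ N := Submodule.mem_span_singleton_self _
    let u₀ : U.obj := ⟨v, hmem⟩
    have hu₀ : u₀ ∈ compo U.obj p := mem_compo_iff.2 (Subtype.ext (vtx_smul_compo v))
    have hu0 : (⟨u₀, hu₀⟩ : compo U.obj p) ≠ 0 := fun h =>
      hv0 (Subtype.ext (congrArg (fun z : compo U.obj p => ((z : U.obj) : N).1) h))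
    have hspan : ∀ w : U.obj, ∃ c : K, w = c • u₀ := fun w => by
      obtain ⟨c, hc⟩ := exists_smul_eq_of_mem_span hv w.2
      exact ⟨c, Subtype.ext hc⟩
    have hrad : ∀ x ∈ radIdeal K kronecker, x • u₀ = 0 := fun x hx => Subtype.ext (hv x hx)
    have hPU : P (F.obj U).obj := by
      match p, v, hu₀, hu0 with
      | 0, v, hu₀, hu0 =>
        obtain ⟨e, he⟩ := exists_equiv_left (S := S) (R := R) L hu0 hspan hrad
        obtain ⟨j⟩ := hF.nonempty_iso hS U he
        exact P.prop_of_iso j.symm hPS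
      | 1, v, hu₀, hu0 =>
        obtain ⟨e, he⟩ := exists_equiv_right (S := S) (R := R) L hu0 hspan hrad
        obtain ⟨j⟩ := hF.nonempty_iso hR U he
        exact P.prop_of_iso j.symm hPR
    have hlt : Module.finrank K T.obj < Module.finrank K V.obj := by
      have h4 : LinearMap.ker (π.hom.restrictScalars K) ≠ ⊥ := by
        rw [Submodule.ne_bot_iff]
        refine ⟨v, ?_, fun h => hv0 (Subtype.ext h)⟩
        exact (Submodule.Quotient.mk_eq_zero N).2 hmem
      have h5 := LinearMap.finrank_range_add_finrank_ker (π.hom.restrictScalars K)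
      rw [LinearMap.range_eq_top.2 (show Function.Surjective (π.hom.restrictScalars K) from hπ),
        finrank_top] at h5
      have h6 := Submodule.one_le_finrank_iff.2 h4
      change Module.finrank K (ModuleCat.of (PiAlg K) (V.obj ⧸ N)) < _
      omega
    have hPT : P (F.obj T).obj := ih _ hlt T rfl
    let E : ShortComplex (ModuleCat.{u} (Lam K Q)) :=
      ShortComplex.mk (F.map f).hom (F.map g).hom
        (ModuleCat.hom_ext (LinearMap.ext fun m => h2.apply_apply_eq_zero m))
    have hE : E.ShortExact := ModuleCat.shortComplex_shortExact E h2 h1 h3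
    exact P.prop_X₂_of_shortExact hE hPU hPT

/-- Essential surjectivity holds because the image satisfies all the closure properties that define
`hallSubcategory S R` and hence contains it. -/
lemma IsHallFunctor.lift_isEquivalence (hS : Module.Finite K S) (hR : Module.Finite K R)
    (hSR : IsHallPair S R) (hF : IsHallFunctor L F)
    (h : ∀ V, hallSubcategory S R ((F ⋙ (isFD K Q).ι).obj V)) :
    ((hallSubcategory S R).lift (F ⋙ (isFD K Q).ι) h).IsEquivalence := by
  have := hF.faithful hSR
  have := hF.full hS hR hSR
  refine { faithful := inferInstance, full := inferInstance, essSurj := ⟨fun M => ?_⟩ }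
  obtain ⟨hM, V, hV, e, he⟩ := hallSubcategory_le_hallImage L hS hR hSR _ M.property
  obtain ⟨i⟩ := hF.nonempty_iso hM ⟨V, hV⟩ he
  exact ⟨⟨V, hV⟩, ⟨(hallSubcategory S R).isoMk i⟩⟩

end HallFunctor

end

end HallFunctors

open HallFunctors in
theorem mainTheorem7 {K : Type u} [Field K] [IsAlgClosed K] [CharZero K]
    {I H : Type} [Fintype I] [Fintype H] (Q : OrientedGraph I H)
    (S R : ModuleCat.{u} (Lam K Q)) (hS : isFD K Q S) (hR : isFD K Q R) (hSR : IsHallPair S R) :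
    Nonempty (DualCocycles S R) ∧
    ∀ D : DualCocycles S R,
      Nonempty (UniversalLifting D) ∧
      ∀ L : UniversalLifting D,
        (∃ F : FDMod K kronecker ⥤ FDMod K Q, IsHallFunctor L F) ∧
        ∀ F : FDMod K kronecker ⥤ FDMod K Q, IsHallFunctor L F →
          IsExactFunctor F ∧
          ∃ hF : ∀ V, hallSubcategory S R ((F ⋙ (isFD K Q).ι).obj V),
            ((hallSubcategory S R).lift (F ⋙ (isFD K Q).ι) hF).IsEquivalence := by
  refine ⟨exists_dualCocycles hS hR hSR.ext_SR, fun D =>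
    ⟨exists_universalLifting hS hR hSR D, fun L =>
      ⟨exists_hallFunctor L hS hR, fun F hF =>
        ⟨hF.isExactFunctor, hF.hallSubcategory_obj hS hR, hF.lift_isEquivalence hS hR hSR _⟩⟩⟩⟩
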